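/- **Model.** There are $k$ sites and a coordinator. Items $a_1,a_2,\dots\in[n]$ of a stream fixed in advance arrive one by one, each at one of the sites (arbitrarily chosen). Each site can exchange messages with the coordinator over a two-way channel; an exchange is started by the site that receives an item, and ends before the next arrival. All parties run randomized programs, the same for all inputs, on a random access machine with logarithmic costs (an instruction costs the number of bits it handles). The programs know $n$, $k$, the window size $w$, $\lceil 1/\epsilon\rceil$ and $\lceil 1/\delta\rceil$, and each site knows its own number. After $L\ge 1$ arrivals let $A^w=(a_{\max(1,L-w+1)},\dots,a_L)$ be the sequence of the most recent $w$ items (of all items, if $L<w$), and let $H(A^w)=\sum_{i\in[n]}p_i\log_2(1/p_i)$, where $p_i$ is the fraction of entries of $A^w$ that are equal to $i$ (and $0\log_2(1/0)=0$). Below, $\tilde O(x)$ stands for a bound $C\,x\,\log_2^{C}\!\bigl(2+\tfrac{nkw}{\epsilon\delta}\bigr)$ with an absolute constant $C$. **Theorem.** There is an algorithm such that, for all integers $n,k,w\ge 1$ and all reals $0<\epsilon\le 1/20$ and $0<\delta<1$, for every stream and every assignment of its items to sites, the coordinator maintains an estimate $\hat H(A^w)$ with the following property after every number $L\ge 1$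 of arrivals: * if $H(A^w)>1$, then $\Pr\bigl[\,|H(A^w)-\hat H(A^w)|>\epsilon H(A^w)\,\bigr]\le\delta$; * if $H(A^w)\le 1$, then $\Pr\bigl[\,|H(A^w)-\hat H(A^w)|>\epsilon\,\bigr]\le\delta$. Moreover, for every outcome of the random choices, the algorithm uses * $\tilde O\bigl(k/\epsilon^{2}+\sqrt{k}/\epsilon^{3}\bigr)$ bits of communication in total during any $w$ consecutive arrivals; * $\tilde O(\epsilon^{-2})$ bits of space at each site at all times; * amortized $\tilde O(\epsilon^{-2})$ processing time per item, that is, total time at most $\tilde O(\epsilon^{-2})\cdot L$ at all sites together during the first $L$ arrivals. -/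

import Mathlib

noncomputable section

namespace Monitoring

/-! ### A randomized random access machine with logarithmic costs

Every party runs a program over a memory of cells that hold natural numbers. The cost of an
instruction is the number of bits it handles, so packing much data into one cell gains nothing.
The only loops are those whose number of rounds is fixed on entry, so every program halts. -/

inductive BinOp
  | add | sub | mul | div | mod | lt | eq

/-- Truncated subtraction, integer division; comparisons return `1` or `0`. -/
def BinOp.eval : BinOp → ℕ → ℕ → ℕ
  | .add, a, b => a + b
  | .sub, a, b => a - b
  | .mul, a, b => a * b
  | .div, a, b => a / b
  | .mod, a, b => a % b
  | .lt, a, b => if a < b then 1 else 0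
  | .eq, a, b => if a = b then 1 else 0

/-- Expressions: constants, the content of the cell with a computed address, the binary length of
a number, and arithmetic. -/
inductive Expr
  | lit (v : ℕ)
  | cell (addr : Expr)
  | size (e : Expr)
  | bin (o : BinOp) (a b : Expr)

/-- All cells but finitely many hold `0`. -/
abbrev Memory := ℕ →₀ ℕ

/-- Bits needed to store a memory: address and content of every nonzero cell. -/
def memBits (m : Memory) : ℕ := m.sum fun a v => 1 + Nat.size a + Nat.size v

def Expr.eval (m : Memory) : Expr → ℕ
  | .lit v => v
  | .cell a => m (a.eval m)
  | .size e => Nat.size (e.eval m)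
  | .bin o a b => o.eval (a.eval m) (b.eval m)

/-- Logarithmic cost: one plus the binary length of the value, for every subexpression. -/
def Expr.cost (m : Memory) : Expr → ℕ
  | .lit v => 1 + Nat.size v
  | .cell a => a.cost m + 1 + Nat.size (m (a.eval m))
  | .size e => e.cost m + 1 + Nat.size (Nat.size (e.eval m))
  | .bin o a b => a.cost m + b.cost m + 1 + Nat.size (o.eval (a.eval m) (b.eval m))

/-- Programs. `Q` is the type of kinds of questions that the program may put to other machines:
there are none for a site (`Q = Empty`), and there is one for the coordinator (`Q = Unit`). -/
inductive Cmd (Q : Type)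
  | skip
  /-- store the value of an expression -/
  | set (addr e : Expr)
  /-- store a uniformly random number with the given number of binary digits -/
  | rand (addr digits : Expr)
  /-- store the next word of the incoming message (`0` if there is none) -/
  | recv (addr : Expr)
  /-- append a word to the outgoing message -/
  | send (e : Expr)
  /-- deliver the outgoing message to the machine with the given number, and wait for its reply,
  which becomes the incoming message -/
  | ask (q : Q) (dest : Expr)
  | seq (c d : Cmd Q)
  /-- branch on whether the value of the expression is nonzero -/
  | ite (e : Expr) (c d : Cmd Q)
  /-- repeat the body as many times as the value that the expression has on entry -/
  | loop (e : Expr) (c : Cmd Q)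

/-- Length of an encoding of a message (a list of numbers) as a self-delimiting bit string: each
number `v` is preceded by a flag, and is written with its length in unary, in `2 * size v + 1`
bits; a last flag ends the message. -/
def msgBits (l : List ℕ) : ℕ := 1 + (l.map fun v => 2 * Nat.size v + 2).sum

/-- A machine, with the time it has used and the largest space it has occupied so far. -/
structure Machine where
  mem : Memory
  inbox : List ℕ
  outbox : List ℕ
  time : ℕ
  peak : ℕ

/-- Space occupied at the moment, in bits, message buffers included. -/
def Machine.space (M : Machine) : ℕ := memBits M.mem + msgBits M.inbox + msgBits M.outbox

/-- Charge an instruction that handles `c` bits, while the counters of the enclosing loops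
occupy `h` bits. The `c` bits are charged to time, and to space for intermediate values; they
always cover the growth of memory and buffers that the instruction causes. -/
def Machine.charge (h c : ℕ) (M : Machine) : Machine :=
  { M with time := M.time + c, peak := max M.peak (M.space + h + c) }

def Machine.write (a v : ℕ) (M : Machine) : Machine := { M with mem := M.mem.update a v }

/-- A uniformly random number below `2 ^ b`. -/
def uniformBits (b : ℕ) : PMF ℕ := (PMF.uniformOfFintype (Fin (2 ^ b))).map fun x => (x : ℕ)

def iterPMF {α : Type} (f : α → PMF α) : ℕ → α → PMF α
  | 0, s => PMF.pure s
  | r + 1, s => (f s).bind (iterPMF f r)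

/-- Execution of a program: the law of the resulting state. `reply` says how the rest of the
system, whose state is in `σ`, answers a question; `h` is the number of bits that the counters of
the enclosing loops occupy. -/
def Cmd.exec {Q σ : Type} (reply : Q → ℕ → List ℕ → σ → PMF (List ℕ × σ)) :
    Cmd Q → ℕ → Machine × σ → PMF (Machine × σ)
  | .skip, _, s => PMF.pure s
  | .set a e, h, (M, g) =>
      PMF.pure ((M.charge h (a.cost M.mem + e.cost M.mem)).write (a.eval M.mem) (e.eval M.mem), g)
  | .rand a d, h, (M, g) =>
      (uniformBits (d.eval M.mem)).map fun x =>
        ((M.charge h (a.cost M.mem + d.cost M.mem + d.eval M.mem)).write (a.eval M.mem) x, g)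
  | .recv a, h, (M, g) =>
      let v := M.inbox.headD 0
      let M' := (M.charge h (a.cost M.mem + 1 + Nat.size v)).write (a.eval M.mem) v
      PMF.pure ({ M' with inbox := M.inbox.tail }, g)
  | .send e, h, (M, g) =>
      let v := e.eval M.mem
      let M' := M.charge h (e.cost M.mem + 2 * Nat.size v + 2)
      PMF.pure ({ M' with outbox := M.outbox ++ [v] }, g)
  | .ask q d, h, (M, g) =>
      (reply q (d.eval M.mem) M.outbox g).map fun r =>
        ({ M.charge h (d.cost M.mem + msgBits M.outbox + msgBits r.1) with
            inbox := r.1, outbox := [] }, r.2)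
  | .seq c d, h, s => (c.exec reply h s).bind (d.exec reply h)
  | .ite e c d, h, (M, g) =>
      let s := (M.charge h (e.cost M.mem), g)
      if e.eval M.mem ≠ 0 then c.exec reply h s else d.exec reply h s
  | .loop e c, h, (M, g) =>
      let r := e.eval M.mem
      let h' := h + Nat.size r + 1
      iterPMF (fun s => c.exec reply h' (s.1.charge h (Nat.size r + 1), s.2)) r
        (M.charge h (e.cost M.mem), g)

/-! ### The distributed monitoring model -/

/-- One program for all sites, run when an item arrives or when the coordinator sends a message,
and a program for the coordinator, run when a site reports something on the arrival of an item. -/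
structure Algorithm where
  onItem : Cmd Empty
  onMessage : Cmd Empty
  coordinator : Cmd Unit

/-- `bitLog` lists the numbers of bits exchanged on the arrivals so far, the latest first. -/
structure System (k : ℕ) where
  coord : Machine
  sites : Fin k → Machine
  bitLog : List ℕ

/-- What the coordinator reports: the quotient of its cells `5` and `6`. -/
def System.estimate {k : ℕ} (S : System k) : ℝ := (S.coord.mem 5 : ℝ) / (S.coord.mem 6 : ℝ)

/-- A site runs a program on a message; the result is its answer and its new state. Receiving the
message is charged. -/
def runSite (c : Cmd Empty) (msg : List ℕ) (M : Machine) : PMF (List ℕ × Machine) :=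
  (c.exec (σ := Unit) (fun q => q.elim) 0
      ({ M with inbox := msg, outbox := [] }.charge 0 (msgBits msg), ())).map fun s =>
    (s.1.outbox, { s.1 with inbox := [], outbox := [] })

/-- A question of the coordinator to a site: both the question and the answer are counted. -/
def Algorithm.askSite (alg : Algorithm) {k : ℕ} (_ : Unit) (j : ℕ) (msg : List ℕ)
    (s : (Fin k → Machine) × ℕ) : PMF (List ℕ × ((Fin k → Machine) × ℕ)) :=
  if hj : j < k then
    (runSite alg.onMessage msg (s.1 ⟨j, hj⟩)).map fun r =>
      (r.1, (Function.update s.1 ⟨j, hj⟩ r.2, s.2 + msgBits msg + msgBits r.1))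
  else PMF.pure ([], s)

/-- Arrival of item `a.2` at site `a.1`. If the site sends nothing, then the coordinator does not
notice. Otherwise the coordinator learns the sender and the message, and it may exchange further
messages with all sites, which ends before the next arrival. -/
def Algorithm.arrive (alg : Algorithm) {n k : ℕ} (S : System k) (a : Fin k × Fin n) :
    PMF (System k) :=
  (runSite alg.onItem [(a.2 : ℕ)] (S.sites a.1)).bind fun r =>
    let sites := Function.update S.sites a.1 r.2
    if r.1 = [] then PMF.pure { S with sites := sites, bitLog := 0 :: S.bitLog }
    else
      (alg.coordinator.exec alg.askSite 0
          ({ S.coord with inbox := (a.1 : ℕ) :: r.1, outbox := [] },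
            (sites, msgBits r.1))).map fun t =>
        { coord := t.1, sites := t.2.1, bitLog := t.2.2 :: S.bitLog }

/-- The parameters, which all parties know, in cells `0` to `4`. -/
def paramMem (n k w e d : ℕ) : Memory :=
  ((((Finsupp.single 0 n).update 1 k).update 2 w).update 3 e).update 4 d

def initMachine (m : Memory) : Machine :=
  { mem := m, inbox := [], outbox := [], time := 0,
    peak := Machine.space { mem := m, inbox := [], outbox := [], time := 0, peak := 0 } }

/-- Initially each party holds the parameters, and site `i` also its number in cell `5`. -/
def initSystem (n k w e d : ℕ) : System k :=
  { coord := initMachine (paramMem n k w e d)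
    sites := fun i => initMachine ((paramMem n k w e d).update 5 (i : ℕ))
    bitLog := [] }

/-- The law of the state of the system after the arrivals in the list `A`, for universe size `n`,
`k` sites, window size `w`, and accuracy parameters `ε`, `δ`, which the parties know as
`⌈1/ε⌉` and `⌈1/δ⌉`. -/
def Algorithm.run (alg : Algorithm) (n k w : ℕ) (ε δ : ℝ) (A : List (Fin k × Fin n)) :
    PMF (System k) :=
  A.foldl (fun p a => p.bind fun S => alg.arrive S a)
    (PMF.pure (initSystem n k w ⌈1 / ε⌉₊ ⌈1 / δ⌉₊))

/-! ### Entropy and the resource bounds -/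

/-- The most recent `w` items (all items, if there are fewer). -/
def window {n k : ℕ} (w : ℕ) (A : List (Fin k × Fin n)) : List (Fin n) :=
  (A.drop (A.length - w)).map Prod.snd

/-- Empirical Shannon entropy, in bits. -/
def entropy {n : ℕ} (B : List (Fin n)) : ℝ :=
  ∑ i : Fin n, ((B.count i : ℝ) / B.length) * Real.logb 2 (1 / ((B.count i : ℝ) / B.length))

/-- `C · x · log(2 + nkw/(εδ))^C`: what `Õ(x)` stands for, with the constant `C`. -/
def softO (C n k w : ℕ) (ε δ x : ℝ) : ℝ :=
  C * x * Real.logb 2 (2 + n * k * w / (ε * δ)) ^ C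

end Monitoring

end

/-! If `i` occurs `c_i` times in a list of length `m`, then `H = log₂ m - (1/m) ∑ c_i log₂ c_i`. The
sum `∑ c log c` telescopes along the list: an entry that is followed by `r` more occurrences of its
item contributes `inc r = (r+1) log (r+1) - r log r`. So it suffices to estimate the sum of `inc`
over the window up to an error of `m / (4e)`, with `e = ⌈1/ε⌉`, from a sample of the entries.

The later occurrences of a sampled item are not counted, because that would be expensive across `k`
sites. A sample draws a number `i`, and each later occurrence of its item hits it independently with
probability about `1 - q^i`, where `q = 1 - 1/K`. After `r` occurrences it has been hit with
probability about `1 - q^(ri)`. The key identity is `K ∑_i (1 - q^(ri)) (1 - q^i) / i² ≈ inc r`. It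
holds because `(1-a)(1-b) = (1-a) + (1-b) - (1-ab)` and because `dil y = ∑ (1 - e^(-yi)) / i²`
equals `y - y log y + O(y²)` (`dil_bounds`, `series_bounds`). The number `i` is drawn with
probability `1 / (2^a 2^l)` for `2^l ≤ i < 2^(l+1)`, and a hit sample counts with the matching
inverse weight. All values are then bounded up to a logarithmic factor, so that about `P`, of order
`e² lg⁴`, samples concentrate well enough.

The sampling rate is `1/W`, and `T` follows the length of the window up to constant factors; both
only double, so that `W` stays about `T / P`. A site cuts its arrivals into blocks of length `W /
(2k)` and chooses one uniform offset below `W` per block, so it samples each arrival with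
probability `1/W` and reports each completed block to the clock of the coordinator. While `W < 2k`,
all items are forwarded, and site 0 treats them all.

Concentration comes from an exponential potential. The stream is fixed, so the conditional
expectation of the final weight of a slot, given its present threshold, is an explicit function of
the future (`sf`, `pot`). An arrival does not increase the expectation of `pot` times the expected
factor `Qf` of future samples (`arrive_ex`, `runFrom_ex`). Independence of the offsets and `1 + x ≤
e^x` bound `Qf` by `exp (facSum)` (`Qf_le`), which is evaluated by the identity above
(`facLog_main`, `facSum_main`). A second weight, a factor 2 per recent slot, shows that a relevant
sample is hardly ever dropped for lack of space (`pot_cnt`). Together these give `concentration`.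

The resource bounds hold for every outcome. A site spends a credit for each word it sends, and
credits arise from broadcasts and completed blocks. A stored sample raises the clipped sum of the
expiry times by at least `w + 1`, which allows `O(N)` samples per window, and a harmonic sum bounds
the completed blocks (`bits_le`, `peak_le`, `time_le`). The resulting accuracy is the additive error
`ε` for every value of the entropy (`accuracy`), which covers both cases of the theorem. -/

noncomputable section
open scoped ENNReal
namespace Monitoring

/-! ### Expectations and almost sure properties of discrete laws -/

/-- Expectation of a nonnegative function. -/
def Ex {α : Type} (p : PMF α) (f : α → ℝ≥0∞) : ℝ≥0∞ := ∑' a, p a * f a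

/-- All outcomes have the property `Q`. -/
def Sure {α : Type} (p : PMF α) (Q : α → Prop) : Prop := ∀ a ∈ p.support, Q a

section laws
variable {α β : Type}

theorem Ex_pure (a : α) (f : α → ℝ≥0∞) : Ex (PMF.pure a) f = f a := by
  unfold Ex
  rw [tsum_eq_single a]
  · simp
  · intro b hb; simp [PMF.pure_apply, hb]

theorem Ex_bind (p : PMF α) (q : α → PMF β) (f : β → ℝ≥0∞) :
    Ex (p.bind q) f = Ex p fun a => Ex (q a) f := by
  unfold Ex
  simp only [PMF.bind_apply, ← ENNReal.tsum_mul_right, ← ENNReal.tsum_mul_left]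
  rw [ENNReal.tsum_comm]
  simp only [mul_assoc]

theorem Ex_map (p : PMF α) (g : α → β) (f : β → ℝ≥0∞) : Ex (p.map g) f = Ex p (f ∘ g) := by
  rw [← PMF.bind_pure_comp, Ex_bind]
  simp [Ex_pure, Function.comp_def]

theorem Ex_mono (p : PMF α) {f g : α → ℝ≥0∞} (h : ∀ a ∈ p.support, f a ≤ g a) :
    Ex p f ≤ Ex p g := by
  refine ENNReal.tsum_le_tsum fun a => ?_
  by_cases ha : p a = 0
  · simp [ha]
  · exact mul_le_mul_right (h a ((PMF.mem_support_iff p a).2 ha)) _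

theorem Ex_const (p : PMF α) (c : ℝ≥0∞) : Ex p (fun _ => c) = c := by
  simp [Ex, ENNReal.tsum_mul_right, p.tsum_coe]

theorem Ex_mul_left (p : PMF α) (c : ℝ≥0∞) (f : α → ℝ≥0∞) :
    Ex p (fun a => c * f a) = c * Ex p f := by
  simp only [Ex, ← ENNReal.tsum_mul_left]; congr 1; ext a; ring

theorem Sure.ex_le {p : PMF α} {Q : α → Prop} (h : Sure p Q) {f : α → ℝ≥0∞} {b : ℝ≥0∞}
    (hf : ∀ a, Q a → f a ≤ b) : Ex p f ≤ b :=
  (Ex_mono p fun a ha => hf a (h a ha)).trans (Ex_const p b).le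

/-- An outcome of positive probability at which `f` is infinite would make the expectation infinite.
-/
theorem sure_of_ex_ne_top {p : PMF α} {Q : α → Prop} {f : α → ℝ≥0∞} (h : Ex p f ≠ ⊤)
    (hf : ∀ a, ¬ Q a → f a = ⊤) : Sure p Q := by
  intro a ha
  by_contra hq
  refine h ?_
  refine ENNReal.tsum_eq_top_of_eq_top ⟨a, ?_⟩
  rw [hf a hq]
  exact ENNReal.mul_top ((PMF.mem_support_iff p a).1 ha)

theorem Sure.mono {p : PMF α} {Q R : α → Prop} (h : Sure p Q) (hr : ∀ a, Q a → R a) : Sure p R :=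
  fun a ha => hr a (h a ha)

theorem Sure.and {p : PMF α} {Q R : α → Prop} (h : Sure p Q) (h' : Sure p R) :
    Sure p fun a => Q a ∧ R a := fun a ha => ⟨h a ha, h' a ha⟩

theorem sure_pure {a : α} {Q : α → Prop} (h : Q a) : Sure (PMF.pure a) Q := by
  intro b hb
  rw [PMF.support_pure] at hb
  rwa [Set.mem_singleton_iff.1 hb]

theorem Sure.bind {p : PMF α} {q : α → PMF β} {Q : α → Prop} {R : β → Prop} (h : Sure p Q)
    (hq : ∀ a, Q a → Sure (q a) R) : Sure (p.bind q) R := by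
  intro b hb
  obtain ⟨a, ha, hab⟩ := (PMF.mem_support_bind_iff _ _ _).1 hb
  exact hq a (h a ha) b hab

theorem Sure.map {p : PMF α} {g : α → β} {R : β → Prop} (h : Sure p fun a => R (g a)) :
    Sure (p.map g) R := by
  intro b hb
  obtain ⟨a, ha, rfl⟩ := (PMF.mem_support_map_iff _ _ _).1 hb
  exact h a ha

/-- Markov's inequality. Restricting to the support makes invariants of the run available when `1 ≤
f a` is checked. -/
theorem measure_le_ex {p : PMF α} {A : Set α} {f : α → ℝ≥0∞}
    (h : ∀ a ∈ p.support, a ∈ A → 1 ≤ f a) : p.toOuterMeasure A ≤ Ex p f := by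
  rw [PMF.toOuterMeasure_apply]
  refine ENNReal.tsum_le_tsum fun a => ?_
  by_cases ha : a ∈ A
  · rw [Set.indicator_of_mem ha]
    by_cases hp : p a = 0
    · simp [hp]
    · exact le_mul_of_one_le_right' (h a ((PMF.mem_support_iff p a).2 hp) ha)
  · rw [Set.indicator_of_notMem ha]; exact zero_le

/-- A supermartingale argument with a time-dependent `V`. Setting `V = ⊤` where an invariant fails
makes the hypothesis trivial there, so one function carries both the invariant and the bound. -/
theorem Ex_iter (f : α → PMF α) (V : ℕ → α → ℝ≥0∞) (r : ℕ)
    (h : ∀ i < r, ∀ s, Ex (f s) (V (i + 1)) ≤ V i s) (s : α) :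
    Ex (iterPMF f r s) (V r) ≤ V 0 s := by
  induction r generalizing V s with
  | zero => simp [iterPMF, Ex_pure]
  | succ r ih =>
    rw [iterPMF, Ex_bind]
    refine (Ex_mono _ fun a _ => ?_).trans (h 0 (by omega) s)
    exact ih (fun i => V (i + 1)) (fun i hi s => h (i + 1) (by omega) s) a

theorem sure_iter {f : α → PMF α} (I : ℕ → α → Prop) {r : ℕ}
    (h : ∀ i < r, ∀ s, I i s → Sure (f s) (I (i + 1))) {s : α} (hs : I 0 s) :
    Sure (iterPMF f r s) (I r) := by
  induction r generalizing I s with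
  | zero => exact sure_pure hs
  | succ r ih =>
    rw [iterPMF]
    exact (h 0 (by omega) s hs).bind fun a ha =>
      ih (fun i => I (i + 1)) (fun i hi s hs => h (i + 1) (by omega) s hs) ha

theorem uniformBits_eq (b : ℕ) : uniformBits b =
    (PMF.uniformOfFintype (Fin (2 ^ b))).bind fun a => PMF.pure (a : ℕ) := PMF.map_id _

theorem Ex_uniformBits (b : ℕ) (f : ℕ → ℝ≥0∞) :
    Ex (uniformBits b) f = (∑ x ∈ Finset.range (2 ^ b), f x) / 2 ^ b := by
  rw [uniformBits_eq, Ex_bind]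
  simp only [Ex_pure]
  rw [Ex, tsum_fintype, Finset.sum_range]
  simp only [PMF.uniformOfFintype_apply, Fintype.card_fin]
  rw [← Finset.mul_sum, mul_comm, div_eq_mul_inv]
  norm_num

end laws

/-! ### Rules for programs -/

section rules
variable {Q σ : Type} {reply : Q → ℕ → List ℕ → σ → PMF (List ℕ × σ)} {h : ℕ} {M : Machine} {g : σ}
  {F : Machine × σ → ℝ≥0∞} {R : Machine × σ → Prop}

theorem Ex_skip (s : Machine × σ) : Ex ((Cmd.skip : Cmd Q).exec reply h s) F = F s := by
  rw [Cmd.exec, Ex_pure]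

theorem Ex_seq (c d : Cmd Q) (s : Machine × σ) : Ex ((Cmd.seq c d).exec reply h s) F =
    Ex (c.exec reply h s) fun s' => Ex (d.exec reply h s') F := by
  rw [Cmd.exec, Ex_bind]

theorem Ex_set (a e : Expr) : Ex ((Cmd.set a e : Cmd Q).exec reply h (M, g)) F =
    F ((M.charge h (a.cost M.mem + e.cost M.mem)).write (a.eval M.mem) (e.eval M.mem), g) := by
  rw [Cmd.exec, Ex_pure]

theorem Ex_rand (a d : Expr) : Ex ((Cmd.rand a d : Cmd Q).exec reply h (M, g)) F =
    Ex (uniformBits (d.eval M.mem)) fun x =>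
      F ((M.charge h (a.cost M.mem + d.cost M.mem + d.eval M.mem)).write (a.eval M.mem) x, g) := by
  rw [Cmd.exec, Ex_map]; rfl

theorem Ex_ite (e : Expr) (c d : Cmd Q) : Ex ((Cmd.ite e c d).exec reply h (M, g)) F =
    if e.eval M.mem ≠ 0 then Ex (c.exec reply h (M.charge h (e.cost M.mem), g)) F
    else Ex (d.exec reply h (M.charge h (e.cost M.mem), g)) F := by
  rw [Cmd.exec]; split_ifs <;> rfl

theorem Ex_send (e : Expr) : Ex ((Cmd.send e : Cmd Q).exec reply h (M, g)) F =
    F ({ M.charge h (e.cost M.mem + 2 * Nat.size (e.eval M.mem) + 2) with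
      outbox := M.outbox ++ [e.eval M.mem] }, g) := by
  rw [Cmd.exec, Ex_pure]

theorem Ex_recv (a : Expr) : Ex ((Cmd.recv a : Cmd Q).exec reply h (M, g)) F =
    F ({ (M.charge h (a.cost M.mem + 1 + Nat.size (M.inbox.headD 0))).write (a.eval M.mem)
      (M.inbox.headD 0) with inbox := M.inbox.tail }, g) := by
  rw [Cmd.exec, Ex_pure]

theorem Ex_ask (q : Q) (d : Expr) : Ex ((Cmd.ask q d).exec reply h (M, g)) F =
    Ex (reply q (d.eval M.mem) M.outbox g) fun r =>
      F ({ M.charge h (d.cost M.mem + msgBits M.outbox + msgBits r.1) with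
            inbox := r.1, outbox := [] }, r.2) := by
  rw [Cmd.exec, Ex_map]; rfl

theorem Ex_loop (e : Expr) (c : Cmd Q) (V : ℕ → Machine × σ → ℝ≥0∞)
    (hV : ∀ i < e.eval M.mem, ∀ M' g', Ex (c.exec reply (h + Nat.size (e.eval M.mem) + 1)
      (M'.charge h (Nat.size (e.eval M.mem) + 1), g')) (V (i + 1))
        ≤ V i (M', g')) :
    Ex ((Cmd.loop e c).exec reply h (M, g)) (V (e.eval M.mem)) ≤
      V 0 (M.charge h (e.cost M.mem), g) := by
  rw [Cmd.exec]
  exact Ex_iter _ V _ (fun i hi s => hV i hi s.1 s.2) _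

theorem sure_skip {s : Machine × σ} (hR : R s) : Sure ((Cmd.skip : Cmd Q).exec reply h s) R := by
  rw [Cmd.exec]; exact sure_pure hR

theorem sure_seq {c d : Cmd Q} {s : Machine × σ} {R' : Machine × σ → Prop}
    (hc : Sure (c.exec reply h s) R') (hd : ∀ M' g', R' (M', g') → Sure (d.exec reply h (M', g')) R) :
    Sure ((Cmd.seq c d).exec reply h s) R := by
  rw [Cmd.exec]; exact hc.bind fun a ha => hd a.1 a.2 ha

theorem sure_set {a e : Expr}
    (hR : R ((M.charge h (a.cost M.mem + e.cost M.mem)).write (a.eval M.mem) (e.eval M.mem), g)) :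
    Sure ((Cmd.set a e : Cmd Q).exec reply h (M, g)) R := by
  rw [Cmd.exec]; exact sure_pure hR

theorem sure_ite {e : Expr} {c d : Cmd Q}
    (hc : e.eval M.mem ≠ 0 → Sure (c.exec reply h (M.charge h (e.cost M.mem), g)) R)
    (hd : e.eval M.mem = 0 → Sure (d.exec reply h (M.charge h (e.cost M.mem), g)) R) :
    Sure ((Cmd.ite e c d).exec reply h (M, g)) R := by
  rw [Cmd.exec]; split_ifs
  · exact hc ‹_›
  · exact hd (not_not.1 ‹_›)

theorem sure_send {e : Expr}
    (hR : R ({ M.charge h (e.cost M.mem + 2 * Nat.size (e.eval M.mem) + 2) with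
      outbox := M.outbox ++ [e.eval M.mem] }, g)) :
    Sure ((Cmd.send e : Cmd Q).exec reply h (M, g)) R := by
  rw [Cmd.exec]; exact sure_pure hR

theorem sure_recv {a : Expr}
    (hR : R ({ (M.charge h (a.cost M.mem + 1 + Nat.size (M.inbox.headD 0))).write (a.eval M.mem)
      (M.inbox.headD 0) with inbox := M.inbox.tail }, g)) :
    Sure ((Cmd.recv a : Cmd Q).exec reply h (M, g)) R := by
  rw [Cmd.exec]; exact sure_pure hR

theorem sure_ask {q : Q} {d : Expr} {R' : List ℕ × σ → Prop}
    (hq : Sure (reply q (d.eval M.mem) M.outbox g) R')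
    (hR : ∀ r, R' r → R ({ M.charge h (d.cost M.mem + msgBits M.outbox + msgBits r.1) with
            inbox := r.1, outbox := [] }, r.2)) :
    Sure ((Cmd.ask q d).exec reply h (M, g)) R := by
  rw [Cmd.exec]; exact Sure.map (hq.mono hR)

theorem sure_loop {e : Expr} {c : Cmd Q} (I : ℕ → Machine × σ → Prop)
    (h0 : I 0 (M.charge h (e.cost M.mem), g))
    (hI : ∀ i < e.eval M.mem, ∀ M' g', I i (M', g') →
      Sure (c.exec reply (h + Nat.size (e.eval M.mem) + 1)
      (M'.charge h (Nat.size (e.eval M.mem) + 1), g')) (I (i + 1)))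
    (hR : ∀ s, I (e.eval M.mem) s → R s) :
    Sure ((Cmd.loop e c).exec reply h (M, g)) R := by
  rw [Cmd.exec]
  exact (sure_iter I (fun i hi s hs => hI i hi s.1 s.2 hs) h0).mono hR

end rules

@[simp] theorem Machine.charge_mem (h c : ℕ) (M : Machine) : (M.charge h c).mem = M.mem := rfl
@[simp] theorem Machine.charge_inbox (h c : ℕ) (M : Machine) : (M.charge h c).inbox = M.inbox := rfl
@[simp] theorem Machine.charge_outbox (h c : ℕ) (M : Machine) :
    (M.charge h c).outbox = M.outbox := rfl
@[simp] theorem Machine.write_mem (a v : ℕ) (M : Machine) : (M.write a v).mem = M.mem.update a v :=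
  rfl
@[simp] theorem Machine.write_inbox (a v : ℕ) (M : Machine) : (M.write a v).inbox = M.inbox := rfl
@[simp] theorem Machine.write_outbox (a v : ℕ) (M : Machine) : (M.write a v).outbox = M.outbox := rfl
@[simp] theorem Machine.charge_time (h c : ℕ) (M : Machine) : (M.charge h c).time = M.time + c := rfl
@[simp] theorem Machine.write_time (a v : ℕ) (M : Machine) : (M.write a v).time = M.time := rfl
@[simp] theorem Machine.write_peak (a v : ℕ) (M : Machine) : (M.write a v).peak = M.peak := rfl

theorem upd_apply (m : Memory) (a v b : ℕ) : (m.update a v) b = if b = a then v else m b := by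
  rw [Finsupp.coe_update, Function.update_apply]

/-! ### Expressions -/

namespace Expr
instance : Add Expr := ⟨.bin .add⟩
instance : Sub Expr := ⟨.bin .sub⟩
instance : Mul Expr := ⟨.bin .mul⟩
instance : Div Expr := ⟨.bin .div⟩
instance (n : ℕ) : OfNat Expr n := ⟨.lit n⟩
/-- The content of a fixed cell. -/
def c (a : ℕ) : Expr := .cell (.lit a)
def lt (a b : Expr) : Expr := .bin .lt a b
def eq (a b : Expr) : Expr := .bin .eq a b

variable (m : Memory) (a b : Expr)
@[simp] theorem eval_add : (a + b).eval m = a.eval m + b.eval m := rfl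
@[simp] theorem eval_sub : (a - b).eval m = a.eval m - b.eval m := rfl
@[simp] theorem eval_mul : (a * b).eval m = a.eval m * b.eval m := rfl
@[simp] theorem eval_div : (a / b).eval m = a.eval m / b.eval m := rfl
@[simp] theorem eval_lt : (lt a b).eval m = if a.eval m < b.eval m then 1 else 0 := rfl
@[simp] theorem eval_eq : (eq a b).eval m = if a.eval m = b.eval m then 1 else 0 := rfl
@[simp] theorem eval_ofNat (n : ℕ) : (no_index (OfNat.ofNat n : Expr)).eval m = n := rfl
@[simp] theorem eval_lit (n : ℕ) : (lit n).eval m = n := rfl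
@[simp] theorem eval_c (n : ℕ) : (c n).eval m = m n := rfl
@[simp] theorem eval_cell : (cell a).eval m = m (a.eval m) := rfl
@[simp] theorem eval_size : (size a).eval m = Nat.size (a.eval m) := rfl

/-- A weight of an expression that bounds the size of its value and its cost. -/
def weight : Expr → ℕ
  | .lit v => Nat.log2 v + 2
  | .cell a => a.weight + 2
  | .size a => 2 * a.weight + 2
  | .bin _ a b => 2 * a.weight + 2 * b.weight + 2

theorem size_add_le (x y : ℕ) : Nat.size (x + y) ≤ Nat.size x + Nat.size y + 1 := by
  rw [Nat.size_le]
  have hx := Nat.lt_size_self x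
  have hy := Nat.lt_size_self y
  have h1 : 2 ^ Nat.size x ≤ 2 ^ (Nat.size x + Nat.size y) := Nat.pow_le_pow_right (by norm_num) (by omega)
  have h2 : 2 ^ Nat.size y ≤ 2 ^ (Nat.size x + Nat.size y) := Nat.pow_le_pow_right (by norm_num) (by omega)
  rw [pow_succ]; omega

theorem size_mul_le (x y : ℕ) : Nat.size (x * y) ≤ Nat.size x + Nat.size y := by
  rw [Nat.size_le, pow_add]
  exact Nat.mul_lt_mul'' (Nat.lt_size_self x) (Nat.lt_size_self y)

theorem size_size_le (x : ℕ) : Nat.size (Nat.size x) ≤ Nat.size x := by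
  rw [Nat.size_le]; exact Nat.lt_two_pow_self

theorem size_ite_le (p : Prop) [Decidable p] : Nat.size (if p then 1 else 0) ≤ 1 := by
  split <;> simp

/-- An operation produces at most one bit more than its operands have together. So values and costs
are linear in the cell length `β`, with a factor that depends on the expression only; for a concrete
expression it is compared with `κ` by computation. -/
theorem size_eval_le {m : Memory} {β : ℕ} (hβ : 1 ≤ β) (hm : ∀ a, Nat.size (m a) ≤ β) (e : Expr) :
    1 ≤ e.weight ∧ Nat.size (e.eval m) ≤ e.weight * β ∧ e.cost m ≤ 2 * e.weight * β := by
  induction e with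
  | lit v =>
    have h1 : Nat.size v ≤ Nat.log2 v + 1 := by rw [Nat.size_le]; exact Nat.lt_log2_self
    simp only [weight, eval, cost]; refine ⟨by omega, by nlinarith, by nlinarith⟩
  | cell a ih =>
    simp only [weight, eval, cost]
    have := hm (a.eval m)
    refine ⟨by omega, by nlinarith, by nlinarith⟩
  | size a ih =>
    simp only [weight, eval, cost]
    have h2 := size_size_le (a.eval m)
    have h3 := size_size_le (Nat.size (a.eval m))
    have h4 : 1 * 1 ≤ a.weight * β := Nat.mul_le_mul ih.1 hβ
    refine ⟨by omega, by nlinarith, by nlinarith⟩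
  | bin o a b iha ihb =>
    simp only [weight, eval, cost]
    have key : Nat.size (o.eval (a.eval m) (b.eval m)) ≤
        Nat.size (a.eval m) + Nat.size (b.eval m) + 1 := by
      cases o <;> simp only [BinOp.eval]
      · exact size_add_le _ _
      · exact (Nat.size_le_size (Nat.sub_le _ _)).trans (by omega)
      · exact (size_mul_le _ _).trans (by omega)
      · exact (Nat.size_le_size (Nat.div_le_self _ _)).trans (by omega)
      · exact (Nat.size_le_size (Nat.mod_le _ _)).trans (by omega)
      · exact (size_ite_le _).trans (by omega)
      · exact (size_ite_le _).trans (by omega)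
    obtain ⟨-, a1, a2⟩ := iha
    obtain ⟨-, b1, b2⟩ := ihb
    refine ⟨by omega, by nlinarith, by nlinarith⟩
end Expr

end Monitoring
end

/-! ### The monitoring algorithm as concrete programs. -/

noncomputable section
open scoped ENNReal
namespace Monitoring

/-! ### Parameters and programs -/

/-- The numbers that all parties know. -/
structure Par where
  n : ℕ
  k : ℕ
  w : ℕ
  e : ℕ
  d : ℕ

namespace Par
variable (p : Par)
/-- The total length of the parameters, which stands for a logarithmic factor. -/
def lg : ℕ := Nat.size p.n + Nat.size p.k + Nat.size p.w + Nat.size p.e + Nat.size p.d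
/-- The sampling effort: an item is sampled about `P / min (L, w)` times. -/
def P : ℕ := 2 ^ 40 * (p.e * p.e) * (p.lg * p.lg * p.lg * p.lg)
/-- The number of slots for samples. -/
def N : ℕ := 2 ^ 10 * p.P * p.lg
/-- The number of digits of the number of scales of thresholds. -/
def a : ℕ := Nat.size p.lg + 3
/-- The mesh of the thresholds. -/
def K : ℕ := 2 ^ 20 * (p.w * p.w) * p.e
/-- The number of digits of the numbers that items draw. -/
def dd : ℕ := 8 * p.lg
/-- The scaling of the values of samples. -/
def A : ℕ := 2 ^ 20 * p.P * p.e
/-- The exponent in the approximation of logarithms by lengths of powers. -/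
def E : ℕ := 2 ^ 20 * p.K * p.w * p.e
end Par

open Monitoring.Expr

def lgE : Expr := .size (c 0) + .size (c 1) + .size (c 2) + .size (c 3) + .size (c 4)
def PE : Expr := .lit (2 ^ 40) * (c 3 * c 3) * (lgE * lgE * lgE * lgE)
def NE : Expr := .lit (2 ^ 10) * PE * lgE
def aE : Expr := .size lgE + 3
def KE : Expr := .lit (2 ^ 20) * (c 2 * c 2) * c 3
def ddE : Expr := 8 * lgE
def AE : Expr := .lit (2 ^ 20) * PE * c 3
def EE : Expr := .lit (2 ^ 20) * KE * c 2 * c 3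

/-- Treat slot `s = c 10` at a site when the item `c 9` arrives. -/
def siteSlot : Cmd Empty :=
  .seq (.ite (eq (.cell (2 * c 10 + 16)) (c 9))
    (.seq (.rand 11 ddE)
      (.ite (lt (c 11) (.cell (2 * c 10 + 17)))
        (.seq (.set (2 * c 10 + 17) 0) (.send (c 10 + 1)))
        .skip))
    .skip)
  (.set 10 (c 10 + 1))

/-- Treat the arrival of the item `c 9` at a site: find the hits, choose the sample of the current
block of arrivals, and count. -/
def siteProc : Cmd Empty :=
  .seq (.ite (c 7) .skip (.rand 8 (.size (c 6 + 1) - 1)))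
  (.seq (.set 10 0)
  (.seq (.loop NE siteSlot)
  (.seq (.ite (eq (c 8) (c 7)) (.send (NE + 2 + c 9)) .skip)
  (.seq (.set 7 (c 7 + 1))
    (.ite (lt (c 7) ((c 6 + 1) / (2 * c 1))) .skip (.seq (.set 7 0) (.send (NE + 1))))))))

/-- Cells of a site: `6` holds `W - 1`, so that empty memory means `W = 1`; `7` is the position in
the block, `8` the offset of the sample, `9` the item; slot `s` has its item at `2s + 16` and its
threshold at `2s + 17`. If the block length `W / (2k)` is zero, the item is forwarded. -/
def siteItem : Cmd Empty :=
  .seq (.recv 9) (.ite ((c 6 + 1) / (2 * c 1)) siteProc (.send (c 9)))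

/-- A first word `0` asks the site to treat a forwarded item. Otherwise the first word is `W`,
followed by the data of one slot; a new value of `W` restarts the block. -/
def siteMsg : Cmd Empty :=
  .seq (.recv 11)
  (.ite (c 11)
    (.seq (.ite (eq (c 11) (c 6 + 1)) .skip (.seq (.set 6 (c 11 - 1)) (.set 7 0)))
    (.seq (.recv 10) (.seq (.recv (2 * c 10 + 16)) (.recv (2 * c 10 + 17)))))
    (.seq (.recv 9) siteProc))

/-- Store a power. -/
def powCmd (t : ℕ) (b e : Expr) : Cmd Unit :=
  .seq (.set (.lit t) 1) (.loop e (.set (.lit t) (c t * b)))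

/-- The number of sites that receive the data of the slots. -/
def kkE : Expr := lt 0 ((c 7 + 1) / (2 * c 1)) * c 1 + eq 0 ((c 7 + 1) / (2 * c 1))

/-- Send the data of the slot `c 15` to the sites. -/
def bcast : Cmd Unit :=
  .seq (.set 22 0)
  (.loop kkE
    (.seq (.send (c 7 + 1)) (.seq (.send (c 15))
    (.seq (.send (.cell (4 * c 15 + 64))) (.seq (.send (.cell (4 * c 15 + 65)))
    (.seq (.ask () (c 22)) (.set 22 (c 22 + 1))))))))

/-- Look for a slot whose sample has left the window. -/
def findSlot : Cmd Unit :=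
  .seq (.set 15 NE) (.seq (.set 27 0)
    (.loop NE (.seq (.ite (lt (c 9) (.cell (4 * c 27 + 67))) .skip (.set 15 (c 27)))
      (.set 27 (c 27 + 1)))))

/-- Choose a threshold for a sample. -/
def drawThreshold : Cmd Unit :=
  .seq (.rand 16 aE) (.seq (powCmd 17 2 (c 16)) (.seq (.rand 18 (c 16)) (.set 18 (c 18 + c 17))))

/-- Fill the slot `c 15` with the item `c 13 - 1`. -/
def fillSlot : Cmd Unit :=
  .seq (powCmd 19 KE (c 18)) (.seq (powCmd 20 (KE - 1) (c 18)) (.seq (powCmd 21 2 ddE)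
  (.seq (powCmd 29 2 aE)
  (.seq (.set (4 * c 15 + 64) (c 13 - 1))
  (.seq (.set (4 * c 15 + 65) (c 21 * (c 19 - c 20) / c 19))
  (.seq (.set (4 * c 15 + 66) (AE * (c 7 + 1) * c 29 * c 17 * KE * (c 19 - c 20) /
    ((PE / (c 8 + 1) + 1) * c 19 * (c 18 * c 18))))
  (.seq (.set (4 * c 15 + 67) (c 9 + c 2 + 1))
  (.set 10 (c 10 + 1)))))))))

/-- A new sample of the item `c 13 - 1`. If there is no free slot, then it is dropped. -/
def newSample : Cmd Unit :=
  .seq findSlot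
  (.ite (lt (c 15) NE) (.seq drawThreshold (.seq fillSlot bcast)) (.set 28 (c 9 + c 2 + 1)))

/-- The word `s + 1` reports a hit of slot `s`, `N + 1` a completed block, and `N + 2 + v` a sample
of item `v`. No word is `0`, so the default value of `recv` marks the end. Cell `13` becomes `v +
1`, leaving `0` for the absence of a sample. -/
def readWords : Cmd Unit :=
  .seq (.set 13 0) (.seq (.set 14 0)
  (.loop (NE + 2) (.seq (.recv 12)
    (.ite (c 12)
      (.ite (lt (c 12) (NE + 1)) (.set (4 * (c 12 - 1) + 65) 0)
        (.ite (eq (c 12) (NE + 1)) (.set 14 1) (.set 13 (c 12 - (NE + 1)))))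
      .skip))))

/-- Cells `7` and `8` hold `W - 1` and `T - 1`. The length `T` doubles when `2T` is at most the
clock and at most `w`; then `W` doubles too unless `2T < 2WP`. After each change all slots are sent
again, which reaches the sites that join when the blocks become nonempty. -/
def rescale : Cmd Unit :=
  .ite (lt (c 9) (2 * (c 8 + 1))) .skip
  (.ite (lt (c 2) (2 * (c 8 + 1))) .skip
    (.seq (.set 8 (2 * c 8 + 1))
    (.seq (.ite (lt (c 8 + 1) (2 * (c 7 + 1) * PE)) .skip (.set 7 (2 * c 7 + 1)))
    (.seq (.set 15 0) (.loop NE (.seq bcast (.set 15 (c 15 + 1))))))))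

def tickCmd : Cmd Unit :=
  .seq (.set 9 (c 9 + ((c 7 + 1) / (2 * c 1) + eq 0 ((c 7 + 1) / (2 * c 1))))) rescale

def minE : Expr := lt (c 9) (c 2) * c 9 + (1 - lt (c 9) (c 2)) * c 2

/-- Logarithms are read off from lengths: `size (m^E) / E` approximates `log₂ m`, and `K (size
((K+1)^E) - size (K^E)) / E` approximates `1 / ln 2`. Cells `5` and `6` are the numerator and
denominator of `log₂ m - X / (m ln 2)`, where `X` is the sum of the values of the live samples that
have been hit. -/
def estimateCmd : Cmd Unit :=
  .seq (powCmd 23 minE EE) (.seq (powCmd 24 (KE + 1) EE) (.seq (powCmd 25 KE EE)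
  (.seq (.set 26 0) (.seq (.set 27 0)
  (.seq (.loop NE (.seq
    (.ite (.cell (4 * c 27 + 65)) .skip
      (.ite (lt (c 9) (.cell (4 * c 27 + 67))) (.set 26 (c 26 + .cell (4 * c 27 + 66))) .skip))
    (.set 27 (c 27 + 1))))
  (.seq (.set 5 (.size (c 23) * AE * minE - KE * (.size (c 24) - .size (c 25)) * c 26))
    (.set 6 (EE * AE * minE))))))))

/-- What the coordinator does with a report of a site. -/
def digest : Cmd Unit :=
  .seq readWords
  (.seq (.ite (c 13) (.loop (PE / (c 8 + 1) + 1) newSample) .skip)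
  (.seq (.ite (c 14) tickCmd .skip) estimateCmd))

/-- The first word of the inbox is the number of the sender, which does not matter. If the block
length is zero, the report is the item itself; site 0 treats it, and its answer takes the place of
the report. -/
def coordCmd : Cmd Unit :=
  .seq (.recv 11)
  (.seq (.ite ((c 7 + 1) / (2 * c 1)) .skip
    (.seq (.recv 12) (.seq (.send 0) (.seq (.send (c 12)) (.ask () 0)))))
  digest)

def algo : Algorithm := ⟨siteItem, siteMsg, coordCmd⟩

/-- The memory holds the parameters. -/
def HasPar (p : Par) (m : Memory) : Prop :=
  m 0 = p.n ∧ m 1 = p.k ∧ m 2 = p.w ∧ m 3 = p.e ∧ m 4 = p.d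

namespace HasPar
variable {p : Par} {m : Memory} (h : HasPar p m)
include h
theorem lgE_eval : lgE.eval m = p.lg := by
  obtain ⟨h0, h1, h2, h3, h4⟩ := h; simp [lgE, Par.lg, *]
theorem PE_eval : PE.eval m = p.P := by
  simp [PE, Par.P, h.lgE_eval, h.2.2.2.1]
theorem NE_eval : NE.eval m = p.N := by simp [NE, Par.N, h.lgE_eval, h.PE_eval]
theorem aE_eval : aE.eval m = p.a := by simp [aE, Par.a, h.lgE_eval]
theorem KE_eval : KE.eval m = p.K := by simp [KE, Par.K, h.2.2.1, h.2.2.2.1]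
theorem ddE_eval : ddE.eval m = p.dd := by simp [ddE, Par.dd, h.lgE_eval]
theorem AE_eval : AE.eval m = p.A := by simp [AE, Par.A, h.PE_eval, h.2.2.2.1]
theorem EE_eval : EE.eval m = p.E := by simp [EE, Par.E, h.KE_eval, h.2.2.1, h.2.2.2.1]
omit h
theorem congr {m' : Memory} (h : HasPar p m) (hm : ∀ a < 5, m' a = m a) : HasPar p m' := by
  obtain ⟨h0, h1, h2, h3, h4⟩ := h
  refine ⟨?_, ?_, ?_, ?_, ?_⟩ <;> rw [hm _ (by norm_num)] <;> assumption
end HasPar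

end Monitoring
end

/-! ### Behaviour and resources of a single site. -/

noncomputable section
open scoped ENNReal
namespace Monitoring
open Monitoring.Expr

/-! ### Resources of a site -/

/-- A bound on the length of all numbers that a site handles. -/
def Par.β (p : Par) : ℕ := 128 * p.lg

/-- The constant in the cost of an instruction. -/
def κ : ℕ := 2 ^ 22

/-- A bound for the space of a site. -/
def Par.Y (p : Par) : ℕ := 2 * κ * p.β * (p.N + 20)

structure Par.Valid (p : Par) : Prop where
  n : 0 < p.n
  k : 0 < p.k
  w : 0 < p.w
  e : 20 ≤ p.e
  d : 0 < p.d

theorem one_le_size {x : ℕ} (h : 0 < x) : 1 ≤ Nat.size x := Nat.size_pos.2 h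

namespace Par.Valid
variable {p : Par} (hp : p.Valid)
include hp

theorem lg_pos : 9 ≤ p.lg := by
  have := one_le_size hp.n; have := one_le_size hp.k; have := one_le_size hp.w
  have := one_le_size hp.d
  have : Nat.size 20 ≤ Nat.size p.e := Nat.size_le_size hp.e
  have h5 : Nat.size 20 = 5 := by decide +kernel
  unfold Par.lg; omega

theorem lg_lt : p.lg < 2 ^ p.lg := by have := hp.k; exact Nat.lt_two_pow_self

theorem size_le_lg : Nat.size p.n ≤ p.lg ∧ Nat.size p.k ≤ p.lg ∧ Nat.size p.w ≤ p.lg ∧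
    Nat.size p.e ≤ p.lg ∧ Nat.size p.d ≤ p.lg := by have := hp.k; unfold Par.lg; omega

theorem N_lt : p.N < 2 ^ (50 + 7 * p.lg) := by
  have he : p.e < 2 ^ p.lg := (Nat.lt_size_self p.e).trans_le
    (Nat.pow_le_pow_right (by norm_num) hp.size_le_lg.2.2.2.1)
  have hl := hp.lg_lt
  have h0 : 0 < p.lg := by have := hp.lg_pos; omega
  have e0 : 0 < p.e := by have := hp.e; omega
  unfold Par.N Par.P
  calc 2 ^ 10 * (2 ^ 40 * (p.e * p.e) * (p.lg * p.lg * p.lg * p.lg)) * p.lg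
      = 2 ^ 50 * (p.e ^ 2 * p.lg ^ 5) := by ring
    _ < 2 ^ 50 * ((2 ^ p.lg) ^ 2 * (2 ^ p.lg) ^ 5) := by
        gcongr
    _ = 2 ^ (50 + 7 * p.lg) := by ring

theorem size_of_lt {x : ℕ} (hx : x < 2 ^ (120 * p.lg)) : Nat.size x ≤ p.β := by
  have := hp.k
  rw [Nat.size_le]; exact hx.trans_le (Nat.pow_le_pow_right (by norm_num) (by unfold Par.β; omega))

theorem two_pow_le {a : ℕ} (h : a ≤ 13 * p.lg) : 2 ^ a ≤ 2 ^ (13 * p.lg) := by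
  have := hp.k
  exact Nat.pow_le_pow_right (by norm_num) h

theorem lt_big {x : ℕ} (hx : Nat.size x ≤ p.lg) : x < 2 ^ (13 * p.lg) :=
  (Nat.lt_size_self x).trans_le (hp.two_pow_le (by omega))

/-- The constant `50` in the exponent is absorbed by `6 * lg`, as `lg ≥ 9`. -/
theorem N_lt' : p.N < 2 ^ (13 * p.lg) := hp.N_lt.trans_le (hp.two_pow_le (by have := hp.lg_pos; omega))

/-- The factor `8192` leaves room for sums of a few numbers below `2 ^ (13 * lg)`, so that linear
arithmetic alone bounds the lengths of computed addresses and words. -/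
theorem big_mul (x : ℕ) (hx : x < 2 ^ (13 * p.lg) * 8192) : x < 2 ^ (120 * p.lg) := by
  refine hx.trans_le ?_
  have : (8192 : ℕ) = 2 ^ 13 := by norm_num
  rw [this, ← pow_add]
  exact Nat.pow_le_pow_right (by norm_num) (by have := hp.lg_pos; omega)

theorem β_pos : 1 ≤ p.β := by have := hp.lg_pos; unfold Par.β; omega

end Par.Valid

/-- The resources of a site: short numbers, few cells, `q` words in the outgoing message, and time
at most `t`. -/
structure Res (p : Par) (t q : ℕ) (M : Machine) : Prop where
  size : ∀ a, Nat.size (M.mem a) ≤ p.β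
  supp : ∀ a, 2 * p.N + 18 ≤ a → M.mem a = 0
  inb : M.inbox.length ≤ 9 ∧ ∀ x ∈ M.inbox, Nat.size x ≤ p.β
  outb : M.outbox.length ≤ q ∧ ∀ x ∈ M.outbox, Nat.size x ≤ p.β
  peak : M.peak ≤ p.Y
  time : M.time ≤ t

theorem msgBits_le {l : List ℕ} {b : ℕ} (h : ∀ x ∈ l, Nat.size x ≤ b) :
    msgBits l ≤ 1 + l.length * (2 * b + 2) := by
  unfold msgBits
  have := List.sum_le_card_nsmul (l.map fun v => 2 * Nat.size v + 2) (2 * b + 2) (by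
    intro y hy
    obtain ⟨x, hx, rfl⟩ := List.mem_map.1 hy
    have := h x hx; omega)
  simpa using this

theorem memBits_le {m : Memory} {A b s : ℕ} (hA : ∀ a, A ≤ a → m a = 0)
    (hb : ∀ a, Nat.size (m a) ≤ b) (hs : Nat.size A ≤ s) : memBits m ≤ A * (1 + s + b) := by
  unfold memBits Finsupp.sum
  have hsub : m.support ⊆ Finset.range A := by
    intro a ha
    rw [Finset.mem_range]
    by_contra hc
    exact Finsupp.mem_support_iff.1 ha (hA a (by omega))
  calc _ ≤ ∑ a ∈ m.support, (1 + s + b) := by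
        refine Finset.sum_le_sum fun a ha => ?_
        have h1 := Nat.size_le_size (Finset.mem_range.1 (hsub ha)).le
        have h2 := hb a
        show 1 + Nat.size a + Nat.size (m a) ≤ _
        omega
    _ ≤ _ := by
        rw [Finset.sum_const, smul_eq_mul]
        exact Nat.mul_le_mul_right _ ((Finset.card_le_card hsub).trans (by simp))

namespace Res
variable {p : Par} {t q : ℕ} {M : Machine}

theorem cost_le (hp : p.Valid) (h : Res p t q M) (e : Expr) : e.cost M.mem ≤ 2 * e.weight * p.β :=
  (size_eval_le hp.β_pos h.size e).2.2

/-- There are at most `2N + 18` occupied cells, nine incoming and `N + 9` outgoing words, all of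
`O(β)` bits. -/
theorem space_le (hp : p.Valid) (h : Res p t q M) (hq : q ≤ p.N + 9) :
    M.space ≤ 20 * p.β * (p.N + 20) := by
  unfold Machine.space
  have h1 := memBits_le h.supp h.size (s := p.β)
    (hp.size_of_lt (hp.big_mul _ (by have := hp.N_lt'; have := hp.lg_pos; omega)))
  have h2 := msgBits_le h.inb.2
  have h3 := msgBits_le h.outb.2
  have h4 : M.inbox.length * (2 * p.β + 2) ≤ 9 * (2 * p.β + 2) := Nat.mul_le_mul_right _ h.inb.1
  have h5 : M.outbox.length * (2 * p.β + 2) ≤ (p.N + 9) * (2 * p.β + 2) :=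
    Nat.mul_le_mul_right _ (h.outb.1.trans hq)
  have := hp.β_pos
  nlinarith

/-- The bound `Y` exceeds the space at rest by more than the cost of one instruction and the loop
counters, so the peak never has to be tracked from one instruction to the next. -/
theorem charge (hp : p.Valid) (h : Res p t q M) (hq : q ≤ p.N + 9) {h' c : ℕ} (hh : h' ≤ 2 * p.β)
    (hc : c ≤ κ * p.β) : Res p (t + κ * p.β) q (M.charge h' c) := by
  refine ⟨h.size, h.supp, h.inb, h.outb, ?_, by have := h.time; simp; omega⟩
  have h1 := h.space_le hp hq
  refine max_le h.peak ?_
  have := hp.β_pos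
  unfold Par.Y
  have : (κ : ℕ) ≥ 100 := by unfold κ; norm_num
  nlinarith [Nat.zero_le (κ * p.β * p.N)]

theorem mono {t' q' : ℕ} (h : Res p t q M) (ht : t ≤ t') (hq : q ≤ q') : Res p t' q' M :=
  ⟨h.size, h.supp, h.inb, ⟨h.outb.1.trans hq, h.outb.2⟩, h.peak, h.time.trans ht⟩

theorem write {a v : ℕ} (h : Res p t q M) (ha : a < 2 * p.N + 18) (hv : Nat.size v ≤ p.β) :
    Res p t q (M.write a v) := by
  refine ⟨fun b => ?_, fun b hb => ?_, h.inb, h.outb, h.peak, h.time⟩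
  · simp only [Machine.write_mem, upd_apply]; split
    · exact hv
    · exact h.size b
  · simp only [Machine.write_mem, upd_apply]; rw [if_neg (by omega)]; exact h.supp b hb

theorem push {v : ℕ} (h : Res p t q M) (hv : Nat.size v ≤ p.β) :
    Res p t (q + 1) { M with outbox := M.outbox ++ [v] } := by
  refine ⟨h.size, h.supp, h.inb, ⟨by simpa using h.outb.1, fun x hx => ?_⟩, h.peak, h.time⟩
  rcases List.mem_append.1 hx with hx | hx
  · exact h.outb.2 x hx
  · rw [List.mem_singleton.1 hx]; exact hv

theorem pop (h : Res p t q M) : Res p t q { M with inbox := M.inbox.tail } :=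
  ⟨h.size, h.supp, ⟨by simp; have := h.inb.1; omega,
    fun x hx => h.inb.2 x (List.mem_of_mem_tail hx)⟩, h.outb, h.peak, h.time⟩

theorem headD_size (h : Res p t q M) : Nat.size (M.inbox.headD 0) ≤ p.β := by
  cases hi : M.inbox with
  | nil => simp
  | cons x l => exact h.inb.2 x (by simp [hi])

theorem set (hp : p.Valid) (h : Res p t q M) (hq : q ≤ p.N + 9) {h' : ℕ} (hh : h' ≤ 2 * p.β)
    {a e : Expr} (hae : 2 * a.weight + 2 * e.weight ≤ κ) (ha : a.eval M.mem < 2 * p.N + 18)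
    (hv : Nat.size (e.eval M.mem) ≤ p.β) :
    Res p (t + κ * p.β) q
      ((M.charge h' (a.cost M.mem + e.cost M.mem)).write (a.eval M.mem) (e.eval M.mem)) := by
  refine (h.charge hp hq hh ?_).write ha hv
  have := h.cost_le hp a; have := h.cost_le hp e; nlinarith

theorem rand (hp : p.Valid) (h : Res p t q M) (hq : q ≤ p.N + 9) {h' : ℕ} (hh : h' ≤ 2 * p.β)
    {a e : Expr} (hae : 2 * a.weight + 2 * e.weight + 1 ≤ κ) (ha : a.eval M.mem < 2 * p.N + 18)
    (hd : e.eval M.mem ≤ p.β) {x : ℕ} (hx : x < 2 ^ e.eval M.mem) :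
    Res p (t + κ * p.β) q
      ((M.charge h' (a.cost M.mem + e.cost M.mem + e.eval M.mem)).write (a.eval M.mem) x) := by
  refine (h.charge hp hq hh ?_).write ha ((Nat.size_le.2 hx).trans hd)
  have := h.cost_le hp a; have := h.cost_le hp e; nlinarith

theorem test (hp : p.Valid) (h : Res p t q M) (hq : q ≤ p.N + 9) {h' : ℕ} (hh : h' ≤ 2 * p.β)
    {e : Expr} (hae : 2 * e.weight ≤ κ) : Res p (t + κ * p.β) q (M.charge h' (e.cost M.mem)) := by
  refine h.charge hp hq hh ?_
  have := h.cost_le hp e; nlinarith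

theorem send (hp : p.Valid) (h : Res p t q M) (hq : q ≤ p.N + 9) {h' : ℕ} (hh : h' ≤ 2 * p.β)
    {e : Expr} (hae : 2 * e.weight + 4 ≤ κ) (hv : Nat.size (e.eval M.mem) ≤ p.β) :
    Res p (t + κ * p.β) (q + 1)
      { M.charge h' (e.cost M.mem + 2 * Nat.size (e.eval M.mem) + 2) with
        outbox := M.outbox ++ [e.eval M.mem] } := by
  refine (h.charge hp hq hh ?_).push hv
  have := h.cost_le hp e; have := hp.β_pos; nlinarith

theorem recv (hp : p.Valid) (h : Res p t q M) (hq : q ≤ p.N + 9) {h' : ℕ} (hh : h' ≤ 2 * p.β)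
    {a : Expr} (hae : 2 * a.weight + 2 ≤ κ) (ha : a.eval M.mem < 2 * p.N + 18) :
    Res p (t + κ * p.β) q
      { (M.charge h' (a.cost M.mem + 1 + Nat.size (M.inbox.headD 0))).write (a.eval M.mem)
      (M.inbox.headD 0) with inbox := M.inbox.tail } := by
  refine Res.pop ((h.charge hp hq hh ?_).write ha h.headD_size)
  have := h.cost_le hp a; have := h.headD_size; have := hp.β_pos; nlinarith

section
variable {Q σ : Type} {reply : Q → ℕ → List ℕ → σ → PMF (List ℕ × σ)} {h' : ℕ} {g : σ}
  {F : Machine × σ → ℝ≥0∞} {B : ℝ≥0∞} {a e : Expr} {x y : ℕ}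

/-- These rules push a bound on an expectation through one instruction. The machine afterwards is
known only by its memory, buffers and resource bound, which keeps exact time and peak out of later
goals. -/
theorem ex_set (hp : p.Valid) (h : Res p t q M) (hq : q ≤ p.N + 9) (hh : h' ≤ 2 * p.β)
    (hae : 2 * a.weight + 2 * e.weight ≤ κ) (ha : a.eval M.mem = x) (hx : x < 2 * p.N + 18)
    (he : e.eval M.mem = y) (hy : Nat.size y ≤ p.β)
    (hF : ∀ M', M'.mem = M.mem.update x y → M'.inbox = M.inbox → M'.outbox = M.outbox →
      Res p (t + κ * p.β) q M' → F (M', g) ≤ B) :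
    Ex ((Cmd.set a e : Cmd Q).exec reply h' (M, g)) F ≤ B := by
  rw [Ex_set]
  refine hF _ ?_ rfl rfl (h.set hp hq hh hae (ha ▸ hx) (he ▸ hy))
  simp [ha, he]

theorem ex_rand (hp : p.Valid) (h : Res p t q M) (hq : q ≤ p.N + 9) (hh : h' ≤ 2 * p.β)
    (hae : 2 * a.weight + 2 * e.weight + 1 ≤ κ) (ha : a.eval M.mem = x) (hx : x < 2 * p.N + 18)
    (he : e.eval M.mem = y) (hy : y ≤ p.β) {φ : ℕ → ℝ≥0∞}
    (hF : ∀ u < 2 ^ y, ∀ M', M'.mem = M.mem.update x u → M'.inbox = M.inbox →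
      M'.outbox = M.outbox → Res p (t + κ * p.β) q M' → F (M', g) ≤ φ u) :
    Ex ((Cmd.rand a e : Cmd Q).exec reply h' (M, g)) F ≤
      (∑ u ∈ Finset.range (2 ^ y), φ u) / 2 ^ y := by
  rw [Ex_rand, Ex_uniformBits]
  simp only [he]
  refine ENNReal.div_le_div_right (Finset.sum_le_sum fun u hu => ?_) _
  rw [Finset.mem_range] at hu
  have := h.rand hp hq hh hae (ha ▸ hx) (he ▸ hy) (he.symm ▸ hu)
  rw [he] at this
  refine hF u hu _ ?_ rfl rfl this
  simp [ha]

theorem ex_ite (hp : p.Valid) (h : Res p t q M) (hq : q ≤ p.N + 9) (hh : h' ≤ 2 * p.β)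
    {c d : Cmd Q} (hae : 2 * e.weight ≤ κ)
    (hc : e.eval M.mem ≠ 0 → ∀ M', M'.mem = M.mem → M'.inbox = M.inbox → M'.outbox = M.outbox →
      Res p (t + κ * p.β) q M' → Ex (c.exec reply h' (M', g)) F ≤ B)
    (hd : e.eval M.mem = 0 → ∀ M', M'.mem = M.mem → M'.inbox = M.inbox → M'.outbox = M.outbox →
      Res p (t + κ * p.β) q M' → Ex (d.exec reply h' (M', g)) F ≤ B) :
    Ex ((Cmd.ite e c d).exec reply h' (M, g)) F ≤ B := by
  rw [Ex_ite]
  have := h.test hp hq hh hae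
  split
  · exact hc ‹_› _ rfl rfl rfl this
  · exact hd (not_not.1 ‹_›) _ rfl rfl rfl this

theorem ex_send (hp : p.Valid) (h : Res p t q M) (hq : q ≤ p.N + 9) (hh : h' ≤ 2 * p.β)
    (hae : 2 * e.weight + 4 ≤ κ) (he : e.eval M.mem = y) (hy : Nat.size y ≤ p.β)
    (hF : ∀ M', M'.mem = M.mem → M'.inbox = M.inbox → M'.outbox = M.outbox ++ [y] →
      Res p (t + κ * p.β) (q + 1) M' → F (M', g) ≤ B) :
    Ex ((Cmd.send e : Cmd Q).exec reply h' (M, g)) F ≤ B := by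
  rw [Ex_send]
  refine hF _ rfl rfl ?_ (h.send hp hq hh hae (he ▸ hy))
  simp [he]

theorem ex_recv (hp : p.Valid) (h : Res p t q M) (hq : q ≤ p.N + 9) (hh : h' ≤ 2 * p.β)
    (hae : 2 * a.weight + 2 ≤ κ) (ha : a.eval M.mem = x) (hx : x < 2 * p.N + 18)
    (hF : ∀ M', M'.mem = M.mem.update x (M.inbox.headD 0) → M'.inbox = M.inbox.tail →
      M'.outbox = M.outbox → Res p (t + κ * p.β) q M' → F (M', g) ≤ B) :
    Ex ((Cmd.recv a : Cmd Q).exec reply h' (M, g)) F ≤ B := by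
  rw [Ex_recv]
  refine hF _ ?_ rfl rfl (h.recv hp hq hh hae (ha ▸ hx))
  simp [ha]
end

end Res

theorem Ex_loop_le {Q σ : Type} {reply : Q → ℕ → List ℕ → σ → PMF (List ℕ × σ)} {h : ℕ}
    {M : Machine} {g : σ} {F : Machine × σ → ℝ≥0∞} {e : Expr} {c : Cmd Q}
    (V : ℕ → Machine × σ → ℝ≥0∞) (r : ℕ) (hr : e.eval M.mem = r) (hF : ∀ s, F s ≤ V r s)
    (hV : ∀ i < r, ∀ M' g', Ex (c.exec reply (h + Nat.size r + 1)
      (M'.charge h (Nat.size r + 1), g')) (V (i + 1)) ≤ V i (M', g')) :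
    Ex ((Cmd.loop e c).exec reply h (M, g)) F ≤ V 0 (M.charge h (e.cost M.mem), g) := by
  subst hr
  exact (Ex_mono _ fun s _ => hF s).trans (Ex_loop e c V hV)

theorem sum_range_ite_lt (D x : ℕ) (hx : x ≤ D) (b c : ℝ≥0∞) :
    ∑ u ∈ Finset.range D, (if u < x then b else c) = x * b + (D - x : ℕ) * c := by
  rw [Finset.range_eq_Ico, ← Finset.sum_Ico_consecutive _ (Nat.zero_le x) hx]
  congr 1
  · rw [Finset.sum_congr rfl (g := fun _ => b)]
    · simp
    · intro u hu; rw [if_pos (Finset.mem_Ico.1 hu).2]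
  · rw [Finset.sum_congr rfl (g := fun _ => c)]
    · simp
    · intro u hu; rw [if_neg (by have := (Finset.mem_Ico.1 hu).1; omega)]

end Monitoring
end

noncomputable section
open scoped ENNReal
namespace Monitoring
open Monitoring.Expr

/-! ### The program of a site on an arrival -/

/-- Sites ask nobody. -/
abbrev noReply : Empty → ℕ → List ℕ → Unit → PMF (List ℕ × Unit) := fun q => q.elim

/-- The state of a site after it treated its first `i` slots, where `m` is the memory before. -/
structure SlotPost (m : Memory) (v i : ℕ) (M : Machine) : Prop where
  frame : ∀ a, a ≠ 10 → a ≠ 11 → (∀ s < i, a ≠ 2 * s + 17) → M.mem a = m a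
  cnt : M.mem 10 = i
  hit : ∀ s < i, M.mem (2 * s + 17) ≠ m (2 * s + 17) → M.mem (2 * s + 17) = 0 ∧ m (2 * s + 16) = v
  out : M.outbox =
    ((List.range i).filter fun s => decide (M.mem (2 * s + 17) ≠ m (2 * s + 17))).map (· + 1)

/-- Average over the outcomes of the treatment of slot `s`. -/
def mix (p : Par) (m : Memory) (v : ℕ) (γ₁ γ₀ : ℕ → ℝ≥0∞) (s : ℕ) : ℝ≥0∞ :=
  if m (2 * s + 16) = v then
    (m (2 * s + 17) * γ₁ s + (2 ^ p.dd - m (2 * s + 17) : ℕ) * γ₀ s) / 2 ^ p.dd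
  else γ₀ s

variable {p : Par} {m : Memory} {v i t : ℕ} {M : Machine}

theorem SlotPost.next (h : SlotPost m v i M) {M' : Machine}
    (hm : ∀ a, a ≠ 10 → a ≠ 11 → a ≠ 2 * i + 17 → M'.mem a = M.mem a) (h10 : M'.mem 10 = i + 1)
    (hh : (M'.mem (2 * i + 17) = m (2 * i + 17) ∧ M'.outbox = M.outbox) ∨
      (M'.mem (2 * i + 17) = 0 ∧ m (2 * i + 17) ≠ 0 ∧ m (2 * i + 16) = v ∧
        M'.outbox = M.outbox ++ [i + 1])) : SlotPost m v (i + 1) M' := by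
  have hlt : ∀ s < i, M'.mem (2 * s + 17) = M.mem (2 * s + 17) := fun s hs =>
    hm _ (by omega) (by omega) (by omega)
  refine ⟨fun a h1 h2 h3 => ?_, h10, fun s hs hne => ?_, ?_⟩
  · rw [hm a h1 h2 (h3 i (by omega))]
    exact h.frame a h1 h2 fun s hs => h3 s (by omega)
  · rcases Nat.lt_succ_iff_lt_or_eq.1 hs with hs' | rfl
    · rw [hlt s hs'] at hne ⊢; exact h.hit s hs' hne
    · rcases hh with hh | hh
      · exact absurd hh.1 hne
      · exact ⟨hh.1, hh.2.2.1⟩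
  · rw [List.range_succ, List.filter_append, List.map_append]
    have : (List.range i).filter (fun s => decide (M'.mem (2 * s + 17) ≠ m (2 * s + 17))) =
        (List.range i).filter fun s => decide (M.mem (2 * s + 17) ≠ m (2 * s + 17)) :=
      List.filter_congr fun s hs => by rw [hlt s (List.mem_range.1 hs)]
    rw [this, ← h.out]
    rcases hh with hh | hh
    · simp [hh.1, hh.2]
    · rw [hh.2.2.2]; simp [hh.1, Ne.symm hh.2.1]

/-- Here `γ₁` and `γ₀` are arbitrary weights for a hit and for no hit, and `rest` carries the
factors of the other slots. A random number of `dd` digits lies below the threshold with probability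
`thr / 2^dd`. -/
theorem siteSlot_spec (hp : p.Valid) (hi : i < p.N) (hm : HasPar p m) (hv : m 9 = v)
    (hthr : m (2 * i + 17) ≤ 2 ^ p.dd) (h : SlotPost m v i M) (hr : Res p t i M) {h' : ℕ}
    (hh : h' ≤ 2 * p.β) {G : Machine × Unit → ℝ≥0∞} {γ₁ γ₀ : ℕ → ℝ≥0∞} {rest : ℝ≥0∞}
    (hG : ∀ M', SlotPost m v (i + 1) M' → Res p (t + 6 * (κ * p.β)) (i + 1) M' →
      (∀ s < i, M'.mem (2 * s + 17) = M.mem (2 * s + 17)) →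
      G (M', ()) ≤ (if M'.mem (2 * i + 17) ≠ m (2 * i + 17) then γ₁ i else γ₀ i) * rest) :
    Ex (siteSlot.exec noReply h' (M, ())) G ≤ mix p m v γ₁ γ₀ i * rest := by
  have hN := hp.N_lt'
  have hlg := hp.lg_pos
  have e9 : M.mem 9 = v := by rw [h.frame 9 (by norm_num) (by norm_num) (by omega), hv]
  have e16 : M.mem (2 * i + 16) = m (2 * i + 16) :=
    h.frame _ (by omega) (by omega) (by omega)
  have e17 : M.mem (2 * i + 17) = m (2 * i + 17) :=
    h.frame _ (by omega) (by omega) (by omega)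
  have hM : HasPar p M.mem :=
    hm.congr fun a ha => h.frame a (by omega) (by omega) (by omega)
  have si : Nat.size (i + 1) ≤ p.β := hp.size_of_lt (hp.big_mul _ (by omega))
  simp only [siteSlot, Ex_seq]
  -- The branches share their end, the increment of the slot counter; the threshold alone tells
  -- whether the slot was hit.
  have last : ∀ {M₁ : Machine} {t' q' : ℕ}, (∀ a, a ≠ 11 → a ≠ 2 * i + 17 → M₁.mem a = M.mem a) →
      ((M₁.mem (2 * i + 17) = m (2 * i + 17) ∧ M₁.outbox = M.outbox) ∨
      (M₁.mem (2 * i + 17) = 0 ∧ m (2 * i + 17) ≠ 0 ∧ m (2 * i + 16) = v ∧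
        M₁.outbox = M.outbox ++ [i + 1])) → t' ≤ t + 5 * (κ * p.β) → q' ≤ i + 1 →
      Res p t' q' M₁ → Ex ((Cmd.set 10 (c 10 + 1)).exec noReply h' (M₁, ())) G ≤
        (if M₁.mem (2 * i + 17) ≠ m (2 * i + 17) then γ₁ i else γ₀ i) * rest := by
    intro M₁ t' q' hm₁ hc₁ ht hq hr₁
    have e10 : M₁.mem 10 = i := by rw [hm₁ 10 (by omega) (by omega), h.cnt]
    refine hr₁.ex_set hp (by omega) hh (by decide) (x := 10) (y := i + 1) rfl (by omega)
      (by simp [e10]) si ?_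
    intro M₂ hM₂ _ ho hr₂
    have hx : M₂.mem (2 * i + 17) = M₁.mem (2 * i + 17) := by
      rw [hM₂, upd_apply, if_neg (by omega)]
    rw [← hx]
    refine hG M₂ (h.next ?_ (by simp [hM₂, upd_apply]) (by rw [hx, ho]; exact hc₁))
      (hr₂.mono (by omega) hq) ?_
    · intro a h1 h2 h3; rw [hM₂, upd_apply, if_neg h1, hm₁ a h2 h3]
    · intro s hs; rw [hM₂, upd_apply, if_neg (by omega), hm₁ _ (by omega) (by omega)]
  unfold mix
  refine hr.ex_ite hp (by omega) hh (by decide) ?_ ?_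
  · intro hit M₁ hM₁ _ ho₁ hr₁
    have hit : m (2 * i + 16) = v := by
      by_contra hc; simp [h.cnt, e16, e9, hc] at hit
    simp only [hit, if_true, Ex_seq]
    -- The mixture is written as an average over the `2^dd` values of the random number, split at
    -- the threshold.
    rw [ENNReal.mul_div_right_comm.symm, ← sum_range_ite_lt _ _ hthr, Finset.sum_mul]
    refine hr₁.ex_rand hp (by omega) hh (by decide) (x := 11) rfl (by omega) (y := p.dd)
      (by rw [hM₁, hM.ddE_eval]) (by simp only [Par.dd, Par.β]; omega)
      (φ := fun u => (if u < m (2 * i + 17) then γ₁ i else γ₀ i) * rest) ?_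
    intro u hu M₂ hM₂ _ ho₂ hr₂
    have f11 : M₂.mem 11 = u := by simp [hM₂, upd_apply]
    have f10 : M₂.mem 10 = i := by simp [hM₂, hM₁, upd_apply, h.cnt]
    have f17 : M₂.mem (2 * i + 17) = m (2 * i + 17) := by
      rw [hM₂, upd_apply, if_neg (by omega), hM₁, e17]
    refine hr₂.ex_ite hp (by omega) hh (by decide) ?_ ?_
    · intro hlt M₃ hM₃ _ ho₃ hr₃
      have hlt : u < m (2 * i + 17) := by
        by_contra hc; simp [f11, f10, f17, hc] at hlt
      simp only [hlt, if_true, Ex_seq]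
      refine hr₃.ex_set hp (by omega) hh (by decide) (x := 2 * i + 17) (y := 0)
        (by simp [hM₃, f10]) (by omega) rfl (by simp) ?_
      intro M₄ hM₄ _ ho₄ hr₄
      refine hr₄.ex_send hp (by omega) hh (by decide) (y := i + 1)
        (by simp [hM₄, upd_apply, hM₃, f10]) si ?_
      intro M₅ hM₅ _ ho₅ hr₅
      have h17 : M₅.mem (2 * i + 17) = 0 := by simp [hM₅, hM₄, upd_apply]
      refine (last ?_ (Or.inr ⟨h17, (Nat.zero_le u).trans_lt hlt |>.ne', hit, by rw [ho₅, ho₄, ho₃, ho₂, ho₁]⟩) (by omega)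
        le_rfl hr₅).trans_eq ?_
      · intro a h1 h2
        rw [hM₅, hM₄, upd_apply, if_neg h2, hM₃, hM₂, upd_apply, if_neg h1, hM₁]
      · rw [if_pos (by rw [h17]; omega)]
    · intro hlt M₃ hM₃ _ ho₃ hr₃
      have hlt : ¬ u < m (2 * i + 17) := by
        intro hc; simp [f11, f10, f17, hc] at hlt
      have h17 : M₃.mem (2 * i + 17) = m (2 * i + 17) := by rw [hM₃, f17]
      simp only [hlt, if_false, Ex_skip]
      refine (last ?_ (Or.inl ⟨h17, by rw [ho₃, ho₂, ho₁]⟩) (by omega)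
        (by omega) hr₃).trans_eq ?_
      · intro a h1 h2
        rw [hM₃, hM₂, upd_apply, if_neg h1, hM₁]
      · rw [if_neg (by rw [h17]; simp)]
  · intro hit M₁ hM₁ _ ho₁ hr₁
    have hit : ¬ m (2 * i + 16) = v := by
      intro hc; simp [h.cnt, e16, e9, hc] at hit
    have h17 : M₁.mem (2 * i + 17) = m (2 * i + 17) := by rw [hM₁, e17]
    simp only [hit, if_false, Ex_skip]
    refine (last (fun a _ _ => by rw [hM₁]) (Or.inl ⟨h17, ho₁⟩) (by omega)
      (by omega) hr₁).trans_eq ?_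
    rw [if_neg (by rw [h17]; simp)]

/-- The state of a site after `siteProc`, where `m` is the memory before and `x` the position of the
sample in the block. -/
structure ProcPost (p : Par) (m : Memory) (v x : ℕ) (M : Machine) : Prop where
  frame : ∀ a, a ≠ 7 → a ≠ 8 → a ≠ 9 → a ≠ 10 → a ≠ 11 → (∀ s < p.N, a ≠ 2 * s + 17) → M.mem a = m a
  off : M.mem 8 = x
  pos : M.mem 7 = if m 7 + 1 < (m 6 + 1) / (2 * p.k) then m 7 + 1 else 0
  hit : ∀ s < p.N, M.mem (2 * s + 17) ≠ m (2 * s + 17) →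
    M.mem (2 * s + 17) = 0 ∧ m (2 * s + 16) = v
  out : M.outbox = (((List.range p.N).filter fun s =>
      decide (M.mem (2 * s + 17) ≠ m (2 * s + 17))).map (· + 1) ++
    (if x = m 7 then [p.N + 2 + v] else [])) ++
    (if m 7 + 1 < (m 6 + 1) / (2 * p.k) then [] else [p.N + 1])

/-- The slots use independent random numbers, so the expectation of the product of the weights is
the product of the averages. -/
theorem siteLoop_spec (hp : p.Valid) (hm : HasPar p m) (hv : m 9 = v)
    (hthr : ∀ s < p.N, m (2 * s + 17) ≤ 2 ^ p.dd) (h : SlotPost m v 0 M) (hr : Res p t 0 M)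
    {G : Machine × Unit → ℝ≥0∞} {γ₁ γ₀ : ℕ → ℝ≥0∞} {rest : ℝ≥0∞}
    (hG : ∀ M', SlotPost m v p.N M' → Res p (t + (7 * p.N + 1) * (κ * p.β)) p.N M' →
      G (M', ()) ≤ (∏ s ∈ Finset.range p.N,
        if M'.mem (2 * s + 17) ≠ m (2 * s + 17) then γ₁ s else γ₀ s) * rest) :
    Ex ((Cmd.loop NE siteSlot).exec noReply 0 (M, ())) G ≤
      (∏ s ∈ Finset.range p.N, mix p m v γ₁ γ₀ s) * rest := by
  classical
  have hM : HasPar p M.mem :=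
    hm.congr fun a ha => h.frame a (by omega) (by omega) (by omega)
  have hN := hp.N_lt'
  have sN : Nat.size p.N ≤ p.β := hp.size_of_lt (hp.big_mul _ (by omega))
  have hβ := hp.β_pos
  have hκ : 10 ≤ κ := by unfold κ; norm_num
  -- Realised weights for the slots already treated, averages for the others, and `⊤` where the
  -- invariant fails.
  let V : ℕ → Machine × Unit → ℝ≥0∞ := fun i s =>
    if SlotPost m v i s.1 ∧ Res p (t + (7 * i + 1) * (κ * p.β)) i s.1 then
      (∏ j ∈ Finset.range i, if s.1.mem (2 * j + 17) ≠ m (2 * j + 17) then γ₁ j else γ₀ j) *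
        ((∏ j ∈ Finset.Ico i p.N, mix p m v γ₁ γ₀ j) * rest) else ⊤
  have key := Ex_loop_le (reply := noReply) (h := 0) (M := M) (g := ()) (F := G) (e := NE)
    (c := siteSlot) V p.N hM.NE_eval ?_ ?_
  · refine key.trans_eq ?_
    have r1 := hr.test hp (by omega) (Nat.zero_le _) (e := NE) (by decide)
    have h1 : SlotPost m v 0 (M.charge 0 (NE.cost M.mem)) := ⟨h.frame, h.cnt, h.hit, h.out⟩
    simp only [V]
    rw [if_pos ⟨h1, by simpa using r1⟩]
    simp
  · rintro ⟨M', ⟨⟩⟩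
    simp only [V]
    split_ifs with hc
    · simpa using hG M' hc.1 hc.2
    · exact le_top
  · rintro i hi M' ⟨⟩
    by_cases hc : SlotPost m v i M' ∧ Res p (t + (7 * i + 1) * (κ * p.β)) i M'
    · obtain ⟨hs, hr'⟩ := hc
      have hr'' := hr'.charge hp (by omega) (h' := 0) (Nat.zero_le _) (c := Nat.size p.N + 1)
        (by nlinarith)
      have hs' : SlotPost m v i (M'.charge 0 (Nat.size p.N + 1)) :=
        ⟨hs.frame, hs.cnt, hs.hit, hs.out⟩
      have e1 : V i (M', ()) = mix p m v γ₁ γ₀ i * ((∏ j ∈ Finset.range i,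
          if M'.mem (2 * j + 17) ≠ m (2 * j + 17) then γ₁ j else γ₀ j) *
          ((∏ j ∈ Finset.Ico (i + 1) p.N, mix p m v γ₁ γ₀ j) * rest)) := by
        simp only [V]
        rw [if_pos ⟨hs, hr'⟩, Finset.prod_eq_prod_Ico_succ_bot hi]
        ring
      rw [e1]
      refine siteSlot_spec hp hi hm hv (hthr i hi) hs' hr'' (by omega) ?_
      intro M'' g1 g2 g3
      simp only [V]
      rw [if_pos ⟨g1, g2.mono (by linarith [Nat.zero_le (κ * p.β), Nat.zero_le (p.N * (κ * p.β))]) le_rfl⟩, Finset.prod_range_succ]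
      rw [Finset.prod_congr rfl fun j hj => by
        rw [g3 j (Finset.mem_range.1 hj)]]
      simp only [Machine.charge_mem]
      ring_nf
      exact le_rfl
    · have : V i (M', ()) = ⊤ := if_neg hc
      rw [this]; exact le_top

-- The offset is drawn at the first arrival of a block only, independently of the hits; therefore
-- the bound is a product of an average over hits and an average over `x`. Later in the block `x` is
-- the stored offset.
set_option maxHeartbeats 1000000 in
theorem siteProc_spec (hp : p.Valid) (hm : HasPar p M.mem) (hv : M.mem 9 = v) (hvn : v < p.n)
    (hthr : ∀ s < p.N, M.mem (2 * s + 17) ≤ 2 ^ p.dd) (hW : Nat.size (M.mem 6 + 1) ≤ p.lg + 1)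
    (hpos : Nat.size (M.mem 7 + 1) ≤ p.lg + 1) (hr : Res p t 0 M) (ho : M.outbox = [])
    {G : Machine × Unit → ℝ≥0∞} {γ₁ γ₀ ζ : ℕ → ℝ≥0∞}
    (hG : ∀ x M', (M.mem 7 = 0 → x < 2 ^ (Nat.size (M.mem 6 + 1) - 1)) →
      (M.mem 7 ≠ 0 → x = M.mem 8) → ProcPost p M.mem v x M' →
      Res p (t + (7 * p.N + 10) * (κ * p.β)) (p.N + 2) M' →
      G (M', ()) ≤ (∏ s ∈ Finset.range p.N,
        if M'.mem (2 * s + 17) ≠ M.mem (2 * s + 17) then γ₁ s else γ₀ s) * ζ x) :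
    Ex (siteProc.exec noReply 0 (M, ())) G ≤
      (∏ s ∈ Finset.range p.N, mix p M.mem v γ₁ γ₀ s) *
      (if M.mem 7 = 0 then (∑ x ∈ Finset.range (2 ^ (Nat.size (M.mem 6 + 1) - 1)), ζ x) /
        2 ^ (Nat.size (M.mem 6 + 1) - 1) else ζ (M.mem 8)) := by
  have hN := hp.N_lt'
  have hlg := hp.lg_pos
  have hn := hp.lt_big hp.size_le_lg.1
  have sN : Nat.size (p.N + 1) ≤ p.β := hp.size_of_lt (hp.big_mul _ (by omega))
  have sv : Nat.size (p.N + 2 + v) ≤ p.β := hp.size_of_lt (hp.big_mul _ (by omega))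
  have sp : Nat.size (M.mem 7 + 1) ≤ p.β := hpos.trans (by unfold Par.β; omega)
  have rest : ∀ x (M₁ : Machine), (M.mem 7 = 0 → x < 2 ^ (Nat.size (M.mem 6 + 1) - 1)) →
      (M.mem 7 ≠ 0 → x = M.mem 8) → M₁.mem 8 = x → (∀ a, a ≠ 8 → M₁.mem a = M.mem a) →
      M₁.outbox = [] → Res p (t + 2 * (κ * p.β)) 0 M₁ →
      Ex ((Cmd.seq (.set 10 0)
        (.seq (.loop NE siteSlot)
        (.seq (.ite (eq (c 8) (c 7)) (.send (NE + 2 + c 9)) .skip)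
        (.seq (.set 7 (c 7 + 1))
        (.ite (lt (c 7) ((c 6 + 1) / (2 * c 1))) .skip
          (.seq (.set 7 0) (.send (NE + 1)))))))).exec noReply 0 (M₁, ())) G ≤
      (∏ s ∈ Finset.range p.N, mix p M.mem v γ₁ γ₀ s) * ζ x := by
    intro x M₁ hx1 hx2 hx hM₁ ho₁ hr₁
    have hp₁ : HasPar p M₁.mem := hm.congr fun a ha => hM₁ a (by omega)
    simp only [Ex_seq]
    refine hr₁.ex_set hp (by omega) (Nat.zero_le _) (by decide) (x := 10) (y := 0) rfl (by omega)
      rfl (by simp) ?_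
    intro M₂ hM₂ _ ho₂ hr₂
    have e2 : ∀ s, mix p M.mem v γ₁ γ₀ s = mix p M₁.mem v γ₁ γ₀ s := by
      intro s; unfold mix; rw [hM₁ _ (by omega), hM₁ _ (by omega)]
    simp only [e2]
    refine siteLoop_spec hp hp₁ (by rw [hM₁ 9 (by norm_num), hv])
      (fun s hs => by rw [hM₁ _ (by omega)]; exact hthr s hs) ?_ hr₂ ?_
    · refine ⟨fun a h1 _ _ => by rw [hM₂, upd_apply, if_neg h1], by simp [hM₂, upd_apply],
        fun s hs => absurd hs (by omega), by rw [ho₂, ho₁]; rfl⟩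
    intro M₃ h₃ hr₃
    have f : ∀ a, a ≠ 8 → a ≠ 10 → a ≠ 11 → (∀ s < p.N, a ≠ 2 * s + 17) → M₃.mem a = M.mem a :=
      fun a h1 h2 h3 h4 => by rw [h₃.frame a h2 h3 h4, hM₁ a h1]
    have f8 : M₃.mem 8 = x := by
      rw [h₃.frame 8 (by norm_num) (by norm_num) (by omega), hx]
    have f7 : M₃.mem 7 = M.mem 7 := f 7 (by norm_num) (by norm_num) (by norm_num) (by omega)
    have f6 : M₃.mem 6 = M.mem 6 := f 6 (by norm_num) (by norm_num) (by norm_num) (by omega)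
    have f9 : M₃.mem 9 = v := by
      rw [f 9 (by norm_num) (by norm_num) (by norm_num) (by omega), hv]
    have hp₃ : HasPar p M₃.mem := hm.congr fun a ha =>
      f a (by omega) (by omega) (by omega) (by omega)
    -- the part after the sample has been sent
    have fin : ∀ {M₄ : Machine} {t' q' : ℕ}, M₄.mem = M₃.mem →
        M₄.outbox = M₃.outbox ++ (if x = M.mem 7 then [p.N + 2 + v] else []) →
        t' ≤ t + (7 * p.N + 6) * (κ * p.β) → q' ≤ p.N + 1 → Res p t' q' M₄ →
        Ex ((Cmd.set 7 (c 7 + 1)).exec noReply 0 (M₄, ())) (fun s' => Ex ((Cmd.ite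
          (lt (c 7) ((c 6 + 1) / (2 * c 1))) .skip
            (.seq (.set 7 0) (.send (NE + 1)))).exec noReply 0 s') G) ≤
        (∏ s ∈ Finset.range p.N, if M₃.mem (2 * s + 17) ≠ M₁.mem (2 * s + 17) then γ₁ s else γ₀ s)
          * ζ x := by
      intro M₄ t' q' hM₄ ho₄ ht hq hr₄
      refine hr₄.ex_set hp (by omega) (Nat.zero_le _) (by decide) (x := 7) (y := M.mem 7 + 1) rfl
        (by omega) (by simp [hM₄, f7]) sp ?_
      intro M₅ hM₅ _ ho₅ hr₅
      have e17 : ∀ s, M₁.mem (2 * s + 17) = M.mem (2 * s + 17) := fun s => hM₁ _ (by omega)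
      have post : ∀ M₆ : Machine, (∀ a, a ≠ 7 → M₆.mem a = M₃.mem a) →
          M₆.mem 7 = (if M.mem 7 + 1 < (M.mem 6 + 1) / (2 * p.k) then M.mem 7 + 1 else 0) →
          M₆.outbox = M₄.outbox ++
            (if M.mem 7 + 1 < (M.mem 6 + 1) / (2 * p.k) then [] else [p.N + 1]) →
          Res p (t + (7 * p.N + 10) * (κ * p.β)) (p.N + 2) M₆ →
          G (M₆, ()) ≤ (∏ s ∈ Finset.range p.N,
            if M₃.mem (2 * s + 17) ≠ M₁.mem (2 * s + 17) then γ₁ s else γ₀ s) * ζ x := by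
        intro M₆ g1 g2 g3 g4
        have e3 : ∀ s, M₃.mem (2 * s + 17) = M₆.mem (2 * s + 17) := fun s => (g1 _ (by omega)).symm
        simp only [e17, e3]
        refine hG x M₆ hx1 hx2 ⟨?_, ?_, g2, ?_, ?_⟩ g4
        · intro a h1 h2 _ h3 h4 h5; rw [g1 a h1, f a h2 h3 h4 h5]
        · rw [g1 8 (by norm_num), f8]
        · intro s hs hne
          rw [← e3, ← e17] at hne
          have := h₃.hit s hs hne
          rw [← e3, ← hM₁ _ (by omega)]; exact this
        · rw [g3, ho₄, h₃.out]
          simp only [e17, e3]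
      have g5 : ∀ a, a ≠ 7 → M₅.mem a = M₃.mem a := fun a ha => by
        rw [hM₅, upd_apply, if_neg ha, hM₄]
      have g57 : M₅.mem 7 = M.mem 7 + 1 := by simp [hM₅, upd_apply]
      have g56 : M₅.mem 6 = M.mem 6 := by rw [g5 6 (by norm_num), f6]
      have hp₅ : HasPar p M₅.mem := hp₃.congr fun a ha => g5 a (by omega)
      have ev : (lt (c 7) ((c 6 + 1) / (2 * c 1))).eval M₅.mem =
          if M.mem 7 + 1 < (M.mem 6 + 1) / (2 * p.k) then 1 else 0 := by
        simp [g57, g56, hp₅.2.1]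
      refine hr₅.ex_ite hp (by omega) (Nat.zero_le _) (by decide) ?_ ?_
      · intro hb M₆ hM₆ _ ho₆ hr₆
        rw [ev] at hb
        have hb' : M.mem 7 + 1 < (M.mem 6 + 1) / (2 * p.k) := by
          by_contra hc; simp [hc] at hb
        rw [Ex_skip]
        refine post M₆ (fun a ha => by rw [hM₆, g5 a ha]) (by rw [hM₆, g57, if_pos hb'])
          (by rw [ho₆, ho₅, if_pos hb', List.append_nil]) (hr₆.mono (by linarith [Nat.zero_le (κ * p.β), Nat.zero_le (p.N * (κ * p.β))]) (by omega))
      · intro hb M₆ hM₆ _ ho₆ hr₆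
        rw [ev] at hb
        have hb' : ¬ M.mem 7 + 1 < (M.mem 6 + 1) / (2 * p.k) := by
          intro hc; simp [hc] at hb
        rw [Ex_seq]
        refine hr₆.ex_set hp (by omega) (Nat.zero_le _) (by decide) (x := 7) (y := 0) rfl
          (by omega) rfl (by simp) ?_
        intro M₇ hM₇ _ ho₇ hr₇
        have hp₇ : HasPar p M₇.mem := hp₅.congr fun a ha => by
          rw [hM₇, upd_apply, if_neg (by omega), hM₆]
        refine hr₇.ex_send hp (by omega) (Nat.zero_le _) (by decide) (y := p.N + 1)
          (by simp [hp₇.NE_eval]) sN ?_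
        intro M₈ hM₈ _ ho₈ hr₈
        refine post M₈ (fun a ha => by rw [hM₈, hM₇, upd_apply, if_neg ha, hM₆, g5 a ha])
          (by rw [hM₈, hM₇, if_neg hb']; simp [upd_apply])
          (by rw [ho₈, ho₇, ho₆, ho₅, if_neg hb']) (hr₈.mono (by linarith [Nat.zero_le (κ * p.β), Nat.zero_le (p.N * (κ * p.β))]) (by omega))
    refine hr₃.ex_ite hp (by omega) (Nat.zero_le _) (by decide) ?_ ?_
    · intro hb M₄ hM₄ _ ho₄ hr₄
      have hb' : x = M.mem 7 := by
        by_contra hc; simp [f8, f7, hc] at hb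
      refine hr₄.ex_send hp (by omega) (Nat.zero_le _) (by decide) (y := p.N + 2 + v)
        (by rw [hM₄]; simp [hp₃.NE_eval, f9]) sv ?_
      intro M₅ hM₅ _ ho₅ hr₅
      exact fin (by rw [hM₅, hM₄]) (by rw [ho₅, ho₄, if_pos hb']) (by linarith [Nat.zero_le (κ * p.β), Nat.zero_le (p.N * (κ * p.β))]) le_rfl hr₅
    · intro hb M₄ hM₄ _ ho₄ hr₄
      have hb' : ¬ x = M.mem 7 := by
        intro hc; simp [f8, f7, hc] at hb
      rw [Ex_skip]
      exact fin hM₄ (by rw [ho₄, if_neg hb', List.append_nil]) (by linarith [Nat.zero_le (κ * p.β), Nat.zero_le (p.N * (κ * p.β))]) (by omega) hr₄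
  rw [siteProc, Ex_seq]
  refine hr.ex_ite hp (by omega) (Nat.zero_le _) (by decide) ?_ ?_
  · intro h7 M₁ hM₁ _ ho₁ hr₁
    have h7 : M.mem 7 ≠ 0 := by simpa using h7
    rw [Ex_skip, if_neg h7]
    exact rest _ _ (fun h => absurd h h7) (fun _ => rfl) (by rw [hM₁]) (fun a _ => by rw [hM₁])
      (by rw [ho₁, ho]) (hr₁.mono (by linarith [Nat.zero_le (κ * p.β), Nat.zero_le (p.N * (κ * p.β))]) le_rfl)
  · intro h7 M₁ hM₁ _ ho₁ hr₁
    have h7 : M.mem 7 = 0 := by simpa using h7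
    rw [if_pos h7, ← mul_div_assoc, Finset.mul_sum]
    refine hr₁.ex_rand hp (by omega) (Nat.zero_le _) (by decide) (x := 8) rfl (by omega)
      (by simp [hM₁]) (by unfold Par.β; omega) ?_
    intro u hu M₂ hM₂ _ ho₂ hr₂
    exact rest u M₂ (fun _ => hu) (fun h => absurd h7 h) (by simp [hM₂, upd_apply])
      (fun a ha => by rw [hM₂, upd_apply, if_neg ha, hM₁]) (by rw [ho₂, ho₁, ho])
      (hr₂.mono (by linarith [Nat.zero_le (κ * p.β), Nat.zero_le (p.N * (κ * p.β))]) le_rfl)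

end Monitoring
end

noncomputable section
open scoped ENNReal
namespace Monitoring
open Monitoring.Expr

/-! ### What a site does on an arrival and on a message -/

/-- With a test function that is `0` on `Q` and `⊤` elsewhere, the rules for expectations also prove
properties of all outcomes, and a program need not be analysed twice. -/
theorem sure_of_ex {α : Type} {p : PMF α} {Q : α → Prop}
    (h : ∀ F : α → ℝ≥0∞, (∀ a, Q a → F a ≤ 0) → Ex p F ≤ 0) : Sure p Q := by
  classical
  refine sure_of_ex_ne_top (f := fun a => if Q a then 0 else ⊤) ?_ fun a ha => if_neg ha
  have := h (fun a => if Q a then 0 else ⊤) fun a ha => by simp [ha]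
  intro hc; rw [hc] at this; simp at this

variable {p : Par} {v t : ℕ} {M : Machine}

/-- The resources of a site between its activities. -/
structure Idle (p : Par) (t : ℕ) (M : Machine) : Prop where
  res : Res p t 0 M
  inbox : M.inbox = []
  outbox : M.outbox = []

theorem Idle.start (hp : p.Valid) (h : Idle p t M) {msg : List ℕ} (hl : msg.length ≤ 9)
    (hm : ∀ x ∈ msg, Nat.size x ≤ p.β) :
    Res p (t + κ * p.β) 0 ({ M with inbox := msg, outbox := [] }.charge 0 (msgBits msg)) := by
  have h1 : Res p t 0 { M with inbox := msg, outbox := [] } :=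
    ⟨h.res.size, h.res.supp, ⟨hl, hm⟩, by simp, h.res.peak, h.res.time⟩
  refine h1.charge hp (by omega) (Nat.zero_le _) ?_
  have h2 := msgBits_le hm
  have h3 : msg.length * (2 * p.β + 2) ≤ 9 * (2 * p.β + 2) := Nat.mul_le_mul_right _ hl
  have := hp.β_pos
  have : 100 ≤ κ := by unfold κ; norm_num
  nlinarith

theorem Res.idle {q : ℕ} (h : Res p t q M) : Idle p t { M with inbox := [], outbox := [] } :=
  ⟨⟨h.size, h.supp, by simp, by simp, h.peak, h.time⟩, rfl, rfl⟩

theorem Idle.mono {t' : ℕ} (h : Idle p t M) (ht : t ≤ t') : Idle p t' M :=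
  ⟨h.res.mono ht le_rfl, h.inbox, h.outbox⟩

/-- The memory of a site after it learned the data of slot `s`. -/
structure SetPost (m : Memory) (W s x y : ℕ) (m' : Memory) : Prop where
  frame : ∀ a, a ≠ 6 → a ≠ 7 → a ≠ 10 → a ≠ 11 → a ≠ 2 * s + 16 → a ≠ 2 * s + 17 → m' a = m a
  scale : m' 6 + 1 = W
  pos : m' 7 = if W = m 6 + 1 then m 7 else 0
  item : m' (2 * s + 16) = x
  thr : m' (2 * s + 17) = y

theorem runSite_set (hp : p.Valid) (h : Idle p t M) {W s x y : ℕ} (hW : 0 < W) (hs : s < p.N)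
    (sW : Nat.size W ≤ p.β) (ss : Nat.size s ≤ p.β) (sx : Nat.size x ≤ p.β)
    (sy : Nat.size y ≤ p.β) :
    Sure (runSite siteMsg [W, s, x, y] M) fun r => r.1 = [] ∧ SetPost M.mem W s x y r.2.mem ∧
      Idle p (t + 20 * (κ * p.β)) r.2 := by
  rw [runSite]
  refine Sure.map (sure_of_ex fun F hF => ?_)
  have hr := h.start hp (msg := [W, s, x, y]) (by simp) (by simp; exact ⟨sW, ss, sx, sy⟩)
  have hm : ({ M with inbox := [W, s, x, y], outbox := [] }.charge 0
    (msgBits [W, s, x, y])).mem = M.mem := rfl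
  have hi : ({ M with inbox := [W, s, x, y], outbox := [] }.charge 0
    (msgBits [W, s, x, y])).inbox = [W, s, x, y] := rfl
  have ho : ({ M with inbox := [W, s, x, y], outbox := [] }.charge 0
    (msgBits [W, s, x, y])).outbox = [] := rfl
  generalize ({ M with inbox := [W, s, x, y], outbox := [] }.charge 0
    (msgBits [W, s, x, y])) = M₀ at hr hm hi ho
  rw [siteMsg, Ex_seq]
  refine hr.ex_recv hp (by omega) (Nat.zero_le _) (by decide) (x := 11) rfl (by omega) ?_
  intro M₁ hM₁ hi₁ ho₁ hr₁
  rw [hi] at hM₁ hi₁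
  refine hr₁.ex_ite hp (by omega) (Nat.zero_le _) (by decide) ?_ ?_
  swap
  · intro hc; simp [hM₁, upd_apply] at hc; omega
  intro _ M₂ hM₂ hi₂ ho₂ hr₂
  rw [Ex_seq]
  have f6 : M₂.mem 6 = M.mem 6 := by simp [hM₂, hM₁, upd_apply, hm]
  have f11 : M₂.mem 11 = W := by simp [hM₂, hM₁, upd_apply]
  have rest : ∀ {M₃ : Machine} {t' : ℕ}, (∀ a, a ≠ 6 → a ≠ 7 → a ≠ 11 → M₃.mem a = M.mem a) →
      M₃.mem 6 + 1 = W → (M₃.mem 7 = if W = M.mem 6 + 1 then M.mem 7 else 0) →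
      M₃.inbox = [s, x, y] → M₃.outbox = [] → t' ≤ t + 7 * (κ * p.β) → Res p t' 0 M₃ →
      Ex ((Cmd.seq (.recv 10) (.seq (.recv (2 * c 10 + 16)) (.recv (2 * c 10 + 17)))).exec
        noReply 0 (M₃, ())) F ≤ 0 := by
    intro M₃ t' g1 g2 g3 g4 g5 ht hr₃
    simp only [Ex_seq]
    refine hr₃.ex_recv hp (by omega) (Nat.zero_le _) (by decide) (x := 10) rfl (by omega) ?_
    intro M₄ hM₄ hi₄ ho₄ hr₄
    rw [g4] at hM₄ hi₄
    have e4 : M₄.mem 10 = s := by simp [hM₄, upd_apply]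
    refine hr₄.ex_recv hp (by omega) (Nat.zero_le _) (by decide) (x := 2 * s + 16)
      (by simp [e4]) (by omega) ?_
    intro M₅ hM₅ hi₅ ho₅ hr₅
    rw [hi₄] at hM₅ hi₅
    have e5 : M₅.mem 10 = s := by rw [hM₅, upd_apply, if_neg (by omega), e4]
    refine hr₅.ex_recv hp (by omega) (Nat.zero_le _) (by decide) (x := 2 * s + 17)
      (by simp [e5]) (by omega) ?_
    intro M₆ hM₆ hi₆ ho₆ hr₆
    rw [hi₅] at hM₆ hi₆
    refine hF _ ⟨by show M₆.outbox = []; rw [ho₆, ho₅, ho₄, g5], ⟨?_, ?_, ?_, ?_, ?_⟩, ?_⟩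
    · intro a h1 h2 h3 h4 h5 h6
      show M₆.mem a = _
      rw [hM₆, upd_apply, if_neg h6, hM₅, upd_apply, if_neg h5, hM₄, upd_apply, if_neg h3,
        g1 a h1 h2 h4]
    · show M₆.mem 6 + 1 = _
      rw [hM₆, upd_apply, if_neg (by omega), hM₅, upd_apply, if_neg (by omega), hM₄, upd_apply,
        if_neg (by omega), g2]
    · show M₆.mem 7 = _
      rw [hM₆, upd_apply, if_neg (by omega), hM₅, upd_apply, if_neg (by omega), hM₄, upd_apply,
        if_neg (by omega), g3]
    · show M₆.mem _ = _
      rw [hM₆, upd_apply, if_neg (by omega), hM₅, upd_apply, if_pos rfl]; rfl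
    · show M₆.mem _ = _
      rw [hM₆, upd_apply, if_pos rfl]; rfl
    · exact hr₆.idle.mono (by linarith [Nat.zero_le (κ * p.β)])
  refine hr₂.ex_ite hp (by omega) (Nat.zero_le _) (by decide) ?_ ?_
  · intro hc M₃ hM₃ hi₃ ho₃ hr₃
    have hc' : W = M.mem 6 + 1 := by by_contra hn; simp [f6, f11, hn] at hc
    rw [Ex_skip]
    refine rest ?_ (by rw [hM₃, f6, hc']) ?_ (by rw [hi₃, hi₂, hi₁]; rfl)
      (by rw [ho₃, ho₂, ho₁, ho]) (by linarith [Nat.zero_le (κ * p.β)]) hr₃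
    · intro a h1 h2 h3; rw [hM₃, hM₂, hM₁, upd_apply, if_neg h3, hm]
    · rw [hM₃, if_pos hc', hM₂, hM₁, upd_apply, if_neg (by omega), hm]
  · intro hc M₃ hM₃ hi₃ ho₃ hr₃
    have hc' : ¬ W = M.mem 6 + 1 := by intro hn; simp [f6, f11, hn] at hc
    rw [Ex_seq]
    refine hr₃.ex_set hp (by omega) (Nat.zero_le _) (by decide) (x := 6) (y := W - 1) rfl
      (by omega) (by simp [hM₃, f11]) ((Nat.size_le_size (Nat.sub_le _ _)).trans sW) ?_
    intro M₄ hM₄ hi₄ ho₄ hr₄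
    refine hr₄.ex_set hp (by omega) (Nat.zero_le _) (by decide) (x := 7) (y := 0) rfl
      (by omega) rfl (by simp) ?_
    intro M₅ hM₅ hi₅ ho₅ hr₅
    refine rest ?_ ?_ ?_ (by rw [hi₅, hi₄, hi₃, hi₂, hi₁]; rfl)
      (by rw [ho₅, ho₄, ho₃, ho₂, ho₁, ho]) (by linarith [Nat.zero_le (κ * p.β)]) hr₅
    · intro a h1 h2 h3
      rw [hM₅, upd_apply, if_neg h2, hM₄, upd_apply, if_neg h1, hM₃, hM₂, hM₁, upd_apply,
        if_neg h3, hm]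
    · rw [hM₅, upd_apply, if_neg (by omega), hM₄, upd_apply, if_pos rfl]; omega
    · rw [hM₅, upd_apply, if_pos rfl, if_neg hc']

/-- The bound for the expectation over what a site finds out about an arrival. -/
def arrivalBound (p : Par) (m : Memory) (v : ℕ) (γ₁ γ₀ ζ : ℕ → ℝ≥0∞) : ℝ≥0∞ :=
  (∏ s ∈ Finset.range p.N, mix p m v γ₁ γ₀ s) *
    (if m 7 = 0 then (∑ x ∈ Finset.range (2 ^ (Nat.size (m 6 + 1) - 1)), ζ x) /
      2 ^ (Nat.size (m 6 + 1) - 1) else ζ (m 8))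

theorem arrivalBound_congr {m m' : Memory} (h : ∀ a, a ≠ 9 → a ≠ 11 → m' a = m a) (v : ℕ)
    (γ₁ γ₀ ζ : ℕ → ℝ≥0∞) : arrivalBound p m' v γ₁ γ₀ ζ = arrivalBound p m v γ₁ γ₀ ζ := by
  unfold arrivalBound mix
  rw [h 6 (by norm_num) (by norm_num), h 7 (by norm_num) (by norm_num),
    h 8 (by norm_num) (by norm_num)]
  congr 1
  refine Finset.prod_congr rfl fun s _ => ?_
  rw [h _ (by omega) (by omega), h _ (by omega) (by omega)]

theorem ProcPost.congr {m m' : Memory} {x : ℕ} (h : ∀ a, a ≠ 9 → a ≠ 11 → m' a = m a)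
    (hq : ProcPost p m' v x M) : ProcPost p m v x M := by
  have e7 := h 7 (by norm_num) (by norm_num)
  have e6 := h 6 (by norm_num) (by norm_num)
  have e17 : ∀ s, m' (2 * s + 17) = m (2 * s + 17) := fun s => h _ (by omega) (by omega)
  have e16 : ∀ s, m' (2 * s + 16) = m (2 * s + 16) := fun s => h _ (by omega) (by omega)
  obtain ⟨h1, h2, h3, h4, h5⟩ := hq
  refine ⟨fun a a1 a2 a3 a4 a5 a6 => by rw [h1 a a1 a2 a3 a4 a5 a6, h a a3 a5], h2,
    by rw [h3, e7, e6], ?_, ?_⟩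
  · simpa only [e17, e16] using h4
  · simpa only [e17, e7, e6] using h5

/-- What is needed of the memory of a site that treats an arrival. -/
structure Ready (p : Par) (m : Memory) : Prop where
  par : HasPar p m
  thr : ∀ s < p.N, m (2 * s + 17) ≤ 2 ^ p.dd
  scale : Nat.size (m 6 + 1) ≤ p.lg + 1
  pos : Nat.size (m 7 + 1) ≤ p.lg + 1

/-- The conclusion about a result of `runSite` for an arrival. -/
def RunBound (p : Par) (t : ℕ) (m : Memory) (v : ℕ) (γ₁ γ₀ ζ : ℕ → ℝ≥0∞)
    (G : List ℕ × Machine → ℝ≥0∞) : Prop :=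
  ∀ x M', (m 7 = 0 → x < 2 ^ (Nat.size (m 6 + 1) - 1)) → (m 7 ≠ 0 → x = m 8) →
    ProcPost p m v x M' → M'.outbox.length ≤ p.N + 2 → (∀ y ∈ M'.outbox, Nat.size y ≤ p.β) →
    Idle p (t + (7 * p.N + 20) * (κ * p.β)) { M' with inbox := [], outbox := [] } →
    G (M'.outbox, { M' with inbox := [], outbox := [] }) ≤ (∏ s ∈ Finset.range p.N,
      if M'.mem (2 * s + 17) ≠ m (2 * s + 17) then γ₁ s else γ₀ s) * ζ x

theorem siteProc_runBound (hp : p.Valid) {m : Memory} (hm : Ready p m) (hvn : v < p.n)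
    (hM : ∀ a, a ≠ 9 → a ≠ 11 → M.mem a = m a) (h9 : M.mem 9 = v) (hr : Res p (t + 5 * (κ * p.β)) 0 M)
    (ho : M.outbox = []) {G : List ℕ × Machine → ℝ≥0∞} {γ₁ γ₀ ζ : ℕ → ℝ≥0∞}
    (hG : RunBound p t m v γ₁ γ₀ ζ G) :
    Ex (siteProc.exec noReply 0 (M, ()))
      (G ∘ fun s => (s.1.outbox, { s.1 with inbox := [], outbox := [] })) ≤
      arrivalBound p m v γ₁ γ₀ ζ := by
  rw [← arrivalBound_congr hM]
  have e7 := hM 7 (by norm_num) (by norm_num)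
  have e6 := hM 6 (by norm_num) (by norm_num)
  have e8 := hM 8 (by norm_num) (by norm_num)
  refine siteProc_spec hp (hm.par.congr fun a ha => hM a (by omega) (by omega)) h9 hvn
    (fun s hs => by rw [hM _ (by omega) (by omega)]; exact hm.thr s hs) (by rw [e6]; exact hm.scale)
    (by rw [e7]; exact hm.pos) hr ho ?_
  intro x M' h1 h2 h3 h4
  have := hG x M' (by rwa [e7, e6] at h1) (by rwa [e7, e8] at h2) (h3.congr hM) h4.outb.1 h4.outb.2
    (h4.idle.mono (by linarith [Nat.zero_le (κ * p.β)]))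
  have e17 : ∀ s, M.mem (2 * s + 17) = m (2 * s + 17) := fun s => hM _ (by omega) (by omega)
  simp only [e17]
  exact this

theorem runSite_item (hp : p.Valid) (h : Idle p t M) (hm : Ready p M.mem) (hvn : v < p.n)
    (hB : (M.mem 6 + 1) / (2 * p.k) ≠ 0) {G : List ℕ × Machine → ℝ≥0∞} {γ₁ γ₀ ζ : ℕ → ℝ≥0∞}
    (hG : RunBound p t M.mem v γ₁ γ₀ ζ G) :
    Ex (runSite siteItem [v] M) G ≤ arrivalBound p M.mem v γ₁ γ₀ ζ := by
  have hn := hp.lt_big hp.size_le_lg.1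
  rw [runSite, Ex_map]
  have sv : Nat.size v ≤ p.β := hp.size_of_lt (hp.big_mul _ (by omega))
  have hr := h.start hp (msg := [v]) (by simp) (by simpa using sv)
  rw [siteItem, Ex_seq]
  refine hr.ex_recv hp (by omega) (Nat.zero_le _) (by decide) (x := 9) rfl (by omega) ?_
  intro M₁ hM₁ hi₁ ho₁ hr₁
  have f : ∀ a, a ≠ 9 → M₁.mem a = M.mem a := fun a ha => by
    rw [hM₁, upd_apply, if_neg ha]; rfl
  have hp₁ : HasPar p M₁.mem := hm.par.congr fun a ha => f a (by omega)
  refine hr₁.ex_ite hp (by omega) (Nat.zero_le _) (by decide) ?_ ?_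
  · intro _ M₂ hM₂ hi₂ ho₂ hr₂
    refine siteProc_runBound hp hm hvn (fun a h1 _ => by rw [hM₂, f a h1])
      (by simp [hM₂, hM₁, upd_apply]) (hr₂.mono (by linarith [Nat.zero_le (κ * p.β)]) le_rfl)
      (by rw [ho₂, ho₁]; rfl) hG
  · intro hc
    simp only [eval_div, eval_add, eval_c, eval_mul, eval_ofNat, hp₁.2.1, f 6 (by norm_num)] at hc
    exact absurd hc hB

theorem runSite_forward (hp : p.Valid) (h : Idle p t M) (hm : HasPar p M.mem) (hvn : v < p.n)
    (hB : (M.mem 6 + 1) / (2 * p.k) = 0) :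
    Sure (runSite siteItem [v] M) fun r => r.1 = [v] ∧ (∀ a, a ≠ 9 → r.2.mem a = M.mem a) ∧
      Idle p (t + 20 * (κ * p.β)) r.2 := by
  have hn := hp.lt_big hp.size_le_lg.1
  rw [runSite]
  refine Sure.map (sure_of_ex fun F hF => ?_)
  have sv : Nat.size v ≤ p.β := hp.size_of_lt (hp.big_mul _ (by omega))
  have hr := h.start hp (msg := [v]) (by simp) (by simpa using sv)
  rw [siteItem, Ex_seq]
  refine hr.ex_recv hp (by omega) (Nat.zero_le _) (by decide) (x := 9) rfl (by omega) ?_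
  intro M₁ hM₁ hi₁ ho₁ hr₁
  have f : ∀ a, a ≠ 9 → M₁.mem a = M.mem a := fun a ha => by
    rw [hM₁, upd_apply, if_neg ha]; rfl
  have hp₁ : HasPar p M₁.mem := hm.congr fun a ha => f a (by omega)
  refine hr₁.ex_ite hp (by omega) (Nat.zero_le _) (by decide) ?_ ?_
  · intro hc
    simp only [eval_div, eval_add, eval_c, eval_mul, eval_ofNat, hp₁.2.1, f 6 (by norm_num)] at hc
    exact absurd hB hc
  · intro _ M₂ hM₂ hi₂ ho₂ hr₂
    refine hr₂.ex_send hp (by omega) (Nat.zero_le _) (by decide) (y := v)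
      (by simp [hM₂, hM₁, upd_apply]) sv ?_
    intro M₃ hM₃ hi₃ ho₃ hr₃
    refine hF _ ⟨?_, ?_, hr₃.idle.mono (by linarith [Nat.zero_le (κ * p.β)])⟩
    · show M₃.outbox = [v]
      rw [ho₃, ho₂, ho₁]; rfl
    · intro a ha
      show M₃.mem a = _
      rw [hM₃, hM₂, f a ha]

/-- Reading the message changes the scratch cells `9` and `11` only, so a forwarded item is treated
with the same bound as an item of the site's own. -/
theorem runSite_serve (hp : p.Valid) (h : Idle p t M) (hm : Ready p M.mem) (hvn : v < p.n)
    {G : List ℕ × Machine → ℝ≥0∞} {γ₁ γ₀ ζ : ℕ → ℝ≥0∞}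
    (hG : RunBound p t M.mem v γ₁ γ₀ ζ G) :
    Ex (runSite siteMsg [0, v] M) G ≤ arrivalBound p M.mem v γ₁ γ₀ ζ := by
  have hn := hp.lt_big hp.size_le_lg.1
  rw [runSite, Ex_map]
  have sv : Nat.size v ≤ p.β := hp.size_of_lt (hp.big_mul _ (by omega))
  have hr := h.start hp (msg := [0, v]) (by simp) (by simpa using sv)
  rw [siteMsg, Ex_seq]
  refine hr.ex_recv hp (by omega) (Nat.zero_le _) (by decide) (x := 11) rfl (by omega) ?_
  intro M₁ hM₁ hi₁ ho₁ hr₁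
  have f : ∀ a, a ≠ 11 → M₁.mem a = M.mem a := fun a ha => by
    rw [hM₁, upd_apply, if_neg ha]; rfl
  refine hr₁.ex_ite hp (by omega) (Nat.zero_le _) (by decide) ?_ ?_
  · intro hc
    simp [hM₁, upd_apply] at hc
  · intro _ M₂ hM₂ hi₂ ho₂ hr₂
    rw [Ex_seq]
    refine hr₂.ex_recv hp (by omega) (Nat.zero_le _) (by decide) (x := 9) rfl (by omega) ?_
    intro M₃ hM₃ hi₃ ho₃ hr₃
    refine siteProc_runBound hp hm hvn ?_ ?_ (hr₃.mono (by linarith [Nat.zero_le (κ * p.β)]) le_rfl)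
      (by rw [ho₃, ho₂, ho₁]; rfl) hG
    · intro a h1 h2; rw [hM₃, upd_apply, if_neg h1, hM₂, f a h2]
    · rw [hM₃, upd_apply, if_pos rfl, hi₂, hi₁]; rfl

end Monitoring
end

/-! ### Elementary programs of the coordinator: powers, free slots, random thresholds. -/

noncomputable section
open scoped ENNReal
namespace Monitoring
open Monitoring.Expr

/-! ### Rules for the program of the coordinator, whose resources are not bounded -/

/-- The machines differ in their time and space only. -/
structure Same (M M' : Machine) : Prop where
  mem : M'.mem = M.mem
  inb : M'.inbox = M.inbox
  out : M'.outbox = M.outbox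

/-- The machine `M'` arises from `M` by writing `y` to the cell `x`. -/
structure Wrote (M : Machine) (x y : ℕ) (M' : Machine) : Prop where
  mem : M'.mem = M.mem.update x y
  inb : M'.inbox = M.inbox
  out : M'.outbox = M.outbox

theorem Wrote.at {M M' : Machine} {x y : ℕ} (h : Wrote M x y M') : M'.mem x = y := by
  rw [h.mem, upd_apply, if_pos rfl]

theorem Wrote.off {M M' : Machine} {x y : ℕ} (h : Wrote M x y M') {b : ℕ} (hb : b ≠ x) :
    M'.mem b = M.mem b := by
  rw [h.mem, upd_apply, if_neg hb]

section rules
variable {Q σ : Type} {reply : Q → ℕ → List ℕ → σ → PMF (List ℕ × σ)} {h : ℕ} {M : Machine} {g : σ}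
  {R : Machine × σ → Prop} {a e : Expr} {x y : ℕ} {F : Machine × σ → ℝ≥0∞} {B : ℝ≥0∞}

theorem co_set (ha : a.eval M.mem = x) (he : e.eval M.mem = y)
    (hR : ∀ M', Wrote M x y M' → R (M', g)) :
    Sure ((Cmd.set a e : Cmd Q).exec reply h (M, g)) R :=
  sure_set (hR _ ⟨by simp [ha, he], rfl, rfl⟩)

theorem co_ite {c d : Cmd Q}
    (hc : e.eval M.mem ≠ 0 → ∀ M', Same M M' → Sure (c.exec reply h (M', g)) R)
    (hd : e.eval M.mem = 0 → ∀ M', Same M M' → Sure (d.exec reply h (M', g)) R) :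
    Sure ((Cmd.ite e c d).exec reply h (M, g)) R :=
  sure_ite (fun h1 => hc h1 _ ⟨rfl, rfl, rfl⟩) (fun h1 => hd h1 _ ⟨rfl, rfl, rfl⟩)

theorem co_recv (ha : a.eval M.mem = x)
    (hR : ∀ M', M'.mem = M.mem.update x (M.inbox.headD 0) → M'.inbox = M.inbox.tail →
      M'.outbox = M.outbox → R (M', g)) :
    Sure ((Cmd.recv a : Cmd Q).exec reply h (M, g)) R :=
  sure_recv (hR _ (by simp [ha]) rfl rfl)

theorem co_send (he : e.eval M.mem = y)
    (hR : ∀ M', M'.mem = M.mem → M'.inbox = M.inbox → M'.outbox = M.outbox ++ [y] → R (M', g)) :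
    Sure ((Cmd.send e : Cmd Q).exec reply h (M, g)) R :=
  sure_send (hR _ rfl rfl (by simp [he]))

theorem co_loop {c : Cmd Q} {r : ℕ} (hr : e.eval M.mem = r) (I : ℕ → Machine × σ → Prop)
    (h0 : ∀ M', Same M M' → I 0 (M', g))
    (hI : ∀ i < r, ∀ M₁ g₁, I i (M₁, g₁) → ∀ M₂, Same M₁ M₂ → ∀ h',
      Sure (c.exec reply h' (M₂, g₁)) (I (i + 1)))
    (hR : ∀ s, I r s → R s) : Sure ((Cmd.loop e c).exec reply h (M, g)) R := by
  subst hr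
  exact sure_loop I (h0 _ ⟨rfl, rfl, rfl⟩)
    (fun i hi M' g' hI' => hI i hi M' g' hI' (M'.charge _ _) ⟨rfl, rfl, rfl⟩ _) hR

theorem ex_co_ite {c d : Cmd Q}
    (hc : e.eval M.mem ≠ 0 → ∀ M', Same M M' → Ex (c.exec reply h (M', g)) F ≤ B)
    (hd : e.eval M.mem = 0 → ∀ M', Same M M' → Ex (d.exec reply h (M', g)) F ≤ B) :
    Ex ((Cmd.ite e c d).exec reply h (M, g)) F ≤ B := by
  rw [Ex_ite]
  split
  · exact hc ‹_› _ ⟨rfl, rfl, rfl⟩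
  · exact hd (not_not.1 ‹_›) _ ⟨rfl, rfl, rfl⟩

theorem ex_co_rand {φ : ℕ → ℝ≥0∞} (ha : a.eval M.mem = x) (he : e.eval M.mem = y)
    (hF : ∀ u < 2 ^ y, ∀ M', Wrote M x u M' → F (M', g) ≤ φ u) :
    Ex ((Cmd.rand a e : Cmd Q).exec reply h (M, g)) F ≤
      (∑ u ∈ Finset.range (2 ^ y), φ u) / 2 ^ y := by
  rw [Ex_rand, Ex_uniformBits]
  simp only [he]
  refine ENNReal.div_le_div_right (Finset.sum_le_sum fun u hu => ?_) _
  exact hF u (Finset.mem_range.1 hu) _ ⟨by simp [ha], rfl, rfl⟩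

end rules

variable {σ : Type} {reply : Unit → ℕ → List ℕ → σ → PMF (List ℕ × σ)} {h : ℕ} {M : Machine}
  {g : σ} {p : Par}

/-- The base is evaluated again in each round while cell `t` changes; hence base and exponent must
have the same value in all memories that agree outside `t`. -/
theorem powCmd_spec {t vb ve : ℕ} {b e : Expr}
    (hb : ∀ m' : Memory, (∀ a, a ≠ t → m' a = M.mem a) → b.eval m' = vb)
    (he : ∀ m' : Memory, (∀ a, a ≠ t → m' a = M.mem a) → e.eval m' = ve) :
    Sure ((powCmd t b e).exec reply h (M, g)) fun s => s.2 = g ∧ Wrote M t (vb ^ ve) s.1 := by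
  refine sure_seq (R' := fun s => s.2 = g ∧ Wrote M t 1 s.1)
    (co_set rfl rfl fun M' h1 => ⟨rfl, h1⟩) ?_
  rintro M₁ g' ⟨hg, h1⟩
  dsimp only at hg h1
  subst hg
  refine co_loop (he _ fun a ha => h1.off ha) (fun i s => s.2 = g' ∧ Wrote M t (vb ^ i) s.1) ?_ ?_
    fun s hs => hs
  · intro M₂ h2
    exact ⟨rfl, by rw [h2.mem, h1.mem, pow_zero], by rw [h2.inb, h1.inb], by rw [h2.out, h1.out]⟩
  · rintro i - M₂ g₂ ⟨hg₂, h2⟩ M₃ h3 h'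
    dsimp only at hg₂ h2
    subst hg₂
    refine co_set (x := t) (y := vb ^ (i + 1)) rfl ?_ fun M₄ h4 => ⟨rfl, ?_, ?_, ?_⟩
    · rw [eval_mul, eval_c, hb _ fun a ha => by rw [h3.mem, h2.off ha], h3.mem, h2.at, pow_succ]
    · rw [h4.mem, h3.mem, h2.mem]
      ext a; simp only [upd_apply]; split_ifs <;> rfl
    · rw [h4.inb, h3.inb, h2.inb]
    · rw [h4.out, h3.out, h2.out]

/-! ### Slots of the coordinator -/

/-- Item, threshold, value and expiry of the sample in slot `s`. -/
def item (m : Memory) (s : ℕ) : ℕ := m (4 * s + 64)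
def thr (m : Memory) (s : ℕ) : ℕ := m (4 * s + 65)
def val (m : Memory) (s : ℕ) : ℕ := m (4 * s + 66)
def expi (m : Memory) (s : ℕ) : ℕ := m (4 * s + 67)

/-- Only auxiliary cells have changed. -/
def Keep (m m' : Memory) : Prop := ∀ a, a < 11 ∨ a = 13 ∨ a = 14 ∨ a = 28 ∨ 30 ≤ a → m' a = m a

namespace Keep
variable {m m' : Memory}
theorem rfl' : Keep m m := fun _ _ => rfl
theorem par (h : Keep m m') (hm : HasPar p m) : HasPar p m' :=
  hm.congr fun a ha => h a (by omega)
theorem item (h : Keep m m') (s : ℕ) : item m' s = item m s := h _ (by omega)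
theorem thr (h : Keep m m') (s : ℕ) : thr m' s = thr m s := h _ (by omega)
theorem expi (h : Keep m m') (s : ℕ) : expi m' s = expi m s := h _ (by omega)
end Keep

/-- A slot is free once its expiry is at most the clock; empty slots have expiry `0`. The initial
value `N` of cell `15` survives exactly if there is no free slot. -/
theorem findSlot_spec (hm : HasPar p M.mem) :
    Sure (findSlot.exec reply h (M, g)) fun s => s.2 = g ∧ Keep M.mem s.1.mem ∧
      s.1.outbox = M.outbox ∧
      ((s.1.mem 15 < p.N ∧ expi M.mem (s.1.mem 15) ≤ M.mem 9) ∨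
        (s.1.mem 15 = p.N ∧ ∀ s < p.N, M.mem 9 < expi M.mem s)) := by
  refine sure_seq (R' := fun s => s.2 = g ∧ Wrote M 15 p.N s.1)
    (co_set rfl hm.NE_eval fun M' h1 => ⟨rfl, h1⟩) ?_
  rintro M₁ g' ⟨hg, h1⟩
  dsimp only at hg h1
  subst hg
  refine sure_seq (R' := fun s => s.2 = g' ∧ Wrote M₁ 27 0 s.1)
    (co_set rfl rfl fun M' h2 => ⟨rfl, h2⟩) ?_
  rintro M₂ g'' ⟨hg, h2⟩
  dsimp only at hg h2
  subst hg
  have k2 : Keep M.mem M₂.mem := fun a ha => by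
    rw [h2.off (by omega), h1.off (by omega)]
  refine co_loop (r := p.N) (k2.par hm).NE_eval (fun i s => s.2 = g'' ∧ Keep M.mem s.1.mem ∧
      s.1.outbox = M.outbox ∧ s.1.mem 27 = i ∧
      ((s.1.mem 15 < p.N ∧ expi M.mem (s.1.mem 15) ≤ M.mem 9) ∨
        (s.1.mem 15 = p.N ∧ ∀ s < i, M.mem 9 < expi M.mem s))) ?_ ?_ ?_
  · intro M₃ h3
    refine ⟨rfl, by rw [h3.mem]; exact k2, by rw [h3.out, h2.out, h1.out],
      by rw [h3.mem, h2.at], Or.inr ⟨by rw [h3.mem, h2.off (by norm_num), h1.at], by simp⟩⟩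
  · rintro i hi M₃ g₃ ⟨hg, k3, o3, c3, d3⟩ M₄ h4 h'
    dsimp only at hg k3 o3 c3 d3
    subst hg
    have k4 : Keep M.mem M₄.mem := by rw [h4.mem]; exact k3
    have e9 : M₄.mem 9 = M.mem 9 := k4 9 (by omega)
    have e27 : M₄.mem 27 = i := by rw [h4.mem, c3]
    have ee : M₄.mem (4 * i + 67) = expi M.mem i := k4 _ (by omega)
    refine sure_seq (R' := fun s => s.2 = g₃ ∧ Keep M.mem s.1.mem ∧ s.1.outbox = M.outbox ∧
      s.1.mem 27 = i ∧ ((s.1.mem 15 < p.N ∧ expi M.mem (s.1.mem 15) ≤ M.mem 9) ∨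
        (s.1.mem 15 = p.N ∧ ∀ s < i + 1, M.mem 9 < expi M.mem s))) ?_ ?_
    · refine co_ite ?_ ?_
      · intro hc M₅ h5
        have hc : M.mem 9 < expi M.mem i := by
          by_contra hn; simp [e9, e27, ee, hn] at hc
        refine sure_skip ⟨rfl, by rw [h5.mem]; exact k4, by rw [h5.out, h4.out, o3],
          by rw [h5.mem, e27], ?_⟩
        dsimp only
        rw [h5.mem, h4.mem]
        refine d3.imp id fun d => ⟨d.1, fun s hs => ?_⟩
        rcases Nat.lt_succ_iff_lt_or_eq.1 hs with hs | rfl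
        · exact d.2 s hs
        · exact hc
      · intro hc M₅ h5
        have hc : ¬ M.mem 9 < expi M.mem i := by
          intro hn; simp [e9, e27, ee, hn] at hc
        refine co_set (x := 15) (y := i) rfl (by simp [h5.mem, e27]) fun M₆ h6 => ?_
        refine ⟨rfl, fun a ha => ?_, by rw [h6.out, h5.out, h4.out, o3], ?_, Or.inl ?_⟩
        · rw [h6.off (by omega), h5.mem, k4 a ha]
        · rw [h6.off (by norm_num), h5.mem, e27]
        · rw [h6.at]; exact ⟨hi, by omega⟩
    · rintro M₅ g₅ ⟨hg, k5, o5, c5, d5⟩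
      dsimp only at hg k5 o5 c5 d5
      subst hg
      refine co_set (x := 27) (y := i + 1) rfl (by simp [c5]) fun M₆ h6 => ?_
      refine ⟨rfl, fun a ha => ?_, by rw [h6.out, o5], h6.at, ?_⟩
      · rw [h6.off (by omega), k5 a ha]
      · rw [h6.off (by norm_num)]; exact d5
  · rintro s ⟨hg, k, o, -, d⟩
    exact ⟨hg, k, o, d⟩

/-- The threshold of a sample with the number `i`. -/
def Par.thrOf (p : Par) (i : ℕ) : ℕ := 2 ^ p.dd * (p.K ^ i - (p.K - 1) ^ i) / p.K ^ i

/-- The value of a sample with the number `i` from the scale `f = 2 ^ l`, at the sampling rate `1 / W`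
and the scale `T` of the length. -/
def Par.valOf (p : Par) (W T f i : ℕ) : ℕ :=
  p.A * W * 2 ^ p.a * f * p.K * (p.K ^ i - (p.K - 1) ^ i) / ((p.P / T + 1) * p.K ^ i * (i * i))

/-- A uniform scale `l`, then a uniform number in `[2^l, 2^(l+1))`: up to the factor `2^a`, a number
`i` has probability of order `1/i`. -/
theorem drawThreshold_ex (hm : HasPar p M.mem) {F : Machine × σ → ℝ≥0∞} {φ : ℕ → ℕ → ℝ≥0∞}
    (hF : ∀ l < 2 ^ p.a, ∀ j < 2 ^ l, ∀ M', (∀ a, a ≠ 16 → a ≠ 17 → a ≠ 18 → M'.mem a = M.mem a) →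
      M'.mem 17 = 2 ^ l → M'.mem 18 = j + 2 ^ l → M'.outbox = M.outbox → F (M', g) ≤ φ l j) :
    Ex (drawThreshold.exec reply h (M, g)) F ≤
      (∑ l ∈ Finset.range (2 ^ p.a), (∑ j ∈ Finset.range (2 ^ l), φ l j) / 2 ^ l) / 2 ^ p.a := by
  rw [drawThreshold, Ex_seq]
  refine ex_co_rand (x := 16) rfl hm.aE_eval fun l hl M₁ h1 => ?_
  rw [Ex_seq]
  refine Sure.ex_le (powCmd_spec (vb := 2) (ve := l) (fun _ _ => rfl)
    fun m' hm' => by rw [eval_c, hm' 16 (by norm_num), h1.at]) ?_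
  rintro ⟨M₂, g₂⟩ ⟨hg, h2⟩
  dsimp only at hg h2
  subst hg
  rw [Ex_seq]
  refine ex_co_rand (x := 18) (y := l) rfl (by rw [eval_c, h2.off (by norm_num), h1.at])
    fun j hj M₃ h3 => ?_
  refine Sure.ex_le (co_set (R := fun s => s.2 = g₂ ∧ Wrote M₃ 18 (j + 2 ^ l) s.1) (x := 18)
    (y := j + 2 ^ l) rfl ?_ fun M₄ h4 => ⟨rfl, h4⟩) ?_
  · rw [eval_add, eval_c, eval_c, h3.at, h3.off (by norm_num), h2.at]
  rintro ⟨M₄, g₄⟩ ⟨hg, h4⟩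
  dsimp only at hg h4
  subst hg
  refine hF l hl j hj M₄ ?_ ?_ h4.at (by rw [h4.out, h3.out, h2.out, h1.out])
  · intro a h16 h17 h18
    rw [h4.off h18, h3.off h18, h2.off h17, h1.off h16]
  · rw [h4.off (by norm_num), h3.off (by norm_num), h2.at]

theorem fillSlot_spec (hm : HasPar p M.mem) {s f i : ℕ} (hs : M.mem 15 = s) (hf : M.mem 17 = f)
    (hi : M.mem 18 = i) :
    Sure (fillSlot.exec reply h (M, g)) fun r => r.2 = g ∧ r.1.outbox = M.outbox ∧
      r.1.mem 15 = s ∧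
      item r.1.mem s = M.mem 13 - 1 ∧ thr r.1.mem s = p.thrOf i ∧
      val r.1.mem s = p.valOf (M.mem 7 + 1) (M.mem 8 + 1) f i ∧
      expi r.1.mem s = M.mem 9 + p.w + 1 ∧ r.1.mem 10 = M.mem 10 + 1 ∧
      ∀ a, (a < 10 ∨ a = 13 ∨ a = 14 ∨ a = 28 ∨ 30 ≤ a) → a ≠ 4 * s + 64 → a ≠ 4 * s + 65 →
        a ≠ 4 * s + 66 → a ≠ 4 * s + 67 → r.1.mem a = M.mem a := by
  refine sure_seq (powCmd_spec (vb := p.K) (ve := i)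
    (fun m' k => (hm.congr fun a ha => k a (by omega)).KE_eval)
    (fun m' k => by rw [eval_c, k 18 (by norm_num), hi])) ?_
  rintro M₁ g' ⟨hg, h1⟩; dsimp only at hg h1; subst hg
  have q1 : HasPar p M₁.mem := hm.congr fun a ha => h1.off (by omega)
  refine sure_seq (powCmd_spec (vb := p.K - 1) (ve := i)
    (fun m' k => by rw [eval_sub, (q1.congr fun a ha => k a (by omega)).KE_eval]; rfl)
    (fun m' k => by rw [eval_c, k 18 (by norm_num), h1.off (by norm_num), hi])) ?_
  rintro M₂ g₂ ⟨hg, h2⟩; dsimp only at hg h2; subst hg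
  have q2 : HasPar p M₂.mem := q1.congr fun a ha => h2.off (by omega)
  refine sure_seq (powCmd_spec (vb := 2) (ve := p.dd) (fun _ _ => rfl)
    (fun m' k => (q2.congr fun a ha => k a (by omega)).ddE_eval)) ?_
  rintro M₃ g₃ ⟨hg, h3⟩; dsimp only at hg h3; subst hg
  have q3 : HasPar p M₃.mem := q2.congr fun a ha => h3.off (by omega)
  refine sure_seq (powCmd_spec (vb := 2) (ve := p.a) (fun _ _ => rfl)
    (fun m' k => (q3.congr fun a ha => k a (by omega)).aE_eval)) ?_
  rintro M₄ g₄ ⟨hg, h4⟩; dsimp only at hg h4; subst hg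
  have q4 : HasPar p M₄.mem := q3.congr fun a ha => h4.off (by omega)
  have e4 : ∀ a, a ≠ 19 → a ≠ 20 → a ≠ 21 → a ≠ 29 → M₄.mem a = M.mem a := fun a x1 x2 x3 x4 => by
    rw [h4.off x4, h3.off x3, h2.off x2, h1.off x1]
  have e15 : M₄.mem 15 = s := by rw [e4 15 (by norm_num) (by norm_num) (by norm_num) (by norm_num), hs]
  have e19 : M₄.mem 19 = p.K ^ i := by
    rw [h4.off (by norm_num), h3.off (by norm_num), h2.off (by norm_num), h1.at]
  have e20 : M₄.mem 20 = (p.K - 1) ^ i := by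
    rw [h4.off (by norm_num), h3.off (by norm_num), h2.at]
  have e21 : M₄.mem 21 = 2 ^ p.dd := by rw [h4.off (by norm_num), h3.at]
  have e29 : M₄.mem 29 = 2 ^ p.a := h4.at
  refine sure_seq (R' := fun r => r.2 = g₄ ∧ Wrote M₄ (4 * s + 64) (M.mem 13 - 1) r.1)
    (co_set (by simp [e15]) (by rw [eval_sub, eval_c, e4 13] <;> first | rfl | norm_num)
      fun M' k => ⟨rfl, k⟩) ?_
  rintro M₅ g₅ ⟨hg, h5⟩; dsimp only at hg h5; subst hg
  have e5 : ∀ a, a < 64 → M₅.mem a = M₄.mem a := fun a ha => h5.off (by omega)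
  refine sure_seq (R' := fun r => r.2 = g₅ ∧ Wrote M₅ (4 * s + 65) (p.thrOf i) r.1)
    (co_set (by simp [e5, e15]) (by simp [e5, e19, e20, e21, Par.thrOf]) fun M' k => ⟨rfl, k⟩) ?_
  rintro M₆ g₆ ⟨hg, h6⟩; dsimp only at hg h6; subst hg
  have e6 : ∀ a, a < 64 → M₆.mem a = M₄.mem a := fun a ha => by rw [h6.off (by omega), e5 a ha]
  have q6 : HasPar p M₆.mem := q4.congr fun a ha => e6 a (by omega)
  refine sure_seq (R' := fun r => r.2 = g₆ ∧ Wrote M₆ (4 * s + 66)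
    (p.valOf (M.mem 7 + 1) (M.mem 8 + 1) f i) r.1)
    (co_set (by simp [e6, e15]) ?_ fun M' k => ⟨rfl, k⟩) ?_
  · simp only [eval_div, eval_mul, eval_add, eval_sub, q6.AE_eval, q6.KE_eval, q6.PE_eval, eval_c,
      e6 _ (show 7 < 64 by norm_num), e6 _ (show 29 < 64 by norm_num), e6 _ (show 17 < 64 by norm_num),
      e6 _ (show 19 < 64 by norm_num), e6 _ (show 20 < 64 by norm_num), e6 _ (show 8 < 64 by norm_num),
      e6 _ (show 18 < 64 by norm_num), e19, e20, e29, Par.valOf, eval_ofNat]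
    rw [e4 7, e4 8, e4 17, e4 18, hf, hi] <;> norm_num
  rintro M₇ g₇ ⟨hg, h7⟩; dsimp only at hg h7; subst hg
  have e7 : ∀ a, a < 64 → M₇.mem a = M₄.mem a := fun a ha => by rw [h7.off (by omega), e6 a ha]
  refine sure_seq (R' := fun r => r.2 = g₇ ∧ Wrote M₇ (4 * s + 67) (M.mem 9 + p.w + 1) r.1)
    (co_set (by simp [e7, e15]) ?_ fun M' k => ⟨rfl, k⟩) ?_
  · simp [e7, e4, hm.2.2.1]
  rintro M₈ g₈ ⟨hg, h8⟩; dsimp only at hg h8; subst hg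
  have e8 : ∀ a, a < 64 → M₈.mem a = M₄.mem a := fun a ha => by rw [h8.off (by omega), e7 a ha]
  refine co_set (x := 10) (y := M.mem 10 + 1) rfl (by simp [e8, e4]) fun M₉ h9 => ?_
  have n9 : ∀ a, a ≠ 10 → M₉.mem a = M₈.mem a := fun a ha => h9.off ha
  refine ⟨rfl, ?_, ?_, ?_, ?_, ?_, ?_, h9.at, ?_⟩
  · show M₉.outbox = _
    rw [h9.out, h8.out, h7.out, h6.out, h5.out, h4.out, h3.out, h2.out, h1.out]
  · show M₉.mem 15 = s
    rw [n9 15 (by norm_num), e8 15 (by norm_num), e15]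
  · show M₉.mem _ = _
    rw [n9 _ (by omega), h8.off (by omega), h7.off (by omega), h6.off (by omega), h5.at]
  · show M₉.mem _ = _
    rw [n9 _ (by omega), h8.off (by omega), h7.off (by omega), h6.at]
  · show M₉.mem _ = _
    rw [n9 _ (by omega), h8.off (by omega), h7.at]
  · show M₉.mem _ = _
    rw [n9 _ (by omega), h8.at]
  · intro a ha x1 x2 x3 x4
    show M₉.mem a = _
    rw [n9 _ (by omega), h8.off (by omega), h7.off (by omega), h6.off (by omega),
      h5.off (by omega), e4 a (by omega) (by omega) (by omega) (by omega)]

end Monitoring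
end

/-! ### Broadcasts, credits for communication, and agreement of the sites with the coordinator. -/

noncomputable section
open scoped ENNReal
namespace Monitoring
open Monitoring.Expr

variable {p : Par} {h : ℕ} {M : Machine}

/-! ### Sending the data of a slot to the sites -/

/-- The sites, and the number of bits exchanged. -/
abbrev Net (k : ℕ) : Type := (Fin k → Machine) × ℕ

/-- The number of sites that know the slots, at the sampling rate `1 / W`. -/
def Par.kk (p : Par) (W : ℕ) : ℕ := if 0 < W / (2 * p.k) then p.k else 1

theorem Par.kk_le (hp : p.Valid) (W : ℕ) : p.kk W ≤ p.k := by
  have := hp.k; unfold Par.kk; split <;> omega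

theorem kkE_eval {m : Memory} (hm : HasPar p m) : kkE.eval m = p.kk (m 7 + 1) := by
  simp only [kkE, eval_add, eval_mul, eval_lt, eval_eq, eval_div, eval_c, eval_ofNat, hm.2.1,
    Par.kk]
  by_cases hc : 0 < (m 7 + 1) / (2 * p.k)
  · simp [hc, hc.ne]
  · have : (m 7 + 1) / (2 * p.k) = 0 := Nat.eq_zero_of_not_pos hc
    simp [this]

theorem bcast_spec (hp : p.Valid) (hm : HasPar p M.mem) {g : Net p.k} {W s : ℕ} (hW : M.mem 7 + 1 = W)
    (hs : M.mem 15 = s) (hsN : s < p.N) (sW : Nat.size W ≤ p.β)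
    (hx : Nat.size (item M.mem s) ≤ p.β) (hy : Nat.size (thr M.mem s) ≤ p.β)
    (ho : M.outbox = []) (hg : ∀ j, Idle p (g.1 j).time (g.1 j)) :
    Sure (bcast.exec algo.askSite h (M, g)) fun r => Keep M.mem r.1.mem ∧ r.1.mem 15 = s ∧
      r.1.outbox = [] ∧
      (∀ j : Fin p.k, ((j : ℕ) < p.kk W → SetPost (g.1 j).mem W s (item M.mem s) (thr M.mem s)
        (r.2.1 j).mem ∧ Idle p ((g.1 j).time + 20 * (κ * p.β)) (r.2.1 j)) ∧
        (p.kk W ≤ j → r.2.1 j = g.1 j)) ∧ r.2.2 ≤ g.2 + p.kk W * (20 * p.β) := by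
  have hN := hp.N_lt'
  have hβ := hp.β_pos
  have ss : Nat.size s ≤ p.β := hp.size_of_lt (hp.big_mul _ (by omega))
  have hkk := p.kk_le hp W
  refine sure_seq (R' := fun r => r.2 = g ∧ Wrote M 22 0 r.1)
    (co_set rfl rfl fun M' k => ⟨rfl, k⟩) ?_
  rintro M₁ g₁ ⟨hg₁, h1⟩; dsimp only at hg₁ h1; subst hg₁
  have q1 : HasPar p M₁.mem := hm.congr fun a ha => h1.off (by omega)
  refine co_loop (r := p.kk W) (by rw [kkE_eval q1, h1.off (by norm_num), hW])
    (fun i r => Keep M.mem r.1.mem ∧ r.1.mem 15 = s ∧ r.1.mem 22 = i ∧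
      r.1.outbox = [] ∧
      (∀ j : Fin p.k, ((j : ℕ) < i → SetPost (g₁.1 j).mem W s (item M.mem s) (thr M.mem s)
        (r.2.1 j).mem ∧ Idle p ((g₁.1 j).time + 20 * (κ * p.β)) (r.2.1 j)) ∧
        (i ≤ j → r.2.1 j = g₁.1 j)) ∧ r.2.2 ≤ g₁.2 + i * (20 * p.β)) ?_ ?_ ?_
  · intro M₂ h2
    refine ⟨fun a ha => ?_, ?_, ?_, ?_, ?_, ?_⟩
    · rw [h2.mem, h1.off (by omega)]
    · rw [h2.mem, h1.off (by norm_num), hs]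
    · rw [h2.mem, h1.at]
    · rw [h2.out, h1.out, ho]
    · intro j; exact ⟨fun hj => absurd hj (Nat.not_lt_zero _), fun _ => rfl⟩
    · simp
  · rintro i hi M₂ g₂ ⟨k2, e15, e22, o2, n2, b2⟩ M₃ h3 h'
    dsimp only at k2 e15 e22 o2 n2 b2
    have k3 : Keep M.mem M₃.mem := by rw [h3.mem]; exact k2
    have f15 : M₃.mem 15 = s := by rw [h3.mem, e15]
    refine sure_seq (R' := fun r => r.2 = g₂ ∧ r.1.mem = M₃.mem ∧ r.1.outbox = [W])
      (co_send (y := W) (by simp [k3 7 (by omega), hW]) fun M' x1 _ x3 =>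
        ⟨rfl, x1, by rw [x3, h3.out, o2]; rfl⟩) ?_
    rintro M₄ g₄ ⟨hg, m4, o4⟩; dsimp only at hg m4 o4; subst hg
    refine sure_seq (R' := fun r => r.2 = g₄ ∧ r.1.mem = M₃.mem ∧ r.1.outbox = [W, s])
      (co_send (y := s) (by simp [m4, f15]) fun M' x1 _ x3 =>
        ⟨rfl, by rw [x1, m4], by rw [x3, o4]; rfl⟩) ?_
    rintro M₅ g₅ ⟨hg, m5, o5⟩; dsimp only at hg m5 o5; subst hg
    refine sure_seq (R' := fun r => r.2 = g₅ ∧ r.1.mem = M₃.mem ∧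
      r.1.outbox = [W, s, item M.mem s])
      (co_send (y := item M.mem s) ?_ fun M' x1 _ x3 =>
        ⟨rfl, by rw [x1, m5], by rw [x3, o5]; rfl⟩) ?_
    · simp only [eval_cell, eval_add, eval_mul, eval_c, eval_ofNat, m5, f15]
      exact k3.item s
    rintro M₆ g₆ ⟨hg, m6, o6⟩; dsimp only at hg m6 o6; subst hg
    refine sure_seq (R' := fun r => r.2 = g₆ ∧ r.1.mem = M₃.mem ∧
      r.1.outbox = [W, s, item M.mem s, thr M.mem s])
      (co_send (y := thr M.mem s) ?_ fun M' x1 _ x3 =>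
        ⟨rfl, by rw [x1, m6], by rw [x3, o6]; rfl⟩) ?_
    · simp only [eval_cell, eval_add, eval_mul, eval_c, eval_ofNat, m6, f15]
      exact k3.thr s
    rintro M₇ g₇ ⟨hg, m7, o7⟩; dsimp only at hg m7 o7; subst hg
    have hik : i < p.k := by omega
    refine sure_seq (R' := fun r => r.1.mem = M₃.mem ∧ r.1.outbox = [] ∧
      (∀ j : Fin p.k, ((j : ℕ) < i + 1 → SetPost (g₁.1 j).mem W s (item M.mem s) (thr M.mem s)
        (r.2.1 j).mem ∧ Idle p ((g₁.1 j).time + 20 * (κ * p.β)) (r.2.1 j)) ∧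
        (i + 1 ≤ j → r.2.1 j = g₁.1 j)) ∧ r.2.2 ≤ g₁.2 + (i + 1) * (20 * p.β)) ?_ ?_
    · refine sure_ask (R' := fun r =>
        (∀ j : Fin p.k, ((j : ℕ) < i + 1 → SetPost (g₁.1 j).mem W s (item M.mem s) (thr M.mem s)
        (r.2.1 j).mem ∧ Idle p ((g₁.1 j).time + 20 * (κ * p.β)) (r.2.1 j)) ∧
        (i + 1 ≤ j → r.2.1 j = g₁.1 j)) ∧ r.2.2 ≤ g₁.2 + (i + 1) * (20 * p.β)) ?_ ?_
      · have e : (c 22).eval M₇.mem = i := by rw [eval_c, m7, h3.mem, e22]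
        rw [e, o7, Algorithm.askSite, dif_pos hik]
        have n3 : g₇.1 ⟨i, hik⟩ = g₁.1 ⟨i, hik⟩ := (n2 ⟨i, hik⟩).2 le_rfl
        refine Sure.map ((runSite_set hp (n3 ▸ hg ⟨i, hik⟩) (by omega) hsN sW ss hx hy).mono ?_)
        rintro r ⟨r1, r2, r3⟩
        rw [n3] at r2 r3
        constructor
        · intro j
          by_cases hj : j = ⟨i, hik⟩
          · subst hj
            simp only [Function.update_self]
            exact ⟨fun _ => ⟨r2, r3⟩, fun hj => absurd hj (by simp)⟩
          · simp only [Function.update_of_ne hj]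
            have hj' : (j : ℕ) ≠ i := fun hc => hj (Fin.ext hc)
            exact ⟨fun hl => (n2 j).1 (by omega), fun hl => (n2 j).2 (by omega)⟩
        · dsimp only
          rw [r1]
          have := msgBits_le (l := [W, s, item M.mem s, thr M.mem s]) (b := p.β)
            (by simp; exact ⟨sW, ss, hx, hy⟩)
          have e0 : msgBits [] = 1 := rfl
          have el : ([W, s, item M.mem s, thr M.mem s]).length = 4 := rfl
          rw [el] at this
          rw [e0]
          linarith
      · rintro r ⟨r1, r2⟩
        exact ⟨m7, rfl, r1, r2⟩
    · rintro M₈ g₈ ⟨m8, o8, n8, b8⟩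
      refine co_set (x := 22) (y := i + 1) rfl (by simp [show M₈.mem = M₃.mem from m8, h3.mem, e22])
        fun M₉ h9 => ⟨fun a ha => ?_, ?_, h9.at, by rw [h9.out]; exact o8, n8, b8⟩
      · rw [h9.off (by omega), show M₈.mem = M₃.mem from m8, k3 a ha]
      · rw [h9.off (by norm_num), show M₈.mem = M₃.mem from m8, f15]
  · rintro r ⟨r1, r2, -, r4, r5, r6⟩
    exact ⟨r1, r2, r4, r5, r6⟩

/-! ### Costs that are paid for by credits -/

/-- The number of words that a site may send before it gets new data. -/
def credit (p : Par) (m : Memory) : ℕ :=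
  ((Finset.range p.N).filter fun s => m (2 * s + 17) ≠ 0).card +
    if m 7 = 0 ∨ m 7 ≤ m 8 then 1 else 0

def netCredit (p : Par) (f : Fin p.k → Machine) : ℕ := ∑ j, credit p (f j).mem
def netTime {k : ℕ} (f : Fin k → Machine) : ℕ := ∑ j, (f j).time

/-- On the way from `g` to `g'`, bits and time have been used at a cost of `u` units. -/
structure Paid (p : Par) (g g' : Net p.k) (u : ℕ) : Prop where
  bits : g'.2 + 20 * p.β * netCredit p g'.1 ≤ g.2 + 20 * p.β * netCredit p g.1 + 60 * p.β * u
  time : netTime g'.1 ≤ netTime g.1 + 20 * (κ * p.β) * u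

theorem Paid.refl (g : Net p.k) : Paid p g g 0 := ⟨by simp, by simp⟩

theorem Paid.trans {g g' g'' : Net p.k} {u u' : ℕ} (h : Paid p g g' u) (h' : Paid p g' g'' u') :
    Paid p g g'' (u + u') :=
  ⟨by have := h.bits; have := h'.bits; linarith, by have := h.time; have := h'.time; linarith⟩

theorem credit_le {m : Memory} : credit p m ≤ p.N + 1 := by
  unfold credit
  refine Nat.add_le_add ((Finset.card_filter_le _ _).trans (by simp)) (by split <;> omega)

/-- New data can make one threshold positive and can restart the current block: two credits. -/
theorem SetPost.credit_le {m m' : Memory} {W s x y : ℕ} (h : SetPost m W s x y m') :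
    credit p m' ≤ credit p m + 2 := by
  have h1 : ((Finset.range p.N).filter fun r => m' (2 * r + 17) ≠ 0) ⊆
      insert s ((Finset.range p.N).filter fun r => m (2 * r + 17) ≠ 0) := by
    intro r hr
    rw [Finset.mem_insert]
    by_cases hrs : r = s
    · exact Or.inl hrs
    · right
      rw [Finset.mem_filter] at hr ⊢
      rwa [h.frame _ (by omega) (by omega) (by omega) (by omega) (by omega) (by omega)] at hr
  have h2 := (Finset.card_le_card h1).trans (Finset.card_insert_le _ _)
  unfold credit
  split_ifs <;> omega

theorem sum_fin_ite (k r u : ℕ) : ∑ j : Fin k, (if (j : ℕ) < r then u else 0) ≤ r * u := by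
  rw [Fin.sum_univ_eq_sum_range fun j => if j < r then u else 0]
  calc _ = ∑ j ∈ (Finset.range k).filter (· < r), u := by rw [Finset.sum_filter]
    _ ≤ ∑ j ∈ Finset.range r, u := Finset.sum_le_sum_of_subset (by
        intro j hj; rw [Finset.mem_filter] at hj; simpa using hj.2)
    _ = r * u := by simp

/-- The effect of `bcast` on the network. -/
theorem paid_bcast {g g' : Net p.k} {r W s x y : ℕ}
    (h : ∀ j : Fin p.k, ((j : ℕ) < r → SetPost (g.1 j).mem W s x y (g'.1 j).mem ∧
      Idle p ((g.1 j).time + 20 * (κ * p.β)) (g'.1 j)) ∧ (r ≤ j → g'.1 j = g.1 j))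
    (hb : g'.2 ≤ g.2 + r * (20 * p.β)) : Paid p g g' r := by
  constructor
  · have : netCredit p g'.1 ≤ netCredit p g.1 + r * 2 := by
      refine le_trans ?_ (Nat.add_le_add_left (sum_fin_ite p.k r 2) _)
      unfold netCredit
      rw [← Finset.sum_add_distrib]
      refine Finset.sum_le_sum fun j _ => ?_
      split_ifs with hj
      · exact ((h j).1 hj).1.credit_le
      · rw [(h j).2 (not_lt.1 hj)]; omega
    nlinarith
  · refine le_trans ?_ ((Nat.add_le_add_left (sum_fin_ite p.k r (20 * (κ * p.β))) _).trans
      (by rw [mul_comm r]))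
    unfold netTime
    rw [← Finset.sum_add_distrib]
    refine Finset.sum_le_sum fun j _ => ?_
    split_ifs with hj
    · exact ((h j).1 hj).2.res.time
    · rw [(h j).2 (not_lt.1 hj)]; omega

/-! ### The state of the system while the coordinator works -/

/-- Site memory `ms` agrees with the coordinator memory `m` on the slots. -/
structure Synced (p : Par) (W pos : ℕ) (m ms : Memory) : Prop where
  scale : ms 6 + 1 = W
  pos : ms 7 = pos
  item : ∀ s < p.N, ms (2 * s + 16) = item m s
  -- A hit reported by one site is not passed on, so another site may keep a positive threshold for
  -- a slot that the coordinator already regards as hit.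
  thr : ∀ s < p.N, ms (2 * s + 17) = thr m s ∨ thr m s = 0
  thr_le : ∀ s < p.N, ms (2 * s + 17) ≤ 2 ^ p.dd

/-- The data of the slots at the coordinator are sound. -/
structure SlotsOk (p : Par) (Lh : ℕ) (m : Memory) : Prop where
  item : ∀ s < p.N, item m s < p.n
  thr : ∀ s < p.N, thr m s ≤ 2 ^ p.dd
  expi : ∀ s < p.N, expi m s ≤ Lh + p.w + 1
  -- Cell `28` holds the expiry of the last dropped sample. When a sample is dropped, every slot is
  -- in use, so all expiry times exceed the clock.
  drop : ∀ s < p.N, m 28 ≤ Monitoring.expi m s + p.w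
  pos : 0 < m 28 → ∀ s < p.N, 0 < Monitoring.expi m s
  drop_le : m 28 ≤ Lh + p.w + 1

/-- The sites are sound. -/
structure SitesOk (p : Par) (f : Fin p.k → Machine) : Prop where
  idle : ∀ j, Idle p (f j).time (f j)
  par : ∀ j, HasPar p (f j).mem

/-- The invariant is indexed by the schedule, which depends on the sites of the arrivals and on no
random choice. Sites that do not take part yet keep the scale `W = 1` of empty memory. -/
structure CI (p : Par) (W T Lh : ℕ) (pos : ℕ → ℕ) (m : Memory) (f : Fin p.k → Machine) : Prop where
  par : HasPar p m
  scale : m 7 + 1 = W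
  length : m 8 + 1 = T
  now : m 9 = Lh
  slots : SlotsOk p Lh m
  sites : SitesOk p f
  on : ∀ j : Fin p.k, (j : ℕ) < p.kk W → Synced p W (pos j) m (f j).mem
  off : ∀ j : Fin p.k, p.kk W ≤ j → (f j).mem 6 = 0

theorem SlotsOk.sizes (hp : p.Valid) {Lh : ℕ} {m : Memory} (h : SlotsOk p Lh m) {s : ℕ}
    (hs : s < p.N) :
    Nat.size (Monitoring.item m s) ≤ p.β ∧ Nat.size (Monitoring.thr m s) ≤ p.β := by
  constructor
  · have := h.item s hs
    have := hp.lt_big hp.size_le_lg.1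
    exact hp.size_of_lt (hp.big_mul _ (by omega))
  · have := h.thr s hs
    have h2 : 2 ^ p.dd ≤ 2 ^ (13 * p.lg) := hp.two_pow_le (by unfold Par.dd; omega)
    have : 0 < 2 ^ (13 * p.lg) := by positivity
    exact hp.size_of_lt (hp.big_mul _ (by omega))

theorem SlotsOk.congr {Lh : ℕ} {m m' : Memory} (h : SlotsOk p Lh m)
    (hm : ∀ a, a = 28 ∨ 64 ≤ a → m' a = m a) : SlotsOk p Lh m' := by
  have e1 : ∀ s, Monitoring.item m' s = Monitoring.item m s := fun s => hm _ (by omega)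
  have e2 : ∀ s, Monitoring.thr m' s = Monitoring.thr m s := fun s => hm _ (by omega)
  have e3 : ∀ s, Monitoring.expi m' s = Monitoring.expi m s := fun s => hm _ (by omega)
  have e4 := hm 28 (by omega)
  obtain ⟨h1, h2, h3, h4, h5, h6⟩ := h
  exact ⟨by simpa only [e1] using h1, by simpa only [e2] using h2, by simpa only [e3] using h3,
    by simpa only [e3, e4] using h4, by simpa only [e3, e4] using h5, by simpa only [e4] using h6⟩

theorem Synced.congr {W x : ℕ} {m m' ms : Memory} (h : Synced p W x m ms)
    (hm : ∀ a, 64 ≤ a → m' a = m a) : Synced p W x m' ms :=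
  ⟨h.scale, h.pos, fun s hs => (h.item s hs).trans (hm _ (by omega)).symm, fun s hs => by
    rw [show Monitoring.thr m' s = Monitoring.thr m s from hm _ (by omega)]; exact h.thr s hs,
    h.thr_le⟩

theorem CI.congr {W T Lh : ℕ} {pos : ℕ → ℕ} {m m' : Memory} {f : Fin p.k → Machine}
    (h : CI p W T Lh pos m f) (hm : ∀ a, a < 5 ∨ a = 7 ∨ a = 8 ∨ a = 9 ∨ a = 28 ∨ 64 ≤ a → m' a = m a) :
    CI p W T Lh pos m' f :=
  ⟨h.par.congr fun a ha => hm a (by omega), by rw [hm 7 (by omega), h.scale],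
    by rw [hm 8 (by omega), h.length], by rw [hm 9 (by omega), h.now],
    h.slots.congr fun a ha => hm a (by omega), h.sites,
    fun j hj => (h.on j hj).congr fun a ha => hm a (by omega), h.off⟩

end Monitoring
end

/-! ### The deterministic schedule of the rates, and resynchronization. -/

noncomputable section
open scoped ENNReal
namespace Monitoring
open Monitoring.Expr

variable {p : Par} {h : ℕ} {M : Machine}

/-! ### The schedule -/

/-- The part of the state that only depends on the sites of the arrivals: the sampling rate is
`1 / W`, the length of the window is about `T`, the coordinator knows of `Lh` arrivals, and site `j` is
at position `pos j` of its block. -/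
structure Sk where
  W : ℕ
  T : ℕ
  Lh : ℕ
  pos : ℕ → ℕ

/-- The length of a block of arrivals at a site, `0` if the coordinator sees all items. -/
def Par.blk (p : Par) (W : ℕ) : ℕ := W / (2 * p.k)

def Par.rescale (p : Par) (sk : Sk) : Sk :=
  if sk.Lh < 2 * sk.T ∨ p.w < 2 * sk.T then sk
  else if 2 * sk.T < 2 * sk.W * p.P then { sk with T := 2 * sk.T }
  else ⟨2 * sk.W, 2 * sk.T, sk.Lh, fun _ => 0⟩

/-- The site that treats an arrival at site `i`. -/
def Par.proc (p : Par) (sk : Sk) (i : ℕ) : ℕ := if p.blk sk.W = 0 then 0 else i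

/-- The increment of the clock of the coordinator. -/
def Par.unit (p : Par) (W : ℕ) : ℕ := p.blk W + if p.blk W = 0 then 1 else 0

/-- Whether an arrival at site `i` completes a block. -/
def Par.Ends (p : Par) (sk : Sk) (i : ℕ) : Prop := ¬ sk.pos (p.proc sk i) + 1 < p.blk sk.W

instance (sk : Sk) (i : ℕ) : Decidable (p.Ends sk i) := inferInstanceAs (Decidable (¬ _))

def Par.step (p : Par) (sk : Sk) (i : ℕ) : Sk :=
  if p.Ends sk i then p.rescale ⟨sk.W, sk.T, sk.Lh + p.unit sk.W,
    Function.update sk.pos (p.proc sk i) 0⟩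
  else { sk with pos := Function.update sk.pos (p.proc sk i) (sk.pos (p.proc sk i) + 1) }

theorem Idle.self {t : ℕ} {M : Machine} (h : Idle p t M) : Idle p M.time M :=
  ⟨⟨h.res.size, h.res.supp, h.res.inb, h.res.outb, h.res.peak, le_rfl⟩, h.inbox, h.outbox⟩

theorem SetPost.hasPar {m m' : Memory} {W s x y : ℕ} (h : SetPost m W s x y m') (hm : HasPar p m) :
    HasPar p m' :=
  hm.congr fun a ha => h.frame a (by omega) (by omega) (by omega) (by omega) (by omega) (by omega)

theorem Par.Valid.size_scale (hp : p.Valid) {W : ℕ} (hW : W ≤ p.w) :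
    Nat.size (2 * W) ≤ p.β ∧ Nat.size W ≤ p.β := by
  have := hp.lt_big hp.size_le_lg.2.2.1
  exact ⟨hp.size_of_lt (hp.big_mul _ (by omega)), hp.size_of_lt (hp.big_mul _ (by omega))⟩

theorem Par.Valid.N_pos (hp : p.Valid) : 0 < p.N := by
  have h1 := hp.lg_pos
  have h2 : 0 < p.e := by have := hp.e; omega
  unfold Par.N Par.P; positivity

theorem Par.Valid.P_pos (hp : p.Valid) : 0 < p.P := by
  have h1 := hp.lg_pos
  have h2 : 0 < p.e := by have := hp.e; omega
  unfold Par.P; positivity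

/-- All sites learn all slots. -/
theorem resync_spec (hp : p.Valid) {W' T' W Lh : ℕ} {pos : ℕ → ℕ} {g : Net p.k}
    (hm : HasPar p M.mem) (h7 : M.mem 7 + 1 = W') (h8 : M.mem 8 + 1 = T') (h9 : M.mem 9 = Lh)
    (h15 : M.mem 15 = 0) (ho : M.outbox = []) (hs : SlotsOk p Lh M.mem) (hg : SitesOk p g.1)
    (sW : Nat.size W' ≤ p.β) (hWW : 0 < W ∧ (W' = W ∨ W' = 2 * W))
    (on : ∀ j : Fin p.k, (j : ℕ) < p.kk W → (g.1 j).mem 6 + 1 = W ∧ (g.1 j).mem 7 = pos j)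
    (off : ∀ j : Fin p.k, p.kk W ≤ j → (g.1 j).mem 6 = 0) :
    Sure ((Cmd.loop NE (.seq bcast (.set 15 (c 15 + 1)))).exec algo.askSite h (M, g))
      fun r => CI p W' T' Lh (if W' = W then pos else fun _ => 0) r.1.mem r.2.1 ∧ r.1.outbox = [] ∧
        Keep M.mem r.1.mem ∧ Paid p g r.2 (p.kk W' * p.N) ∧
        ∀ j, (r.2.1 j).mem 8 = (g.1 j).mem 8 := by
  refine co_loop (r := p.N) hm.NE_eval (fun i r => Keep M.mem r.1.mem ∧ r.1.mem 15 = i ∧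
    r.1.outbox = [] ∧ SitesOk p r.2.1 ∧ Paid p g r.2 (p.kk W' * i) ∧
    ∀ j : Fin p.k, (r.2.1 j).mem 8 = (g.1 j).mem 8 ∧ (p.kk W' ≤ j → r.2.1 j = g.1 j) ∧
      ((j : ℕ) < p.kk W' → (i = 0 → r.2.1 j = g.1 j) ∧ (0 < i → (r.2.1 j).mem 6 + 1 = W' ∧
        (r.2.1 j).mem 7 = if W' = (g.1 j).mem 6 + 1 then (g.1 j).mem 7 else 0) ∧
        ∀ s < i, (r.2.1 j).mem (2 * s + 16) = item M.mem s ∧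
          (r.2.1 j).mem (2 * s + 17) = thr M.mem s)) ?_ ?_ ?_
  · intro M₁ h1
    exact ⟨by rw [h1.mem]; exact Keep.rfl', by rw [h1.mem, h15], by rw [h1.out, ho], hg,
      Paid.refl g, fun j => ⟨rfl, fun _ => rfl, fun _ => ⟨fun _ => rfl, fun h => absurd h (by omega),
        fun s hs => absurd hs (by omega)⟩⟩⟩
  · rintro i hi M₁ g₁ ⟨k1, c1, o1, s1, p1, n1⟩ M₂ h2 h'
    dsimp only at k1 c1 o1 s1 p1 n1
    have k2 : Keep M.mem M₂.mem := by rw [h2.mem]; exact k1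
    have z := hs.sizes hp hi
    refine sure_seq (bcast_spec hp (k2.par hm) (W := W') (by rw [k2 7 (by omega), h7])
      (by rw [h2.mem, c1]) hi sW (by rw [k2.item]; exact z.1) (by rw [k2.thr]; exact z.2)
      (by rw [h2.out, o1]) s1.idle) ?_
    rintro M₃ g₃ ⟨k3, c3, o3, n3, b3⟩
    dsimp only at k3 c3 o3 n3 b3
    rw [k2.item, k2.thr] at n3
    refine co_set (x := 15) (y := i + 1) rfl (by simp [c3]) fun M₄ h4 =>
      ⟨fun a ha => ?_, h4.at, by rw [h4.out, o3], ⟨fun j => ?_, fun j => ?_⟩, ?_, fun j => ?_⟩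
    · rw [h4.off (by omega), k3 a ha, k2 a ha]
    · rcases lt_or_ge (j : ℕ) (p.kk W') with hj | hj
      · exact ((n3 j).1 hj).2.self
      · dsimp only; rw [(n3 j).2 hj]; exact s1.idle j
    · rcases lt_or_ge (j : ℕ) (p.kk W') with hj | hj
      · exact ((n3 j).1 hj).1.hasPar (s1.par j)
      · dsimp only; rw [(n3 j).2 hj]; exact s1.par j
    · have := p1.trans (paid_bcast n3 b3)
      rwa [← Nat.mul_succ] at this
    · dsimp only
      rcases lt_or_ge (j : ℕ) (p.kk W') with hj | hj
      swap
      · rw [(n3 j).2 hj]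
        exact ⟨(n1 j).1, (n1 j).2.1, fun hc => absurd hc (by omega)⟩
      · have sp := ((n3 j).1 hj).1
        obtain ⟨a1, a2, a3⟩ := n1 j
        refine ⟨by rw [sp.frame 8 (by norm_num) (by norm_num) (by norm_num) (by norm_num) (by omega)
          (by omega), a1], fun hc => absurd hc (by omega), fun _ => ⟨fun hc => absurd hc (by omega),
          fun _ => ⟨sp.scale, ?_⟩, fun s hs' => ?_⟩⟩
        · rw [sp.pos]
          rcases Nat.eq_zero_or_pos i with h0 | h0
          · rw [(a3 hj).1 h0]
          · rw [((a3 hj).2.1 h0).1, if_pos rfl, ((a3 hj).2.1 h0).2]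
        · rcases Nat.lt_succ_iff_lt_or_eq.1 hs' with hs' | rfl
          · rw [sp.frame (2 * s + 16) (by omega) (by omega) (by omega) (by omega) (by omega)
              (by omega), sp.frame (2 * s + 17) (by omega) (by omega) (by omega) (by omega)
              (by omega) (by omega)]
            exact (a3 hj).2.2 s hs'
          · exact ⟨sp.item, sp.thr⟩
  · rintro ⟨M₁, g₁⟩ ⟨k1, -, o1, s1, p1, n1⟩
    dsimp only at k1 o1 s1 p1 n1
    refine ⟨⟨k1.par hm, by rw [← h7, k1 7 (by omega)], by rw [← h8, k1 8 (by omega)],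
      by rw [← h9, k1 9 (by omega)], hs.congr fun a ha => k1 a (by omega), s1, fun j hj => ?_,
      fun j hj => ?_⟩, o1, k1, p1, fun j => (n1 j).1⟩
    · obtain ⟨-, a2, a3⟩ := (n1 j).2.2 hj
      obtain ⟨a4, a5⟩ := a2 hp.N_pos
      refine ⟨a4, ?_, fun s hs' => ?_, fun s hs' => Or.inl ?_, fun s hs' => ?_⟩
      · rw [a5]
        by_cases hc : W' = W
        · subst hc
          rw [if_pos (on j hj).1.symm, if_pos rfl, (on j hj).2]
        · rw [if_neg hc, if_neg]
          -- A site that has not taken part so far has scale `1`, which differs from `W' = 2 W`; in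
          -- both cases the block restarts.
          rcases lt_or_ge (j : ℕ) (p.kk W) with hl | hl
          · rw [(on j hl).1]; exact hc
          · rw [off j hl]; omega
      · rw [(a3 s hs').1, k1.item]
      · rw [(a3 s hs').2, k1.thr]
      · rw [(a3 s hs').2]; exact hs.thr s hs'
    · rw [(n1 j).2.1 hj]
      -- The set of participating sites only grows, so a site outside it now was outside it before.
      have hk : p.kk W ≤ p.kk W' := by
        have hk := hp.k
        have : W / (2 * p.k) ≤ W' / (2 * p.k) := Nat.div_le_div_right (by omega)
        unfold Par.kk
        split_ifs <;> omega
      exact off j (hk.trans hj)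

/-- Cells `13`, `14`, `10`, `5`, `6` and the slots are the same. -/
def KeepS (m m' : Memory) : Prop :=
  ∀ a, a < 7 ∨ a = 10 ∨ a = 13 ∨ a = 14 ∨ a = 28 ∨ 30 ≤ a → m' a = m a

theorem rescale_spec (hp : p.Valid) {sk : Sk} {g : Net p.k} (ho : M.outbox = [])
    (hW : 0 < sk.W ∧ sk.W ≤ p.w) (hT : 0 < sk.T)
    (hc : CI p sk.W sk.T sk.Lh sk.pos M.mem g.1) :
    Sure (rescale.exec algo.askSite h (M, g)) fun r =>
      CI p (p.rescale sk).W (p.rescale sk).T (p.rescale sk).Lh (p.rescale sk).pos r.1.mem r.2.1 ∧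
      r.1.outbox = [] ∧ KeepS M.mem r.1.mem ∧
      Paid p g r.2 (if (p.rescale sk).T = sk.T then 0 else p.kk (p.rescale sk).W * p.N) ∧
      ∀ j, (r.2.1 j).mem 8 = (g.1 j).mem 8 := by
  have stay : ∀ {M' : Machine}, Same M M' → p.rescale sk = sk →
      CI p (p.rescale sk).W (p.rescale sk).T (p.rescale sk).Lh (p.rescale sk).pos M'.mem g.1 ∧
      M'.outbox = [] ∧ KeepS M.mem M'.mem ∧
      Paid p g g (if (p.rescale sk).T = sk.T then 0 else p.kk (p.rescale sk).W * p.N) ∧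
      ∀ j, (g.1 j).mem 8 = (g.1 j).mem 8 := by
    intro M' hs he
    rw [he, if_pos rfl, hs.mem, hs.out]
    exact ⟨hc, ho, fun _ _ => rfl, Paid.refl g, fun _ => rfl⟩
  refine co_ite ?_ ?_
  · intro he M₁ h1
    have he : sk.Lh < 2 * sk.T := by
      by_contra hn; simp [hc.now, hc.length, hn] at he
    exact sure_skip (stay h1 (by rw [Par.rescale, if_pos (Or.inl he)]))
  intro he M₁ h1
  have he : ¬ sk.Lh < 2 * sk.T := by
    intro hn; simp [hc.now, hc.length, hn] at he
  refine co_ite ?_ ?_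
  · intro he' M₂ h2
    have he' : p.w < 2 * sk.T := by
      by_contra hn; simp [h1.mem, hc.par.2.2.1, hc.length, hn] at he'
    exact sure_skip (stay ⟨by rw [h2.mem, h1.mem], by rw [h2.inb, h1.inb], by rw [h2.out, h1.out]⟩
      (by rw [Par.rescale, if_pos (Or.inr he')]))
  intro he' M₂ h2
  have he' : ¬ p.w < 2 * sk.T := by
    intro hn; simp [h1.mem, hc.par.2.2.1, hc.length, hn] at he'
  have hm2 : M₂.mem = M.mem := by rw [h2.mem, h1.mem]
  refine sure_seq (R' := fun r => r.2 = g ∧ Wrote M₂ 8 (2 * sk.T - 1) r.1)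
    (co_set (x := 8) rfl (by simp [hm2]; have := hc.length; omega) fun M' k => ⟨rfl, k⟩) ?_
  rintro M₃ g₃ ⟨hg, h3⟩; dsimp only at hg h3; subst hg
  have q3 : HasPar p M₃.mem := hc.par.congr fun a ha => by rw [h3.off (by omega), hm2]
  have e7 : M₃.mem 7 + 1 = sk.W := by rw [h3.off (by norm_num), hm2, hc.scale]
  have e8 : M₃.mem 8 + 1 = 2 * sk.T := by rw [h3.at]; omega
  set W' := if 2 * sk.T < 2 * sk.W * p.P then sk.W else 2 * sk.W with hW'
  have eT : (p.rescale sk).T = 2 * sk.T := by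
    rw [Par.rescale, if_neg (by omega)]; split <;> rfl
  have eW : (p.rescale sk).W = W' := by
    rw [Par.rescale, if_neg (by omega), hW']; split <;> rfl
  have eL : (p.rescale sk).Lh = sk.Lh := by
    rw [Par.rescale, if_neg (by omega)]; split <;> rfl
  have eP : (p.rescale sk).pos = if W' = sk.W then sk.pos else fun _ => 0 := by
    rw [Par.rescale, if_neg (by omega), hW']
    by_cases hcc : 2 * sk.T < 2 * sk.W * p.P
    · rw [if_pos hcc, if_pos hcc, if_pos rfl]
    · rw [if_neg hcc, if_neg hcc, if_neg (by omega)]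
  rw [eT, eW, eL, eP, if_neg (show ¬ 2 * sk.T = sk.T by omega)]
  refine sure_seq (R' := fun r => r.2 = g₃ ∧ r.1.mem 7 + 1 = W' ∧ r.1.outbox = [] ∧
    ∀ a, a ≠ 7 → r.1.mem a = M₃.mem a) ?_ ?_
  · have ev : (lt (c 8 + 1) (2 * (c 7 + 1) * PE)).eval M₃.mem =
        if 2 * sk.T < 2 * sk.W * p.P then 1 else 0 := by
      simp only [eval_lt, eval_add, eval_mul, eval_c, eval_ofNat, q3.PE_eval, e7, e8]
    refine co_ite ?_ ?_
    · intro hb M₄ h4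
      rw [ev] at hb
      have hb : 2 * sk.T < 2 * sk.W * p.P := by by_contra hn; simp [hn] at hb
      exact sure_skip ⟨rfl, by rw [h4.mem, e7, hW', if_pos hb],
        by rw [h4.out, h3.out, h2.out, h1.out, ho], fun a _ => by rw [h4.mem]⟩
    · intro hb M₄ h4
      rw [ev] at hb
      have hb : ¬ 2 * sk.T < 2 * sk.W * p.P := by intro hn; simp [hn] at hb
      refine co_set (x := 7) (y := 2 * sk.W - 1) rfl (by simp [h4.mem]; omega) fun M₅ h5 =>
        ⟨rfl, by rw [h5.at, hW', if_neg hb]; omega,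
        by rw [h5.out, h4.out, h3.out, h2.out, h1.out, ho],
        fun a ha => by rw [h5.off ha, h4.mem]⟩
  rintro M₄ g₄ ⟨hg, e4, o4, k4⟩; dsimp only at hg e4 o4 k4; subst hg
  refine sure_seq (R' := fun r => r.2 = g₄ ∧ Wrote M₄ 15 0 r.1)
    (co_set rfl rfl fun M' k => ⟨rfl, k⟩) ?_
  rintro M₅ g₅ ⟨hg, h5⟩; dsimp only at hg h5; subst hg
  have k5 : ∀ a, a ≠ 7 → a ≠ 8 → a ≠ 15 → M₅.mem a = M.mem a := fun a x1 x2 x3 => by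
    rw [h5.off x3, k4 a x1, h3.off x2, hm2]
  refine (resync_spec hp (W' := W') (T' := 2 * sk.T) (W := sk.W) (Lh := sk.Lh) (pos := sk.pos)
    (hc.par.congr fun a ha => k5 a (by omega) (by omega) (by omega))
    (by rw [h5.off (by norm_num), e4])
    (by rw [h5.off (by norm_num), k4 8 (by norm_num), e8])
    (by rw [k5 9 (by norm_num) (by norm_num) (by norm_num), hc.now]) h5.at (by rw [h5.out, o4])
    (hc.slots.congr fun a ha => k5 a (by omega) (by omega) (by omega)) hc.sites ?_
    ⟨hW.1, ?_⟩ (fun j hj => ⟨(hc.on j hj).scale, (hc.on j hj).pos⟩) hc.off).mono ?_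
  · have := hp.size_scale hW.2
    rw [hW']; split
    · exact this.2
    · exact this.1
  · rw [hW']; split <;> simp
  · rintro ⟨M₆, g₆⟩ ⟨r1, r2, r3, r4, r5⟩
    exact ⟨r1, r2, fun a ha => by
      rw [r3 a (by omega), k5 a (by omega) (by omega) (by omega)], r4, r5⟩

end Monitoring
end

/-! ### The exponential potential and the effect of new samples on it. -/

noncomputable section
open scoped ENNReal
namespace Monitoring
open Monitoring.Expr

variable {p : Par} {h : ℕ} {M : Machine}

/-! ### The potential of the slots -/

theorem two_pow_mul_div (b : ℕ) (x : ℝ≥0∞) : 2 ^ b * x / 2 ^ b = x := by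
  rw [mul_comm]; exact ENNReal.mul_div_cancel_right (by simp) (by simp)

/-- Mixture of `x` and `y` with the weights `t / 2 ^ b` and `1 - t / 2 ^ b`. -/
def mix2 (b t : ℕ) (x y : ℝ≥0∞) : ℝ≥0∞ := (t * x + (2 ^ b - t : ℕ) * y) / 2 ^ b

theorem mix2_zero (b : ℕ) (x y : ℝ≥0∞) : mix2 b 0 x y = y := by
  unfold mix2
  simp only [Nat.cast_zero, zero_mul, zero_add, Nat.sub_zero, Nat.cast_pow, Nat.cast_ofNat]
  exact two_pow_mul_div b _

theorem mix2_self {b t : ℕ} (ht : t ≤ 2 ^ b) (x : ℝ≥0∞) : mix2 b t x x = x := by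
  unfold mix2
  rw [← add_mul, ← Nat.cast_add, Nat.add_sub_cancel' ht]
  simp only [Nat.cast_pow, Nat.cast_ofNat]
  exact two_pow_mul_div b _

theorem le_mix2 {b t : ℕ} (ht : t ≤ 2 ^ b) {a z x y : ℝ≥0∞} (hx : z ≤ a * x) (hy : z ≤ a * y) :
    z ≤ a * mix2 b t x y := by
  rw [← mix2_self ht z]
  unfold mix2
  rw [← mul_div_assoc, mul_add, mul_left_comm, mul_left_comm a]
  gcongr

/-- Expected value of a function that is `x` if the item of a sample will be hit in the future, and
`y` if it will not. -/
def sf (b : ℕ) (x y : ℝ≥0∞) (it t : ℕ) : List ℕ → ℝ≥0∞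
  | [] => if t = 0 then x else y
  | v :: l => if it = v then mix2 b t x (sf b x y it t l) else sf b x y it t l

theorem sf_zero (b : ℕ) (x y : ℝ≥0∞) (it : ℕ) (l : List ℕ) : sf b x y it 0 l = x := by
  induction l with
  | nil => simp [sf]
  | cons v l ih => simp only [sf, ih, mix2_zero, ite_self]

/-- `sf` is a convex combination of `x` and `y`. -/
theorem le_sf {b t : ℕ} (ht : t ≤ 2 ^ b) {a z x y : ℝ≥0∞} (hx : z ≤ a * x) (hy : z ≤ a * y) (it : ℕ)
    (l : List ℕ) : z ≤ a * sf b x y it t l := by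
  induction l with
  | nil => unfold sf; split <;> assumption
  | cons v l ih =>
    unfold sf; split
    · exact le_mix2 ht hx ih
    · exact ih

/-- Weights of samples, as functions of value and expiry, and of the expiry of dropped samples. -/
structure Wt where
  χ₁ : ℕ → ℕ → ℝ≥0∞
  χ₀ : ℕ → ℕ → ℝ≥0∞
  ϰ : ℕ → ℝ≥0∞

/-- The two conditions under which storing a sample costs no more than its own factor: an
overwritten sample has expired and removes a factor of at least `1`, and a dropped sample changes
`ϰ` by no more than the factor it would have had. -/
structure Wt.Good (p : Par) (Lh : ℕ) (u : Wt) : Prop where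
  old : ∀ v x, x ≤ Lh → 1 ≤ u.χ₁ v x ∧ 1 ≤ u.χ₀ v x
  drop : ∀ z v, z ≤ Lh + p.w + 1 → u.ϰ (Lh + p.w + 1) ≤ u.ϰ z * u.χ₁ v (Lh + p.w + 1) ∧
    u.ϰ (Lh + p.w + 1) ≤ u.ϰ z * u.χ₀ v (Lh + p.w + 1)

variable {u : Wt}

/-- The stream is fixed, so the future items `fu` are known, and this is the conditional expectation
of the final weight of the slot's present sample given the state. -/
def slotPot (p : Par) (u : Wt) (fu : List ℕ) (m : Memory) (s : ℕ) : ℝ≥0∞ :=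
  sf p.dd (u.χ₁ (val m s) (expi m s)) (u.χ₀ (val m s) (expi m s)) (item m s) (thr m s) fu

def pot (p : Par) (u : Wt) (fu : List ℕ) (m : Memory) : ℝ≥0∞ :=
  (∏ s ∈ Finset.range p.N, slotPot p u fu m s) * u.ϰ (m 28)

/-- The factor of a new sample. -/
def fresh (p : Par) (u : Wt) (fu : List ℕ) (W T Lh v : ℕ) : ℝ≥0∞ :=
  (∑ l ∈ Finset.range (2 ^ p.a), (∑ j ∈ Finset.range (2 ^ l),
    sf p.dd (u.χ₁ (p.valOf W T (2 ^ l) (j + 2 ^ l)) (Lh + p.w + 1))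
      (u.χ₀ (p.valOf W T (2 ^ l) (j + 2 ^ l)) (Lh + p.w + 1)) v (p.thrOf (j + 2 ^ l)) fu) /
        2 ^ l) / 2 ^ p.a

theorem le_avg {b : ℕ} {φ : ℕ → ℝ≥0∞} {a z : ℝ≥0∞} (hφ : ∀ x < 2 ^ b, z ≤ a * φ x) :
    z ≤ a * ((∑ x ∈ Finset.range (2 ^ b), φ x) / 2 ^ b) := by
  have : z = (∑ x ∈ Finset.range (2 ^ b), z) / 2 ^ b := by
    simp only [Finset.sum_const, Finset.card_range, nsmul_eq_mul, Nat.cast_pow, Nat.cast_ofNat]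
    exact (two_pow_mul_div b z).symm
  rw [this, ← mul_div_assoc, Finset.mul_sum]
  exact ENNReal.div_le_div_right (Finset.sum_le_sum fun x hx => hφ x (Finset.mem_range.1 hx)) _

theorem Par.thrOf_le (p : Par) (i : ℕ) : p.thrOf i ≤ 2 ^ p.dd := by
  unfold Par.thrOf
  exact Nat.div_le_of_le_mul (by rw [mul_comm]; exact Nat.mul_le_mul_right _ (Nat.sub_le _ _))

theorem pot_congr {fu : List ℕ} {m m' : Memory} (hm : ∀ a, a = 28 ∨ 64 ≤ a → m' a = m a) :
    pot p u fu m' = pot p u fu m := by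
  unfold pot slotPot item thr val expi
  rw [hm 28 (by omega)]
  congr 1
  refine Finset.prod_congr rfl fun s _ => ?_
  rw [hm _ (by omega), hm _ (by omega), hm _ (by omega), hm _ (by omega)]

/-! ### New samples -/

/-- The expiry times, those before `R` set to `R`, added up. -/
def expSum (p : Par) (m : Memory) (R : ℕ) : ℕ := ∑ s ∈ Finset.range p.N, max (expi m s) R

/-- The changes between two states of the coordinator and the network when `d` samples are stored. -/
structure Grown (p : Par) (W Lh : ℕ) (m m' : Memory) (g g' : Net p.k) (d : ℕ) : Prop where
  cnt : m' 10 = m 10 + d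
  paid : Paid p g g' (p.kk W * d)
  expi : ∀ R ≤ Lh, expSum p m R + (p.w + 1) * d ≤ expSum p m' R
  off : ∀ j, (g'.1 j).mem 8 = (g.1 j).mem 8
  cells : m' 5 = m 5 ∧ m' 6 = m 6 ∧ m' 13 = m 13 ∧ m' 14 = m 14

theorem Grown.trans {W Lh d d' : ℕ} {m m' m'' : Memory} {g g' g'' : Net p.k}
    (h : Grown p W Lh m m' g g' d) (h' : Grown p W Lh m' m'' g' g'' d') :
    Grown p W Lh m m'' g g'' (d + d') := by
  refine ⟨by rw [h'.cnt, h.cnt, add_assoc], by rw [mul_add]; exact h.paid.trans h'.paid,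
    fun R hR => ?_, fun j => (h'.off j).trans (h.off j), ?_⟩
  · have := h.expi R hR; have := h'.expi R hR; linarith
  · obtain ⟨a1, a2, a3, a4⟩ := h.cells
    obtain ⟨b1, b2, b3, b4⟩ := h'.cells
    exact ⟨b1.trans a1, b2.trans a2, b3.trans a3, b4.trans a4⟩

/-- Either a free slot takes the sample, and the random threshold is averaged to `fresh`, or the
sample is dropped, and `Wt.Good.drop` pays. The factor is the same in both cases, so the bound does
not depend on how full the slots are. -/
theorem newSample_ex (hp : p.Valid) {W T Lh v : ℕ} {pos : ℕ → ℕ} {g : Net p.k} {fu : List ℕ}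
    (hu : u.Good p Lh) (hc : CI p W T Lh pos M.mem g.1) (ho : M.outbox = [])
    (h13 : M.mem 13 = v + 1) (hv : v < p.n) (hW : 0 < W ∧ W ≤ p.w)
    {F : Machine × Net p.k → ℝ≥0∞} {Z : ℝ≥0∞}
    (hF : ∀ M' g' d, CI p W T Lh pos M'.mem g'.1 → M'.outbox = [] →
      Grown p W Lh M.mem M'.mem g g' d → F (M', g') ≤ pot p u fu M'.mem * Z) :
    Ex (newSample.exec algo.askSite h (M, g)) F ≤
      fresh p u fu W T Lh v * (pot p u fu M.mem * Z) := by
  rw [newSample, Ex_seq]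
  refine Sure.ex_le (findSlot_spec hc.par) ?_
  rintro ⟨M₁, g₁⟩ ⟨hg, k1, o1, d1⟩
  dsimp only at hg k1 o1 d1
  subst hg
  have ev : (lt (c 15) NE).eval M₁.mem = if M₁.mem 15 < p.N then 1 else 0 := by
    simp only [eval_lt, eval_c, (k1.par hc.par).NE_eval]
  refine ex_co_ite ?_ ?_
  · -- a free slot
    intro hb M₂ h2
    rw [ev] at hb
    have hb : M₁.mem 15 < p.N := by by_contra hn; simp [hn] at hb
    obtain ⟨s, hs15⟩ : ∃ s, M₁.mem 15 = s := ⟨_, rfl⟩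
    have hs : s < p.N := hs15 ▸ hb
    have hex : expi M.mem s ≤ Lh := by
      rcases d1 with d1 | d1
      · rw [← hs15, ← hc.now]; exact d1.2
      · omega
    have k2 : Keep M.mem M₂.mem := by rw [h2.mem]; exact k1
    rw [Ex_seq]
    have key : ∀ l < 2 ^ p.a, ∀ j < 2 ^ l, ∀ M',
        (∀ a, a ≠ 16 → a ≠ 17 → a ≠ 18 → M'.mem a = M₂.mem a) →
        M'.mem 17 = 2 ^ l → M'.mem 18 = j + 2 ^ l → M'.outbox = M₂.outbox →
        Ex ((Cmd.seq fillSlot bcast).exec algo.askSite h (M', g₁)) F ≤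
        sf p.dd (u.χ₁ (p.valOf W T (2 ^ l) (j + 2 ^ l)) (Lh + p.w + 1))
          (u.χ₀ (p.valOf W T (2 ^ l) (j + 2 ^ l)) (Lh + p.w + 1)) v (p.thrOf (j + 2 ^ l)) fu *
          (pot p u fu M.mem * Z) := by
      intro l hl j hj M₃ k3 e17 e18 o3
      have k3' : Keep M.mem M₃.mem := fun a ha => by
        rw [k3 a (by omega) (by omega) (by omega), k2 a ha]
      rw [Ex_seq]
      refine Sure.ex_le (fillSlot_spec (k3'.par hc.par) (s := s)
        (by rw [k3 15 (by norm_num) (by norm_num) (by norm_num), h2.mem, hs15]) e17 e18) ?_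
      rintro ⟨M₄, g₄⟩ ⟨hg, o4, e15, ei, et, ew, ee, e10, k4⟩
      dsimp only at hg o4 e15 ei et ew ee e10 k4
      subst hg
      rw [k3' 13 (by omega), h13, Nat.add_sub_cancel] at ei
      rw [k3' 7 (by omega), k3' 8 (by omega), hc.scale, hc.length] at ew
      rw [k3' 9 (by omega), hc.now] at ee
      rw [k3' 10 (by omega)] at e10
      have k4' : ∀ a, (a < 10 ∨ a = 13 ∨ a = 14 ∨ a = 28 ∨ 30 ≤ a) → a ≠ 4 * s + 64 →
          a ≠ 4 * s + 65 → a ≠ 4 * s + 66 → a ≠ 4 * s + 67 → M₄.mem a = M.mem a :=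
        fun a ha x1 x2 x3 x4 => by rw [k4 a ha x1 x2 x3 x4, k3' a (by omega)]
      have same : ∀ r, r ≠ s → item M₄.mem r = item M.mem r ∧ thr M₄.mem r = thr M.mem r ∧
          val M₄.mem r = val M.mem r ∧ expi M₄.mem r = expi M.mem r := fun r hr =>
        ⟨k4' _ (by omega) (by omega) (by omega) (by omega) (by omega),
          k4' _ (by omega) (by omega) (by omega) (by omega) (by omega),
          k4' _ (by omega) (by omega) (by omega) (by omega) (by omega),
          k4' _ (by omega) (by omega) (by omega) (by omega) (by omega)⟩
      have e28 : M₄.mem 28 = M.mem 28 :=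
        k4' _ (by omega) (by omega) (by omega) (by omega) (by omega)
      have q4 : HasPar p M₄.mem := hc.par.congr fun a ha =>
        k4' _ (by omega) (by omega) (by omega) (by omega) (by omega)
      have slots4 : SlotsOk p Lh M₄.mem := by
        have hs' := hc.slots
        refine ⟨fun r hr => ?_, fun r hr => ?_, fun r hr => ?_, fun r hr => ?_, fun hz r hr => ?_,
          by rw [e28]; exact hs'.drop_le⟩
        · by_cases hrs : r = s
          · rw [hrs, ei]; exact hv
          · rw [(same r hrs).1]; exact hs'.item r hr
        · by_cases hrs : r = s
          · rw [hrs, et]; exact p.thrOf_le _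
          · rw [(same r hrs).2.1]; exact hs'.thr r hr
        · by_cases hrs : r = s
          · rw [hrs, ee]
          · rw [(same r hrs).2.2.2]; exact hs'.expi r hr
        · rw [e28]
          by_cases hrs : r = s
          · rw [hrs, ee]; have := hs'.drop_le; omega
          · rw [(same r hrs).2.2.2]; exact hs'.drop r hr
        · rw [e28] at hz
          by_cases hrs : r = s
          · rw [hrs, ee]; omega
          · rw [(same r hrs).2.2.2]; exact hs'.pos hz r hr
      have e7 : M₄.mem 7 + 1 = W := by
        rw [k4' _ (by omega) (by omega) (by omega) (by omega) (by omega), hc.scale]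
      have z := slots4.sizes hp hs
      refine Sure.ex_le (bcast_spec hp q4 e7 e15 hs (hp.size_scale hW.2).2 z.1 z.2
        (by rw [o4, o3, h2.out, o1, ho]) hc.sites.idle) ?_
      rintro ⟨M₅, g₅⟩ ⟨k5, -, o5, n5, b5⟩
      dsimp only at k5 o5 n5 b5
      refine (hF M₅ g₅ 1 ?_ o5 ?_).trans ?_
      · refine ⟨k5.par q4, by rw [k5 7 (by omega), e7], ?_, ?_,
          slots4.congr fun a ha => k5 a (by omega), ⟨fun i => ?_, fun i => ?_⟩, fun i hi => ?_,
          fun i hi => ?_⟩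
        · rw [k5 8 (by omega), k4' _ (by omega) (by omega) (by omega) (by omega) (by omega),
            hc.length]
        · rw [k5 9 (by omega), k4' _ (by omega) (by omega) (by omega) (by omega) (by omega),
            hc.now]
        · rcases lt_or_ge (i : ℕ) (p.kk W) with hi | hi
          · exact ((n5 i).1 hi).2.self
          · rw [(n5 i).2 hi]; exact hc.sites.idle i
        · rcases lt_or_ge (i : ℕ) (p.kk W) with hi | hi
          · exact ((n5 i).1 hi).1.hasPar (hc.sites.par i)
          · rw [(n5 i).2 hi]; exact hc.sites.par i
        · have sp := ((n5 i).1 hi).1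
          have on := hc.on i hi
          refine ⟨sp.scale, by rw [sp.pos, if_pos on.scale.symm, on.pos], fun r hr => ?_,
            fun r hr => ?_, fun r hr => ?_⟩
          · rw [k5.item]
            by_cases hrs : r = s
            · subst hrs; rw [sp.item]
            · rw [sp.frame _ (by omega) (by omega) (by omega) (by omega) (by omega) (by omega),
                on.item r hr, (same r hrs).1]
          · rw [k5.thr]
            by_cases hrs : r = s
            · subst hrs; exact Or.inl sp.thr
            · rw [sp.frame _ (by omega) (by omega) (by omega) (by omega) (by omega) (by omega),
                (same r hrs).2.1]
              exact on.thr r hr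
          · by_cases hrs : r = s
            · subst hrs; rw [sp.thr]; exact slots4.thr _ hr
            · rw [sp.frame _ (by omega) (by omega) (by omega) (by omega) (by omega) (by omega)]
              exact on.thr_le r hr
        · rw [(n5 i).2 hi]; exact hc.off i hi
      · refine ⟨by rw [k5 10 (by omega), e10], ?_, fun R hR => ?_, fun i => ?_, ?_, ?_, ?_, ?_⟩
        · rw [mul_one]; exact paid_bcast n5 b5
        -- The overwritten expiry, clipped below at `R ≤ Lh`, counted at most `Lh`; the new one
        -- counts `Lh + w + 1`.
        · unfold expSum
          rw [← Finset.add_sum_erase _ _ (Finset.mem_range.2 hs),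
            ← Finset.add_sum_erase _ (fun r => max (expi M₅.mem r) R) (Finset.mem_range.2 hs)]
          rw [Finset.sum_congr rfl fun r hr => by
            rw [← (same r (Finset.ne_of_mem_erase hr)).2.2.2, ← k5.expi r]]
          rw [k5.expi, ee]
          have : max (Lh + p.w + 1) R = Lh + p.w + 1 := by omega
          have : max (expi M.mem s) R ≤ Lh := by omega
          omega
        · rcases lt_or_ge (i : ℕ) (p.kk W) with hi | hi
          · exact ((n5 i).1 hi).1.frame 8 (by norm_num) (by norm_num) (by norm_num) (by norm_num)
              (by omega) (by omega)
          · rw [(n5 i).2 hi]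
        all_goals
          rw [k5 _ (by omega), k4' _ (by omega) (by omega) (by omega) (by omega) (by omega)]
      · rw [pot_congr fun a ha => k5 a (by omega)]
        rw [← mul_assoc]
        gcongr
        unfold pot
        rw [e28, ← mul_assoc]
        gcongr
        rw [← Finset.mul_prod_erase _ _ (Finset.mem_range.2 hs),
          ← Finset.mul_prod_erase _ (fun r => slotPot p u fu M.mem r) (Finset.mem_range.2 hs)]
        rw [Finset.prod_congr rfl fun r hr => show slotPot p u fu M₄.mem r =
          slotPot p u fu M.mem r by
            obtain ⟨x1, x2, x3, x4⟩ := same r (Finset.ne_of_mem_erase hr)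
            unfold slotPot; rw [x1, x2, x3, x4]]
        have e1 : slotPot p u fu M₄.mem s =
          sf p.dd (u.χ₁ (p.valOf W T (2 ^ l) (j + 2 ^ l)) (Lh + p.w + 1))
          (u.χ₀ (p.valOf W T (2 ^ l) (j + 2 ^ l)) (Lh + p.w + 1)) v (p.thrOf (j + 2 ^ l)) fu := by
          unfold slotPot; rw [ei, et, ew, ee]
        rw [e1]
        gcongr
        -- The overwritten sample had a factor of at least `1`, which may be left out.
        have hold := hu.old (val M.mem s) _ hex
        refine le_mul_of_one_le_left' ?_
        have := le_sf (hc.slots.thr s hs) (a := 1) (by simpa using hold.1) (by simpa using hold.2)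
          (item M.mem s) fu
        rwa [one_mul] at this
    refine (drawThreshold_ex (k2.par hc.par) key).trans_eq ?_
    unfold fresh
    simp only [← Finset.sum_mul, ENNReal.mul_div_right_comm]
  · intro hb M₂ h2
    rw [ev] at hb
    have hb : ¬ M₁.mem 15 < p.N := by intro hn; simp [hn] at hb
    have hall : ∀ s < p.N, Lh < expi M.mem s := by
      rcases d1 with d1 | d1
      · omega
      · rw [← hc.now]; exact d1.2
    have k2 : Keep M.mem M₂.mem := by rw [h2.mem]; exact k1
    refine Sure.ex_le (co_set (R := fun r => r.2 = g₁ ∧ Wrote M₂ 28 (Lh + p.w + 1) r.1) (x := 28)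
      rfl ?_ fun M' k => ⟨rfl, k⟩) ?_
    · simp only [eval_add, eval_c, eval_ofNat, k2 9 (by omega), k2 2 (by omega), hc.now,
        hc.par.2.2.1]
    rintro ⟨M₃, g₃⟩ ⟨hg, h3⟩
    dsimp only at hg h3
    subst hg
    have k3 : ∀ a, a < 11 ∨ a = 13 ∨ a = 14 ∨ 30 ≤ a → M₃.mem a = M.mem a := fun a ha => by
      rw [h3.off (by omega), k2 a (by omega)]
    have ie : ∀ s, expi M₃.mem s = expi M.mem s := fun s => k3 _ (by omega)
    have ii : ∀ s, item M₃.mem s = item M.mem s := fun s => k3 _ (by omega)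
    have it : ∀ s, thr M₃.mem s = thr M.mem s := fun s => k3 _ (by omega)
    have iv : ∀ s, val M₃.mem s = val M.mem s := fun s => k3 _ (by omega)
    refine (hF M₃ g₃ 0 ?_ (by rw [h3.out, h2.out, o1, ho]) ?_).trans ?_
    · refine ⟨hc.par.congr fun a ha => k3 a (by omega), by rw [k3 7 (by omega), hc.scale],
        by rw [k3 8 (by omega), hc.length], by rw [k3 9 (by omega), hc.now], ?_, hc.sites,
        fun j hj => (hc.on j hj).congr fun a ha => k3 a (by omega), hc.off⟩
      have hs' := hc.slots
      refine ⟨fun r hr => by rw [ii]; exact hs'.item r hr, fun r hr => by rw [it]; exact hs'.thr r hr,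
        fun r hr => by rw [ie]; exact hs'.expi r hr, fun r hr => ?_, fun _ r hr => ?_, by rw [h3.at]⟩
      · rw [ie, h3.at]; have := hall r hr; omega
      · rw [ie]; have := hall r hr; omega
    · refine ⟨k3 10 (by omega), by rw [mul_zero]; exact Paid.refl _, fun R hR => ?_, fun _ => rfl,
        k3 _ (by omega), k3 _ (by omega), k3 _ (by omega), k3 _ (by omega)⟩
      unfold expSum
      simp only [ie]; omega
    · rw [← mul_assoc]
      gcongr
      unfold pot
      have : ∀ s, slotPot p u fu M₃.mem s = slotPot p u fu M.mem s := fun s => by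
        unfold slotPot; rw [ie, ii, it, iv]
      simp only [this, h3.at]
      rw [mul_left_comm]
      gcongr
      rw [mul_comm]
      unfold fresh
      refine le_avg fun l _ => le_avg fun j _ => ?_
      -- Both weights of the dropped sample satisfy the drop condition, hence so does their average
      -- `sf`, and so does the average over the thresholds.
      have hd := fun v => hu.drop (M.mem 28) v hc.slots.drop_le
      exact le_sf (p.thrOf_le _) (hd _).1 (hd _).2 _ _

end Monitoring
end

/-! ### The coordinator: reading reports and computing the estimate. -/

noncomputable section
open scoped ENNReal
namespace Monitoring
open Monitoring.Expr

variable {p : Par} {h : ℕ} {M : Machine} {u : Wt}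

/-! ### The program of the coordinator -/

/-- The memory after the coordinator has read the words `l` about the item `v`. -/
structure ReadPost (p : Par) (v : ℕ) (l : List ℕ) (m m' : Memory) : Prop where
  frame : ∀ a, a ≠ 12 → a ≠ 13 → a ≠ 14 → (∀ s < p.N, a ≠ 4 * s + 65) → m' a = m a
  thr : ∀ s < p.N, thr m' s = if s + 1 ∈ l then 0 else thr m s
  samp : m' 13 = if p.N + 2 + v ∈ l then v + 1 else 0
  tick : m' 14 = if p.N + 1 ∈ l then 1 else 0

theorem readWords_spec {σ : Type} {reply : Unit → ℕ → List ℕ → σ → PMF (List ℕ × σ)} {g : σ}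
    (hm : HasPar p M.mem) {l : List ℕ} {v : ℕ} (hl : M.inbox = l) (hlen : l.length ≤ p.N + 2)
    (hx : ∀ x ∈ l, 0 < x ∧ (x ≤ p.N + 1 ∨ x = p.N + 2 + v)) :
    Sure (readWords.exec reply h (M, g)) fun r => r.2 = g ∧ r.1.outbox = M.outbox ∧
      ReadPost p v l M.mem r.1.mem := by
  refine sure_seq (R' := fun r => r.2 = g ∧ Wrote M 13 0 r.1)
    (co_set rfl rfl fun M' k => ⟨rfl, k⟩) ?_
  rintro M₁ g₁ ⟨hg, h1⟩; dsimp only at hg h1; subst hg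
  refine sure_seq (R' := fun r => r.2 = g₁ ∧ Wrote M₁ 14 0 r.1)
    (co_set rfl rfl fun M' k => ⟨rfl, k⟩) ?_
  rintro M₂ g₂ ⟨hg, h2⟩; dsimp only at hg h2; subst hg
  have q2 : HasPar p M₂.mem := hm.congr fun a ha => by rw [h2.off (by omega), h1.off (by omega)]
  refine co_loop (r := p.N + 2) (by rw [eval_add, q2.NE_eval, eval_ofNat]) (fun i r => r.2 = g₂ ∧
    r.1.outbox = M.outbox ∧ r.1.inbox = l.drop i ∧ ReadPost p v (l.take i) M.mem r.1.mem) ?_ ?_ ?_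
  · intro M₃ h3
    refine ⟨rfl, by rw [h3.out, h2.out, h1.out], by rw [h3.inb, h2.inb, h1.inb, hl, List.drop_zero],
      ⟨fun a _ a2 a3 _ => by rw [h3.mem, h2.off a3, h1.off a2], fun s _ => ?_, ?_, ?_⟩⟩
    · unfold thr
      rw [h3.mem, h2.off (by omega), h1.off (by omega)]; simp
    · rw [h3.mem, h2.off (by omega), h1.at]; simp
    · rw [h3.mem, h2.at]; simp
  · rintro i hi M₃ g₃ ⟨hg, o3, i3, r3⟩ M₄ h4 h'
    dsimp only at hg o3 i3 r3; subst hg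
    have hd : M₄.inbox.headD 0 = l.getD i 0 := by
      rw [h4.inb, i3, List.headD_eq_head?_getD, List.head?_drop, List.getD_eq_getElem?_getD]
    have ht : M₄.inbox.tail = l.drop (i + 1) := by rw [h4.inb, i3, List.tail_drop]
    refine sure_seq (R' := fun r => r.2 = g₃ ∧ r.1.outbox = M.outbox ∧ r.1.inbox = l.drop (i + 1) ∧
      r.1.mem 12 = l.getD i 0 ∧ ReadPost p v (l.take i) M.mem r.1.mem) ?_ ?_
    · refine co_recv (x := 12) rfl fun M₅ m5 i5 o5 => ⟨rfl, by rw [o5, h4.out, o3], by rw [i5, ht],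
        by show M₅.mem 12 = _; rw [m5, upd_apply, if_pos rfl, hd], ?_⟩
      have e5 : ∀ a, a ≠ 12 → M₅.mem a = M₃.mem a := fun a ha => by
        rw [m5, upd_apply, if_neg ha, h4.mem]
      exact ⟨fun a a1 a2 a3 a4 => by rw [e5 a a1, r3.frame a a1 a2 a3 a4],
        fun s hs => by rw [← r3.thr s hs]; exact e5 _ (by omega),
        by rw [e5 13 (by norm_num), r3.samp], by rw [e5 14 (by norm_num), r3.tick]⟩
    · rintro M₅ g₅ ⟨hg, o5, i5, c5, r5⟩
      dsimp only at hg o5 i5 c5 r5; subst hg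
      have q5 : HasPar p M₅.mem := hm.congr fun a ha =>
        r5.frame a (by omega) (by omega) (by omega) (fun s _ => by omega)
      have fin : ∀ M₆ : Machine, Same M₅ M₆ → l.length ≤ i →
          M₆.outbox = M.outbox ∧ M₆.inbox = l.drop (i + 1) ∧
            ReadPost p v (l.take (i + 1)) M.mem M₆.mem := by
        intro M₆ h6 hil
        rw [List.take_of_length_le (by omega : l.length ≤ i + 1), h6.mem, h6.out, h6.inb]
        rw [List.take_of_length_le hil] at r5
        exact ⟨o5, i5, r5⟩
      refine co_ite ?_ ?_
      swap
      · intro h0 M₆ h6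
        rw [eval_c, c5] at h0
        refine sure_skip ⟨rfl, fin M₆ h6 ?_⟩
        by_contra hlt
        rw [not_le] at hlt
        rw [List.getD_eq_getElem _ _ hlt] at h0
        have := (hx _ (List.getElem_mem hlt)).1
        omega
      intro h0 M₆ h6
      rw [eval_c, c5] at h0
      have hlt : i < l.length := by
        by_contra hc
        rw [List.getD_eq_default _ _ (by omega)] at h0; exact h0 rfl
      obtain ⟨x, hxl⟩ : ∃ x, l.getD i 0 = x := ⟨_, rfl⟩
      have hxm : x ∈ l := by
        rw [← hxl, List.getD_eq_getElem _ _ hlt]; exact List.getElem_mem hlt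
      have htk : l.take (i + 1) = l.take i ++ [x] := by
        rw [← hxl, List.getD_eq_getElem _ _ hlt]; exact (List.take_concat_get' l i hlt).symm
      obtain ⟨x0, x1⟩ := hx x hxm
      have e12 : M₆.mem 12 = x := by rw [h6.mem, c5, hxl]
      have q6 : HasPar p M₆.mem := by rw [h6.mem]; exact q5
      rw [htk]
      have r6 : ReadPost p v (l.take i) M.mem M₆.mem := by rw [h6.mem]; exact r5
      refine co_ite ?_ ?_
      · intro hb M₇ h7
        have hb : x < p.N + 1 := by
          by_contra hn; simp [e12, q6.NE_eval, hn] at hb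
        have e7 : M₇.mem 12 = x := by rw [h7.mem, e12]
        refine co_set (x := 4 * (x - 1) + 65) (y := 0)
          (by rw [eval_add, eval_mul, eval_sub, eval_c, e7]; rfl) rfl fun M₈ h8 =>
          ⟨rfl, by rw [h8.out, h7.out, h6.out, o5], by rw [h8.inb, h7.inb, h6.inb, i5], ?_, ?_, ?_, ?_⟩
        · intro a a1 a2 a3 a4
          rw [h8.off (a4 (x - 1) (by omega)), h7.mem, r6.frame a a1 a2 a3 a4]
        · intro s hs
          unfold thr
          by_cases hsx : s = x - 1
          · subst hsx
            rw [h8.at, if_pos]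
            rw [Nat.sub_add_cancel x0]; simp
          · rw [h8.off (by omega), h7.mem]
            have := r6.thr s hs
            unfold thr at this
            rw [this]
            have : s + 1 ≠ x := by omega
            simp [this]
        · rw [h8.off (by omega), h7.mem, r6.samp]
          have : p.N + 2 + v ≠ x := by omega
          simp [this]
        · rw [h8.off (by omega), h7.mem, r6.tick]
          have : p.N + 1 ≠ x := by omega
          simp [this]
      · intro hb M₇ h7
        have hb : ¬ x < p.N + 1 := by
          intro hn; simp [e12, q6.NE_eval, hn] at hb
        have r7 : ReadPost p v (l.take i) M.mem M₇.mem := by rw [h7.mem]; exact r6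
        have e7 : M₇.mem 12 = x := by rw [h7.mem, e12]
        have q7 : HasPar p M₇.mem := by rw [h7.mem]; exact q6
        refine co_ite ?_ ?_
        · intro hc M₈ h8
          have hc : x = p.N + 1 := by
            by_contra hn; simp [e7, q7.NE_eval, hn] at hc
          refine co_set (x := 14) (y := 1) rfl rfl fun M₉ h9 =>
            ⟨rfl, by rw [h9.out, h8.out, h7.out, h6.out, o5],
              by rw [h9.inb, h8.inb, h7.inb, h6.inb, i5], ?_, ?_, ?_, ?_⟩
          · intro a a1 a2 a3 a4
            rw [h9.off a3, h8.mem, r7.frame a a1 a2 a3 a4]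
          · intro s hs
            have := r7.thr s hs
            unfold thr at this ⊢
            rw [h9.off (by omega), h8.mem, this]
            have : s + 1 ≠ x := by omega
            simp [this]
          · rw [h9.off (by omega), h8.mem, r7.samp]
            have : p.N + 2 + v ≠ x := by omega
            simp [this]
          · rw [h9.at, hc]; simp
        · intro hc M₈ h8
          have hc : x ≠ p.N + 1 := by
            intro hn; simp [e7, q7.NE_eval, hn] at hc
          have hxv : x = p.N + 2 + v := by omega
          refine co_set (x := 13) (y := v + 1) rfl ?_ fun M₉ h9 =>
            ⟨rfl, by rw [h9.out, h8.out, h7.out, h6.out, o5],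
              by rw [h9.inb, h8.inb, h7.inb, h6.inb, i5], ?_, ?_, ?_, ?_⟩
          · rw [eval_sub, eval_add, eval_c, h8.mem, e7, q7.NE_eval]
            change x - (p.N + 1) = v + 1
            omega
          · intro a a1 a2 a3 a4
            rw [h9.off a2, h8.mem, r7.frame a a1 a2 a3 a4]
          · intro s hs
            have := r7.thr s hs
            unfold thr at this ⊢
            rw [h9.off (by omega), h8.mem, this]
            have : s + 1 ≠ x := by omega
            simp [this]
          · rw [h9.at, hxv]; simp
          · rw [h9.off (by omega), h8.mem, r7.tick]
            have : p.N + 1 ≠ x := by omega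
            simp [this]
  · rintro ⟨M₃, g₃⟩ ⟨hg, o3, -, r3⟩
    rw [List.take_of_length_le hlen] at r3
    exact ⟨hg, o3, r3⟩

/-- The sum of the values of the samples in the window that have been hit. -/
def liveSum (p : Par) (m : Memory) : ℕ :=
  ∑ s ∈ Finset.range p.N, if thr m s = 0 ∧ m 9 < expi m s then val m s else 0

/-- The coordinator reports its current estimate. -/
structure Rep (p : Par) (m : Memory) : Prop where
  num : m 5 = Nat.size ((min (m 9) p.w) ^ p.E) * p.A * min (m 9) p.w -
    p.K * (Nat.size ((p.K + 1) ^ p.E) - Nat.size (p.K ^ p.E)) * liveSum p m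
  den : m 6 = p.E * p.A * min (m 9) p.w

theorem minE_eval {m : Memory} (hm : HasPar p m) : minE.eval m = min (m 9) p.w := by
  simp only [minE, eval_add, eval_mul, eval_sub, eval_lt, eval_c, eval_ofNat, hm.2.2.1]
  split_ifs
  · simp; omega
  · simp; omega

theorem estimateCmd_spec {σ : Type} {reply : Unit → ℕ → List ℕ → σ → PMF (List ℕ × σ)} {g : σ}
    (hm : HasPar p M.mem) :
    Sure (estimateCmd.exec reply h (M, g)) fun r => r.2 = g ∧ r.1.outbox = M.outbox ∧
      Rep p r.1.mem ∧ ∀ a, a < 5 ∨ a = 7 ∨ a = 8 ∨ a = 9 ∨ a = 10 ∨ a = 13 ∨ a = 14 ∨ a = 28 ∨ 30 ≤ a →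
        r.1.mem a = M.mem a := by
  refine sure_seq (powCmd_spec (vb := min (M.mem 9) p.w) (ve := p.E)
    (fun m' k => by rw [minE_eval (hm.congr fun a ha => k a (by omega)), k 9 (by norm_num)])
    (fun m' k => (hm.congr fun a ha => k a (by omega)).EE_eval)) ?_
  rintro M₁ g₁ ⟨hg, h1⟩; dsimp only at hg h1; subst hg
  have q1 : HasPar p M₁.mem := hm.congr fun a ha => h1.off (by omega)
  refine sure_seq (powCmd_spec (vb := p.K + 1) (ve := p.E)
    (fun m' k => by
      rw [eval_add, (q1.congr fun a ha => k a (by omega)).KE_eval, eval_ofNat])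
    (fun m' k => (q1.congr fun a ha => k a (by omega)).EE_eval)) ?_
  rintro M₂ g₂ ⟨hg, h2⟩; dsimp only at hg h2; subst hg
  have q2 : HasPar p M₂.mem := q1.congr fun a ha => h2.off (by omega)
  refine sure_seq (powCmd_spec (vb := p.K) (ve := p.E)
    (fun m' k => (q2.congr fun a ha => k a (by omega)).KE_eval)
    (fun m' k => (q2.congr fun a ha => k a (by omega)).EE_eval)) ?_
  rintro M₃ g₃ ⟨hg, h3⟩; dsimp only at hg h3; subst hg
  refine sure_seq (R' := fun r => r.2 = g₃ ∧ Wrote M₃ 26 0 r.1)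
    (co_set rfl rfl fun M' k => ⟨rfl, k⟩) ?_
  rintro M₄ g₄ ⟨hg, h4⟩; dsimp only at hg h4; subst hg
  refine sure_seq (R' := fun r => r.2 = g₄ ∧ Wrote M₄ 27 0 r.1)
    (co_set rfl rfl fun M' k => ⟨rfl, k⟩) ?_
  rintro M₅ g₅ ⟨hg, h5⟩; dsimp only at hg h5; subst hg
  have k5 : ∀ a, a ≠ 23 → a ≠ 24 → a ≠ 25 → a ≠ 26 → a ≠ 27 → M₅.mem a = M.mem a :=
    fun a a1 a2 a3 a4 a5 => by rw [h5.off a5, h4.off a4, h3.off a3, h2.off a2, h1.off a1]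
  have q5 : HasPar p M₅.mem := hm.congr fun a ha =>
    k5 a (by omega) (by omega) (by omega) (by omega) (by omega)
  have e23 : M₅.mem 23 = min (M.mem 9) p.w ^ p.E := by
    rw [h5.off (by norm_num), h4.off (by norm_num), h3.off (by norm_num), h2.off (by norm_num), h1.at]
  have e24 : M₅.mem 24 = (p.K + 1) ^ p.E := by
    rw [h5.off (by norm_num), h4.off (by norm_num), h3.off (by norm_num), h2.at]
  have e25 : M₅.mem 25 = p.K ^ p.E := by
    rw [h5.off (by norm_num), h4.off (by norm_num), h3.at]
  refine sure_seq (R' := fun r => r.2 = g₅ ∧ r.1.outbox = M.outbox ∧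
    (∀ a, a ≠ 26 → a ≠ 27 → r.1.mem a = M₅.mem a) ∧ r.1.mem 26 = liveSum p M.mem) ?_ ?_
  · refine co_loop (r := p.N) q5.NE_eval (fun i r => r.2 = g₅ ∧ r.1.outbox = M.outbox ∧
      (∀ a, a ≠ 26 → a ≠ 27 → r.1.mem a = M₅.mem a) ∧ r.1.mem 27 = i ∧
      r.1.mem 26 = ∑ s ∈ Finset.range i,
        if thr M.mem s = 0 ∧ M.mem 9 < expi M.mem s then val M.mem s else 0) ?_ ?_ ?_
    · intro M₆ h6
      refine ⟨rfl, by rw [h6.out, h5.out, h4.out, h3.out, h2.out, h1.out], fun a _ _ => by rw [h6.mem],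
        by rw [h6.mem, h5.at], ?_⟩
      rw [h6.mem, h5.off (by norm_num), h4.at]; simp
    · rintro i hi M₆ g₆ ⟨hg, o6, k6, c6, s6⟩ M₇ h7 h'
      dsimp only at hg o6 k6 c6 s6; subst hg
      have e27 : M₇.mem 27 = i := by rw [h7.mem, c6]
      have k7 : ∀ a, a ≠ 26 → a ≠ 27 → M₇.mem a = M₅.mem a := fun a a1 a2 => by
        rw [h7.mem, k6 a a1 a2]
      have kk : ∀ a, 64 ≤ a → M₇.mem a = M.mem a := fun a ha => by
        rw [k7 a (by omega) (by omega), k5 a (by omega) (by omega) (by omega) (by omega) (by omega)]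
      have e9 : M₇.mem 9 = M.mem 9 := by
        rw [k7 9 (by omega) (by omega), k5 9 (by omega) (by omega) (by omega) (by omega) (by omega)]
      have et : M₇.mem (4 * i + 65) = thr M.mem i := kk _ (by omega)
      have ee : M₇.mem (4 * i + 67) = expi M.mem i := kk _ (by omega)
      have ew : M₇.mem (4 * i + 66) = val M.mem i := kk _ (by omega)
      refine sure_seq (R' := fun r => r.2 = g₆ ∧ r.1.outbox = M.outbox ∧
        (∀ a, a ≠ 26 → a ≠ 27 → r.1.mem a = M₅.mem a) ∧ r.1.mem 27 = i ∧
        r.1.mem 26 = ∑ s ∈ Finset.range (i + 1),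
          if thr M.mem s = 0 ∧ M.mem 9 < expi M.mem s then val M.mem s else 0) ?_ ?_
      · rw [Finset.sum_range_succ, ← s6, ← h7.mem]
        have stay : ∀ M₈ : Machine, Same M₇ M₈ → ¬ (thr M.mem i = 0 ∧ M.mem 9 < expi M.mem i) →
            M₈.outbox = M.outbox ∧ (∀ a, a ≠ 26 → a ≠ 27 → M₈.mem a = M₅.mem a) ∧ M₈.mem 27 = i ∧
            M₈.mem 26 = M₇.mem 26 + if thr M.mem i = 0 ∧ M.mem 9 < expi M.mem i
              then val M.mem i else 0 := by
          intro M₈ h8 hn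
          rw [if_neg hn, h8.mem, h8.out]
          exact ⟨by rw [h7.out, o6], k7, e27, rfl⟩
        refine co_ite ?_ ?_
        · intro hb M₈ h8
          refine sure_skip ⟨rfl, stay M₈ h8 fun hc => hb ?_⟩
          simp [e27, et, hc.1]
        · intro hb M₈ h8
          have hb : thr M.mem i = 0 := by simpa [e27, et] using hb
          refine co_ite ?_ ?_
          · intro hb' M₉ h9
            have hb' : M.mem 9 < expi M.mem i := by
              by_contra hn; simp [h8.mem, e27, e9, ee, hn] at hb'
            have k9 : ∀ a, M₉.mem a = M₇.mem a := fun a => by rw [h9.mem, h8.mem]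
            refine co_set (x := 26) (y := M₇.mem 26 + val M.mem i) rfl ?_ fun M' h' =>
              ⟨rfl, by rw [h'.out, h9.out, h8.out, h7.out, o6], fun a a1 a2 => ?_, ?_, ?_⟩
            · simp [k9, e27, ew]
            · rw [h'.off a1, k9, k7 a a1 a2]
            · rw [h'.off (by norm_num), k9, e27]
            · rw [h'.at, if_pos ⟨hb, hb'⟩]
          · intro hb' M₉ h9
            refine sure_skip ⟨rfl, stay M₉ ⟨by rw [h9.mem, h8.mem], by rw [h9.inb, h8.inb],
              by rw [h9.out, h8.out]⟩ fun hc => ?_⟩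
            simp [h8.mem, e27, e9, ee, hc.2] at hb'
      · rintro M₈ g₈ ⟨hg, o8, k8, c8, s8⟩
        dsimp only at hg o8 k8 c8 s8; subst hg
        refine co_set (x := 27) (y := i + 1) rfl (by simp [c8]) fun M₉ h9 =>
          ⟨rfl, by rw [h9.out, o8], fun a a1 a2 => by rw [h9.off a2, k8 a a1 a2], h9.at,
            by rw [h9.off (by norm_num), s8]⟩
    · rintro r ⟨r1, r2, r3, -, r4⟩
      exact ⟨r1, r2, r3, r4⟩
  rintro M₆ g₆ ⟨hg, o6, k6, s6⟩; dsimp only at hg o6 k6 s6; subst hg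
  have q6 : HasPar p M₆.mem := q5.congr fun a ha => k6 a (by omega) (by omega)
  have e9 : M₆.mem 9 = M.mem 9 := by
    rw [k6 9 (by omega) (by omega), k5 9 (by omega) (by omega) (by omega) (by omega) (by omega)]
  refine sure_seq (R' := fun r => r.2 = g₆ ∧ Wrote M₆ 5 (Nat.size ((min (M.mem 9) p.w) ^ p.E) * p.A *
    min (M.mem 9) p.w - p.K * (Nat.size ((p.K + 1) ^ p.E) - Nat.size (p.K ^ p.E)) *
      liveSum p M.mem) r.1) (co_set rfl ?_ fun M' k => ⟨rfl, k⟩) ?_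
  · simp only [eval_sub, eval_mul, eval_size, eval_c, q6.AE_eval, q6.KE_eval, minE_eval q6, e9, s6,
      k6 _ (show 23 ≠ 26 by norm_num) (show 23 ≠ 27 by norm_num), e23, e24, e25,
      k6 _ (show 24 ≠ 26 by norm_num) (show 24 ≠ 27 by norm_num),
      k6 _ (show 25 ≠ 26 by norm_num) (show 25 ≠ 27 by norm_num)]
  rintro M₇ g₇ ⟨hg, h7⟩; dsimp only at hg h7; subst hg
  have q7 : HasPar p M₇.mem := q6.congr fun a ha => h7.off (by omega)
  refine co_set (x := 6) (y := p.E * p.A * min (M.mem 9) p.w) rfl ?_ fun M₈ h8 => ?_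
  · simp only [eval_mul, q7.EE_eval, q7.AE_eval, minE_eval q7]
    rw [h7.off (by norm_num), e9]
  have k8 : ∀ a, a < 5 ∨ a = 7 ∨ a = 8 ∨ a = 9 ∨ a = 10 ∨ a = 13 ∨ a = 14 ∨ a = 28 ∨ 30 ≤ a →
      M₈.mem a = M.mem a := fun a ha => by
    rw [h8.off (by omega), h7.off (by omega), k6 a (by omega) (by omega),
      k5 a (by omega) (by omega) (by omega) (by omega) (by omega)]
  have el : liveSum p M₈.mem = liveSum p M.mem := by
    unfold liveSum
    refine Finset.sum_congr rfl fun s _ => ?_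
    rw [show thr M₈.mem s = thr M.mem s from k8 _ (by omega),
      show expi M₈.mem s = expi M.mem s from k8 _ (by omega),
      show val M₈.mem s = val M.mem s from k8 _ (by omega), k8 9 (by omega)]
  refine ⟨rfl, by rw [h8.out, h7.out, o6], ⟨?_, ?_⟩, k8⟩
  · dsimp only
    rw [el, k8 9 (by omega), h8.off (by norm_num), h7.at]
  · dsimp only
    rw [k8 9 (by omega), h8.at]

end Monitoring
end

noncomputable section
open scoped ENNReal
namespace Monitoring
open Monitoring.Expr

variable {p : Par} {h : ℕ} {M : Machine} {u : Wt}

/-- The changes while the coordinator treats a report, where `d` samples are stored and `e` units of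
cost arise otherwise. -/
structure Done (p : Par) (W Lh : ℕ) (m m' : Memory) (g g' : Net p.k) (d e : ℕ) : Prop where
  cnt : m' 10 = m 10 + d
  paid : Paid p g g' (p.kk W * d + e)
  expi : ∀ R ≤ Lh, expSum p m R + (p.w + 1) * d ≤ expSum p m' R
  off : ∀ j, (g'.1 j).mem 8 = (g.1 j).mem 8

/-- The `P / T + 1` copies of a sampled item draw their thresholds independently, so their factors
multiply to a power of `fresh`. -/
theorem samples_ex (hp : p.Valid) {W T Lh v : ℕ} {pos : ℕ → ℕ} {g : Net p.k} {fu : List ℕ}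
    (hu : u.Good p Lh) (hc : CI p W T Lh pos M.mem g.1) (ho : M.outbox = [])
    (h13 : M.mem 13 = v + 1) (hv : v < p.n) (hW : 0 < W ∧ W ≤ p.w)
    {F : Machine × Net p.k → ℝ≥0∞} {Z : ℝ≥0∞}
    (hF : ∀ M' g' d, CI p W T Lh pos M'.mem g'.1 → M'.outbox = [] →
      Grown p W Lh M.mem M'.mem g g' d → F (M', g') ≤ pot p u fu M'.mem * Z) :
    Ex ((Cmd.loop (PE / (c 8 + 1) + 1) newSample).exec algo.askSite h (M, g)) F ≤
      fresh p u fu W T Lh v ^ (p.P / T + 1) * (pot p u fu M.mem * Z) := by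
  classical
  let V : ℕ → Machine × Net p.k → ℝ≥0∞ := fun i s =>
    if CI p W T Lh pos s.1.mem s.2.1 ∧ s.1.outbox = [] ∧ ∃ d, Grown p W Lh M.mem s.1.mem g s.2 d then
      fresh p u fu W T Lh v ^ (p.P / T + 1 - i) * (pot p u fu s.1.mem * Z) else ⊤
  have key := Ex_loop_le (reply := algo.askSite) (h := h) (M := M) (g := g) (F := F)
    (e := PE / (c 8 + 1) + 1) (c := newSample) V (p.P / T + 1)
    (by simp only [eval_add, eval_div, hc.par.PE_eval, eval_c, hc.length, eval_ofNat]) ?_ ?_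
  · refine key.trans_eq ?_
    simp only [V]
    rw [if_pos ⟨hc, ho, 0, rfl, by rw [mul_zero]; exact Paid.refl g, fun R _ => by simp,
      fun _ => rfl, rfl, rfl, rfl, rfl⟩]
    rfl
  · rintro ⟨M', g'⟩
    simp only [V]
    split_ifs with hs
    · obtain ⟨s1, s2, d, s3⟩ := hs
      rw [Nat.sub_self, pow_zero, one_mul]
      exact hF M' g' d s1 s2 s3
    · exact le_top
  · intro i hi M' g'
    by_cases hs : CI p W T Lh pos M'.mem g'.1 ∧ M'.outbox = [] ∧
        ∃ d, Grown p W Lh M.mem M'.mem g g' d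
    · have e1 : V i (M', g') = fresh p u fu W T Lh v * (pot p u fu M'.mem *
          (fresh p u fu W T Lh v ^ (p.P / T + 1 - (i + 1)) * Z)) := by
        simp only [V]
        rw [if_pos hs, show p.P / T + 1 - i = (p.P / T + 1 - (i + 1)) + 1 by omega, pow_succ]
        ring
      rw [e1]
      obtain ⟨s1, s2, d, s3⟩ := hs
      refine newSample_ex (M := M'.charge h (Nat.size (p.P / T + 1) + 1)) hp hu s1 s2
        (s3.cells.2.2.1.trans h13) hv hW ?_
      intro M₂ g₂ d₂ t1 t2 t3
      simp only [V]
      rw [if_pos ⟨t1, t2, d + d₂, s3.trans t3⟩]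
      exact le_of_eq (by ring)
    · have : V i (M', g') = ⊤ := if_neg hs
      rw [this]; exact le_top

theorem tickCmd_spec (hp : p.Valid) {W T Lh : ℕ} {pos : ℕ → ℕ} {g : Net p.k} (ho : M.outbox = [])
    (hW : 0 < W ∧ W ≤ p.w) (hT : 0 < T) (hc : CI p W T Lh pos M.mem g.1) :
    Sure (tickCmd.exec algo.askSite h (M, g)) fun r =>
      let sk' := p.rescale ⟨W, T, Lh + p.unit W, pos⟩
      CI p sk'.W sk'.T sk'.Lh sk'.pos r.1.mem r.2.1 ∧ KeepS M.mem r.1.mem ∧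
      Paid p g r.2 (if sk'.T = T then 0 else p.kk sk'.W * p.N) ∧
      ∀ j, (r.2.1 j).mem 8 = (g.1 j).mem 8 := by
  refine sure_seq (R' := fun r => r.2 = g ∧ Wrote M 9 (Lh + p.unit W) r.1)
    (co_set rfl ?_ fun M' k => ⟨rfl, k⟩) ?_
  · simp only [eval_add, eval_div, eval_mul, eval_eq, eval_c, eval_ofNat, hc.now, hc.scale,
      hc.par.2.1, Par.unit, show W / (2 * p.k) = p.blk W from rfl]
    by_cases h0 : p.blk W = 0
    · simp [h0]
    · rw [if_neg h0, if_neg fun hn => h0 hn.symm]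
  rintro M₁ g₁ ⟨hg, h1⟩; dsimp only at hg h1; subst hg
  have k1 : ∀ a, a ≠ 9 → M₁.mem a = M.mem a := fun a ha => h1.off ha
  have ie : ∀ s, expi M₁.mem s = expi M.mem s := fun s => k1 _ (by omega)
  have ii : ∀ s, item M₁.mem s = item M.mem s := fun s => k1 _ (by omega)
  have it : ∀ s, thr M₁.mem s = thr M.mem s := fun s => k1 _ (by omega)
  have hs := hc.slots
  refine (rescale_spec hp (sk := ⟨W, T, Lh + p.unit W, pos⟩) (by rw [h1.out, ho]) hW hT
    ⟨hc.par.congr fun a ha => k1 a (by omega), by rw [k1 7 (by omega), hc.scale],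
      by rw [k1 8 (by omega), hc.length], h1.at,
      ⟨fun s hs' => by rw [ii]; exact hs.item s hs', fun s hs' => by rw [it]; exact hs.thr s hs',
        fun s hs' => ?_, fun s hs' => by rw [ie, k1 28 (by omega)]; exact hs.drop s hs',
        fun hz s hs' => by rw [ie]; rw [k1 28 (by omega)] at hz; exact hs.pos hz s hs',
        by rw [k1 28 (by omega)]; have := hs.drop_le; dsimp only; omega⟩, hc.sites,
      fun j hj => (hc.on j hj).congr fun a ha => k1 a (by omega), hc.off⟩).mono ?_
  · rw [ie]; have := hs.expi s hs'; dsimp only; omega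
  · rintro ⟨M₂, g₂⟩ ⟨r1, -, r2, r3, r4⟩
    exact ⟨r1, fun a ha => by rw [r2 a ha, k1 a (by omega)], r3, r4⟩

/-- `B` bounds the potential after the hits have been entered. New samples come before the clock
moves, so their factor belongs to the old `W`, `T` and `Lh`; clock, rescaling and estimate leave the
potential as it is. -/
theorem digest_ex (hp : p.Valid) {W T Lh v : ℕ} {pos : ℕ → ℕ} {g : Net p.k} {fu l : List ℕ}
    (hu : u.Good p Lh) (hm : HasPar p M.mem) (hl : M.inbox = l) (hlen : l.length ≤ p.N + 2)
    (hx : ∀ x ∈ l, 0 < x ∧ (x ≤ p.N + 1 ∨ x = p.N + 2 + v)) (ho : M.outbox = [])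
    (hv : v < p.n) (hW : 0 < W ∧ W ≤ p.w) (hT : 0 < T) {B : ℝ≥0∞}
    (hR : ∀ m, ReadPost p v l M.mem m → CI p W T Lh pos m g.1 ∧ pot p u fu m ≤ B)
    {sk' : Sk} (hsk : sk' = if p.N + 1 ∈ l then p.rescale ⟨W, T, Lh + p.unit W, pos⟩
      else ⟨W, T, Lh, pos⟩)
    {F : Machine × Net p.k → ℝ≥0∞} {Z : ℝ≥0∞}
    (hF : ∀ M' g' d, CI p sk'.W sk'.T sk'.Lh sk'.pos M'.mem g'.1 → Rep p M'.mem →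
      Done p W Lh M.mem M'.mem g g' d (if sk'.T = T then 0 else p.kk sk'.W * p.N) →
      F (M', g') ≤ pot p u fu M'.mem * Z) :
    Ex (digest.exec algo.askSite h (M, g)) F ≤
      (if p.N + 2 + v ∈ l then fresh p u fu W T Lh v ^ (p.P / T + 1) else 1) * (B * Z) := by
  rw [digest, Ex_seq]
  refine Sure.ex_le (readWords_spec hm hl hlen hx) ?_
  rintro ⟨M₁, g₁⟩ ⟨hg, o1, r1⟩
  dsimp only at hg o1 r1; subst hg
  obtain ⟨c1, b1⟩ := hR _ r1
  rw [ho] at o1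
  have ie : ∀ R, expSum p M₁.mem R = expSum p M.mem R := fun R => by
    unfold expSum
    refine Finset.sum_congr rfl fun s _ => ?_
    rw [show expi M₁.mem s = expi M.mem s from r1.frame _ (by omega) (by omega) (by omega)
      fun r _ => by omega]
  have fin : ∀ M₂ (g₂ : Net p.k) d, CI p W T Lh pos M₂.mem g₂.1 → M₂.outbox = [] →
      Grown p W Lh M₁.mem M₂.mem g₁ g₂ d →
      Ex ((Cmd.seq (.ite (c 14) tickCmd .skip) estimateCmd).exec algo.askSite h (M₂, g₂)) F ≤
        pot p u fu M₂.mem * Z := by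
    intro M₂ g₂ d c2 o2 w2
    have est : ∀ M₃ (g₃ : Net p.k), CI p sk'.W sk'.T sk'.Lh sk'.pos M₃.mem g₃.1 →
        KeepS M₂.mem M₃.mem → Paid p g₂ g₃ (if sk'.T = T then 0 else p.kk sk'.W * p.N) →
        (∀ j, (g₃.1 j).mem 8 = (g₂.1 j).mem 8) →
        Ex (estimateCmd.exec algo.askSite h (M₃, g₃)) F ≤ pot p u fu M₂.mem * Z := by
      intro M₃ g₃ c3 k3 p3 n3
      refine Sure.ex_le (estimateCmd_spec c3.par) ?_
      rintro ⟨M₄, g₄⟩ ⟨hg, o4, rep, k4⟩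
      dsimp only at hg o4 rep k4; subst hg
      refine (hF M₄ g₄ d (c3.congr fun a ha => k4 a (by omega)) rep ⟨?_, ?_, ?_, ?_⟩).trans ?_
      · rw [k4 10 (by omega), k3 10 (by omega), w2.cnt, r1.frame 10 (by omega) (by omega) (by omega)
          fun r _ => by omega]
      · exact w2.paid.trans p3
      · intro R hR'
        rw [← ie]
        refine (w2.expi R hR').trans_eq ?_
        unfold expSum
        refine Finset.sum_congr rfl fun s _ => ?_
        rw [show expi M₄.mem s = expi M₃.mem s from k4 _ (by omega),
          show expi M₃.mem s = expi M₂.mem s from k3 _ (by omega)]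
      · intro j; rw [n3, w2.off]
      · rw [pot_congr fun a ha => k4 a (by omega), pot_congr fun a ha => k3 a (by omega)]
    rw [Ex_seq]
    have e14 : (c 14).eval M₂.mem = if p.N + 1 ∈ l then 1 else 0 := by
      rw [eval_c, w2.cells.2.2.2, r1.tick]
    refine ex_co_ite ?_ ?_
    · intro hb M₃ h3
      rw [e14] at hb
      have hb : p.N + 1 ∈ l := by by_contra hn; simp [hn] at hb
      rw [if_pos hb] at hsk
      refine Sure.ex_le (tickCmd_spec hp (by rw [h3.out, o2]) hW hT
        (c2.congr (m' := M₃.mem) fun a _ => by rw [h3.mem])) ?_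
      rintro ⟨M₄, g₄⟩ ⟨t1, t2, t3, t4⟩
      rw [← hsk] at t1 t3
      exact est M₄ g₄ t1 (fun a ha => by rw [t2 a ha, h3.mem]) t3 t4
    · intro hb M₃ h3
      rw [e14] at hb
      have hb : p.N + 1 ∉ l := by intro hn; simp [hn] at hb
      rw [if_neg hb] at hsk
      rw [Ex_skip]
      refine est M₃ g₂ ?_ (fun a ha => by rw [h3.mem]) ?_ fun _ => rfl
      · rw [hsk, h3.mem]; exact c2
      · rw [hsk, if_pos rfl]; exact Paid.refl _
  have e13 : (c 13).eval M₁.mem = if p.N + 2 + v ∈ l then v + 1 else 0 := by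
    rw [eval_c, r1.samp]
  rw [Ex_seq]
  refine ex_co_ite ?_ ?_
  · intro hb M₂ h2
    rw [e13] at hb
    have hb : p.N + 2 + v ∈ l := by by_contra hn; simp [hn] at hb
    rw [if_pos hb]
    refine (samples_ex (M := M₂) (Z := Z) (fu := fu) (v := v) hp hu (by rw [h2.mem]; exact c1)
      (by rw [h2.out, o1]) (by rw [h2.mem, ← eval_c, e13, if_pos hb]) hv hW ?_).trans ?_
    · intro M' g' d t1 t2 t3
      rw [h2.mem] at t3
      exact fin M' g' d t1 t2 t3
    · rw [h2.mem]; gcongr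
  · intro hb M₂ h2
    rw [e13] at hb
    have hb : p.N + 2 + v ∉ l := by intro hn; simp [hn] at hb
    rw [if_neg hb, Ex_skip, one_mul]
    refine (fin M₂ g₁ 0 (by rw [h2.mem]; exact c1) (by rw [h2.out, o1]) ⟨by rw [h2.mem]; rfl,
      by rw [mul_zero]; exact Paid.refl _, fun R _ => by rw [h2.mem]; simp, fun _ => rfl,
      by rw [h2.mem], by rw [h2.mem], by rw [h2.mem], by rw [h2.mem]⟩).trans ?_
    rw [h2.mem]; gcongr

end Monitoring
end

/-! ### One arrival: potential, credits and time. -/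

noncomputable section
open scoped ENNReal
namespace Monitoring
open Monitoring.Expr

variable {p : Par} {h : ℕ} {M : Machine} {u : Wt}

/-! ### What a site has done on an arrival -/

section proc
variable {ms : Memory} {v x : ℕ}

/-- Hits use the words `1, …, N`, a completed block `N + 1`, a sample `N + 2 + v`; as these do not
overlap, the report can be decoded. -/
theorem ProcPost.mem_hit (h : ProcPost p ms v x M) {s : ℕ} (hs : s < p.N) :
    s + 1 ∈ M.outbox ↔ M.mem (2 * s + 17) ≠ ms (2 * s + 17) := by
  rw [h.out]
  simp only [List.mem_append, List.mem_map, List.mem_filter, List.mem_range, decide_eq_true_eq]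
  constructor
  · rintro ((⟨r, ⟨-, hr⟩, hrs⟩ | h1) | h1)
    · obtain rfl : r = s := by omega
      exact hr
    · split_ifs at h1
      · simp at h1; omega
      · simp at h1
    · split_ifs at h1
      · simp at h1
      · simp at h1; omega
  · exact fun hr => Or.inl (Or.inl ⟨s, ⟨hs, hr⟩, rfl⟩)

theorem ProcPost.mem_sample (h : ProcPost p ms v x M) :
    p.N + 2 + v ∈ M.outbox ↔ x = ms 7 := by
  rw [h.out]
  simp only [List.mem_append, List.mem_map, List.mem_filter, List.mem_range, decide_eq_true_eq]
  constructor
  · rintro ((⟨r, ⟨h1, -⟩, hrs⟩ | h1) | h1)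
    · omega
    · split_ifs at h1 with hc
      · exact hc
      · simp at h1
    · split_ifs at h1
      · simp at h1
      · simp at h1; omega
  · intro hc
    left; right
    simp [hc]

theorem ProcPost.mem_tick (h : ProcPost p ms v x M) :
    p.N + 1 ∈ M.outbox ↔ ¬ ms 7 + 1 < (ms 6 + 1) / (2 * p.k) := by
  rw [h.out]
  simp only [List.mem_append, List.mem_map, List.mem_filter, List.mem_range, decide_eq_true_eq]
  constructor
  · rintro ((⟨r, ⟨h1, -⟩, hrs⟩ | h1) | h1)
    · omega
    · split_ifs at h1
      · simp at h1; omega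
      · simp at h1
    · split_ifs at h1 with hc
      · simp at h1
      · exact hc
  · intro hc
    right
    simp [hc]

theorem ProcPost.words (h : ProcPost p ms v x M) :
    ∀ y ∈ M.outbox, 0 < y ∧ (y ≤ p.N + 1 ∨ y = p.N + 2 + v) := by
  rw [h.out]
  simp only [List.mem_append, List.mem_map, List.mem_filter, List.mem_range, decide_eq_true_eq]
  rintro y ((⟨r, ⟨h1, -⟩, hrs⟩ | h1) | h1)
  · omega
  · split_ifs at h1
    · simp at h1; omega
    · simp at h1
  · split_ifs at h1
    · simp at h1
    · simp at h1; omega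

/-- A hit spends the credit of the threshold that it sets to zero, and a sample spends the credit
that a block has while its sample lies ahead. A completed block costs two: its own word, and the
credit of the next block. -/
theorem ProcPost.credit (h : ProcPost p ms v x M) (hx : ms 7 ≠ 0 → x = ms 8) :
    M.outbox.length + credit p M.mem ≤
      credit p ms + 2 * if ms 7 + 1 < (ms 6 + 1) / (2 * p.k) then 0 else 1 := by
  set A := (Finset.range p.N).filter fun s => M.mem (2 * s + 17) ≠ ms (2 * s + 17)
  set C := (Finset.range p.N).filter fun s => M.mem (2 * s + 17) ≠ 0
  set D := (Finset.range p.N).filter fun s => ms (2 * s + 17) ≠ 0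
  -- Thresholds that were hit now and those still positive are disjoint sets of formerly positive
  -- ones.
  have h1 : A.card + C.card ≤ D.card := by
    rw [← Finset.card_union_of_disjoint]
    · refine Finset.card_le_card fun s hs => ?_
      rw [Finset.mem_union, Finset.mem_filter, Finset.mem_filter] at hs
      rw [Finset.mem_filter]
      rcases hs with hs | hs
      · have := (h.hit s (Finset.mem_range.1 hs.1) hs.2).1
        exact ⟨hs.1, fun h0 => hs.2 (by rw [this, h0])⟩
      · refine ⟨hs.1, fun h0 => ?_⟩
        by_cases hc : M.mem (2 * s + 17) = ms (2 * s + 17)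
        · exact hs.2 (hc.trans h0)
        · exact hs.2 (h.hit s (Finset.mem_range.1 hs.1) hc).1
    · rw [Finset.disjoint_left]
      intro s hs hs'
      rw [Finset.mem_filter] at hs hs'
      exact hs'.2 (h.hit s (Finset.mem_range.1 hs.1) hs.2).1
  have h2 : ((List.range p.N).filter fun s =>
      decide (M.mem (2 * s + 17) ≠ ms (2 * s + 17))).length = A.card := by
    rw [← List.toFinset_card_of_nodup (List.nodup_range.filter _)]
    congr 1
    ext s; simp [A]
  have h3 : M.outbox.length = A.card + (if x = ms 7 then 1 else 0) +
      (if ms 7 + 1 < (ms 6 + 1) / (2 * p.k) then 0 else 1) := by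
    rw [h.out, List.length_append, List.length_append, List.length_map, h2]
    split_ifs <;> rfl
  rw [h3]
  unfold Monitoring.credit
  have e8 := h.off
  have e7 := h.pos
  change A.card + _ + _ + (C.card + _) ≤ D.card + _ + _
  rw [e7, e8]
  by_cases c1 : ms 7 + 1 < (ms 6 + 1) / (2 * p.k)
  · simp only [if_pos c1, Nat.succ_ne_zero]
    by_cases c2 : ms 7 = 0
    · rw [if_pos (Or.inl c2)]
      simp only [false_or]
      split_ifs <;> omega
    · have := hx c2
      simp only [false_or]
      split_ifs <;> omega
  · simp only [if_neg c1]
    split_ifs <;> omega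

end proc

/-- At the coordinator a reported slot gets threshold `0`, at which `sf` is the weight of a hit
whatever the future. So the new potential is the product of the weights realised at the site. -/
theorem CI.after {W T Lh v x : ℕ} {pos : ℕ → ℕ} {m m₁ : Memory} {f : Fin p.k → Machine} {j : Fin p.k}
    (hc : CI p W T Lh pos m f) (hj : (j : ℕ) < p.kk W) (hM : ProcPost p (f j).mem v x M)
    {M' : Machine} (hM' : M'.mem = M.mem) (hi : Idle p M'.time M')
    (hfr : ∀ a, (a < 10 ∧ a ≠ 5 ∧ a ≠ 6 ∨ a = 28 ∨ 64 ≤ a) → (∀ s < p.N, a ≠ 4 * s + 65) →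
      m₁ a = m a)
    (hthr : ∀ s < p.N, thr m₁ s = if s + 1 ∈ M.outbox then 0 else thr m s) :
    CI p W T Lh (Function.update pos j (if pos j + 1 < p.blk W then pos j + 1 else 0)) m₁
      (Function.update f j M') ∧
    ∀ fu, pot p u fu m₁ = (∏ s ∈ Finset.range p.N,
      if M.mem (2 * s + 17) ≠ (f j).mem (2 * s + 17) then u.χ₁ (val m s) (expi m s)
        else slotPot p u fu m s) * u.ϰ (m 28) := by
  have ie : ∀ s, expi m₁ s = expi m s := fun s => hfr _ (by omega) fun _ _ => by omega
  have ii : ∀ s, item m₁ s = item m s := fun s => hfr _ (by omega) fun _ _ => by omega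
  have iv : ∀ s, val m₁ s = val m s := fun s => hfr _ (by omega) fun _ _ => by omega
  have e28 : m₁ 28 = m 28 := hfr _ (by omega) fun _ _ => by omega
  have on := hc.on j hj
  have hs := hc.slots
  constructor
  · refine ⟨hc.par.congr fun a ha => ?_, ?_, ?_, ?_, ?_, ⟨fun i => ?_, fun i => ?_⟩, fun i hi' => ?_,
      fun i hi' => ?_⟩
    · exact hfr a (by omega) fun _ _ => by omega
    · rw [hfr 7 (by omega) fun _ _ => by omega, hc.scale]
    · rw [hfr 8 (by omega) fun _ _ => by omega, hc.length]
    · rw [hfr 9 (by omega) fun _ _ => by omega, hc.now]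
    · exact ⟨fun s hs' => by rw [ii]; exact hs.item s hs',
        fun s hs' => by rw [hthr s hs']; split; exacts [Nat.zero_le _, hs.thr s hs'],
        fun s hs' => by rw [ie]; exact hs.expi s hs',
        fun s hs' => by rw [ie, e28]; exact hs.drop s hs',
        fun hz s hs' => by rw [ie]; rw [e28] at hz; exact hs.pos hz s hs',
        by rw [e28]; exact hs.drop_le⟩
    · by_cases hij : i = j
      · subst hij; rw [Function.update_self]; exact hi
      · rw [Function.update_of_ne hij]; exact hc.sites.idle i
    · by_cases hij : i = j
      · subst hij; rw [Function.update_self, hM']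
        exact (hc.sites.par i).congr fun a ha => hM.frame a (by omega) (by omega) (by omega)
          (by omega) (by omega) fun _ _ => by omega
      · rw [Function.update_of_ne hij]; exact hc.sites.par i
    · by_cases hij : i = j
      · subst hij; rw [Function.update_self, Function.update_self, hM']
        refine ⟨?_, ?_, fun s hs' => ?_, fun s hs' => ?_, fun s hs' => ?_⟩
        · rw [hM.frame 6 (by omega) (by omega) (by omega) (by omega) (by omega) fun _ _ => by omega,
            on.scale]
        · rw [hM.pos, on.pos, on.scale]; rfl
        · rw [hM.frame _ (by omega) (by omega) (by omega) (by omega) (by omega) fun _ _ => by omega,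
            on.item s hs', ii]
        · simp only [hthr s hs', hM.mem_hit hs']
          by_cases hcc : M.mem (2 * s + 17) = (f i).mem (2 * s + 17)
          · rw [if_neg (not_not.2 hcc), hcc]; exact on.thr s hs'
          · rw [if_pos hcc]; exact Or.inr rfl
        · by_cases hcc : M.mem (2 * s + 17) = (f i).mem (2 * s + 17)
          · rw [hcc]; exact on.thr_le s hs'
          · rw [(hM.hit s hs' hcc).1]; exact Nat.zero_le _
      · rw [Function.update_of_ne hij, Function.update_of_ne fun hcc => hij (Fin.ext hcc)]
        have on' := hc.on i hi'
        refine ⟨on'.scale, on'.pos, fun s hs' => by rw [on'.item s hs', ii], fun s hs' => ?_,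
          on'.thr_le⟩
        rw [hthr s hs']
        split_ifs
        · exact Or.inr rfl
        · exact on'.thr s hs'
    · rw [Function.update_of_ne fun hcc => by subst hcc; omega]
      exact hc.off i hi'
  · intro fu
    unfold pot
    rw [e28]
    congr 1
    refine Finset.prod_congr rfl fun s hs' => ?_
    rw [Finset.mem_range] at hs'
    unfold slotPot
    simp only [ie, iv, ii, hthr s hs', hM.mem_hit hs']
    by_cases hcc : M.mem (2 * s + 17) = (f j).mem (2 * s + 17)
    · rw [if_neg (not_not.2 hcc), if_neg (not_not.2 hcc)]
    · rw [if_pos hcc, if_pos hcc, sf_zero]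

/-- The average over the hits at a synchronized site. -/
theorem prod_mix {W x v : ℕ} {m ms : Memory} (hs : Synced p W x m ms) (fu : List ℕ) :
    (∏ s ∈ Finset.range p.N, mix p ms v (fun s => u.χ₁ (val m s) (expi m s)) (slotPot p u fu m) s) *
      u.ϰ (m 28) = pot p u (v :: fu) m := by
  unfold pot
  congr 1
  refine Finset.prod_congr rfl fun s hs' => ?_
  rw [Finset.mem_range] at hs'
  have e : mix p ms v (fun s => u.χ₁ (val m s) (expi m s)) (slotPot p u fu m) s =
      if ms (2 * s + 16) = v then mix2 p.dd (ms (2 * s + 17)) (u.χ₁ (val m s) (expi m s))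
        (slotPot p u fu m s) else slotPot p u fu m s := rfl
  rw [e, hs.item s hs']
  unfold slotPot
  rw [sf]
  -- If the coordinator already counts the slot as hit, both outcomes have the weight of a hit, and
  -- the stale threshold at the site is irrelevant.
  rcases hs.thr s hs' with h1 | h1
  · rw [h1]
  · rw [h1, sf_zero, mix2_self (hs.thr_le s hs'), mix2_self (Nat.zero_le _)]

/-! ### The system -/

/-- The positions of the samples in the blocks of the sites. -/
def offs (S : System p.k) (j : ℕ) : ℕ := if hj : j < p.k then (S.sites ⟨j, hj⟩).mem 8 else 0

/-- Expected value of the product of the factors of the future samples. -/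
def Qf (p : Par) (u : Wt) : List (ℕ × ℕ) → Sk → (ℕ → ℕ) → ℝ≥0∞
  | [], _, _ => 1
  | (i, v) :: fu, sk, o =>
    let ψ : ℕ → ℝ≥0∞ := fun x => (if x = sk.pos (p.proc sk i) then
      fresh p u (fu.map Prod.snd) sk.W sk.T sk.Lh v ^ (p.P / sk.T + 1) else 1) *
        Qf p u fu (p.step sk i) (Function.update o (p.proc sk i) x)
    if sk.pos (p.proc sk i) = 0 then
      (∑ x ∈ Finset.range (2 ^ (Nat.size sk.W - 1)), ψ x) / 2 ^ (Nat.size sk.W - 1)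
    else ψ (o (p.proc sk i))

structure Inv (p : Par) (sk : Sk) (S : System p.k) : Prop where
  ci : CI p sk.W sk.T sk.Lh sk.pos S.coord.mem S.sites
  rep : 0 < sk.Lh → Rep p S.coord.mem

structure SkOk (p : Par) (sk : Sk) : Prop where
  scale : 0 < sk.W ∧ sk.W ≤ p.w
  length : 0 < sk.T
  pos : ∀ j, sk.pos j = 0 ∨ sk.pos j < p.blk sk.W

/-- The cost of resynchronization. -/
def resync (p : Par) (sk sk' : Sk) : ℕ := if sk'.T = sk.T then 0 else p.kk sk'.W * p.N

/-- The effect of an arrival at site `i`, where `d` samples are stored and `x` bits are sent. -/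
structure StepRel (p : Par) (sk : Sk) (i : ℕ) (S S' : System p.k) (d x : ℕ) : Prop where
  log : S'.bitLog = x :: S.bitLog
  cnt : S'.coord.mem 10 = S.coord.mem 10 + d
  bits : x + 20 * p.β * netCredit p S'.sites ≤ 20 * p.β * netCredit p S.sites +
    60 * p.β * (p.kk sk.W * d + resync p sk (p.step sk i) + if p.Ends sk i then 1 else 0)
  time : netTime S'.sites ≤ netTime S.sites + (7 * p.N + 60) * (κ * p.β) +
    20 * (κ * p.β) * (p.kk sk.W * d + resync p sk (p.step sk i))
  expi : ∀ R ≤ sk.Lh, expSum p S.coord.mem R + (p.w + 1) * d ≤ expSum p S'.coord.mem R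

theorem sum_update {k : ℕ} (f : Fin k → Machine) (φ : Machine → ℕ) (j : Fin k) (M : Machine) :
    ∑ i, φ (Function.update f j M i) + φ (f j) = ∑ i, φ (f i) + φ M := by
  rw [← Finset.add_sum_erase _ _ (Finset.mem_univ j),
    ← Finset.add_sum_erase _ (fun i => φ (f i)) (Finset.mem_univ j), Function.update_self]
  rw [Finset.sum_congr rfl fun i hi => by rw [Function.update_of_ne (Finset.ne_of_mem_erase hi)]]
  omega

theorem netCredit_update (f : Fin p.k → Machine) (j : Fin p.k) (M : Machine) :
    netCredit p (Function.update f j M) + credit p (f j).mem = netCredit p f + credit p M.mem :=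
  sum_update f (fun M => credit p M.mem) j M

theorem netTime_update {k : ℕ} (f : Fin k → Machine) (j : Fin k) (M : Machine) :
    netTime (Function.update f j M) + (f j).time = netTime f + M.time :=
  sum_update f Machine.time j M

end Monitoring
end

noncomputable section
open scoped ENNReal
namespace Monitoring
open Monitoring.Expr

variable {p : Par} {h : ℕ} {M : Machine} {u : Wt}

/-! ### One arrival -/

theorem kk_of_blk_ne {W : ℕ} (h : p.blk W ≠ 0) : p.kk W = p.k :=
  if_pos (Nat.pos_of_ne_zero h)

theorem kk_of_blk_eq {W : ℕ} (h : p.blk W = 0) : p.kk W = 1 :=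
  if_neg fun hc => hc.ne' h

theorem Par.proc_lt (sk : Sk) (i : Fin p.k) : p.proc sk i < p.kk sk.W := by
  unfold Par.proc
  split_ifs with h
  · rw [kk_of_blk_eq h]; norm_num
  · rw [kk_of_blk_ne h]; exact i.2

theorem digest_after_ex (hp : p.Valid) {sk : Sk} (hu : u.Good p sk.Lh) (hsk : SkOk p sk) {i : ℕ}
    {f : Fin p.k → Machine} {m : Memory} (hI : CI p sk.W sk.T sk.Lh sk.pos m f)
    {j : Fin p.k} (hj : (j : ℕ) = p.proc sk i) (hjk : (j : ℕ) < p.kk sk.W) {v x b : ℕ}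
    (hv : v < p.n) {Mp M' : Machine} (hM : ProcPost p (f j).mem v x Mp) (hM' : M'.mem = Mp.mem)
    (hi : Idle p M'.time M') (hlen : Mp.outbox.length ≤ p.N + 2)
    (hm : ∀ a, a ≠ 11 → a ≠ 12 → M.mem a = m a) (hin : M.inbox = Mp.outbox) (ho : M.outbox = [])
    {fu : List ℕ} {F : Machine × Net p.k → ℝ≥0∞} {Z : ℝ≥0∞}
    (hF : ∀ M₁ g d, CI p (p.step sk i).W (p.step sk i).T (p.step sk i).Lh (p.step sk i).pos
      M₁.mem g.1 → Rep p M₁.mem →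
      Done p sk.W sk.Lh m M₁.mem (Function.update f j M', b) g d (resync p sk (p.step sk i)) →
      F (M₁, g) ≤ pot p u fu M₁.mem * Z) :
    Ex (digest.exec algo.askSite h (M, (Function.update f j M', b))) F ≤
      (∏ s ∈ Finset.range p.N, if Mp.mem (2 * s + 17) ≠ (f j).mem (2 * s + 17) then
        u.χ₁ (val m s) (expi m s) else slotPot p u fu m s) * (u.ϰ (m 28) *
      ((if x = sk.pos (p.proc sk i) then fresh p u fu sk.W sk.T sk.Lh v ^ (p.P / sk.T + 1) else 1) *
        Z)) := by
  have on := hI.on j hjk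
  have eb : (sk.W) / (2 * p.k) = p.blk sk.W := rfl
  have etick : p.N + 1 ∈ Mp.outbox ↔ p.Ends sk i := by
    rw [hM.mem_tick, on.pos, on.scale, hj]; rfl
  have esam : p.N + 2 + v ∈ Mp.outbox ↔ x = sk.pos (p.proc sk i) := by
    rw [hM.mem_sample, on.pos, hj]
  have after : ∀ m₁, ReadPost p v Mp.outbox M.mem m₁ → _ := fun m₁ r1 =>
    hI.after (m₁ := m₁) (u := u) hjk hM hM' hi (fun a ha ha' => by
      rw [r1.frame a (by omega) (by omega) (by omega) ha', hm a (by omega) (by omega)])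
      (fun s hs => by rw [r1.thr s hs]; congr 1; exact hm _ (by omega) (by omega))
  have hstep : p.step sk i = if p.N + 1 ∈ Mp.outbox then
      p.rescale ⟨sk.W, sk.T, sk.Lh + p.unit sk.W, Function.update sk.pos j
        (if sk.pos j + 1 < p.blk sk.W then sk.pos j + 1 else 0)⟩
      else ⟨sk.W, sk.T, sk.Lh, Function.update sk.pos j
        (if sk.pos j + 1 < p.blk sk.W then sk.pos j + 1 else 0)⟩ := by
    unfold Par.step
    by_cases hE : p.Ends sk i
    · rw [if_pos hE, if_pos (etick.2 hE), hj, if_neg hE]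
    · rw [if_neg hE, if_neg (fun hc => hE (etick.1 hc)), hj, if_pos (not_not.1 hE)]
  have key := digest_ex (M := M) (h := h) (Z := Z) (F := F) hp hu
    (hI.par.congr fun a ha => hm a (by omega) (by omega)) hin hlen hM.words ho hv hsk.scale hsk.length
    (W := sk.W) (T := sk.T) (fu := fu) (g := (Function.update f j M', b))
    (fun m₁ r1 => ⟨(after m₁ r1).1, ((after m₁ r1).2 fu).le⟩) hstep ?_
  · refine key.trans_eq ?_
    simp only [esam]
    ring
  · intro M₁ g d t1 t2 t3
    refine hF M₁ g d t1 t2 ⟨?_, t3.paid, fun R hR => ?_, t3.off⟩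
    · rw [t3.cnt, hm 10 (by omega) (by omega)]
    · refine (t3.expi R hR).trans_eq' ?_
      congr 1
      unfold expSum
      refine Finset.sum_congr rfl fun s _ => ?_
      rw [show expi M.mem s = expi m s from hm _ (by omega) (by omega)]

theorem Inv.ready (hp : p.Valid) {sk : Sk} (hsk : SkOk p sk) {m : Memory} {f : Fin p.k → Machine}
    (hI : CI p sk.W sk.T sk.Lh sk.pos m f) {j : Fin p.k} (hj : (j : ℕ) < p.kk sk.W) :
    Ready p (f j).mem := by
  have on := hI.on j hj
  have hw := Nat.lt_size_self p.w
  have h1 : 2 ^ Nat.size p.w ≤ 2 ^ p.lg := Nat.pow_le_pow_right (by norm_num) hp.size_le_lg.2.2.1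
  have h2 : sk.pos j ≤ sk.W := by
    rcases hsk.pos j with h | h
    · omega
    · exact h.le.trans (Nat.div_le_self _ _)
  have h3 := hsk.scale.2
  refine ⟨hI.sites.par j, on.thr_le, ?_, ?_⟩
  · rw [on.scale, Nat.size_le, pow_succ]; omega
  · rw [on.pos, Nat.size_le, pow_succ]; omega

theorem ex_co_ask {σ : Type} {reply : Unit → ℕ → List ℕ → σ → PMF (List ℕ × σ)} {g : σ} {d : Expr}
    {y : ℕ} {l : List ℕ} (hd : d.eval M.mem = y) (hl : M.outbox = l) {F : Machine × σ → ℝ≥0∞}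
    {B : ℝ≥0∞} (hF : ∀ M₁ : List ℕ → Machine, (∀ l, (M₁ l).mem = M.mem ∧ (M₁ l).inbox = l ∧
      (M₁ l).outbox = []) → Ex (reply () y l g) (fun r => F (M₁ r.1, r.2)) ≤ B) :
    Ex ((Cmd.ask () d).exec reply h (M, g)) F ≤ B := by
  rw [Ex_ask, hd, hl]
  exact hF (fun r => { M.charge h (d.cost M.mem + msgBits l + msgBits r) with
    inbox := r, outbox := [] }) fun _ => ⟨rfl, rfl, rfl⟩

theorem CI.site {W T Lh : ℕ} {pos : ℕ → ℕ} {m : Memory} {f : Fin p.k → Machine}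
    (hI : CI p W T Lh pos m f) {i : Fin p.k} (hM : ∀ a, a ≠ 9 → M.mem a = (f i).mem a)
    (hi : Idle p M.time M) : CI p W T Lh pos m (Function.update f i M) := by
  refine ⟨hI.par, hI.scale, hI.length, hI.now, hI.slots, ⟨fun j => ?_, fun j => ?_⟩, fun j hj => ?_,
    fun j hj => ?_⟩
  all_goals
    by_cases hij : j = i
    swap
    · rw [Function.update_of_ne hij]
      first
        | exact hI.sites.idle j
        | exact hI.sites.par j
        | exact hI.on j hj
        | exact hI.off j hj
    subst hij
    rw [Function.update_self]
  · exact hi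
  · exact (hI.sites.par j).congr fun a ha => hM a (by omega)
  · obtain ⟨h1, h2, h3, h4, h5⟩ := hI.on j hj
    refine ⟨by rw [hM 6 (by omega), h1], by rw [hM 7 (by omega), h2], fun s hs => ?_, fun s hs => ?_,
      fun s hs => ?_⟩
    · rw [hM _ (by omega), h3 s hs]
    · rw [hM _ (by omega)]; exact h4 s hs
    · rw [hM _ (by omega)]; exact h5 s hs
  · rw [hM 6 (by omega)]; exact hI.off j hj

theorem offs_update {S S' : System p.k} {j : Fin p.k} {M' : Machine} {x : ℕ} (hx : M'.mem 8 = x)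
    (h : ∀ i, (S'.sites i).mem 8 = (Function.update S.sites j M' i).mem 8) :
    offs S' = Function.update (offs S) j x := by
  funext i
  unfold offs
  by_cases hi : i < p.k
  · rw [dif_pos hi, h]
    by_cases hij : i = j
    · subst hij; simp [hx]
    · rw [Function.update_of_ne hij, Function.update_of_ne fun hc => hij (by rw [← hc]), dif_pos hi]
  · rw [dif_neg hi, Function.update_of_ne fun hc => hi (by rw [hc]; exact j.2), dif_neg hi]

/-- With these weights for hits, misses and offsets, the average over the random choices of the site
is exactly the potential before the arrival times `Qf`. -/
theorem arrivalBound_eq {sk : Sk} {m : Memory} {f : Fin p.k → Machine}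
    (hI : CI p sk.W sk.T sk.Lh sk.pos m f) {i : ℕ} {j : Fin p.k} (hj : (j : ℕ) = p.proc sk i)
    (hjk : (j : ℕ) < p.kk sk.W) {v : ℕ} (fu : List (ℕ × ℕ)) (o : ℕ → ℕ)
    (ho : (f j).mem 8 = o (p.proc sk i)) :
    arrivalBound p (f j).mem v (fun s => u.χ₁ (val m s) (expi m s)) (slotPot p u (fu.map Prod.snd) m)
      (fun x => u.ϰ (m 28) * ((if x = sk.pos (p.proc sk i) then
        fresh p u (fu.map Prod.snd) sk.W sk.T sk.Lh v ^ (p.P / sk.T + 1) else 1) *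
          Qf p u fu (p.step sk i) (Function.update o (p.proc sk i) x))) =
      pot p u (v :: fu.map Prod.snd) m * Qf p u ((i, v) :: fu) sk o := by
  have on := hI.on j hjk
  rw [← prod_mix on, Qf, arrivalBound, on.pos, on.scale, hj, mul_assoc]
  congr 1
  by_cases h0 : sk.pos (p.proc sk i) = 0
  · rw [if_pos h0, if_pos h0, ← Finset.mul_sum, mul_div_assoc]
  · rw [if_neg h0, if_neg h0, ho]

/-- The phase `W < 2k`: site 0 treats every item. Forwarding and the request cost `O(β)` bits, which
the cost unit of the completed block covers. -/
theorem arrive_ex_forward (hp : p.Valid) {sk : Sk} (hu : u.Good p sk.Lh) (hsk : SkOk p sk) {S : System p.k}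
    (hI : Inv p sk S) (hB : p.blk sk.W = 0) (i : Fin p.k) (v : Fin p.n) (fu : List (ℕ × ℕ))
    {F : System p.k → ℝ≥0∞}
    (hF : ∀ S' d x, Inv p (p.step sk i) S' → StepRel p sk i S S' d x →
      F S' ≤ pot p u (fu.map Prod.snd) S'.coord.mem * Qf p u fu (p.step sk i) (offs S')) :
    Ex (algo.arrive S (i, v)) F ≤ pot p u ((v : ℕ) :: fu.map Prod.snd) S.coord.mem *
      Qf p u ((i, v) :: fu) sk (offs S) := by
  have hβ := hp.β_pos
  have hkk := p.proc_lt sk i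
  have hci := hI.ci
  obtain ⟨j, hj⟩ : ∃ j : Fin p.k, (j : ℕ) = p.proc sk i := ⟨⟨p.proc sk i, hkk.trans_le (p.kk_le hp _)⟩, rfl⟩
  have hjk : (j : ℕ) < p.kk sk.W := by rw [hj]; exact hkk
  have hoj : (S.sites j).mem 8 = offs S (p.proc sk i) := by
    unfold offs; rw [← hj, dif_pos j.2]
  rw [Algorithm.arrive, Ex_bind]
  have ei : (((S.sites i).mem 6) + 1) / (2 * p.k) = 0 := by
    rcases lt_or_ge (i : ℕ) (p.kk sk.W) with hi | hi
    · rw [(hci.on i hi).scale]; exact hB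
    · rw [hci.off i hi, Nat.div_eq_of_lt]; have := hp.k; omega
  refine Sure.ex_le (runSite_forward hp (hci.sites.idle i) (hci.sites.par i) v.2 ei) ?_
  rintro ⟨l, Mi⟩ ⟨hl, kMi, iMi⟩
  dsimp only at hl kMi iMi
  subst hl
  simp only [List.cons_ne_nil, if_false, Ex_map]
  have hci' := hci.site kMi iMi.self
  set f := Function.update S.sites i Mi with hf
  have f8 : ∀ r, (f r).mem 8 = (S.sites r).mem 8 := fun r => by
    by_cases hr : r = i
    · subst hr; rw [hf, Function.update_self, kMi 8 (by omega)]
    · rw [hf, Function.update_of_ne hr]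
  have fcr : ∀ r, credit p (f r).mem = credit p (S.sites r).mem := fun r => by
    by_cases hr : r = i
    · subst hr; rw [hf, Function.update_self]
      unfold credit
      rw [kMi 8 (by omega), kMi 7 (by omega)]
      congr 2
      refine Finset.filter_congr fun s _ => by rw [kMi _ (by omega)]
    · rw [hf, Function.update_of_ne hr]
  have hj0 : (j : ℕ) = 0 := by rw [hj, Par.proc, if_pos hB]
  rw [algo]
  dsimp only
  rw [coordCmd, Ex_seq]
  rw [← arrivalBound_eq hci' hj hjk fu (offs S) (by rw [f8, hoj])]
  refine Sure.ex_le (co_recv (M := { S.coord with inbox := [(i : ℕ), (v : ℕ)], outbox := [] }) (x := 11) rfl (R := fun r => r.2 = (f, msgBits [(v : ℕ)]) ∧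
    r.1.mem = S.coord.mem.update 11 i ∧ r.1.inbox = [(v : ℕ)] ∧ r.1.outbox = [])
    fun M' h1 h2 h3 => ⟨rfl, h1, h2, h3⟩) ?_
  rintro ⟨M₁, g₁⟩ ⟨hg, m1, i1, o1⟩
  dsimp only at hg m1 i1 o1
  subst hg
  have k1 : ∀ a, a ≠ 11 → M₁.mem a = S.coord.mem a := fun a ha => by
    rw [m1, upd_apply, if_neg ha]
  rw [Ex_seq]
  refine ex_co_ite ?_ ?_
  · intro hb
    simp only [eval_div, eval_add, eval_mul, eval_c, eval_ofNat, k1 7 (by omega), k1 1 (by omega),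
      hci.scale, hci.par.2.1] at hb
    exact absurd hB hb
  intro _ M₂ h2
  rw [Ex_seq]
  refine Sure.ex_le (co_recv (M := M₂) (x := 12) rfl (R := fun r => r.2 = (f, msgBits [(v : ℕ)]) ∧
    r.1.mem = M₁.mem.update 12 v ∧ r.1.outbox = [])
    fun M' h1 _ h3 => ⟨rfl, by rw [h1, h2.mem, h2.inb, i1]; rfl, by rw [h3, h2.out, o1]⟩) ?_
  rintro ⟨M₃, g₃⟩ ⟨hg, m3, o3⟩
  dsimp only at hg m3 o3
  subst hg
  have k3 : ∀ a, a ≠ 11 → a ≠ 12 → M₃.mem a = S.coord.mem a := fun a ha ha' => by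
    rw [m3, upd_apply, if_neg ha', k1 a ha]
  rw [Ex_seq]
  refine Sure.ex_le (co_send (M := M₃) (y := 0) rfl (R := fun r => r.2 = (f, msgBits [(v : ℕ)]) ∧
    r.1.mem = M₃.mem ∧ r.1.outbox = [0]) fun M' h1 _ h3 => ⟨rfl, h1, by rw [h3, o3]; rfl⟩) ?_
  rintro ⟨M₄, g₄⟩ ⟨hg, m4, o4⟩
  dsimp only at hg m4 o4
  subst hg
  rw [Ex_seq]
  refine Sure.ex_le (co_send (M := M₄) (y := v) (by rw [eval_c, m4, m3, upd_apply, if_pos rfl])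
    (R := fun r => r.2 = (f, msgBits [(v : ℕ)]) ∧ r.1.mem = M₃.mem ∧ r.1.outbox = [0, (v : ℕ)])
    fun M' h1 _ h3 => ⟨rfl, by rw [h1, m4], by rw [h3, o4]; rfl⟩) ?_
  rintro ⟨M₅, g₅⟩ ⟨hg, m5, o5⟩
  dsimp only at hg m5 o5
  subst hg
  refine ex_co_ask (y := 0) rfl o5 fun M₆ h6 => ?_
  have hk0 : 0 < p.k := hp.k
  have hj0' : j = ⟨0, hk0⟩ := Fin.ext hj0
  rw [Algorithm.askSite, dif_pos hk0, ← hj0', Ex_map]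
  refine runSite_serve hp (hci'.sites.idle j) (Inv.ready hp hsk hci' hjk) v.2 ?_
  intro x M' _ hx2 hM hlen hsz hidle
  generalize hM'' : ({ M' with inbox := [], outbox := [] } : Machine) = M'' at hidle ⊢
  have em : M''.mem = M'.mem := by rw [← hM'']
  refine digest_after_ex hp hu hsk hci' hj hjk v.2 hM em hidle.self hlen
    (fun a ha ha' => by rw [(h6 _).1, m5, k3 a ha ha']) (h6 _).2.1 (h6 _).2.2 ?_
  intro M₇ g₇ d t1 t2 t3
  have on := hci'.on j hjk
  -- With block length zero every arrival completes a block.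
  have hE : p.Ends sk i := by unfold Par.Ends; rw [hB]; omega
  refine (hF _ d g₇.2 ⟨t1, fun _ => t2⟩ ⟨rfl, t3.cnt, ?_, ?_, t3.expi⟩).trans_eq ?_
  · have b1 := t3.paid.bits
    have b2 := netCredit_update f j M''
    rw [em] at b2
    have b3 := hM.credit (fun hc => hx2 hc)
    rw [on.pos, on.scale, if_neg (by rw [hj]; exact hE)] at b3
    have b4 : netCredit p f = netCredit p S.sites :=
      Finset.sum_congr rfl fun r _ => fcr r
    have b5 := msgBits_le hsz
    have sv : Nat.size (v : ℕ) ≤ p.β := by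
      have hv := v.2
      have := hp.lt_big hp.size_le_lg.1
      exact hp.size_of_lt (hp.big_mul _ (by omega))
    have b6 : msgBits [(v : ℕ)] ≤ 1 + 1 * (2 * p.β + 2) := msgBits_le (by simpa using sv)
    have b7 : msgBits [0, (v : ℕ)] ≤ 1 + 2 * (2 * p.β + 2) :=
      msgBits_le (by simpa using sv)
    have b8 : M'.outbox.length * (2 * p.β + 2) ≤ M'.outbox.length * (4 * p.β) :=
      Nat.mul_le_mul_left _ (by omega)
    rw [if_pos hE]
    dsimp only at b1 b2 ⊢
    have b9 : netCredit p (Function.update f j M'') +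
      M'.outbox.length ≤ netCredit p S.sites + 2 := by omega
    have b10 := Nat.mul_le_mul_left (20 * p.β) b9
    linarith [Nat.zero_le (M'.outbox.length * p.β)]
  · have b1 := t3.paid.time
    have b2 := netTime_update f j M''
    have b3 := hidle.res.time
    have b4 := netTime_update S.sites i Mi
    have b5 := iMi.res.time
    rw [← hf] at b4
    dsimp only at b1 b2 b3 ⊢
    linarith [Nat.zero_le (κ * p.β)]
  · have e := offs_update (S := S) (S' := { coord := M₇, sites := g₇.1, bitLog := g₇.2 :: S.bitLog })
      (j := j) (M' := M'') (x := x) (em ▸ hM.off) (fun r => by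
        rw [t3.off r]
        by_cases hr : r = j
        · subst hr; simp
        · simp [Function.update_of_ne hr, f8])
    rw [e, hj]

-- The phase `W ≥ 2k`: the site treats its own item, and the coordinator acts only if something is
-- reported.
set_option maxHeartbeats 1000000 in
theorem arrive_ex_sample (hp : p.Valid) {sk : Sk} (hu : u.Good p sk.Lh) (hsk : SkOk p sk) {S : System p.k}
    (hI : Inv p sk S) (hB : p.blk sk.W ≠ 0) (i : Fin p.k) (v : Fin p.n) (fu : List (ℕ × ℕ))
    {F : System p.k → ℝ≥0∞}
    (hF : ∀ S' d x, Inv p (p.step sk i) S' → StepRel p sk i S S' d x →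
      F S' ≤ pot p u (fu.map Prod.snd) S'.coord.mem * Qf p u fu (p.step sk i) (offs S')) :
    Ex (algo.arrive S (i, v)) F ≤ pot p u ((v : ℕ) :: fu.map Prod.snd) S.coord.mem *
      Qf p u ((i, v) :: fu) sk (offs S) := by
  have hβ := hp.β_pos
  have hkk := p.proc_lt sk i
  have hci := hI.ci
  obtain ⟨j, hj⟩ : ∃ j : Fin p.k, (j : ℕ) = p.proc sk i := ⟨⟨p.proc sk i, hkk.trans_le (p.kk_le hp _)⟩, rfl⟩
  have hjk : (j : ℕ) < p.kk sk.W := by rw [hj]; exact hkk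
  have hoj : (S.sites j).mem 8 = offs S (p.proc sk i) := by
    unfold offs; rw [← hj, dif_pos j.2]
  rw [Algorithm.arrive, Ex_bind]
  have hji : j = i := by
    refine Fin.ext ?_
    rw [hj, Par.proc, if_neg hB]
  subst hji
  have hpr : p.proc sk j = j := hj.symm
  have on := hci.on j hjk
  rw [← arrivalBound_eq hci hj hjk fu (offs S) hoj]
  refine runSite_item hp (hci.sites.idle j) (Inv.ready hp hsk hci hjk) v.2
    (by rw [on.scale]; exact hB) ?_
  intro x M' _ hx2 hM hlen hsz hidle
  generalize hM'' : ({ M' with inbox := [], outbox := [] } : Machine) = M'' at hidle ⊢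
  have em : M''.mem = M'.mem := by rw [← hM'']
  have cr := hM.credit (fun hc => hx2 hc)
  have b2 := netCredit_update S.sites j M''
  rw [em] at b2
  have c2 := netTime_update S.sites j M''
  have c3 := hidle.res.time
  rw [on.pos, on.scale] at cr
  have etick : (if sk.pos j + 1 < sk.W / (2 * p.k) then 0 else 1) =
      if p.Ends sk j then 1 else 0 := by
    by_cases hE : p.Ends sk j
    · have hE' := hE
      unfold Par.Ends at hE'
      rw [hpr] at hE'
      rw [if_pos hE]; exact if_neg hE'
    · have hE' := not_not.1 hE
      rw [hpr] at hE'
      rw [if_neg hE]; exact if_pos hE'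
  rw [etick] at cr
  dsimp only
  by_cases hnil : M'.outbox = []
  · -- nothing to report
    rw [if_pos hnil, Ex_pure]
    -- Silence means no hit, no sample and no completed block, so the unchanged state of the
    -- coordinator is the correct one.
    have hE : ¬ p.Ends sk j := by
      intro hE
      have : p.N + 1 ∈ M'.outbox := by
        rw [hM.mem_tick, on.pos, on.scale]; unfold Par.Ends at hE; rwa [hpr] at hE
      rw [hnil] at this; simp at this
    have hxs : x ≠ sk.pos (p.proc sk j) := by
      intro hx
      have : p.N + 2 + (v : ℕ) ∈ M'.outbox := by
        rw [hM.mem_sample, on.pos, hx, hpr]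
      rw [hnil] at this; simp at this
    have aft := hci.after (m₁ := S.coord.mem) (u := u) hjk hM em hidle.self (fun _ _ _ => rfl)
      (fun s hs => by rw [hnil]; simp)
    have hstep : p.step sk j = ⟨sk.W, sk.T, sk.Lh, Function.update sk.pos j
        (if sk.pos j + 1 < p.blk sk.W then sk.pos j + 1 else 0)⟩ := by
      have hE' := not_not.1 hE
      rw [hpr] at hE'
      unfold Par.step
      rw [if_neg hE, hpr, if_pos hE']
    rw [if_neg hE] at cr
    have eW : (p.step sk j).T = sk.T := by rw [hstep]
    refine (hF { coord := S.coord, sites := Function.update S.sites j M'', bitLog := 0 :: S.bitLog }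
      0 0 ⟨by rw [hstep]; exact aft.1, fun hL => hI.rep (by rw [hstep] at hL; exact hL)⟩
      ⟨rfl, rfl, ?_, ?_, fun R _ => by simp⟩).trans_eq ?_
    · rw [resync, if_pos eW, if_neg hE]
      dsimp only at b2 ⊢
      have : netCredit p (Function.update S.sites j M'') ≤
        netCredit p S.sites := by omega
      have := Nat.mul_le_mul_left (20 * p.β) this
      linarith
    · rw [resync, if_pos eW]
      dsimp only at c2 c3 ⊢
      linarith [Nat.zero_le (κ * p.β)]
    · rw [aft.2, if_neg hxs, one_mul, mul_assoc]
      congr 2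
      rw [offs_update (S := S) (j := j) (M' := M'') (x := x) (em ▸ hM.off)
        (fun r => rfl), hpr]
  · rw [if_neg hnil, Ex_map, algo]
    dsimp only
    rw [coordCmd, Ex_seq]
    refine Sure.ex_le (co_recv (M := { S.coord with inbox := (j : ℕ) :: M'.outbox, outbox := [] }) (x := 11) rfl (R := fun r =>
      r.2 = (Function.update S.sites j M'', msgBits M'.outbox) ∧
      r.1.mem = S.coord.mem.update 11 j ∧ r.1.inbox = M'.outbox ∧ r.1.outbox = [])
      fun M₁ h1 h2 h3 => ⟨rfl, h1, h2, h3⟩) ?_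
    rintro ⟨M₁, g₁⟩ ⟨hg, m1, i1, o1⟩
    dsimp only at hg m1 i1 o1
    subst hg
    have k1 : ∀ a, a ≠ 11 → M₁.mem a = S.coord.mem a := fun a ha => by
      rw [m1, upd_apply, if_neg ha]
    rw [Ex_seq]
    refine ex_co_ite ?_ ?_
    swap
    · intro hb
      simp only [eval_div, eval_add, eval_mul, eval_c, eval_ofNat, k1 7 (by omega), k1 1 (by omega),
        hci.scale, hci.par.2.1] at hb
      exact absurd hb hB
    intro _ M₂ h2
    rw [Ex_skip]
    refine digest_after_ex hp hu hsk hci hj hjk v.2 hM em hidle.self hlen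
      (fun a ha _ => by rw [h2.mem, k1 a ha]) (by rw [h2.inb, i1]) (by rw [h2.out, o1]) ?_
    intro M₄ g₄ d t1 t2 t3
    refine (hF _ d g₄.2 ⟨t1, fun _ => t2⟩ ⟨rfl, t3.cnt, ?_, ?_, t3.expi⟩).trans_eq ?_
    · have b1 := t3.paid.bits
      have b5 := msgBits_le hsz
      have hq : 1 ≤ M'.outbox.length := by
        rcases Nat.eq_zero_or_pos M'.outbox.length with h0 | h0
        · exact absurd (List.length_eq_zero_iff.1 h0) hnil
        · exact h0
      have b8 : M'.outbox.length * (2 * p.β + 2) + M'.outbox.length ≤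
          M'.outbox.length * (5 * p.β) := by
        rw [← Nat.mul_succ]; exact Nat.mul_le_mul_left _ (by omega)
      dsimp only at b1 b2 ⊢
      have b9 : netCredit p (Function.update S.sites j M'') +
        M'.outbox.length ≤ netCredit p S.sites + 2 * if p.Ends sk j then 1 else 0 := by omega
      have b10 := Nat.mul_le_mul_left (20 * p.β) b9
      generalize (if p.Ends sk j then 1 else 0) = z at b10 ⊢
      linarith [Nat.zero_le (M'.outbox.length * p.β), Nat.zero_le (p.β * z)]
    · have b1 := t3.paid.time
      dsimp only at b1 c2 c3 ⊢
      linarith [Nat.zero_le (κ * p.β)]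
    · have e := offs_update (S := S)
        (S' := { coord := M₄, sites := g₄.1, bitLog := g₄.2 :: S.bitLog })
        (j := j) (M' := M'') (x := x) (em ▸ hM.off) t3.off
      rw [e, hpr]

/-- The supermartingale step: `pot * Qf` bounds the expected final potential over what is left of
the stream, and one arrival moves its first item from the future to the past. -/
theorem arrive_ex (hp : p.Valid) {sk : Sk} (hu : u.Good p sk.Lh) (hsk : SkOk p sk) {S : System p.k}
    (hI : Inv p sk S) (a : Fin p.k × Fin p.n) (fu : List (ℕ × ℕ)) {F : System p.k → ℝ≥0∞}
    (hF : ∀ S' d x, Inv p (p.step sk a.1) S' → StepRel p sk a.1 S S' d x →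
      F S' ≤ pot p u (fu.map Prod.snd) S'.coord.mem * Qf p u fu (p.step sk a.1) (offs S')) :
    Ex (algo.arrive S a) F ≤ pot p u ((a.2 : ℕ) :: fu.map Prod.snd) S.coord.mem *
      Qf p u ((a.1, a.2) :: fu) sk (offs S) := by
  by_cases hB : p.blk sk.W = 0
  · exact arrive_ex_forward hp hu hsk hI hB a.1 a.2 fu hF
  · exact arrive_ex_sample hp hu hsk hI hB a.1 a.2 fu hF

end Monitoring
end

/-! ### Initial state and whole runs. -/

noncomputable section
open scoped ENNReal
namespace Monitoring
open Monitoring.Expr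

variable {p : Par} {u : Wt}

/-! ### The start -/

theorem paramMem_zero {n k w e d a : ℕ} (ha : 5 ≤ a) : paramMem n k w e d a = 0 := by
  unfold paramMem
  simp only [upd_apply, Finsupp.single_apply]
  repeat' split
  all_goals omega

theorem paramMem_par {n k w e d : ℕ} : HasPar ⟨n, k, w, e, d⟩ (paramMem n k w e d) := by
  unfold paramMem HasPar
  simp [upd_apply]

theorem Idle.init (hp : p.Valid) {m : Memory} (h : ∀ a, Nat.size (m a) ≤ p.β)
    (h' : ∀ a, 2 * p.N + 18 ≤ a → m a = 0) : Idle p (initMachine m).time (initMachine m) := by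
  refine ⟨⟨h, h', ?_, ?_, ?_, le_rfl⟩, rfl, rfl⟩
  · simp [initMachine]
  · simp [initMachine]
  · have : Res p 0 0 { mem := m, inbox := [], outbox := [], time := 0, peak := 0 } :=
      ⟨h, h', by simp, by simp, Nat.zero_le _, le_rfl⟩
    refine (this.space_le hp (Nat.zero_le _)).trans ?_
    unfold Par.Y κ
    exact Nat.mul_le_mul_right _ (Nat.mul_le_mul_right _ (by norm_num))

def sk₀ : Sk := ⟨1, 1, 0, fun _ => 0⟩

theorem skOk_init (hp : p.Valid) : SkOk p sk₀ :=
  ⟨⟨one_pos, hp.w⟩, one_pos, fun _ => Or.inl rfl⟩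

theorem blk_one (hp : p.Valid) : p.blk 1 = 0 := Nat.div_eq_of_lt (by have := hp.k; omega)

theorem inv_init (hp : p.Valid) : Inv p sk₀ (initSystem p.n p.k p.w p.e p.d) := by
  have hβ := hp.β_pos
  have z0 : ∀ a, Nat.size (paramMem p.n p.k p.w p.e p.d a) ≤ p.β := by
    intro a
    obtain ⟨b1, b2, b3, b4, b5⟩ := hp.size_le_lg
    have b6 : Nat.size p.d ≤ p.lg := b5
    have hl : p.lg ≤ p.β := by unfold Par.β; omega
    obtain ⟨e0, e1, e2, e3, e4⟩ := paramMem_par (n := p.n) (k := p.k) (w := p.w) (e := p.e) (d := p.d)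
    rcases lt_or_ge a 5 with ha | ha
    · interval_cases a
      · rw [e0]; exact b1.trans hl
      · rw [e1]; exact b2.trans hl
      · rw [e2]; exact b3.trans hl
      · rw [e3]; exact b4.trans hl
      · rw [e4]; exact b6.trans hl
    · rw [paramMem_zero ha]; simp
  refine ⟨⟨paramMem_par, ?_, ?_, ?_, ⟨?_, ?_, ?_, ?_, ?_, ?_⟩, ⟨fun j => Idle.init hp ?_ ?_, fun j => ?_⟩,
    fun j hj => ⟨?_, ?_, ?_, ?_, ?_⟩, fun j hj => ?_⟩, fun h => absurd h (lt_irrefl _)⟩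
  · simp [initSystem, initMachine, paramMem_zero, sk₀]
  · simp [initSystem, initMachine, paramMem_zero, sk₀]
  · simp [initSystem, initMachine, paramMem_zero, sk₀]
  · intro s _
    have := hp.n
    simpa [initSystem, initMachine, item, paramMem_zero (show 5 ≤ 4 * s + 64 by omega)] using this
  · intro s _
    simp [initSystem, initMachine, thr, paramMem_zero (show 5 ≤ 4 * s + 65 by omega)]
  · intro s _
    simp [initSystem, initMachine, expi, paramMem_zero (show 5 ≤ 4 * s + 67 by omega)]
  · intro s _
    simp [initSystem, initMachine, paramMem_zero]
  · intro h
    simp [initSystem, initMachine, paramMem_zero] at h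
  · simp [initSystem, initMachine, paramMem_zero]
  · intro a
    rw [upd_apply]
    split
    · refine (Nat.size_le_size j.2.le).trans (hp.size_le_lg.2.1.trans ?_)
      unfold Par.β; omega
    · exact z0 a
  · intro a ha
    rw [upd_apply, if_neg (by omega), paramMem_zero (by omega)]
  · exact paramMem_par.congr fun a ha => by
      simp only [initSystem, initMachine, upd_apply]; rw [if_neg (by omega)]
  · simp [initSystem, initMachine, upd_apply, paramMem_zero, sk₀]
  · simp [initSystem, initMachine, upd_apply, paramMem_zero, sk₀]
  · intro s _
    simp only [initSystem, initMachine, upd_apply, item]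
    rw [if_neg (by omega), paramMem_zero (by omega), paramMem_zero (by omega)]
  · intro s _
    simp only [initSystem, initMachine, upd_apply, thr]
    rw [if_neg (by omega), paramMem_zero (by omega), paramMem_zero (by omega)]
    exact Or.inl rfl
  · intro s _
    simp only [initSystem, initMachine, upd_apply]
    rw [if_neg (by omega), paramMem_zero (by omega)]
    exact Nat.zero_le _
  · simp [initSystem, initMachine, upd_apply, paramMem_zero]

/-! ### The schedule, continued -/

theorem Par.Valid.blk_mul_le (_ : p.Valid) (W : ℕ) : 2 * (p.k * p.blk W) ≤ W := by
  unfold Par.blk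
  have := Nat.mul_div_le W (2 * p.k)
  calc _ = 2 * p.k * (W / (2 * p.k)) := by ring
    _ ≤ W := this

theorem Par.Valid.blk_le (hp : p.Valid) (W : ℕ) : 2 * p.blk W ≤ W := by
  have h1 := hp.blk_mul_le W
  have h2 : p.blk W ≤ p.k * p.blk W := Nat.le_mul_of_pos_left _ hp.k
  omega

/-- What an arrival does to the schedule. -/
theorem step_cases (p : Par) (sk : Sk) (i : ℕ) :
    (¬ p.Ends sk i ∧ p.step sk i = ⟨sk.W, sk.T, sk.Lh,
      Function.update sk.pos (p.proc sk i) (sk.pos (p.proc sk i) + 1)⟩) ∨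
    p.Ends sk i ∧
    ((sk.Lh + p.unit sk.W < 2 * sk.T ∨ p.w < 2 * sk.T) ∧ p.step sk i =
        ⟨sk.W, sk.T, sk.Lh + p.unit sk.W, Function.update sk.pos (p.proc sk i) 0⟩ ∨
      (2 * sk.T ≤ sk.Lh + p.unit sk.W ∧ 2 * sk.T ≤ p.w) ∧
      (2 * sk.T < 2 * sk.W * p.P ∧ p.step sk i =
        ⟨sk.W, 2 * sk.T, sk.Lh + p.unit sk.W, Function.update sk.pos (p.proc sk i) 0⟩ ∨
      2 * sk.W * p.P ≤ 2 * sk.T ∧ p.step sk i =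
        ⟨2 * sk.W, 2 * sk.T, sk.Lh + p.unit sk.W, fun _ => 0⟩)) := by
  unfold Par.step
  by_cases hE : p.Ends sk i
  · right
    refine ⟨hE, ?_⟩
    rw [if_pos hE]
    unfold Par.rescale
    dsimp only
    split_ifs with h1 h2
    · exact Or.inl ⟨h1, rfl⟩
    · exact Or.inr ⟨by omega, Or.inl ⟨h2, rfl⟩⟩
    · exact Or.inr ⟨by omega, Or.inr ⟨by omega, rfl⟩⟩
  · rw [if_neg hE]
    exact Or.inl ⟨hE, rfl⟩

theorem step_mono (sk : Sk) (i : ℕ) :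
    sk.W ≤ (p.step sk i).W ∧ sk.T ≤ (p.step sk i).T ∧ sk.Lh ≤ (p.step sk i).Lh := by
  rcases step_cases p sk i with ⟨-, h⟩ | ⟨-, ⟨-, h⟩ | ⟨-, ⟨-, h⟩ | ⟨-, h⟩⟩⟩ <;> rw [h] <;> dsimp only <;> omega

theorem SkOk.step (hp : p.Valid) {sk : Sk} (h : SkOk p sk) (i : ℕ) : SkOk p (p.step sk i) := by
  have hP := hp.P_pos
  obtain ⟨⟨h1, h2⟩, h3, h4⟩ := h
  have up : ∀ j, Function.update sk.pos (p.proc sk i) 0 j = 0 ∨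
      Function.update sk.pos (p.proc sk i) 0 j < p.blk sk.W := fun j => by
    by_cases hj : j = p.proc sk i
    · subst hj; simp
    · rw [Function.update_of_ne hj]; exact h4 j
  rcases step_cases p sk i with ⟨hE, h⟩ | ⟨-, ⟨-, h⟩ | ⟨hw, ⟨-, h⟩ | ⟨hW, h⟩⟩⟩ <;> rw [h]
  · refine ⟨⟨h1, h2⟩, h3, fun j => ?_⟩
    dsimp only
    by_cases hj : j = p.proc sk i
    · subst hj; rw [Function.update_self]; exact Or.inr (not_not.1 hE)
    · rw [Function.update_of_ne hj]; exact h4 j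
  · exact ⟨⟨h1, h2⟩, h3, up⟩
  · exact ⟨⟨h1, h2⟩, by dsimp only; omega, up⟩
  · refine ⟨⟨by dsimp only; omega, ?_⟩, by dsimp only; omega, fun j => Or.inl rfl⟩
    dsimp only
    -- `W` doubles only if `2WP ≤ 2T ≤ w`; thus `2W ≤ w`.
    have : 2 * sk.W * 1 ≤ 2 * sk.W * p.P := Nat.mul_le_mul_left _ hP
    omega

def Par.steps (p : Par) (sk : Sk) : List (ℕ × ℕ) → Sk
  | [] => sk
  | a :: fu => p.steps (p.step sk a.1) fu

theorem steps_append (sk : Sk) (fu fu' : List (ℕ × ℕ)) :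
    p.steps sk (fu ++ fu') = p.steps (p.steps sk fu) fu' := by
  induction fu generalizing sk with
  | nil => rfl
  | cons a fu ih => exact ih _

theorem steps_mono (sk : Sk) (fu : List (ℕ × ℕ)) :
    sk.W ≤ (p.steps sk fu).W ∧ sk.T ≤ (p.steps sk fu).T ∧ sk.Lh ≤ (p.steps sk fu).Lh := by
  induction fu generalizing sk with
  | nil => exact ⟨le_rfl, le_rfl, le_rfl⟩
  | cons a fu ih =>
    have h1 := ih (p.step sk a.1)
    have h2 := step_mono (p := p) sk a.1
    exact ⟨h2.1.trans h1.1, h2.2.1.trans h1.2.1, h2.2.2.trans h1.2.2⟩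

theorem kk_mono (hp : p.Valid) {W W' : ℕ} (h : W ≤ W') : p.kk W ≤ p.kk W' := by
  unfold Par.kk
  have := Nat.div_le_div_right (c := 2 * p.k) h
  have := hp.k
  split_ifs <;> omega

/-- The number of changes of the estimate of the length of the window. -/
def changes (p : Par) : Sk → List (ℕ × ℕ) → ℕ
  | _, [] => 0
  | sk, a :: fu => (if (p.step sk a.1).T = sk.T then 0 else 1) + changes p (p.step sk a.1) fu

/-- The number of completed blocks. -/
def ticks (p : Par) : Sk → List (ℕ × ℕ) → ℕ
  | _, [] => 0
  | sk, a :: fu => (if p.Ends sk a.1 then 1 else 0) + ticks p (p.step sk a.1) fu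

/-- The effect of a sequence of arrivals. -/
structure RunRel (p : Par) (sk : Sk) (fu : List (ℕ × ℕ)) (S S' : System p.k) (d : ℕ) (l : List ℕ) :
    Prop where
  log : S'.bitLog = l ++ S.bitLog
  len : l.length = fu.length
  cnt : S'.coord.mem 10 = S.coord.mem 10 + d
  bits : l.sum + 20 * p.β * netCredit p S'.sites ≤ 20 * p.β * netCredit p S.sites +
    60 * p.β * (p.kk (p.steps sk fu).W * (d + p.N * changes p sk fu) + ticks p sk fu)
  time : netTime S'.sites ≤ netTime S.sites + fu.length * ((7 * p.N + 60) * (κ * p.β)) +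
    20 * (κ * p.β) * (p.kk (p.steps sk fu).W * (d + p.N * changes p sk fu))
  expi : ∀ R ≤ sk.Lh, expSum p S.coord.mem R + (p.w + 1) * d ≤ expSum p S'.coord.mem R

theorem RunRel.nil (sk : Sk) (S : System p.k) : RunRel p sk [] S S 0 [] :=
  ⟨rfl, rfl, rfl, by simp, by simp, fun R _ => by simp⟩

/-- The number of participating sites is monotone along the run, so its final value may replace it
in the cost of each broadcast. -/
theorem RunRel.cons (hp : p.Valid) {sk : Sk} {a : ℕ × ℕ} {fu : List (ℕ × ℕ)} {S S₁ S' : System p.k}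
    {d d' x : ℕ} {l : List ℕ} (h₁ : StepRel p sk a.1 S S₁ d x)
    (h₂ : RunRel p (p.step sk a.1) fu S₁ S' d' l) :
    RunRel p sk (a :: fu) S S' (d + d') (l ++ [x]) := by
  have m1 := step_mono (p := p) sk a.1
  have m2 := steps_mono (p := p) (p.step sk a.1) fu
  have k1 : p.kk sk.W ≤ p.kk (p.steps sk (a :: fu)).W := kk_mono hp (m1.1.trans m2.1)
  have k2 : p.kk (p.step sk a.1).W ≤ p.kk (p.steps sk (a :: fu)).W := kk_mono hp m2.1
  have e : p.steps (p.step sk a.1) fu = p.steps sk (a :: fu) := rfl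
  have hb := h₂.bits
  have ht := h₂.time
  rw [e] at hb ht
  set q := p.kk (p.steps sk (a :: fu)).W
  have r1 : p.kk sk.W * d + resync p sk (p.step sk a.1) ≤
      q * (d + p.N * if (p.step sk a.1).T = sk.T then 0 else 1) := by
    unfold resync
    split_ifs
    · simpa using Nat.mul_le_mul_right d k1
    · rw [mul_add, mul_one]; exact Nat.add_le_add (Nat.mul_le_mul_right d k1) (Nat.mul_le_mul_right _ k2)
  have e1 : q * (d + d' + p.N * changes p sk (a :: fu)) =
      q * (d + p.N * if (p.step sk a.1).T = sk.T then 0 else 1) +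
        q * (d' + p.N * changes p (p.step sk a.1) fu) := by
    have e2 : changes p sk (a :: fu) = (if (p.step sk a.1).T = sk.T then 0 else 1) +
      changes p (p.step sk a.1) fu := rfl
    rw [e2]; ring
  refine ⟨by rw [h₂.log, h₁.log]; simp, by simp [h₂.len], by rw [h₂.cnt, h₁.cnt, add_assoc], ?_, ?_,
    fun R hR => ?_⟩
  · have hb' := h₁.bits
    rw [e1]
    simp only [List.sum_append, List.sum_cons, List.sum_nil, add_zero]
    have : 60 * p.β * (p.kk sk.W * d + resync p sk (p.step sk a.1) +
        if p.Ends sk a.1 then 1 else 0) ≤ 60 * p.β *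
        (q * (d + p.N * if (p.step sk a.1).T = sk.T then 0 else 1) +
          if p.Ends sk a.1 then 1 else 0) := Nat.mul_le_mul_left _ (by omega)
    have e2 : ticks p sk (a :: fu) =
      (if p.Ends sk a.1 then 1 else 0) + ticks p (p.step sk a.1) fu := rfl
    rw [e2]
    linarith
  · have ht' := h₁.time
    rw [e1]
    have := Nat.mul_le_mul_left (20 * (κ * p.β)) r1
    rw [List.length_cons]
    linarith
  · have := h₁.expi R hR
    have := h₂.expi R (hR.trans m1.2.2)
    rw [mul_add]; omega

/-! ### Runs -/

def codes {n k : ℕ} (A : List (Fin k × Fin n)) : List (ℕ × ℕ) := A.map fun a => (a.1, a.2)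

/-- The law of the state after further arrivals. -/
def runFrom {n k : ℕ} (q : PMF (System k)) (A : List (Fin k × Fin n)) : PMF (System k) :=
  A.foldl (fun q a => q.bind fun S => algo.arrive S a) q

theorem runFrom_append {n k : ℕ} (q : PMF (System k)) (A B : List (Fin k × Fin n)) :
    runFrom q (A ++ B) = runFrom (runFrom q A) B := List.foldl_append

theorem runFrom_bind {n k : ℕ} (q : PMF (System k)) (A : List (Fin k × Fin n)) :
    runFrom q A = q.bind fun S => runFrom (PMF.pure S) A := by
  induction A generalizing q with
  | nil => simp [runFrom]
  | cons a A ih =>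
    have e : ∀ q : PMF (System k), runFrom q (a :: A) = runFrom (q.bind fun S => algo.arrive S a) A :=
      fun _ => rfl
    rw [e, ih, PMF.bind_bind]
    congr 1
    funext S
    rw [e, PMF.pure_bind, ← ih]

/-- Iterating `arrive_ex` leaves the potential with empty future, a function of the final memory, on
the left, and the initial potential times the expected factors of all samples on the right. -/
theorem runFrom_ex (hp : p.Valid) (A : List (Fin p.k × Fin p.n)) {sk : Sk} (hsk : SkOk p sk)
    (hu : ∀ Lh ≤ (p.steps sk (codes A)).Lh, u.Good p Lh) {S : System p.k} (hI : Inv p sk S)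
    {F : System p.k → ℝ≥0∞}
    (hF : ∀ S' d l, Inv p (p.steps sk (codes A)) S' → RunRel p sk (codes A) S S' d l →
      F S' ≤ pot p u [] S'.coord.mem) :
    Ex (runFrom (PMF.pure S) A) F ≤ pot p u (A.map fun a => (a.2 : ℕ)) S.coord.mem *
      Qf p u (codes A) sk (offs S) := by
  induction A generalizing sk S with
  | nil =>
    show Ex (PMF.pure S) F ≤ _
    rw [Ex_pure]
    simpa [codes, Qf] using hF S 0 [] hI (RunRel.nil sk S)
  | cons a A ih =>
    have e : runFrom (PMF.pure S) (a :: A) = (algo.arrive S a).bind fun S => runFrom (PMF.pure S) A := by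
      rw [← runFrom_bind]
      show runFrom ((PMF.pure S).bind fun S => algo.arrive S a) A = _
      rw [PMF.pure_bind]
    have em : (A.map fun a => (a.2 : ℕ)) = (codes A).map Prod.snd := by simp [codes]
    rw [e, Ex_bind]
    have key := arrive_ex hp (hu sk.Lh (steps_mono sk _).2.2) hsk hI a (codes A)
      (F := fun S => Ex (runFrom (PMF.pure S) A) F) ?_
    · rw [← em] at key
      exact key
    · intro S' d x hI' hR
      rw [← em]
      refine ih (hsk.step hp _) hu hI' fun S'' d' l hI'' hR' => hF S'' (d + d') (l ++ [x]) hI'' ?_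
      exact RunRel.cons hp (a := (a.1, a.2)) hR hR'

/-- The weight with `ϰ = 0` makes the potential vanish, and the bound on expectations turns into a
statement about all outcomes. -/
theorem runFrom_sure (hp : p.Valid) (A : List (Fin p.k × Fin p.n)) {sk : Sk} (hsk : SkOk p sk)
    {S : System p.k} (hI : Inv p sk S) : Sure (runFrom (PMF.pure S) A) fun S' =>
      Inv p (p.steps sk (codes A)) S' ∧ ∃ d l, RunRel p sk (codes A) S S' d l := by
  refine sure_of_ex fun F hF => ?_
  refine (runFrom_ex (u := ⟨fun _ _ => 1, fun _ _ => 1, fun _ => 0⟩) hp A hsk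
    (fun _ _ => ⟨by simp, by simp⟩) hI fun S' d l h1 h2 => (hF S' ⟨h1, d, l, h2⟩).trans ?_).trans ?_
  · exact bot_le
  · simp [pot]

end Monitoring
end

/-! ### Invariants of the schedule, and the product of the factors over the random offsets. -/

noncomputable section
open scoped ENNReal
namespace Monitoring
open Monitoring.Expr

variable {p : Par} {u : Wt}

/-! ### Invariants of the schedule -/

/-- The schedule after `L` arrivals. -/
structure SkI (p : Par) (sk : Sk) (L : ℕ) : Prop where
  ok : SkOk p sk
  two : ∃ b, sk.W = 2 ^ b
  -- Together with `high` this says that `T / W` is of order `P`, except at the start, where `W = 1`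
  -- and several copies per item make up for it.
  low : sk.W = 1 ∨ sk.W * p.P ≤ sk.T
  high : sk.T < 2 * sk.W * p.P
  len : sk.T = 1 ∨ sk.T ≤ sk.Lh ∧ sk.T ≤ p.w
  len' : sk.Lh < 2 * sk.T ∨ p.w < 2 * sk.T
  lag : sk.Lh + ∑ j ∈ Finset.range p.k, sk.pos j ≤ L
  -- The term `W` pays for incomplete blocks discarded when the rate changed: a doubling of `W`
  -- discards positions of total at most `W / 2`, and the bound doubles as well.
  lag' : 2 * L ≤ 2 * sk.Lh + 2 * ∑ j ∈ Finset.range p.k, sk.pos j + sk.W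
  exact : p.blk sk.W = 0 → L = sk.Lh

theorem SkOk.pos_sum (hp : p.Valid) {sk : Sk} (h : SkOk p sk) :
    2 * ∑ j ∈ Finset.range p.k, sk.pos j ≤ sk.W := by
  refine le_trans ?_ (hp.blk_mul_le sk.W)
  refine Nat.mul_le_mul_left 2 ?_
  calc ∑ j ∈ Finset.range p.k, sk.pos j ≤ ∑ j ∈ Finset.range p.k, p.blk sk.W :=
        Finset.sum_le_sum fun j _ => by have := h.pos j; omega
    _ = _ := by simp

theorem SkOk.pos_eq_zero {sk : Sk} (h : SkOk p sk) (h0 : p.blk sk.W = 0) (j : ℕ) : sk.pos j = 0 := by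
  have := h.pos j; omega

theorem skI_init (hp : p.Valid) : SkI p sk₀ 0 := by
  have hP := hp.P_pos
  refine ⟨skOk_init hp, ⟨0, rfl⟩, Or.inl rfl, ?_, Or.inl rfl, Or.inl ?_, ?_, ?_, fun _ => rfl⟩ <;> simp [sk₀]
  omega

theorem sum_update_range (pos : ℕ → ℕ) {k q : ℕ} (hq : q < k) (x : ℕ) :
    ∑ j ∈ Finset.range k, Function.update pos q x j + pos q = ∑ j ∈ Finset.range k, pos j + x := by
  have hm := Finset.mem_range.2 hq
  have e : ∑ j ∈ (Finset.range k).erase q, Function.update pos q x j =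
      ∑ j ∈ (Finset.range k).erase q, pos j :=
    Finset.sum_congr rfl fun i hi => Function.update_of_ne (Finset.ne_of_mem_erase hi) x pos
  rw [← Finset.add_sum_erase _ _ hm, ← Finset.add_sum_erase _ pos hm, Function.update_self, e]
  omega

theorem proc_lt_k (hp : p.Valid) (sk : Sk) {i : ℕ} (hi : i < p.k) : p.proc sk i < p.k := by
  have := hp.k; unfold Par.proc; split <;> omega

theorem SkI.step (hp : p.Valid) {sk : Sk} {L i : ℕ} (h : SkI p sk L) (hi : i < p.k) :
    SkI p (p.step sk i) (L + 1) := by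
  have hP := hp.P_pos
  have hok := h.ok.step hp i
  obtain ⟨ok, ⟨b, two⟩, low, high, len, len', lag, lag', ex⟩ := h
  have hq := proc_lt_k hp sk hi
  have hb := hp.blk_le sk.W
  have hT := ok.length
  have hS := ok.pos_sum hp
  have hpos := ok.pos (p.proc sk i)
  -- The clock never jumps by more than `T`, so one doubling of `T` is enough to restore `len'`.
  have hunit : 0 < p.unit sk.W ∧ p.unit sk.W ≤ sk.T := by
    unfold Par.unit
    rcases low with low | low
    · rw [low, blk_one hp, if_pos rfl]; omega
    · have : sk.W * 1 ≤ sk.W * p.P := Nat.mul_le_mul_left _ hP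
      split_ifs <;> omega
  rcases step_cases p sk i with ⟨hE, h⟩ | ⟨hE, h⟩
  · have hE' := not_not.1 hE
    have hs := sum_update_range sk.pos hq (sk.pos (p.proc sk i) + 1)
    rw [h] at hok ⊢
    exact ⟨hok, ⟨b, two⟩, low, high, len, len', by dsimp only; omega, by dsimp only; omega,
      fun h0 => by dsimp only at h0; omega⟩
  · have hE' : ¬ sk.pos (p.proc sk i) + 1 < p.blk sk.W := hE
    have hs := sum_update_range sk.pos hq 0
    set R := ∑ j ∈ Finset.range p.k, Function.update sk.pos (p.proc sk i) 0 j with hR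
    have l1 : sk.Lh + p.unit sk.W + R ≤ L + 1 ∧ 2 * (L + 1) ≤ 2 * (sk.Lh + p.unit sk.W) + 2 * R + sk.W
        ∧ (p.blk sk.W = 0 → L + 1 = sk.Lh + p.unit sk.W) := by
      by_cases h0 : p.blk sk.W = 0
      · have z : ∑ j ∈ Finset.range p.k, sk.pos j = 0 :=
          Finset.sum_eq_zero fun j _ => ok.pos_eq_zero h0 j
        have := ex h0
        have e : p.unit sk.W = 1 := by unfold Par.unit; rw [if_pos h0, h0]
        omega
      · have e : p.unit sk.W = p.blk sk.W := by unfold Par.unit; rw [if_neg h0]; rfl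
        omega
    rcases h with ⟨hw, h⟩ | ⟨hw, ⟨hPT, h⟩ | ⟨hPT, h⟩⟩ <;> rw [h] at hok ⊢
    · exact ⟨hok, ⟨b, two⟩, low, high, by dsimp only; omega, hw, l1.1, l1.2.1, l1.2.2⟩
    · refine ⟨hok, ⟨b, two⟩, by dsimp only; omega, hPT, by dsimp only; omega, ?_, l1.1, l1.2.1, l1.2.2⟩
      dsimp only; omega
    · refine ⟨hok, ⟨b + 1, by dsimp only; rw [two, pow_succ, mul_comm]⟩, Or.inr hPT, ?_,
        by dsimp only; omega, ?_, ?_, ?_, fun h0 => ?_⟩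
      · dsimp only
        have : 2 * (2 * sk.W) * p.P = 2 * (2 * sk.W * p.P) := by ring
        omega
      · dsimp only; omega
      · simp; omega
      · simp; omega
      · dsimp only at h0 ⊢
        refine l1.2.2 ?_
        have : p.blk sk.W ≤ p.blk (2 * sk.W) := Nat.div_le_div_right (by omega)
        omega

theorem SkI.steps (hp : p.Valid) {sk : Sk} {L : ℕ} (h : SkI p sk L) {fu : List (ℕ × ℕ)}
    (hi : ∀ a ∈ fu, a.1 < p.k) : SkI p (p.steps sk fu) (L + fu.length) := by
  induction fu generalizing sk L with
  | nil => exact h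
  | cons a fu ih =>
    have := ih (h.step hp (hi a (by simp))) fun b hb => hi b (by simp [hb])
    rw [List.length_cons, add_comm fu.length, ← add_assoc]
    exact this

/-! ### The product of the factors of the samples -/

/-- The factor of the samples of an item. -/
def fac (p : Par) (u : Wt) (l : List ℕ) (sk : Sk) (v : ℕ) : ℝ :=
  (fresh p u l sk.W sk.T sk.Lh v ^ (p.P / sk.T + 1)).toReal

/-- The factor of the current block of site `j`, if its sample is at position `o`. -/
def pend (p : Par) (u : Wt) (j o : ℕ) : List (ℕ × ℕ) → Sk → ℝ
  | [], _ => 1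
  | (i, v) :: fu, sk =>
    (if p.proc sk i = j ∧ sk.pos j = o then fac p u (fu.map Prod.snd) sk v else 1) *
      if (p.step sk i).pos j = 0 then 1 else pend p u j o fu (p.step sk i)

/-- The sum of `factor - 1` over the remaining arrivals of the current block of site `j`. A block
has a single sample, so by `sum_pend` this is the total excess over all offsets. -/
def blkSum (p : Par) (u : Wt) (j : ℕ) : List (ℕ × ℕ) → Sk → ℝ
  | [], _ => 0
  | (i, v) :: fu, sk =>
    (if p.proc sk i = j then fac p u (fu.map Prod.snd) sk v - 1 else 0) +
      if (p.step sk i).pos j = 0 then 0 else blkSum p u j fu (p.step sk i)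

/-- The contribution of the samples of an item to the exponent. -/
def facLog (p : Par) (u : Wt) (l : List ℕ) (sk : Sk) (v : ℕ) : ℝ :=
  if sk.W = 1 then Real.log (fac p u l sk v) else (fac p u l sk v - 1) / sk.W

def facSum (p : Par) (u : Wt) : List (ℕ × ℕ) → Sk → ℝ
  | [], _ => 0
  | (i, v) :: fu, sk => facLog p u (fu.map Prod.snd) sk v + facSum p u fu (p.step sk i)

/-- The correction for the block of site `j`. -/
def corr (p : Par) (u : Wt) (fu : List (ℕ × ℕ)) (sk : Sk) (o : ℕ → ℕ) (j : ℕ) : ℝ :=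
  if sk.pos j = 0 then 1 else pend p u j (o j) fu sk * Real.exp (-(blkSum p u j fu sk / sk.W))

theorem fac_nonneg (l : List ℕ) (sk : Sk) (v : ℕ) : 0 ≤ fac p u l sk v := ENNReal.toReal_nonneg

theorem pend_nonneg (j o : ℕ) (fu : List (ℕ × ℕ)) (sk : Sk) : 0 ≤ pend p u j o fu sk := by
  induction fu generalizing sk with
  | nil => exact zero_le_one
  | cons a fu ih =>
    unfold pend
    refine mul_nonneg ?_ ?_
    · split_ifs; exacts [fac_nonneg _ _ _, zero_le_one]
    · split_ifs; exacts [zero_le_one, ih _]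

theorem corr_nonneg (fu : List (ℕ × ℕ)) (sk : Sk) (o : ℕ → ℕ) (j : ℕ) : 0 ≤ corr p u fu sk o j := by
  unfold corr
  split_ifs
  · exact zero_le_one
  · exact mul_nonneg (pend_nonneg _ _ _ _) (Real.exp_nonneg _)

/-- How positions change. -/
theorem step_pos (sk : Sk) (i j : ℕ) (h : (p.step sk i).pos j ≠ 0) :
    (p.step sk i).W = sk.W ∧ (p.step sk i).pos j = if j = p.proc sk i then sk.pos j + 1 else sk.pos j := by
  rcases step_cases p sk i with ⟨-, e⟩ | ⟨-, ⟨-, e⟩ | ⟨-, ⟨-, e⟩ | ⟨-, e⟩⟩⟩ <;> rw [e] at h ⊢ <;>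
    dsimp only at h ⊢
  all_goals
    first
    | exact absurd rfl h
    | refine ⟨rfl, ?_⟩
      by_cases hj : j = p.proc sk i
      · subst hj
        simp at h ⊢
      · rw [Function.update_of_ne hj, if_neg hj]

/-- The position of the sample has passed, so nothing is pending in this block. -/
theorem pend_of_lt (j o : ℕ) (fu : List (ℕ × ℕ)) (sk : Sk) (h : o < sk.pos j) :
    pend p u j o fu sk = 1 := by
  induction fu generalizing sk with
  | nil => rfl
  | cons a fu ih =>
    unfold pend
    rw [if_neg (by rintro ⟨-, h'⟩; omega), one_mul]
    split_ifs with h0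
    · rfl
    · refine ih _ ?_
      rw [(step_pos sk a.1 j h0).2]; split <;> omega

/-- Each offset selects at most one arrival of the block, so `pend` is one factor or `1`, and the
excess is additive over the arrivals. -/
theorem sum_pend (hp : p.Valid) (j : ℕ) (fu : List (ℕ × ℕ)) (sk : Sk) (hsk : SkOk p sk) :
    ∑ o ∈ Finset.range sk.W, (pend p u j o fu sk - 1) = blkSum p u j fu sk := by
  induction fu generalizing sk with
  | nil => simp [pend, blkSum]
  | cons a fu ih =>
    obtain ⟨i, v⟩ := a
    have hpos : sk.pos j < sk.W := by
      have := hsk.pos j; have := hp.blk_le sk.W; have := hsk.scale.1; omega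
    simp only [pend, blkSum]
    set f := fac p u (fu.map Prod.snd) sk v
    -- the remaining factor
    have rest : ∑ o ∈ Finset.range sk.W,
        ((if (p.step sk i).pos j = 0 then 1 else pend p u j o fu (p.step sk i)) - 1) =
        if (p.step sk i).pos j = 0 then 0 else blkSum p u j fu (p.step sk i) := by
      split_ifs with h0
      · simp
      · rw [← ih _ (hsk.step hp i), (step_pos sk i j h0).1]
    rw [← rest]
    by_cases hj : p.proc sk i = j
    swap
    · simp [hj]
    -- The offset that selects the present arrival contributes nothing afterwards, so its factor
    -- stands alone.
    · have cur : ∀ o, o = sk.pos j →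
          (if (p.step sk i).pos j = 0 then 1 else pend p u j o fu (p.step sk i)) = 1 := by
        intro o ho
        split_ifs with h0
        · rfl
        · refine pend_of_lt _ _ _ _ ?_
          rw [(step_pos sk i j h0).2, if_pos hj.symm]; omega
      simp only [hj, true_and, if_true]
      rw [← Finset.add_sum_erase _ _ (Finset.mem_range.2 hpos),
        ← Finset.add_sum_erase _ (fun o => (if (p.step sk i).pos j = 0 then (1 : ℝ) else _) - 1)
          (Finset.mem_range.2 hpos), if_pos rfl, cur _ rfl]
      rw [Finset.sum_congr rfl fun o ho => by
        rw [if_neg (fun h => Finset.ne_of_mem_erase ho h.symm), one_mul]]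
      ring

/-- The average over the `W` offsets is `1 + blkSum / W`, at most its exponential. -/
theorem sum_pend_le (hp : p.Valid) (j : ℕ) (fu : List (ℕ × ℕ)) (sk : Sk) (hsk : SkOk p sk) :
    (∑ o ∈ Finset.range sk.W, pend p u j o fu sk) / sk.W ≤ Real.exp (blkSum p u j fu sk / sk.W) := by
  have hW : (0 : ℝ) < sk.W := by exact_mod_cast hsk.scale.1
  have h := sum_pend (u := u) hp j fu sk hsk
  rw [Finset.sum_sub_distrib] at h
  simp only [Finset.sum_const, Finset.card_range, nsmul_eq_mul, mul_one] at h
  have e : (∑ o ∈ Finset.range sk.W, pend p u j o fu sk) / sk.W = blkSum p u j fu sk / sk.W + 1 := by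
    rw [← h]; field_simp; ring
  rw [e]
  exact Real.add_one_le_exp _

theorem corr_other (j i v : ℕ) (fu : List (ℕ × ℕ)) (sk : Sk) (o : ℕ → ℕ) (x : ℕ)
    (hj : j ≠ p.proc sk i) :
    corr p u fu (p.step sk i) (Function.update o (p.proc sk i) x) j = corr p u ((i, v) :: fu) sk o j := by
  unfold corr
  rw [Function.update_of_ne hj]
  simp only [pend, blkSum]
  have e2 : ¬ p.proc sk i = j := fun h => hj h.symm
  simp only [e2, if_false, false_and]
  by_cases h0 : (p.step sk i).pos j = 0
  · simp [h0]
  · obtain ⟨h1, h2⟩ := step_pos sk i j h0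
    rw [if_neg hj] at h2
    rw [if_neg h0, if_neg (by rwa [← h2]), if_neg h0, if_neg h0, h1, one_mul, zero_add]

-- When a block begins, the average over its offset is replaced by an exponential of the summed
-- excess; `corr` compares, within a block, the factor for the drawn offset with that exponential.
-- For `W = 1` nothing is random and `facLog` is the logarithm itself, since with many copies per
-- item the excess of the power would be too large.
set_option maxHeartbeats 1000000 in
theorem Qf_le (hp : p.Valid) (hf : ∀ l W T Lh v, fresh p u l W T Lh v ≠ ⊤) (fu : List (ℕ × ℕ))
    {sk : Sk} {L : ℕ} (hsk : SkI p sk L) (hi : ∀ a ∈ fu, a.1 < p.k) (o : ℕ → ℕ) :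
    Qf p u fu sk o ≤ ENNReal.ofReal (Real.exp (facSum p u fu sk) *
      ∏ j ∈ Finset.range p.k, corr p u fu sk o j) := by
  induction fu generalizing sk L o with
  | nil => simp [Qf, facSum, corr, pend, blkSum]
  | cons a fu ih =>
    obtain ⟨i, v⟩ := a
    have hik : i < p.k := hi (i, v) (by simp)
    have hq := Finset.mem_range.2 (proc_lt_k hp sk hik)
    set q := p.proc sk i with hqd
    have hW : (0 : ℝ) < sk.W := by exact_mod_cast hsk.ok.scale.1
    obtain ⟨b, hb⟩ := hsk.two
    have hb' : 2 ^ (Nat.size sk.W - 1) = sk.W := by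
      rw [hb, Nat.size_pow]; simp
    obtain ⟨f, hfd⟩ : ∃ f, f = fac p u (fu.map Prod.snd) sk v := ⟨_, rfl⟩
    have hf0 : 0 ≤ f := hfd ▸ fac_nonneg _ _ _
    have hif : ∀ x, 0 ≤ if x = sk.pos q then f else 1 := fun x => by
      split_ifs; exacts [hf0, zero_le_one]
    have hfr : fresh p u (fu.map Prod.snd) sk.W sk.T sk.Lh v ^ (p.P / sk.T + 1) = ENNReal.ofReal f := by
      rw [hfd, fac, ENNReal.ofReal_toReal (ENNReal.pow_ne_top (hf _ _ _ _ _))]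
    set sk' := p.step sk i with hsk'
    obtain ⟨c, hc⟩ : ∃ c, c = Real.exp (facSum p u fu sk') * ∏ j ∈ (Finset.range p.k).erase q,
      corr p u ((i, v) :: fu) sk o j := ⟨_, rfl⟩
    have hc0 : 0 ≤ c := hc ▸ mul_nonneg (Real.exp_nonneg _) (Finset.prod_nonneg fun j _ => corr_nonneg _ _ _ _)
    -- the factor of the current site
    obtain ⟨r, hr⟩ : ∃ r : ℕ → ℝ, ∀ x, r x = (if x = sk.pos q then f else 1) *
      if sk'.pos q = 0 then 1 else pend p u q x fu sk' * Real.exp (-(blkSum p u q fu sk' / sk'.W)) :=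
      ⟨_, fun _ => rfl⟩
    have hr0 : ∀ x, 0 ≤ r x := fun x => hr x ▸ mul_nonneg (hif x)
      (by split_ifs; exacts [zero_le_one, mul_nonneg (pend_nonneg _ _ _ _) (Real.exp_nonneg _)])
    have main : ∀ x, (if x = sk.pos q then
        fresh p u (fu.map Prod.snd) sk.W sk.T sk.Lh v ^ (p.P / sk.T + 1) else 1) *
        Qf p u fu sk' (Function.update o q x) ≤ ENNReal.ofReal (c * r x) := by
      intro x
      refine (mul_le_mul_right (ih (hsk.step hp hik) (fun a ha => hi a (by simp [ha])) _) _).trans_eq ?_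
      have e1 : (if x = sk.pos q then fresh p u (fu.map Prod.snd) sk.W sk.T sk.Lh v ^ (p.P / sk.T + 1)
          else 1) = ENNReal.ofReal (if x = sk.pos q then f else 1) := by
        split_ifs
        · exact hfr
        · simp
      rw [e1, ← ENNReal.ofReal_mul (hif x), ← Finset.mul_prod_erase _ _ hq,
        Finset.prod_congr rfl fun j hj => corr_other j i v fu sk o x (Finset.ne_of_mem_erase hj)]
      congr 1
      rw [hr, hc]
      have e2 : corr p u fu (p.step sk i) (Function.update o q x) q = if sk'.pos q = 0 then 1 else
          pend p u q x fu sk' * Real.exp (-(blkSum p u q fu sk' / sk'.W)) := by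
        unfold corr; rw [Function.update_self]
      rw [e2]
      ring
    have eblk : blkSum p u q ((i, v) :: fu) sk = (f - 1) +
        if sk'.pos q = 0 then 0 else blkSum p u q fu sk' := by
      simp only [blkSum]; rw [if_pos hqd.symm, hfd]
    have epend : ∀ x, r x = pend p u q x ((i, v) :: fu) sk *
        Real.exp (-((if sk'.pos q = 0 then 0 else blkSum p u q fu sk') / sk.W)) := by
      intro x
      rw [hr]
      simp only [pend]
      have : (p.proc sk i = q ∧ sk.pos q = x) ↔ x = sk.pos q := ⟨fun h => h.2.symm, fun h => ⟨rfl, h.symm⟩⟩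
      simp only [this, ← hfd]
      by_cases h0 : sk'.pos q = 0
      · rw [if_pos h0, if_pos h0, if_pos h0]; simp
      · rw [if_neg h0, if_neg h0, if_neg h0, (step_pos sk i q h0).1, mul_assoc]
    obtain ⟨y, hy⟩ : ∃ y, y = facLog p u (fu.map Prod.snd) sk v := ⟨_, rfl⟩
    have esum : facSum p u ((i, v) :: fu) sk = y + facSum p u fu sk' := by rw [hy]; rfl
    rw [Qf]
    dsimp only
    rw [esum, ← Finset.mul_prod_erase _ _ hq]
    by_cases h0 : sk.pos q = 0
    · rw [if_pos h0, hb']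
      have e3 : corr p u ((i, v) :: fu) sk o q = 1 := by unfold corr; rw [if_pos h0]
      have : ∀ x ∈ Finset.range sk.W, _ := fun x _ => main x
      refine (ENNReal.div_le_div_right (Finset.sum_le_sum this) _).trans ?_
      rw [← ENNReal.ofReal_sum_of_nonneg fun x _ => mul_nonneg hc0 (hr0 x)]
      have e4 : (2 : ℝ≥0∞) ^ (Nat.size sk.W - 1) = ENNReal.ofReal sk.W := by
        rw [ENNReal.ofReal_natCast]; exact_mod_cast hb'
      rw [e4, ← ENNReal.ofReal_div_of_pos hW]
      refine ENNReal.ofReal_le_ofReal ?_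
      rw [← Finset.mul_sum, mul_div_assoc]
      -- The average over the offset of a new block, by `sum_pend_le`; the remainder of `blkSum`
      -- cancels against the exponential in `corr`.
      have e5 : (∑ x ∈ Finset.range sk.W, r x) / sk.W ≤ Real.exp y := by
        rw [hy, facLog, ← hfd]
        split_ifs with hW1
        · have h1 : sk'.pos q = 0 := by
            by_contra h1
            have h2 := step_pos sk i q h1
            refine h1 ((hsk.ok.step hp i).pos_eq_zero ?_ q)
            rw [h2.1, hW1, blk_one hp]
          rw [hW1, Finset.sum_range_one, hr, if_pos h1, if_pos h0.symm]
          simpa using Real.le_exp_log f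
        rw [Finset.sum_congr rfl fun x _ => epend x, ← Finset.sum_mul, mul_div_right_comm]
        refine (mul_le_mul_of_nonneg_right (sum_pend_le hp q _ sk hsk.ok) (Real.exp_nonneg _)).trans_eq ?_
        rw [← Real.exp_add, eblk]
        congr 1
        ring
      refine (mul_le_mul_of_nonneg_left e5 hc0).trans_eq ?_
      rw [hc, e3, Real.exp_add]
      ring
    · have hW1 : sk.W ≠ 1 := fun h1 => h0 (hsk.ok.pos_eq_zero (by rw [h1, blk_one hp]) q)
      have ey : y = (f - 1) / sk.W := by rw [hy, facLog, if_neg hW1, hfd]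
      rw [if_neg h0, ey]
      refine (main _).trans_eq ?_
      congr 1
      have e3 : corr p u ((i, v) :: fu) sk o q = pend p u q (o q) ((i, v) :: fu) sk *
          Real.exp (-(blkSum p u q ((i, v) :: fu) sk / sk.W)) := by unfold corr; rw [if_neg h0]
      rw [epend, e3, eblk, hc, Real.exp_add, add_div, neg_add, Real.exp_add]
      have : Real.exp ((f - 1) / sk.W) * Real.exp (-((f - 1) / sk.W)) = 1 := by
        rw [← Real.exp_add, add_neg_cancel, Real.exp_zero]
      have key : ∀ z r d g e e' : ℝ, e * e' = 1 → z * r * (d * g) = e * z * (d * (e' * g) * r) := by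
        intro z r d g e e' h
        linear_combination (-(z * r * d * g)) * h
      exact key _ _ _ _ _ _ this

theorem facSum_eq (fu : List (ℕ × ℕ)) (sk : Sk) : facSum p u fu sk =
    ∑ t ∈ Finset.range fu.length, facLog p u ((fu.map Prod.snd).drop (t + 1)) (p.steps sk (fu.take t))
      ((fu.map Prod.snd).getD t 0) := by
  induction fu generalizing sk with
  | nil => rfl
  | cons a fu ih =>
    obtain ⟨i, v⟩ := a
    rw [List.length_cons, Finset.sum_range_succ', facSum, ih, add_comm]
    rfl

theorem Qf_init_le (hp : p.Valid) (hf : ∀ l W T Lh v, fresh p u l W T Lh v ≠ ⊤) (fu : List (ℕ × ℕ))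
    (hi : ∀ a ∈ fu, a.1 < p.k) (o : ℕ → ℕ) :
    Qf p u fu sk₀ o ≤ ENNReal.ofReal (Real.exp (facSum p u fu sk₀)) := by
  refine (Qf_le hp hf fu (skI_init hp) hi o).trans_eq ?_
  congr 1
  rw [Finset.prod_eq_one fun j _ => ?_, mul_one]
  exact if_pos rfl

end Monitoring
end

/-! ### A dilogarithm series for the increments of `x log x`. -/

noncomputable section
open scoped ENNReal
namespace Monitoring

/-! ### A series for logarithms -/

/-- The dilogarithm, up to a change of variables. -/
def dil (y : ℝ) : ℝ := ∑' i : ℕ, (1 - Real.exp (-(y * (i + 1)))) / (i + 1) ^ 2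

theorem summable_sq : Summable fun i : ℕ => 1 / ((i : ℝ) + 1) ^ 2 := by
  have := (summable_nat_add_iff 1).2 (Real.summable_one_div_nat_pow.2 one_lt_two)
  simpa using this

theorem dil_term {y : ℝ} (hy : 0 ≤ y) (i : ℕ) :
    ‖(1 - Real.exp (-(y * (i + 1)))) / ((i : ℝ) + 1) ^ 2‖ ≤ 1 / ((i : ℝ) + 1) ^ 2 := by
  have h1 : Real.exp (-(y * (i + 1))) ≤ 1 := Real.exp_le_one_iff.2 (by
    have : 0 ≤ y * (i + 1) := by positivity
    linarith)
  have h2 := Real.exp_pos (-(y * (i + 1)))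
  rw [Real.norm_of_nonneg (div_nonneg (by linarith) (by positivity))]
  gcongr
  linarith

theorem dil_summable {y : ℝ} (hy : 0 ≤ y) :
    Summable fun i : ℕ => (1 - Real.exp (-(y * (i + 1)))) / ((i : ℝ) + 1) ^ 2 :=
  Summable.of_norm_bounded summable_sq (dil_term hy)

/-- Termwise differentiation gives `∑ e^(-yi) / i = -log (1 - e^(-y))`. -/
theorem dil_hasDerivAt {y : ℝ} (hy : 0 < y) :
    HasDerivAt dil (-Real.log (1 - Real.exp (-y))) y := by
  have e : ∀ z : ℝ, ∀ i : ℕ, Real.exp (-(z * (i + 1))) = Real.exp (-z) ^ (i + 1) := fun z i => by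
    rw [← Real.exp_nat_mul]; congr 1; push_cast; ring
  have hx : ∀ z : ℝ, 0 < z → |Real.exp (-z)| < 1 := fun z hz => by
    rw [abs_of_pos (Real.exp_pos _)]; exact Real.exp_lt_one_iff.2 (by linarith)
  have hs := Real.hasSum_pow_div_log_of_abs_lt_one (hx y hy)
  rw [← hs.tsum_eq]
  -- On the half-line beyond `y / 2` the derivatives are dominated by a geometric series.
  have hy2 : 0 < y / 2 := by linarith
  have hu : Summable fun i : ℕ => Real.exp (-(y / 2)) ^ (i + 1) :=
    (summable_nat_add_iff 1).2 (summable_geometric_of_lt_one (Real.exp_nonneg _)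
      (Real.exp_lt_one_iff.2 (by linarith)))
  refine hasDerivAt_tsum_of_isPreconnected
    (g := fun (i : ℕ) z => (1 - Real.exp (-(z * (i + 1)))) / ((i : ℝ) + 1) ^ 2) (g' := fun i z => Real.exp (-z) ^ (i + 1) / ((i : ℝ) + 1))
    hu (isOpen_Ioi (a := y / 2)) isPreconnected_Ioi
    (fun i z _ => ?_) (fun i z hz => ?_) (y₀ := y) (by simp; linarith) (dil_summable hy.le)
    (by simp; linarith)
  · rw [← e]
    have h1 : HasDerivAt (fun z : ℝ => -(z * (i + 1))) (-(1 * ((i : ℝ) + 1))) z :=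
      ((hasDerivAt_id z).mul_const _).neg
    have := (h1.exp.const_sub 1).div_const (((i : ℝ) + 1) ^ 2)
    refine this.congr_deriv ?_
    have : (i : ℝ) + 1 ≠ 0 := by positivity
    field_simp
  · have hz' : y / 2 < z := hz
    rw [Real.norm_of_nonneg (by positivity)]
    refine (div_le_self (by positivity) (by simp)).trans ?_
    gcongr

theorem dil_continuousOn : ContinuousOn dil (Set.Ici 0) :=
  continuousOn_tsum (fun i => by fun_prop) summable_sq fun i y hy => dil_term hy i

theorem dil_zero : dil 0 = 0 := by simp [dil]

/-- From `z e^(-z) ≤ 1 - e^(-z) ≤ z` the derivative of `dil` lies between `-log z` and `-log z + z`.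
All functions compared vanish at `0`. -/
theorem dil_bounds {y : ℝ} (hy : 0 ≤ y) :
    y + Real.negMulLog y ≤ dil y ∧ dil y ≤ y + Real.negMulLog y + y ^ 2 / 2 := by
  have hd : ∀ z : ℝ, 0 < z → HasDerivAt (fun z => z + Real.negMulLog z) (-Real.log z) z := fun z hz =>
    ((hasDerivAt_id z).add (Real.hasDerivAt_negMulLog hz.ne')).congr_deriv (by ring)
  have hc : ContinuousOn (fun z => z + Real.negMulLog z) (Set.Ici 0) :=
    (continuous_id.add Real.continuous_negMulLog).continuousOn
  have e1 : ∀ z : ℝ, 0 < z → 0 < 1 - Real.exp (-z) := fun z hz => by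
    have := Real.exp_lt_one_iff.2 (show -z < 0 by linarith); linarith
  constructor
  · have hm : MonotoneOn (fun z => dil z - (z + Real.negMulLog z)) (Set.Ici 0) := by
      refine monotoneOn_of_hasDerivWithinAt_nonneg (convex_Ici 0) (dil_continuousOn.sub hc)
        (f' := fun z => -Real.log (1 - Real.exp (-z)) - -Real.log z) (fun z hz => ?_) fun z hz => ?_
      · rw [interior_Ici] at hz
        exact ((dil_hasDerivAt hz).sub (hd z hz)).hasDerivWithinAt
      · rw [interior_Ici] at hz
        have hz' : 0 < z := hz
        have := Real.add_one_le_exp (-z)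
        have := Real.log_le_log (e1 z hz') (show 1 - Real.exp (-z) ≤ z by linarith)
        linarith
    have := hm (Set.mem_Ici.2 le_rfl) (Set.mem_Ici.2 hy) hy
    simp only [dil_zero, Real.negMulLog_zero] at this
    linarith
  · have hm : MonotoneOn (fun z => z + Real.negMulLog z + z ^ 2 / 2 - dil z) (Set.Ici 0) := by
      refine monotoneOn_of_hasDerivWithinAt_nonneg (convex_Ici 0)
        ((hc.add (by fun_prop)).sub dil_continuousOn)
        (f' := fun z => -Real.log z + z - -Real.log (1 - Real.exp (-z))) (fun z hz => ?_) fun z hz => ?_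
      · rw [interior_Ici] at hz
        have h2 : HasDerivAt (fun z : ℝ => z ^ 2 / 2) z z :=
          ((hasDerivAt_pow 2 z).div_const 2).congr_deriv (by simp)
        exact (((hd z hz).add h2).sub (dil_hasDerivAt hz)).hasDerivWithinAt
      · rw [interior_Ici] at hz
        have hz' : 0 < z := hz
        have h3 : z * Real.exp (-z) ≤ 1 - Real.exp (-z) := by
          have h4 := Real.add_one_le_exp z
          have h5 : Real.exp z * Real.exp (-z) = 1 := by rw [← Real.exp_add]; simp
          have h6 := Real.exp_pos (-z)
          nlinarith
        have h7 := Real.log_le_log (by positivity) h3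
        rw [Real.log_mul hz'.ne' (Real.exp_ne_zero _), Real.log_exp] at h7
        linarith
    have := hm (Set.mem_Ici.2 le_rfl) (Set.mem_Ici.2 hy) hy
    simp only [dil_zero, Real.negMulLog_zero] at this
    linarith

/-- The increment of `x ↦ x log x`. -/
def inc (r : ℕ) : ℝ := (r + 1) * Real.log (r + 1) - r * Real.log r

theorem inc_bounds (r : ℕ) : 0 ≤ inc r ∧ inc r ≤ 1 + Real.log (r + 1) := by
  unfold inc
  rcases Nat.eq_zero_or_pos r with rfl | hr
  · simp
  · have h0 : (0 : ℝ) < r := by exact_mod_cast hr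
    have h1 : Real.log r ≤ Real.log (r + 1) := Real.log_le_log h0 (by linarith)
    have h2 : 0 ≤ Real.log ((r : ℝ) + 1) := Real.log_nonneg (by linarith)
    have h3 : Real.log ((r : ℝ) + 1) - Real.log r ≤ 1 / r := by
      rw [← Real.log_div (by positivity) (by positivity)]
      have := Real.log_le_sub_one_of_pos (show 0 < ((r : ℝ) + 1) / r by positivity)
      refine this.trans_eq ?_
      field_simp; ring
    have h4 : (r : ℝ) * (Real.log (r + 1) - Real.log r) ≤ 1 := by
      calc _ ≤ (r : ℝ) * (1 / r) := by gcongr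
        _ = 1 := by field_simp
    constructor
    · nlinarith
    · linarith

def serTerm (q : ℝ) (r i : ℕ) : ℝ := (1 - q ^ (r * i)) * (1 - q ^ i) / (i : ℝ) ^ 2

/-- By `(1-a)(1-b) = (1-a) + (1-b) - (1-ab)` the series is a second difference of `dil`. -/
theorem serTerm_hasSum {h : ℝ} (hh : 0 ≤ h) (r : ℕ) :
    HasSum (fun i => serTerm (Real.exp (-h)) r (i + 1)) (dil (h * r) + dil h - dil (h * (r + 1))) := by
  have s1 := (dil_summable (show 0 ≤ h * r by positivity)).hasSum
  have s2 := (dil_summable hh).hasSum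
  have s3 := (dil_summable (show 0 ≤ h * ((r : ℝ) + 1) by positivity)).hasSum
  refine ((s1.add s2).sub s3).congr_fun fun i => ?_
  have e : ∀ a : ℕ, Real.exp (-h) ^ a = Real.exp (-(h * a)) := fun a => by
    rw [← Real.exp_nat_mul]; congr 1; ring
  have e2 : Real.exp (-(h * (r + 1) * ((i : ℝ) + 1))) =
      Real.exp (-(h * r * ((i : ℝ) + 1))) * Real.exp (-(h * ((i : ℝ) + 1))) := by
    rw [← Real.exp_add]; congr 1; ring
  unfold serTerm
  rw [e, e, e2]
  push_cast
  rw [← mul_assoc h]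
  ring

theorem serTerm_nonneg {q : ℝ} (h0 : 0 ≤ q) (h1 : q ≤ 1) (r i : ℕ) : 0 ≤ serTerm q r i :=
  div_nonneg (mul_nonneg (sub_nonneg.2 (pow_le_one₀ h0 h1)) (sub_nonneg.2 (pow_le_one₀ h0 h1)))
    (by positivity)

theorem serTerm_le {q : ℝ} (h0 : 0 ≤ q) (h1 : q ≤ 1) (r i : ℕ) : serTerm q r i ≤ 1 / (i : ℝ) ^ 2 := by
  unfold serTerm
  gcongr
  have := pow_le_one₀ (n := r * i) h0 h1
  have := pow_le_one₀ (n := i) h0 h1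
  have := pow_nonneg h0 (r * i)
  have := pow_nonneg h0 i
  nlinarith

/-- The tail telescopes, as `1/(J+1)² ≤ 1/J - 1/(J+1)`. -/
theorem sum_tail_le {φ : ℕ → ℝ} (hφ : ∀ i : ℕ, φ i ≤ 1 / ((i : ℝ) + 1) ^ 2) {I J : ℕ} (hI : 0 < I)
    (hJ : I ≤ J) : ∑ i ∈ Finset.range J, φ i ≤ ∑ i ∈ Finset.range I, φ i + 1 / I - 1 / J := by
  induction J, hJ using Nat.le_induction with
  | base => linarith
  | succ J hJ ih =>
    rw [Finset.sum_range_succ]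
    have hJ0 : (0 : ℝ) < J := by exact_mod_cast hI.trans_le hJ
    have h1 := hφ J
    have h2 : 1 / ((J : ℝ) + 1) ^ 2 ≤ 1 / J - 1 / (J + 1) := by
      rw [div_sub_div _ _ hJ0.ne' (by positivity), div_le_div_iff₀ (by positivity) (by positivity)]
      nlinarith
    push_cast
    linarith

/-- The series approximates the increments of `x ↦ x log x`. -/
theorem series_bounds {K : ℝ} (hK : 2 ≤ K) (r : ℕ) {I : ℕ} (hI : 0 < I) :
    |K * ∑ i ∈ Finset.range I, serTerm (1 - 1 / K) r (i + 1) - inc r| ≤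
      6 * (r + 1) ^ 2 / K + K / I := by
  have hK0 : 0 < K := by linarith
  have hq0 : 0 < 1 - 1 / K := by
    have : 1 / K ≤ 1 / 2 := by gcongr
    linarith
  have hq1 : 1 - 1 / K ≤ 1 := by have : 0 ≤ 1 / K := by positivity
                                 linarith
  -- The step of the second difference; it satisfies `K h = 1 + O(1/K)`.
  set h := -Real.log (1 - 1 / K) with hh
  have hq : 1 - 1 / K = Real.exp (-h) := by rw [hh, neg_neg, Real.exp_log hq0]
  have h1 : 1 / K ≤ h := by
    have := Real.log_le_sub_one_of_pos hq0; linarith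
  have h2 : h ≤ 1 / K + 2 / K ^ 2 := by
    have := Real.one_sub_inv_le_log_of_pos hq0
    have e : 1 - (1 - 1 / K)⁻¹ = -(1 / (K - 1)) := by
      have : K - 1 ≠ 0 := by linarith
      have : 1 - 1 / K = (K - 1) / K := by field_simp
      rw [this, inv_div]
      field_simp; ring
    have e3 : 1 / (K - 1) ≤ 1 / K + 2 / K ^ 2 := by
      have : 1 / K + 2 / K ^ 2 = (K + 2) / K ^ 2 := by field_simp
      rw [this, div_le_div_iff₀ (by linarith) (by positivity)]
      nlinarith
    rw [e] at this
    linarith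
  have hh0 : 0 ≤ h := le_trans (by positivity) h1
  have hs := serTerm_hasSum hh0 r
  rw [← hq] at hs
  set s := ∑ i ∈ Finset.range I, serTerm (1 - 1 / K) r (i + 1) with hsd
  set D := dil (h * r) + dil h - dil (h * (r + 1)) with hD
  have l1 : s ≤ D := sum_le_hasSum _ (fun i _ => serTerm_nonneg hq0.le hq1 _ _) hs
  have l2 : D ≤ s + 1 / I := by
    refine le_of_tendsto hs.tendsto_sum_nat ?_
    filter_upwards [Filter.eventually_ge_atTop I] with J hJ
    have := sum_tail_le (φ := fun i => serTerm (1 - 1 / K) r (i + 1)) (fun i => by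
      have := serTerm_le hq0.le hq1 r (i + 1)
      push_cast at this; exact this) hI hJ
    have : (0 : ℝ) ≤ 1 / J := by positivity
    linarith
  have r0 : (0 : ℝ) ≤ r := Nat.cast_nonneg r
  have b1 := dil_bounds (show 0 ≤ h * r by positivity)
  have b2 := dil_bounds hh0
  have b3 := dil_bounds (show 0 ≤ h * ((r : ℝ) + 1) by positivity)
  have hpos : 0 < h := lt_of_lt_of_le (by positivity) h1
  -- The linear terms and the terms with `log h` cancel, and `h * inc r` remains.
  have e4 : (h * r + Real.negMulLog (h * r)) + (h + Real.negMulLog h) -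
      (h * (r + 1) + Real.negMulLog (h * (r + 1))) = h * inc r := by
    rw [Real.negMulLog_mul, Real.negMulLog_mul]
    unfold inc Real.negMulLog
    ring
  have l3 : |D - h * inc r| ≤ h ^ 2 * (r + 1) ^ 2 := by
    rw [abs_le]
    have : 0 ≤ h ^ 2 * r := by positivity
    have : 0 ≤ h ^ 2 * r ^ 2 := by positivity
    have : 0 ≤ h ^ 2 := by positivity
    constructor <;> nlinarith
  obtain ⟨i1, i2⟩ := inc_bounds r
  have i3 : inc r ≤ r + 1 := by
    have := Real.log_le_sub_one_of_pos (show (0 : ℝ) < r + 1 by positivity)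
    linarith
  have h3 : h ≤ 2 / K := by
    refine h2.trans ?_
    have : 2 / K ^ 2 ≤ 1 / K := by
      rw [div_le_div_iff₀ (by positivity) hK0]; nlinarith
    have e : 2 / K = 1 / K + 1 / K := by ring
    linarith
  have l4 : K * h ^ 2 ≤ 4 / K := by
    have : h ^ 2 ≤ (2 / K) ^ 2 := by gcongr
    calc K * h ^ 2 ≤ K * (2 / K) ^ 2 := by gcongr
      _ = 4 / K := by field_simp; ring
  have l5 : K * h ≤ 1 + 2 / K := by
    calc K * h ≤ K * (1 / K + 2 / K ^ 2) := by gcongr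
      _ = 1 + 2 / K := by field_simp
  have l6 : 1 ≤ K * h := by
    calc 1 = K * (1 / K) := by field_simp
      _ ≤ K * h := by gcongr
  have l7 : K * |D - h * inc r| ≤ 4 / K * (r + 1) ^ 2 := by
    calc _ ≤ K * (h ^ 2 * (r + 1) ^ 2) := by gcongr
      _ = K * h ^ 2 * (r + 1) ^ 2 := by ring
      _ ≤ _ := by gcongr
  have l8 : |K * h * inc r - inc r| ≤ 2 / K * (r + 1) ^ 2 := by
    have e : K * h * inc r - inc r = (K * h - 1) * inc r := by ring
    rw [e, abs_of_nonneg (mul_nonneg (by linarith) i1)]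
    have : (0 : ℝ) ≤ r ^ 2 := by positivity
    calc (K * h - 1) * inc r ≤ 2 / K * (r + 1) := mul_le_mul (by linarith) i3 i1 (by positivity)
      _ ≤ _ := by gcongr; nlinarith
  have l9 : |K * (s - D)| ≤ K / I := by
    rw [abs_mul, abs_of_pos hK0, abs_of_nonpos (by linarith), div_eq_mul_one_div]
    gcongr
    linarith
  have e5 : K * s - inc r = K * (s - D) + K * (D - h * inc r) + (K * h * inc r - inc r) := by ring
  rw [e5]
  refine (abs_add_three _ _ _).trans ?_
  rw [abs_mul K (D - _), abs_of_pos hK0]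
  have : 6 * ((r : ℝ) + 1) ^ 2 / K = 4 / K * (r + 1) ^ 2 + 2 / K * (r + 1) ^ 2 := by ring
  linarith

end Monitoring
end

/-! ### The mean contribution of an arrival. -/

noncomputable section
open scoped ENNReal
namespace Monitoring

variable {p : Par} {u : Wt}

/-! ### The factor of a sample -/

/-- The average over the choice of a threshold. -/
def avg (a : ℕ) (φ : ℕ → ℕ → ℝ) : ℝ :=
  (∑ l ∈ Finset.range (2 ^ a), (∑ j ∈ Finset.range (2 ^ l), φ l j) / 2 ^ l) / 2 ^ a

theorem avg_mono {a : ℕ} {φ ψ : ℕ → ℕ → ℝ} (h : ∀ l < 2 ^ a, ∀ j < 2 ^ l, φ l j ≤ ψ l j) :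
    avg a φ ≤ avg a ψ := by
  unfold avg
  gcongr with l hl j hj
  exact h l (Finset.mem_range.1 hl) j (Finset.mem_range.1 hj)

theorem avg_const (a : ℕ) (c : ℝ) : avg a (fun _ _ => c) = c := by
  unfold avg
  simp

theorem avg_add (a : ℕ) (φ ψ : ℕ → ℕ → ℝ) : avg a (fun l j => φ l j + ψ l j) = avg a φ + avg a ψ := by
  unfold avg
  simp only [Finset.sum_add_distrib, add_div]

theorem avg_mul (a : ℕ) (c : ℝ) (φ : ℕ → ℕ → ℝ) : avg a (fun l j => c * φ l j) = c * avg a φ := by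
  unfold avg
  simp only [← Finset.mul_sum, mul_div_assoc]

theorem fresh_ofReal {l : List ℕ} {W T Lh v : ℕ} {φ : ℕ → ℕ → ℝ} (hφ : ∀ l j, 0 ≤ φ l j)
    (h : ∀ f < 2 ^ p.a, ∀ j < 2 ^ f, sf p.dd (u.χ₁ (p.valOf W T (2 ^ f) (j + 2 ^ f)) (Lh + p.w + 1))
      (u.χ₀ (p.valOf W T (2 ^ f) (j + 2 ^ f)) (Lh + p.w + 1)) v (p.thrOf (j + 2 ^ f)) l =
        ENNReal.ofReal (φ f j)) :
    fresh p u l W T Lh v = ENNReal.ofReal (avg p.a φ) := by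
  have e2 : ∀ b : ℕ, (2 : ℝ≥0∞) ^ b = ENNReal.ofReal (2 ^ b) := fun b => by
    rw [ENNReal.ofReal_pow (by norm_num)]; simp
  unfold fresh avg
  rw [e2, ENNReal.ofReal_div_of_pos (by positivity),
    ENNReal.ofReal_sum_of_nonneg fun l _ => div_nonneg (Finset.sum_nonneg fun j _ => hφ l j) (by positivity)]
  congr 1
  refine Finset.sum_congr rfl fun f hf => ?_
  rw [e2, ENNReal.ofReal_div_of_pos (by positivity),
    ENNReal.ofReal_sum_of_nonneg fun j _ => hφ f j]
  congr 1
  exact Finset.sum_congr rfl fun j hj => h f (Finset.mem_range.1 hf) j (Finset.mem_range.1 hj)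

theorem mix2_ofReal {b t : ℕ} (ht : t ≤ 2 ^ b) {x y : ℝ} (hx : 0 ≤ x) (hy : 0 ≤ y) :
    mix2 b t (ENNReal.ofReal x) (ENNReal.ofReal y) =
      ENNReal.ofReal (t / 2 ^ b * x + (1 - t / 2 ^ b) * y) := by
  have e2 : (2 : ℝ≥0∞) ^ b = ENNReal.ofReal (2 ^ b) := by
    rw [ENNReal.ofReal_pow (by norm_num)]; simp
  unfold mix2
  rw [e2, ← ENNReal.ofReal_natCast t, ← ENNReal.ofReal_natCast (2 ^ b - t),
    ← ENNReal.ofReal_mul (Nat.cast_nonneg _), ← ENNReal.ofReal_mul (Nat.cast_nonneg _),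
    ← ENNReal.ofReal_add (by positivity) (by positivity), ← ENNReal.ofReal_div_of_pos (by positivity)]
  congr 1
  rw [Nat.cast_sub ht]
  push_cast
  field_simp

theorem sf_const {b t : ℕ} (ht : t ≤ 2 ^ b) (x : ℝ≥0∞) (it : ℕ) (l : List ℕ) : sf b x x it t l = x := by
  induction l with
  | nil => simp [sf]
  | cons v l ih => rw [sf, ih, mix2_self ht, ite_self]

/-- The sample is missed by all later occurrences with probability `(1 - t/2^b) ^ count`. Threshold
`0` is excluded because it encodes a hit. -/
theorem sf_ofReal {b t : ℕ} (ht : t ≤ 2 ^ b) (h0 : 0 < t) {x : ℝ} (hx : 0 ≤ x) (it : ℕ) (l : List ℕ) :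
    sf b (ENNReal.ofReal x) 1 it t l =
      ENNReal.ofReal (1 + (1 - (1 - t / 2 ^ b) ^ l.count it) * (x - 1)) := by
  have hτ : (0 : ℝ) ≤ t / 2 ^ b := by positivity
  have hτ1 : (t : ℝ) / 2 ^ b ≤ 1 := by
    rw [div_le_one (by positivity)]; exact_mod_cast ht
  induction l with
  | nil => simp [sf, h0.ne']
  | cons v l ih =>
    rw [sf, ih]
    have hp0 : (0 : ℝ) ≤ (1 - t / 2 ^ b) ^ l.count it := by
      refine pow_nonneg ?_ _; linarith
    have hp1 : (1 - (t : ℝ) / 2 ^ b) ^ l.count it ≤ 1 := pow_le_one₀ (by linarith) (by linarith)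
    by_cases hv : it = v
    · subst hv
      rw [if_pos rfl, mix2_ofReal ht hx (by nlinarith), List.count_cons_self, pow_succ]
      congr 1
      ring
    · rw [if_neg hv, List.count_cons_of_ne (fun h => hv h.symm)]

/-- The contribution of an item to the exponent, if its samples have the average factor `r`. -/
theorem facLog_le (hp : p.Valid) {sk : Sk} {L : ℕ} (h : SkI p sk L) {l : List ℕ} {v : ℕ} {r : ℝ}
    (hr : 0 < r) (hf : fresh p u l sk.W sk.T sk.Lh v = ENNReal.ofReal r) :
    facLog p u l sk v ≤ (p.P / sk.T + 1 : ℕ) / sk.W * (r - 1) := by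
  have hfac : fac p u l sk v = r ^ (p.P / sk.T + 1) := by
    unfold fac
    rw [hf, ENNReal.toReal_pow, ENNReal.toReal_ofReal hr.le]
  unfold facLog
  rw [hfac]
  split_ifs with hW
  · rw [hW, Real.log_pow, Nat.cast_one, div_one]
    exact mul_le_mul_of_nonneg_left (Real.log_le_sub_one_of_pos hr) (Nat.cast_nonneg _)
  · have h1 := h.ok.scale.1
    have h2 : 2 ≤ sk.W := by omega
    -- Once `W ≥ 2`, `T ≥ W P > P`, and an item is stored in a single copy.
    have h3 : p.P / sk.T = 0 := by
      refine Nat.div_eq_of_lt ?_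
      have h4 := h.low.resolve_left hW
      have := hp.P_pos
      nlinarith
    rw [h3]
    simp
    rw [div_eq_inv_mul]

theorem rate_le (hp : p.Valid) {sk : Sk} {L : ℕ} (h : SkI p sk L) :
    ((p.P / sk.T + 1 : ℕ) : ℝ) / sk.W ≤ 3 * p.P / sk.T := by
  have hT : (0 : ℝ) < sk.T := by exact_mod_cast h.ok.length
  have hW : (1 : ℝ) ≤ sk.W := by exact_mod_cast h.ok.scale.1
  have hP : (0 : ℝ) < p.P := by exact_mod_cast hp.P_pos
  have h1 : ((p.P / sk.T : ℕ) : ℝ) ≤ p.P / sk.T := Nat.cast_div_le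
  have h2 : (sk.T : ℝ) < 2 * sk.W * p.P := by exact_mod_cast h.high
  rw [Nat.cast_add, Nat.cast_one, add_div]
  have h3 : ((p.P / sk.T : ℕ) : ℝ) / sk.W ≤ p.P / sk.T := (div_le_self (Nat.cast_nonneg _) hW).trans h1
  have h4 : (1 : ℝ) / sk.W ≤ 2 * p.P / sk.T := by
    rw [div_le_div_iff₀ (by linarith) hT]; linarith
  have : 3 * (p.P : ℝ) / sk.T = p.P / sk.T + 2 * p.P / sk.T := by ring
  linarith

/-- A copy stands for at most `T / P` arrivals, which bounds the values of samples. -/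
theorem omega_le (hp : p.Valid) {sk : Sk} {L : ℕ} (h : SkI p sk L) :
    (sk.W : ℝ) / (p.P / sk.T + 1 : ℕ) ≤ sk.T / p.P := by
  have hT : (0 : ℝ) < sk.T := by exact_mod_cast h.ok.length
  have hP : (0 : ℝ) < p.P := by exact_mod_cast hp.P_pos
  rw [div_le_div_iff₀ (by positivity) hP]
  rcases h.low with h1 | h1
  · have : p.P < (p.P / sk.T + 1) * sk.T := by
      rw [← Nat.div_lt_iff_lt_mul h.ok.length]; omega
    rw [h1]
    have : (p.P : ℝ) < (p.P / sk.T + 1 : ℕ) * sk.T := by exact_mod_cast this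
    push_cast at this ⊢
    linarith
  · have h2 : (sk.W : ℝ) * p.P ≤ sk.T := by exact_mod_cast h1
    refine h2.trans (le_mul_of_one_le_right hT.le ?_)
    simp

/-! ### The values of samples -/

theorem Par.Valid.K_ge (hp : p.Valid) : 2 ^ 20 * (p.w ^ 2 * p.e) ≤ p.K ∧ 2 ≤ p.K := by
  have h1 := hp.w
  have h2 := hp.e
  have h3 : 1 ≤ p.w * p.w := Nat.mul_pos h1 h1
  unfold Par.K
  constructor
  · exact le_of_eq (by ring)
  · nlinarith

theorem Par.Valid.K_le (hp : p.Valid) : p.K ≤ 2 ^ (20 + 3 * p.lg) := by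
  have hs := hp.size_le_lg
  have h1 : p.w < 2 ^ p.lg := (Nat.lt_size_self _).trans_le (Nat.pow_le_pow_right (by norm_num) hs.2.2.1)
  have h2 : p.e < 2 ^ p.lg := (Nat.lt_size_self _).trans_le
    (Nat.pow_le_pow_right (by norm_num) hs.2.2.2.1)
  unfold Par.K
  calc 2 ^ 20 * (p.w * p.w) * p.e ≤ 2 ^ 20 * (2 ^ p.lg * 2 ^ p.lg) * 2 ^ p.lg := by gcongr
    _ = 2 ^ (20 + 3 * p.lg) := by ring

/-- The decay of the series. -/
def Par.q (p : Par) : ℝ := 1 - 1 / p.K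

theorem Par.Valid.q_bounds (hp : p.Valid) : 0 ≤ p.q ∧ p.q ≤ 1 ∧ 0 < (p.K : ℝ) := by
  have h2 : (2 : ℝ) ≤ p.K := by exact_mod_cast hp.K_ge.2
  unfold Par.q
  have : 1 / (p.K : ℝ) ≤ 1 := by rw [div_le_one (by linarith)]; linarith
  have : 0 < 1 / (p.K : ℝ) := by positivity
  refine ⟨by linarith, by linarith, by linarith⟩

theorem pow_ratio (hp : p.Valid) (i : ℕ) :
    ((p.K ^ i - (p.K - 1) ^ i : ℕ) : ℝ) / (p.K ^ i : ℕ) = 1 - p.q ^ i := by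
  obtain ⟨-, -, hK⟩ := hp.q_bounds
  have h1 := hp.K_ge.2
  have h2 : (p.K - 1) ^ i ≤ p.K ^ i := Nat.pow_le_pow_left (by omega) i
  rw [Nat.cast_sub h2]
  push_cast [Nat.cast_sub (show 1 ≤ p.K by omega)]
  unfold Par.q
  rw [sub_div, div_self (by positivity), ← div_pow, sub_div, div_self hK.ne']

/-- As `K^i - (K-1)^i ≥ K^(i-1)` and `2^dd ≥ K`, rounding cannot produce the threshold `0`, which
would count as a hit. -/
theorem thrOf_pos (hp : p.Valid) {i : ℕ} (hi : 0 < i) : 0 < p.thrOf i := by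
  have hK := hp.K_ge.2
  unfold Par.thrOf
  refine Nat.div_pos ?_ (by positivity)
  obtain ⟨i, rfl⟩ := Nat.exists_eq_add_of_lt hi
  rw [zero_add]
  have h1 : (p.K - 1) ^ (i + 1) + p.K ^ i ≤ p.K ^ (i + 1) := by
    have h2 : (p.K - 1) ^ i ≤ p.K ^ i := Nat.pow_le_pow_left (by omega) i
    obtain ⟨k, hk⟩ : ∃ k, p.K = k + 1 := ⟨p.K - 1, by omega⟩
    rw [hk] at h2 ⊢
    rw [Nat.add_sub_cancel] at h2 ⊢
    rw [pow_succ, pow_succ]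
    nlinarith
  have h3 : p.K ≤ 2 ^ p.dd := hp.K_le.trans (Nat.pow_le_pow_right (by norm_num) (by
    have := hp.lg_pos; unfold Par.dd; omega))
  calc p.K ^ (i + 1) = p.K * p.K ^ i := by ring
    _ ≤ 2 ^ p.dd * (p.K ^ (i + 1) - (p.K - 1) ^ (i + 1)) := Nat.mul_le_mul h3 (by omega)

theorem div_bounds (a b : ℕ) : (a : ℝ) / b - 1 ≤ (a / b : ℕ) ∧ ((a / b : ℕ) : ℝ) ≤ a / b := by
  refine ⟨?_, Nat.cast_div_le⟩
  rw [← Nat.floor_div_eq_div (K := ℝ)]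
  exact (Nat.sub_one_lt_floor _).le

/-- The probability that a sample is hit when its item occurs `c` times. -/
def hitP (p : Par) (i c : ℕ) : ℝ := 1 - (1 - p.thrOf i / 2 ^ p.dd) ^ c

theorem hitP_bounds (i c : ℕ) : 0 ≤ hitP p i c ∧ hitP p i c ≤ 1 := by
  have h1 : (p.thrOf i : ℝ) / 2 ^ p.dd ≤ 1 := by
    rw [div_le_one (by positivity)]; exact_mod_cast p.thrOf_le i
  have h2 : (0 : ℝ) ≤ p.thrOf i / 2 ^ p.dd := by positivity
  unfold hitP
  have := pow_le_one₀ (n := c) (show (0 : ℝ) ≤ 1 - p.thrOf i / 2 ^ p.dd by linarith) (by linarith)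
  have := pow_nonneg (show (0 : ℝ) ≤ 1 - p.thrOf i / 2 ^ p.dd by linarith) c
  constructor <;> linarith

theorem abs_pow_sub_le {a b : ℝ} (ha : 0 ≤ a) (ha1 : a ≤ 1) (hb : 0 ≤ b) (hb1 : b ≤ 1) (c : ℕ) :
    |a ^ c - b ^ c| ≤ c * |a - b| := by
  induction c with
  | zero => simp
  | succ c ih =>
    have e : a ^ (c + 1) - b ^ (c + 1) = a * (a ^ c - b ^ c) + (a - b) * b ^ c := by ring
    rw [e]
    refine (abs_add_le _ _).trans ?_
    rw [abs_mul, abs_mul, abs_of_nonneg ha, abs_of_nonneg (pow_nonneg hb c)]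
    have h1 := pow_le_one₀ (n := c) hb hb1
    have h2 := abs_nonneg (a - b)
    have h3 := abs_nonneg (a ^ c - b ^ c)
    push_cast
    nlinarith

/-- A threshold is rounded by at most `2^(-dd)` relative to `2^dd`, and `x ↦ x^c` has Lipschitz
constant `c` on `[0, 1]`. -/
theorem hitP_approx (hp : p.Valid) (i c : ℕ) :
    |hitP p i c - (1 - p.q ^ (c * i))| ≤ c / 2 ^ p.dd := by
  obtain ⟨q0, q1, hK⟩ := hp.q_bounds
  have h1 : (p.thrOf i : ℝ) / 2 ^ p.dd ≤ 1 := by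
    rw [div_le_one (by positivity)]; exact_mod_cast p.thrOf_le i
  have h2 : (0 : ℝ) ≤ p.thrOf i / 2 ^ p.dd := by positivity
  have h3 := div_bounds (2 ^ p.dd * (p.K ^ i - (p.K - 1) ^ i)) (p.K ^ i)
  have e : ((2 ^ p.dd * (p.K ^ i - (p.K - 1) ^ i) : ℕ) : ℝ) / (p.K ^ i : ℕ) =
      2 ^ p.dd * (1 - p.q ^ i) := by
    rw [← pow_ratio hp, Nat.cast_mul]; push_cast; ring
  rw [e] at h3
  have h4 : |(1 - (p.thrOf i : ℝ) / 2 ^ p.dd) - p.q ^ i| ≤ 1 / 2 ^ p.dd := by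
    have e1 : (1 - (p.thrOf i : ℝ) / 2 ^ p.dd) - p.q ^ i =
        (2 ^ p.dd * (1 - p.q ^ i) - p.thrOf i) / 2 ^ p.dd := by field_simp; ring
    rw [e1, abs_div, abs_of_pos (show (0 : ℝ) < 2 ^ p.dd by positivity)]
    gcongr
    unfold Par.thrOf
    rw [abs_le]; constructor <;> linarith
  have h5 := abs_pow_sub_le (show (0 : ℝ) ≤ 1 - p.thrOf i / 2 ^ p.dd by linarith) (by linarith)
    (pow_nonneg q0 i) (pow_le_one₀ q0 q1) c
  unfold hitP
  rw [mul_comm c, pow_mul, abs_sub_comm]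
  refine (le_of_eq ?_).trans (h5.trans ?_)
  · congr 1; ring
  · calc (c : ℝ) * _ ≤ c * (1 / 2 ^ p.dd) := by gcongr
      _ = _ := by ring

/-- The value of a sample without rounding. -/
def exactVal (p : Par) (W T f i : ℕ) : ℝ :=
  W / (p.P / T + 1 : ℕ) * (2 ^ p.a * f) * (p.K * (1 - p.q ^ i) / (i : ℝ) ^ 2)

theorem Par.Valid.A_pos (hp : p.Valid) : 0 < p.A := by
  have := hp.P_pos; have := hp.e; unfold Par.A; positivity

theorem valOf_approx (hp : p.Valid) (W T f : ℕ) {i : ℕ} (hi : 0 < i) :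
    (p.valOf W T f i : ℝ) / p.A ≤ exactVal p W T f i ∧
      exactVal p W T f i - 1 / p.A ≤ p.valOf W T f i / p.A := by
  have hA : (0 : ℝ) < p.A := by exact_mod_cast hp.A_pos
  obtain ⟨q0, q1, hK⟩ := hp.q_bounds
  have hKi : 0 < p.K ^ i := pow_pos (by have := hp.K_ge.2; omega) i
  have h3 := div_bounds (p.A * W * 2 ^ p.a * f * p.K * (p.K ^ i - (p.K - 1) ^ i))
    ((p.P / T + 1) * p.K ^ i * (i * i))
  have e : ((p.A * W * 2 ^ p.a * f * p.K * (p.K ^ i - (p.K - 1) ^ i) : ℕ) : ℝ) /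
      ((p.P / T + 1) * p.K ^ i * (i * i) : ℕ) = p.A * exactVal p W T f i := by
    unfold exactVal
    rw [← pow_ratio hp, Nat.cast_mul, Nat.cast_mul ((p.P / T + 1) * p.K ^ i), Nat.cast_mul (p.P / T + 1)]
    have : ((p.K ^ i : ℕ) : ℝ) ≠ 0 := by exact_mod_cast hKi.ne'
    have : (i : ℝ) ≠ 0 := by exact_mod_cast hi.ne'
    have : ((p.P / T + 1 : ℕ) : ℝ) ≠ 0 := by positivity
    generalize ((p.K ^ i - (p.K - 1) ^ i : ℕ) : ℝ) = z
    generalize ((p.P / T + 1 : ℕ) : ℝ) = y at *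
    push_cast
    field_simp
  rw [e] at h3
  unfold Par.valOf
  constructor
  · rw [div_le_iff₀ hA]; linarith
  · rw [le_div_iff₀ hA]
    have : (exactVal p W T f i - 1 / p.A) * p.A = p.A * exactVal p W T f i - 1 := by field_simp
    linarith

/-- By Bernoulli's inequality `K (1 - q^i) ≤ i`, and the scale satisfies `f ≤ i`. So drawing
dyadically costs only the factor `2^a`, which is logarithmic. -/
theorem exactVal_bounds (hp : p.Valid) (W T : ℕ) {f i : ℕ} (hf : f ≤ i) (hi : 0 < i) :
    0 ≤ exactVal p W T f i ∧ exactVal p W T f i ≤ W / (p.P / T + 1 : ℕ) * 2 ^ p.a := by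
  obtain ⟨q0, q1, hK⟩ := hp.q_bounds
  have hi0 : (0 : ℝ) < i := by exact_mod_cast hi
  have hq := pow_le_one₀ (n := i) q0 q1
  have hfi : (f : ℝ) ≤ i := by exact_mod_cast hf
  unfold exactVal
  refine ⟨by have := sub_nonneg.2 hq; positivity, ?_⟩
  have h1 : p.K * (1 - p.q ^ i) ≤ i := by
    have h2 := one_add_mul_le_pow (show (-2 : ℝ) ≤ -(1 / p.K) by
      have : 1 / (p.K : ℝ) ≤ 1 := by unfold Par.q at q0; linarith
      linarith) i
    have e : (1 : ℝ) + -(1 / p.K) = p.q := by unfold Par.q; ring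
    rw [e] at h2
    calc (p.K : ℝ) * (1 - p.q ^ i) ≤ p.K * (i * (1 / p.K)) := by gcongr; linarith
      _ = i := by field_simp
  rw [mul_assoc]
  refine mul_le_mul_of_nonneg_left ?_ (by positivity)
  calc (2 : ℝ) ^ p.a * f * (p.K * (1 - p.q ^ i) / (i : ℝ) ^ 2) ≤ 2 ^ p.a * i * (i / (i : ℝ) ^ 2) := by
        gcongr
    _ = 2 ^ p.a := by field_simp

/-- The dyadic ranges `[2^l, 2^(l+1))` tile the numbers from `1` to `2^n - 1`. -/
theorem sum_scales (φ : ℕ → ℝ) (n : ℕ) :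
    ∑ l ∈ Finset.range n, ∑ j ∈ Finset.range (2 ^ l), φ (j + 2 ^ l) =
      ∑ i ∈ Finset.range (2 ^ n - 1), φ (i + 1) := by
  induction n with
  | zero => simp
  | succ n ih =>
    have h := Nat.one_le_two_pow (n := n)
    have e : 2 ^ (n + 1) - 1 = (2 ^ n - 1) + 2 ^ n := by rw [pow_succ]; omega
    rw [Finset.sum_range_succ, ih, e, Finset.sum_range_add]
    congr 1
    refine Finset.sum_congr rfl fun j _ => ?_
    congr 1
    omega

/-- The expected contribution of an item that occurs `c` times later, scaled. -/
def meanVal (p : Par) (W T c : ℕ) : ℝ :=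
  (p.P / T + 1 : ℕ) / W * avg p.a fun l j =>
    hitP p (j + 2 ^ l) c * (p.valOf W T (2 ^ l) (j + 2 ^ l) / p.A)

/-- Values are weighted by inverse probabilities, so all sampling rates cancel from the mean. -/
theorem meanVal_exact (hW : 0 < W) (T c : ℕ) :
    (p.P / T + 1 : ℕ) / W * avg p.a (fun l j => hitP p (j + 2 ^ l) c *
      exactVal p W T (2 ^ l) (j + 2 ^ l)) =
    p.K * ∑ i ∈ Finset.range (2 ^ 2 ^ p.a - 1),
      hitP p (i + 1) c * ((1 - p.q ^ (i + 1)) / ((i + 1 : ℕ) : ℝ) ^ 2) := by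
  have hW' : (W : ℝ) ≠ 0 := by exact_mod_cast hW.ne'
  rw [← sum_scales (fun i => hitP p i c * ((1 - p.q ^ i) / (i : ℝ) ^ 2)), Finset.mul_sum]
  unfold avg
  rw [Finset.sum_div, Finset.mul_sum]
  refine Finset.sum_congr rfl fun l _ => ?_
  rw [Finset.sum_div, Finset.sum_div, Finset.mul_sum, Finset.mul_sum]
  refine Finset.sum_congr rfl fun j _ => ?_
  unfold exactVal
  have : ((p.P / T + 1 : ℕ) : ℝ) ≠ 0 := by positivity
  generalize ((p.P / T + 1 : ℕ) : ℝ) = y at *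
  push_cast
  field_simp

theorem meanVal_round (hp : p.Valid) {W : ℕ} (hW : 0 < W) (T c : ℕ) :
    |meanVal p W T c - p.K * ∑ i ∈ Finset.range (2 ^ 2 ^ p.a - 1),
      hitP p (i + 1) c * ((1 - p.q ^ (i + 1)) / ((i + 1 : ℕ) : ℝ) ^ 2)| ≤ (p.P + 1 : ℕ) / p.A := by
  have hA : (0 : ℝ) < p.A := by exact_mod_cast hp.A_pos
  rw [← meanVal_exact hW T c, meanVal, ← mul_sub]
  have hr : (0 : ℝ) ≤ (p.P / T + 1 : ℕ) / W := by positivity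
  have hr' : ((p.P / T + 1 : ℕ) : ℝ) / W ≤ (p.P + 1 : ℕ) := by
    refine (div_le_self (Nat.cast_nonneg _) (by exact_mod_cast hW)).trans ?_
    have := Nat.div_le_self p.P T
    exact_mod_cast Nat.add_le_add_right this 1
  have up : avg p.a (fun l j => hitP p (j + 2 ^ l) c * (p.valOf W T (2 ^ l) (j + 2 ^ l) / p.A)) ≤
      avg p.a (fun l j => hitP p (j + 2 ^ l) c * exactVal p W T (2 ^ l) (j + 2 ^ l)) :=
    avg_mono fun l _ j _ => mul_le_mul_of_nonneg_left
      (valOf_approx hp W T _ (by positivity)).1 (hitP_bounds _ _).1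
  have lo : avg p.a (fun l j => hitP p (j + 2 ^ l) c * exactVal p W T (2 ^ l) (j + 2 ^ l)) ≤
      avg p.a (fun l j => hitP p (j + 2 ^ l) c * (p.valOf W T (2 ^ l) (j + 2 ^ l) / p.A)) +
        1 / p.A := by
    rw [← avg_const p.a (1 / (p.A : ℝ)), ← avg_add]
    refine avg_mono fun l _ j _ => ?_
    have h2 := (valOf_approx hp W T (2 ^ l) (i := j + 2 ^ l) (by positivity)).2
    have h3 := hitP_bounds (p := p) (j + 2 ^ l) c
    have h4 : 0 ≤ 1 / (p.A : ℝ) := by positivity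
    generalize hitP p (j + 2 ^ l) c = a at *
    calc a * exactVal p W T (2 ^ l) (j + 2 ^ l) ≤
        a * (p.valOf W T (2 ^ l) (j + 2 ^ l) / p.A + 1 / p.A) :=
          mul_le_mul_of_nonneg_left (by linarith) h3.1
      _ = a * (p.valOf W T (2 ^ l) (j + 2 ^ l) / p.A) + a * (1 / p.A) := mul_add _ _ _
      _ ≤ _ := add_le_add_right (mul_le_of_le_one_left h4 h3.2) _
  rw [abs_mul, abs_of_nonneg hr, div_eq_mul_one_div _ (p.A : ℝ)]
  refine mul_le_mul hr' ?_ (abs_nonneg _) (Nat.cast_nonneg _)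
  rw [abs_le]; constructor <;> linarith

/-- The error terms come from rounding the values, rounding the thresholds, the mesh `K`, and
truncating the series. -/
theorem meanVal_approx (hp : p.Valid) {W : ℕ} (hW : 0 < W) (T c : ℕ) :
    |meanVal p W T c - inc c| ≤ (p.P + 1 : ℕ) / p.A + 2 * p.K * c / 2 ^ p.dd +
      6 * (c + 1) ^ 2 / p.K + p.K / (2 ^ 2 ^ p.a - 1 : ℕ) := by
  obtain ⟨q0, q1, hK⟩ := hp.q_bounds
  have h1 := meanVal_round hp hW T c
  have hI0 : 0 < 2 ^ 2 ^ p.a - 1 := by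
    have : 2 ^ 1 ≤ 2 ^ 2 ^ p.a := Nat.pow_le_pow_right (by norm_num) Nat.one_le_two_pow
    omega
  generalize 2 ^ 2 ^ p.a - 1 = I at *
  obtain ⟨X, hX⟩ : ∃ X : ℝ, X = p.K * ∑ i ∈ Finset.range I,
      hitP p (i + 1) c * ((1 - p.q ^ (i + 1)) / ((i + 1 : ℕ) : ℝ) ^ 2) := ⟨_, rfl⟩
  rw [← hX] at h1
  have h2 : |X - p.K * ∑ i ∈ Finset.range I, serTerm p.q c (i + 1)| ≤ 2 * p.K * c / 2 ^ p.dd := by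
    rw [hX, ← mul_sub, abs_mul, abs_of_pos hK, ← Finset.sum_sub_distrib]
    have e : 2 * (p.K : ℝ) * c / 2 ^ p.dd = p.K * (c / 2 ^ p.dd * 2) := by ring
    rw [e]
    refine mul_le_mul_of_nonneg_left ?_ hK.le
    refine (Finset.abs_sum_le_sum_abs _ _).trans ?_
    have h3 : ∀ i ∈ Finset.range I, |hitP p (i + 1) c * ((1 - p.q ^ (i + 1)) / ((i + 1 : ℕ) : ℝ) ^ 2) -
        serTerm p.q c (i + 1)| ≤ c / 2 ^ p.dd * (1 / ((i : ℝ) + 1) ^ 2) := by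
      intro i _
      have e2 : hitP p (i + 1) c * ((1 - p.q ^ (i + 1)) / ((i + 1 : ℕ) : ℝ) ^ 2) -
        serTerm p.q c (i + 1) = (hitP p (i + 1) c - (1 - p.q ^ (c * (i + 1)))) *
          ((1 - p.q ^ (i + 1)) / ((i + 1 : ℕ) : ℝ) ^ 2) := by unfold serTerm; ring
      have h4 := pow_le_one₀ (n := i + 1) q0 q1
      have h5 := pow_nonneg q0 (i + 1)
      rw [e2, abs_mul, abs_of_nonneg (a := (1 - p.q ^ (i + 1)) / _)
        (div_nonneg (by linarith) (by positivity))]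
      refine mul_le_mul (hitP_approx hp _ _) ?_ (div_nonneg (by linarith) (by positivity)) (by positivity)
      push_cast
      gcongr
      linarith
    refine (Finset.sum_le_sum h3).trans ?_
    rw [← Finset.mul_sum]
    refine mul_le_mul_of_nonneg_left ?_ (by positivity)
    have h6 := sum_tail_le (φ := fun i => 1 / ((i : ℝ) + 1) ^ 2) (fun _ => le_rfl) one_pos
      (show 1 ≤ I from hI0)
    have h7 : (0 : ℝ) ≤ (I : ℝ)⁻¹ := by positivity
    simp at h6 ⊢
    linarith
  have h3 := series_bounds (K := p.K) (by exact_mod_cast hp.K_ge.2) c hI0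
  have e : (1 : ℝ) - 1 / p.K = p.q := rfl
  rw [e] at h3
  rw [abs_le] at h1 h2 h3 ⊢
  constructor <;> linarith

/-- The sizes of `A`, `dd`, `K` and `a` are made for this: `A` exceeds `P e`, `K` exceeds `w² e`,
and both `2^dd = 2^(8 lg)` and the truncation point `2^(2^a) ≥ 2^(8 lg)` exceed `K` by a large
factor. Live arrivals span at most `2w`, hence the range of `c`. -/
theorem meanVal_close (hp : p.Valid) {W : ℕ} (hW : 0 < W) (T : ℕ) {c : ℕ} (hc : c ≤ 2 * p.w) :
    |meanVal p W T c - inc c| ≤ 1 / (16 * p.e) := by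
  refine (meanVal_approx hp hW T c).trans ?_
  have hlg := hp.lg_pos
  obtain ⟨q0, q1, hK⟩ := hp.q_bounds
  have he : (0 : ℝ) < p.e := by have := hp.e; exact_mod_cast (show 0 < p.e by omega)
  have hw : (1 : ℝ) ≤ p.w := by exact_mod_cast hp.w
  have hP : (1 : ℝ) ≤ p.P := by exact_mod_cast hp.P_pos
  have hcw : (c : ℝ) ≤ 2 * p.w := by exact_mod_cast hc
  have hs := hp.size_le_lg
  have w2 : (p.w : ℝ) ≤ 2 ^ p.lg := by
    exact_mod_cast ((Nat.lt_size_self _).trans_le (Nat.pow_le_pow_right (by norm_num) hs.2.2.1)).le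
  have e2 : (p.e : ℝ) ≤ 2 ^ p.lg := by
    exact_mod_cast ((Nat.lt_size_self _).trans_le (Nat.pow_le_pow_right (by norm_num) hs.2.2.2.1)).le
  have K2 : (p.K : ℝ) ≤ 2 ^ (20 + 3 * p.lg) := by exact_mod_cast hp.K_le
  have K1 : (2 : ℝ) ^ 20 * (p.w ^ 2 * p.e) ≤ p.K := by exact_mod_cast hp.K_ge.1
  have t1 : ((p.P + 1 : ℕ) : ℝ) / p.A ≤ 1 / (1024 * p.e) := by
    unfold Par.A
    push_cast
    rw [div_le_div_iff₀ (by positivity) (by positivity)]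
    nlinarith
  have t2 : 2 * (p.K : ℝ) * c / 2 ^ p.dd ≤ 1 / (32 * p.e) := by
    rw [div_le_div_iff₀ (by positivity) (by positivity)]
    unfold Par.dd
    calc 2 * (p.K : ℝ) * c * (32 * p.e) ≤ 2 * 2 ^ (20 + 3 * p.lg) * (2 * 2 ^ p.lg) * (32 * 2 ^ p.lg) := by
          gcongr; linarith
      _ = 2 ^ (27 + 5 * p.lg) := by ring
      _ ≤ 2 ^ (8 * p.lg) := pow_le_pow_right₀ (by norm_num) (by omega)
      _ = 1 * 2 ^ (8 * p.lg) := (one_mul _).symm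
  have t3 : 6 * ((c : ℝ) + 1) ^ 2 / p.K ≤ 1 / (1024 * p.e) := by
    rw [div_le_div_iff₀ hK (by positivity)]
    have : ((c : ℝ) + 1) ^ 2 ≤ (3 * p.w) ^ 2 := by gcongr; linarith
    nlinarith
  have t4 : (p.K : ℝ) / (2 ^ 2 ^ p.a - 1 : ℕ) ≤ 1 / (1024 * p.e) := by
    have h8 : 8 * p.lg ≤ 2 ^ p.a := by
      have := Nat.lt_size_self p.lg
      unfold Par.a; rw [pow_add]; omega
    have h9 : 2 ^ (8 * p.lg - 1) ≤ 2 ^ 2 ^ p.a - 1 := by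
      have h10 : 2 ^ (8 * p.lg) ≤ 2 ^ 2 ^ p.a := Nat.pow_le_pow_right (by norm_num) h8
      have h11 : 2 ^ (8 * p.lg) = 2 * 2 ^ (8 * p.lg - 1) := by
        rw [← pow_succ']; congr 1; omega
      have := Nat.one_le_two_pow (n := 8 * p.lg - 1)
      omega
    have h12 : (2 : ℝ) ^ (8 * p.lg - 1) ≤ (2 ^ 2 ^ p.a - 1 : ℕ) := by exact_mod_cast h9
    rw [div_le_div_iff₀ (lt_of_lt_of_le (by positivity) h12) (by positivity)]
    calc (p.K : ℝ) * (1024 * p.e) ≤ 2 ^ (20 + 3 * p.lg) * (1024 * 2 ^ p.lg) := by gcongr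
      _ = 2 ^ (30 + 4 * p.lg) := by ring
      _ ≤ 2 ^ (8 * p.lg - 1) := pow_le_pow_right₀ (by norm_num) (by omega)
      _ ≤ _ := by linarith
  have : (1 : ℝ) / (16 * p.e) = 1 / (32 * p.e) + 32 * (1 / (1024 * p.e)) := by field_simp; norm_num
  have : 0 < 1 / (1024 * (p.e : ℝ)) := by positivity
  linarith

end Monitoring
end

/-! ### The live samples, and the exponents of the two potentials. -/

noncomputable section
open scoped ENNReal
namespace Monitoring

variable {p : Par} {u : Wt} {fu : List (ℕ × ℕ)}

/-! ### Timing -/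

theorem skI_at (hp : p.Valid) (hi : ∀ a ∈ fu, a.1 < p.k) {t : ℕ} (ht : t ≤ fu.length) :
    SkI p (p.steps sk₀ (fu.take t)) t := by
  have := (skI_init hp).steps hp (fu := fu.take t) fun a ha => hi a (List.mem_of_mem_take ha)
  rwa [List.length_take, min_eq_left ht, zero_add] at this

theorem steps_take_mono (sk : Sk) {t t' : ℕ} (h : t ≤ t') :
    (p.steps sk (fu.take t)).W ≤ (p.steps sk (fu.take t')).W ∧
    (p.steps sk (fu.take t)).T ≤ (p.steps sk (fu.take t')).T ∧
    (p.steps sk (fu.take t)).Lh ≤ (p.steps sk (fu.take t')).Lh := by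
  have e : fu.take t' = fu.take t ++ (fu.drop t).take (t' - t) := by
    rw [← List.take_add]; congr 1; omega
  rw [e, steps_append]
  exact steps_mono _ _

/-- The number of arrivals that the coordinator may not know of. -/
def Par.slack (p : Par) (W : ℕ) : ℕ := if p.blk W = 0 then 0 else W

theorem Par.slack_mono (p : Par) {W W' : ℕ} (h : W ≤ W') : p.slack W ≤ p.slack W' := by
  unfold Par.slack Par.blk
  have := Nat.div_le_div_right (c := 2 * p.k) h
  generalize W / (2 * p.k) = x at *
  generalize W' / (2 * p.k) = y at *
  split_ifs <;> omega

theorem SkI.lag_le (hp : p.Valid) {sk : Sk} {L : ℕ} (h : SkI p sk L) :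
    sk.Lh ≤ L ∧ L ≤ sk.Lh + p.slack sk.W := by
  have h1 := h.lag
  have h2 := h.lag'
  have h3 := h.ok.pos_sum hp
  have h4 := h.exact
  unfold Par.slack
  split_ifs <;> omega

/-- Blocks are nonempty only if `W > 1`, and then `W P ≤ T ≤ min Lh w`: the clock lags by at most a
fraction `1/P` of the window. -/
theorem SkI.slack_le (hp : p.Valid) {sk : Sk} {L : ℕ} (h : SkI p sk L) :
    p.slack sk.W * p.P ≤ min sk.Lh p.w := by
  have hP := hp.P_pos
  unfold Par.slack
  split_ifs with h0
  · simp
  · have h1 : sk.W ≠ 1 := fun h1 => h0 (by rw [h1, blk_one hp])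
    have h2 := h.low.resolve_left h1
    have h3 := h.ok.scale.1
    have h4 : 2 ≤ sk.W := by omega
    have h5 : sk.T ≠ 1 := by nlinarith
    have := h.len.resolve_left h5
    omega

theorem SkI.length_le (hp : p.Valid) {sk : Sk} {L : ℕ} (h : SkI p sk L) (hL : 0 < L) :
    sk.T ≤ min sk.Lh p.w ∧ 0 < min sk.Lh p.w := by
  have hw := hp.w
  have hT := h.ok.length
  have h0 : 0 < sk.Lh := by
    by_contra h1
    have h2 := h.slack_le hp
    have h3 := (h.lag_le hp).2
    have hP := hp.P_pos
    have : p.slack sk.W = 0 := by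
      by_contra h4
      have := Nat.mul_pos (Nat.pos_of_ne_zero h4) hP
      omega
    omega
  have := h.len
  omega

theorem SkI.slack_le_w (hp : p.Valid) {sk : Sk} {L : ℕ} (h : SkI p sk L) : p.slack sk.W ≤ p.w := by
  have h1 := h.slack_le hp
  have h2 := Nat.le_mul_of_pos_right (p.slack sk.W) hp.P_pos
  omega

/-- The samples that are still in use are those of the most recent arrivals. -/
theorem live_start (hp : p.Valid) (hi : ∀ a ∈ fu, a.1 < p.k) : ∃ t₀ ≤ fu.length,
    (∀ t ≤ fu.length, (p.steps sk₀ fu).Lh < (p.steps sk₀ (fu.take t)).Lh + p.w + 1 ↔ t₀ ≤ t) ∧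
    t₀ ≤ fu.length + p.slack (p.steps sk₀ fu).W - p.w ∧
    fu.length ≤ t₀ + p.w + p.slack (p.steps sk₀ fu).W := by
  classical
  have hF := skI_at hp hi le_rfl
  rw [List.take_length] at hF
  have lF := hF.lag_le hp
  have hex : ∃ t, (p.steps sk₀ fu).Lh < (p.steps sk₀ (fu.take t)).Lh + p.w + 1 :=
    ⟨fu.length, by rw [List.take_length]; omega⟩
  have mono : ∀ {t t'}, t ≤ t' → (p.steps sk₀ (fu.take t)).Lh ≤ (p.steps sk₀ (fu.take t')).Lh :=
    fun h => (steps_take_mono _ h).2.2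
  have key : ∀ t ≤ fu.length, t ≤ (p.steps sk₀ (fu.take t)).Lh + p.slack (p.steps sk₀ fu).W := by
    intro t ht
    have h1 := ((skI_at hp hi ht).lag_le hp).2
    have h2 := p.slack_mono (steps_take_mono (p := p) (fu := fu) sk₀ ht).1
    rw [List.take_length] at h2
    omega
  -- The clock is monotone, so the live arrivals form a final segment, and `t₀` is its first index.
  have hle : Nat.find hex ≤ fu.length := Nat.find_min' hex (by rw [List.take_length]; omega)
  refine ⟨Nat.find hex, hle, fun t _ => ⟨fun h => Nat.find_min' hex h, fun h => ?_⟩, ?_, ?_⟩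
  · have := Nat.find_spec hex
    have := mono h
    omega
  · set t₁ := fu.length + p.slack (p.steps sk₀ fu).W - p.w with h1
    rcases le_total t₁ fu.length with h2 | h2
    · refine Nat.find_min' hex ?_
      have := key t₁ h2
      omega
    · exact hle.trans h2
  · have h1 := Nat.find_spec hex
    have h2 := ((skI_at hp hi hle).lag_le hp).1
    omega

/-! ### The weights -/

/-- The weight for the estimate. -/
def mainWt (p : Par) (r : ℝ) (F : ℕ) : Wt where
  χ₁ v x := ENNReal.ofReal (Real.exp (if F < x then r * (v / p.A) else 0))
  χ₀ _ _ := 1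
  ϰ z := if z ≤ F then 1 else 0

/-- The weight for the number of samples in use. -/
def cntWt (p : Par) (F : ℕ) : Wt where
  χ₁ _ x := if 0 < x ∧ F < x + p.w then 2 else 1
  χ₀ _ x := if 0 < x ∧ F < x + p.w then 2 else 1
  ϰ _ := 1

/-- A drop that would matter at time `F` sets `ϰ` to `0`, and any other dropped sample has weight
`1`. -/
theorem mainWt_good {r : ℝ} {F Lh : ℕ} (h : Lh ≤ F) : (mainWt p r F).Good p Lh := by
  refine ⟨fun v x hx => ⟨?_, le_rfl⟩, fun z v hz => ?_⟩
  · simp [mainWt, show ¬ F < x by omega]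
  · unfold mainWt
    dsimp only
    by_cases h1 : Lh + p.w + 1 ≤ F
    · rw [if_pos h1, if_pos (by omega), if_neg (by omega)]; simp
    · rw [if_neg h1]; exact ⟨bot_le, bot_le⟩

theorem cntWt_good {F Lh : ℕ} : (cntWt p F).Good p Lh := by
  have h1 : ∀ x : ℕ, (1 : ℝ≥0∞) ≤ if 0 < x ∧ F < x + p.w then 2 else 1 := fun x => by
    split_ifs
    · exact one_le_two
    · exact le_rfl
  exact ⟨fun v x _ => ⟨h1 x, h1 x⟩, fun z v _ => ⟨by simpa [cntWt] using h1 (Lh + p.w + 1),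
    by simpa [cntWt] using h1 (Lh + p.w + 1)⟩⟩

theorem fresh_const {l : List ℕ} {W T Lh v : ℕ} {x : ℝ} (hx : 0 ≤ x)
    (h : ∀ v, u.χ₁ v (Lh + p.w + 1) = ENNReal.ofReal x ∧ u.χ₀ v (Lh + p.w + 1) = ENNReal.ofReal x) :
    fresh p u l W T Lh v = ENNReal.ofReal x := by
  rw [← avg_const p.a x]
  exact fresh_ofReal (fun _ _ => hx) fun f _ j _ => by
    rw [(h _).1, (h _).2, sf_const (p.thrOf_le _)]

theorem fresh_main {r : ℝ} {F Lh W T v : ℕ} {l : List ℕ} (hp : p.Valid) (h : F < Lh + p.w + 1) :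
    fresh p (mainWt p r F) l W T Lh v = ENNReal.ofReal (avg p.a fun f j => 1 +
      hitP p (j + 2 ^ f) (l.count v) *
        (Real.exp (r * (p.valOf W T (2 ^ f) (j + 2 ^ f) / p.A)) - 1)) := by
  have h0 : ∀ f j : ℕ, 0 ≤ 1 + hitP p (j + 2 ^ f) (l.count v) *
      (Real.exp (r * (p.valOf W T (2 ^ f) (j + 2 ^ f) / p.A)) - 1) := fun f j => by
    have := hitP_bounds (p := p) (j + 2 ^ f) (l.count v)
    have := Real.exp_nonneg (r * (p.valOf W T (2 ^ f) (j + 2 ^ f) / p.A))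
    nlinarith
  refine fresh_ofReal h0 fun f _ j _ => ?_
  unfold mainWt
  dsimp only
  rw [if_pos h, sf_ofReal (p.thrOf_le _) (thrOf_pos hp (by positivity)) (Real.exp_nonneg _)]
  rfl

theorem fresh_main_ne_top (hp : p.Valid) (r : ℝ) (F : ℕ) (l : List ℕ) (W T Lh v : ℕ) :
    fresh p (mainWt p r F) l W T Lh v ≠ ⊤ := by
  by_cases h : F < Lh + p.w + 1
  · rw [fresh_main hp h]; exact ENNReal.ofReal_ne_top
  · rw [fresh_const (x := 1) zero_le_one fun v => by simp [mainWt, h]]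
    exact ENNReal.ofReal_ne_top

theorem fresh_cnt (F : ℕ) (l : List ℕ) (W T Lh v : ℕ) : fresh p (cntWt p F) l W T Lh v =
    ENNReal.ofReal (if F < Lh + p.w + 1 + p.w then 2 else 1) := by
  refine fresh_const (by split_ifs <;> norm_num) fun v => ?_
  unfold cntWt
  split_ifs <;> simp_all

theorem facLog_cnt (hp : p.Valid) {sk : Sk} {L F : ℕ} (h : SkI p sk L) (l : List ℕ) (v : ℕ) :
    facLog p (cntWt p F) l sk v ≤ if F < sk.Lh + p.w + 1 + p.w then 3 * (p.P : ℝ) / sk.T else 0 := by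
  refine (facLog_le hp h (by split_ifs <;> norm_num) (fresh_cnt F l sk.W sk.T sk.Lh v)).trans ?_
  split_ifs
  · have := rate_le hp h; linarith
  · simp

theorem facLog_old (hp : p.Valid) {sk : Sk} {L F : ℕ} (h : SkI p sk L) (l : List ℕ) (v : ℕ) {r : ℝ}
    (hF : ¬ F < sk.Lh + p.w + 1) : facLog p (mainWt p r F) l sk v ≤ 0 := by
  refine (facLog_le hp h one_pos (fresh_const zero_le_one fun v => by simp [mainWt, hF])).trans ?_
  simp

/-- From `e^x ≤ 1 + x + x²` for `|x| ≤ 1`: the linear term gives `meanVal`, and the bound `B` on the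
values controls the quadratic one. -/
theorem facLog_main (hp : p.Valid) {sk : Sk} {L F : ℕ} (h : SkI p sk L) (l : List ℕ) (v : ℕ) {r : ℝ}
    (hF : F < sk.Lh + p.w + 1) (hr : |r| * (sk.T / p.P * 2 ^ p.a) ≤ 1) :
    facLog p (mainWt p r F) l sk v ≤
      r * meanVal p sk.W sk.T (l.count v) + r ^ 2 * (sk.T / p.P * (2 ^ p.a) ^ 2) := by
  have hA : (0 : ℝ) < p.A := by exact_mod_cast hp.A_pos
  have hW : (0 : ℝ) < sk.W := by exact_mod_cast h.ok.scale.1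
  have hω := omega_le hp h
  obtain ⟨y, hy⟩ : ∃ y : ℝ, y = (p.P / sk.T + 1 : ℕ) := ⟨_, rfl⟩
  have hy0 : 0 < y := by rw [hy]; positivity
  rw [← hy] at hω
  set B : ℝ := sk.W / y * 2 ^ p.a with hB
  have hB0 : 0 ≤ B := by positivity
  have hrB : |r| * B ≤ 1 := (mul_le_mul_of_nonneg_left
    (mul_le_mul_of_nonneg_right hω (by positivity)) (abs_nonneg r)).trans hr
  have vb : ∀ f j : ℕ, 0 ≤ (p.valOf sk.W sk.T (2 ^ f) (j + 2 ^ f) : ℝ) / p.A ∧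
      (p.valOf sk.W sk.T (2 ^ f) (j + 2 ^ f) : ℝ) / p.A ≤ B := fun f j => by
    refine ⟨by positivity, (valOf_approx hp _ _ _ (by positivity)).1.trans ?_⟩
    rw [hB, hy]
    exact (exactVal_bounds hp _ _ (Nat.le_add_left _ _) (by positivity)).2
  -- The lower bound serves only to make the average factor positive, as `facLog_le` requires.
  have pt : ∀ f j : ℕ, Real.exp (-1) ≤ 1 + hitP p (j + 2 ^ f) (l.count v) *
        (Real.exp (r * (p.valOf sk.W sk.T (2 ^ f) (j + 2 ^ f) / p.A)) - 1) ∧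
      1 + hitP p (j + 2 ^ f) (l.count v) *
        (Real.exp (r * (p.valOf sk.W sk.T (2 ^ f) (j + 2 ^ f) / p.A)) - 1) ≤
      (1 + r ^ 2 * B ^ 2) + r * (hitP p (j + 2 ^ f) (l.count v) *
        (p.valOf sk.W sk.T (2 ^ f) (j + 2 ^ f) / p.A)) := by
    intro f j
    obtain ⟨h1, h2⟩ := vb f j
    obtain ⟨h3, h4⟩ := hitP_bounds (p := p) (j + 2 ^ f) (l.count v)
    generalize hitP p (j + 2 ^ f) (l.count v) = a at *
    generalize (p.valOf sk.W sk.T (2 ^ f) (j + 2 ^ f) : ℝ) / p.A = z at *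
    have h5 : |r * z| ≤ 1 := by
      rw [abs_mul, abs_of_nonneg h1]
      exact (mul_le_mul_of_nonneg_left h2 (abs_nonneg r)).trans hrB
    have h6 := abs_le.1 (Real.abs_exp_sub_one_sub_id_le h5)
    have h7 : (r * z) ^ 2 ≤ r ^ 2 * B ^ 2 := by
      rw [mul_pow]; gcongr
    have h8 : Real.exp (-1) ≤ Real.exp (r * z) := Real.exp_le_exp.2 (abs_le.1 h5).1
    have h9 : Real.exp (-1) ≤ 1 := Real.exp_le_one_iff.2 (by norm_num)
    constructor
    · nlinarith
    · have h10 : a * (r * z) ^ 2 ≤ (r * z) ^ 2 := mul_le_of_le_one_left (sq_nonneg _) h4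
      have h11 : a * (Real.exp (r * z) - 1) ≤ a * (r * z + (r * z) ^ 2) :=
        mul_le_mul_of_nonneg_left (by linarith) h3
      linarith
  have a1 := avg_mono (a := p.a) fun f _ j _ => (pt f j).1
  have a2 := avg_mono (a := p.a) fun f _ j _ => (pt f j).2
  rw [avg_const] at a1
  rw [avg_add p.a (fun _ _ => 1 + r ^ 2 * B ^ 2), avg_const, avg_mul] at a2
  refine (facLog_le hp h ((Real.exp_pos _).trans_le a1) (fresh_main hp hF)).trans ?_
  rw [meanVal, ← hy]
  have e1 : y / sk.W * (r ^ 2 * B ^ 2) ≤ r ^ 2 * (sk.T / p.P * (2 ^ p.a) ^ 2) := by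
    have : y / sk.W * (r ^ 2 * B ^ 2) = r ^ 2 * (sk.W / y * (2 ^ p.a) ^ 2) := by
      rw [hB]; field_simp
    rw [this]
    gcongr
  have e2 := mul_le_mul_of_nonneg_left a2 (show 0 ≤ y / sk.W by positivity)
  have e3 : ∀ X : ℝ, r * (y / sk.W * X) = y / sk.W * (r * X) := fun X => by ring
  rw [e3]
  linarith

/-! ### Sums along the run -/

/-- The sum of `c log c` over the numbers `c` of occurrences of the elements of a list. -/
def ent : List ℕ → ℝ
  | [] => 0
  | v :: l => inc (l.count v) + ent l

theorem ent_drop (l : List ℕ) (t₀ : ℕ) : ent (l.drop t₀) = ∑ t ∈ Finset.range l.length,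
    if t₀ ≤ t then inc ((l.drop (t + 1)).count (l.getD t 0)) else 0 := by
  induction l generalizing t₀ with
  | nil => simp [ent]
  | cons v l ih =>
    rw [List.length_cons, Finset.sum_range_succ']
    cases t₀ with
    | zero =>
      have := ih 0
      simp only [List.drop_zero, Nat.zero_le, if_true] at this
      simp only [List.drop_zero, Nat.zero_le, if_true, ent, this, List.getD_cons_succ,
        List.drop_succ_cons, List.getD_cons_zero]
      exact add_comm _ _
    | succ t₀ => simpa using ih t₀

/-- Expired arrivals contribute nothing, and over the live ones the increments `inc` telescope to
`ent`. The sign of `r` is free, since both tails are needed. -/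
theorem facSum_main (hp : p.Valid) (hi : ∀ a ∈ fu, a.1 < p.k) {t₀ : ℕ} {r m : ℝ}
    (ht₀ : ∀ t ≤ fu.length, (p.steps sk₀ fu).Lh < (p.steps sk₀ (fu.take t)).Lh + p.w + 1 ↔ t₀ ≤ t)
    (h2 : fu.length ≤ t₀ + 2 * p.w)  (hm : (p.steps sk₀ fu).T ≤ m)
    (hr : |r| * (m / p.P * 2 ^ p.a) ≤ 1) :
    facSum p (mainWt p r (p.steps sk₀ fu).Lh) fu sk₀ ≤ r * ent ((fu.map Prod.snd).drop t₀) +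
      (fu.length - t₀ : ℕ) * (|r| / (16 * p.e) + r ^ 2 * (m / p.P * (2 ^ p.a) ^ 2)) := by
  rw [facSum_eq, ent_drop, List.length_map, Finset.mul_sum]
  have e : ((fu.length - t₀ : ℕ) : ℝ) = ∑ t ∈ Finset.range fu.length, if t₀ ≤ t then (1 : ℝ) else 0 := by
    rw [Finset.sum_ite, Finset.sum_const, Finset.sum_const_zero, add_zero, nsmul_eq_mul, mul_one]
    congr 1
    have : (Finset.range fu.length).filter (t₀ ≤ ·) = Finset.Ico t₀ fu.length := by
      ext t; simp; tauto
    rw [this, Nat.card_Ico]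
  rw [e, Finset.sum_mul, ← Finset.sum_add_distrib]
  refine Finset.sum_le_sum fun t ht => ?_
  rw [Finset.mem_range] at ht
  have hs := skI_at hp hi ht.le
  have hT : ((p.steps sk₀ (fu.take t)).T : ℝ) ≤ m := by
    have := (steps_take_mono (p := p) (fu := fu) sk₀ ht.le).2.1
    rw [List.take_length] at this
    exact le_trans (by exact_mod_cast this) hm
  by_cases hl : t₀ ≤ t
  · rw [if_pos hl, if_pos hl, one_mul]
    have hTP : ((p.steps sk₀ (fu.take t)).T : ℝ) / p.P ≤ m / p.P := by gcongr
    refine (facLog_main hp hs _ _ ((ht₀ t ht.le).2 hl) (le_trans ?_ hr)).trans ?_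
    · gcongr
    · have hc : ((fu.map Prod.snd).drop (t + 1)).count ((fu.map Prod.snd).getD t 0) ≤ 2 * p.w := by
        refine List.count_le_length.trans ?_
        rw [List.length_drop, List.length_map]; omega
      have h3 := meanVal_close hp hs.ok.scale.1 (p.steps sk₀ (fu.take t)).T hc
      have h4 : r * meanVal p (p.steps sk₀ (fu.take t)).W (p.steps sk₀ (fu.take t)).T
          (((fu.map Prod.snd).drop (t + 1)).count ((fu.map Prod.snd).getD t 0)) ≤
          r * inc (((fu.map Prod.snd).drop (t + 1)).count ((fu.map Prod.snd).getD t 0)) +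
            |r| / (16 * p.e) := by
        rw [← sub_le_iff_le_add', ← mul_sub, div_eq_mul_one_div]
        refine (le_abs_self _).trans ?_
        rw [abs_mul]
        gcongr
      have h5 : r ^ 2 * (((p.steps sk₀ (fu.take t)).T : ℝ) / p.P * (2 ^ p.a) ^ 2) ≤
        r ^ 2 * (m / p.P * (2 ^ p.a) ^ 2) := by gcongr
      linarith
  · rw [if_neg hl, if_neg hl]
    have := facLog_old hp hs ((fu.map Prod.snd).drop (t + 1)) ((fu.map Prod.snd).getD t 0) (r := r)
      (fun h => hl ((ht₀ t ht.le).1 h))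
    simpa using this

theorem sum_inv_le (w n : ℕ) :
    ∑ t ∈ Finset.range n, (if t + 1 ≤ w then 1 / ((t : ℝ) + 1) else 0) ≤ 1 + Real.log w := by
  have h1 : ∑ t ∈ Finset.range n, (if t + 1 ≤ w then 1 / ((t : ℝ) + 1) else 0) ≤
      ∑ t ∈ Finset.range w, 1 / ((t : ℝ) + 1) := by
    rw [← Finset.sum_filter]
    refine Finset.sum_le_sum_of_subset_of_nonneg (fun t ht => ?_) fun _ _ _ => by positivity
    rw [Finset.mem_filter] at ht
    exact Finset.mem_range.2 ht.2
  refine h1.trans ((le_of_eq ?_).trans (harmonic_le_one_add_log w))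
  unfold harmonic
  push_cast
  exact Finset.sum_congr rfl fun t _ => one_div _

theorem Par.Valid.log_w_le (hp : p.Valid) : Real.log p.w ≤ p.lg := by
  have h1 : (p.w : ℝ) ≤ 2 ^ p.lg := by
    exact_mod_cast ((Nat.lt_size_self _).trans_le
      (Nat.pow_le_pow_right (by norm_num) hp.size_le_lg.2.2.1)).le
  have h2 := Real.log_le_log (by exact_mod_cast hp.w) h1
  rw [Real.log_pow] at h2
  have := Real.log_two_lt_d9
  have : (0 : ℝ) ≤ p.lg := Nat.cast_nonneg _
  nlinarith

/-- `T` is at least a quarter of `min (L + 1) w`: the lag is at most the clock, and `T` would have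
doubled otherwise. -/
theorem SkI.inv_length_le (hp : p.Valid) {sk : Sk} {L : ℕ} (h : SkI p sk L) :
    1 / (sk.T : ℝ) ≤ 4 * ((if L + 1 ≤ p.w then 1 / ((L : ℝ) + 1) else 0) + 1 / p.w) := by
  have hT : (0 : ℝ) < sk.T := by exact_mod_cast h.ok.length
  have hw : (0 : ℝ) < p.w := by exact_mod_cast hp.w
  have hT' := h.ok.length
  have h1 := h.len'
  have h2 := (h.lag_le hp).2
  have h3 := h.slack_le hp
  have h4 := Nat.le_mul_of_pos_right (p.slack sk.W) hp.P_pos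
  rcases le_or_gt p.w (4 * sk.T) with h5 | h5
  · have : (p.w : ℝ) ≤ 4 * sk.T := by exact_mod_cast h5
    have h6 : 1 / (sk.T : ℝ) ≤ 4 * (1 / p.w) := by
      rw [mul_one_div, div_le_div_iff₀ hT hw]; linarith
    have h7 : (0 : ℝ) ≤ if L + 1 ≤ p.w then 1 / ((L : ℝ) + 1) else 0 := by
      split_ifs
      · positivity
      · exact le_rfl
    linarith
  · have h8 : L + 1 ≤ 4 * sk.T := by omega
    have h9 : ((L : ℝ) + 1) ≤ 4 * sk.T := by exact_mod_cast h8
    rw [if_pos (by omega)]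
    have h6 : 1 / (sk.T : ℝ) ≤ 4 * (1 / ((L : ℝ) + 1)) := by
      rw [mul_one_div, div_le_div_iff₀ hT (by positivity)]; linarith
    have : 0 < 1 / (p.w : ℝ) := by positivity
    linarith

/-- Only the last `3w` arrivals count, each with at most `3P/T`. By `inv_length_le` the total is
`O(P)` times a harmonic sum up to `w` plus a constant. -/
theorem facSum_cnt (hp : p.Valid) (hi : ∀ a ∈ fu, a.1 < p.k) :
    facSum p (cntWt p (p.steps sk₀ fu).Lh) fu sk₀ ≤ 24 * p.P * p.lg := by
  have hF := skI_at hp hi le_rfl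
  rw [List.take_length] at hF
  have lF := hF.lag_le hp
  have sF := hF.slack_le_w hp
  have hw : (0 : ℝ) < p.w := by exact_mod_cast hp.w
  have hP : (0 : ℝ) < p.P := by exact_mod_cast hp.P_pos
  rw [facSum_eq]
  have h1 : ∀ t ∈ Finset.range fu.length, facLog p (cntWt p (p.steps sk₀ fu).Lh)
      ((fu.map Prod.snd).drop (t + 1)) (p.steps sk₀ (fu.take t)) ((fu.map Prod.snd).getD t 0) ≤
      12 * p.P * ((if t + 1 ≤ p.w then 1 / ((t : ℝ) + 1) else 0) +
        if fu.length - 3 * p.w ≤ t then 1 / (p.w : ℝ) else 0) := by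
    intro t ht
    rw [Finset.mem_range] at ht
    have hs := skI_at hp hi ht.le
    refine (facLog_cnt hp hs _ _).trans ?_
    have h7 : (0 : ℝ) ≤ if t + 1 ≤ p.w then 1 / ((t : ℝ) + 1) else 0 := by
      split_ifs
      · positivity
      · exact le_rfl
    by_cases hc : (p.steps sk₀ fu).Lh < (p.steps sk₀ (fu.take t)).Lh + p.w + 1 + p.w
    · have h2 := (hs.lag_le hp).1
      rw [if_pos hc, if_pos (show fu.length - 3 * p.w ≤ t by omega), div_eq_mul_one_div]
      refine (mul_le_mul_of_nonneg_left (hs.inv_length_le hp) (by positivity)).trans_eq ?_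
      ring
    · rw [if_neg hc]
      have h8 : (0 : ℝ) ≤ if fu.length - 3 * p.w ≤ t then 1 / (p.w : ℝ) else 0 := by
        split_ifs
        · positivity
        · exact le_rfl
      positivity
  refine (Finset.sum_le_sum h1).trans ?_
  rw [← Finset.mul_sum, Finset.sum_add_distrib]
  have h2 := sum_inv_le p.w fu.length
  have h3 : ∑ t ∈ Finset.range fu.length, (if fu.length - 3 * p.w ≤ t then 1 / (p.w : ℝ) else 0) ≤ 3 := by
    rw [← Finset.sum_filter, Finset.sum_const, nsmul_eq_mul]
    have : (Finset.range fu.length).filter (fu.length - 3 * p.w ≤ ·) =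
        Finset.Ico (fu.length - 3 * p.w) fu.length := by
      ext t; simp; tauto
    rw [this, Nat.card_Ico, mul_one_div, div_le_iff₀ hw]
    exact_mod_cast (show fu.length - (fu.length - 3 * p.w) ≤ 3 * p.w by omega)
  have h4 := hp.log_w_le
  have h5 : (9 : ℝ) ≤ p.lg := by exact_mod_cast hp.lg_pos
  calc _ ≤ 12 * p.P * ((1 + p.lg) + 3 : ℝ) := by gcongr; linarith
    _ ≤ 12 * p.P * (2 * p.lg) := by gcongr; linarith
    _ = _ := by ring

end Monitoring
end

/-! ### The large deviation bound. -/

noncomputable section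
open scoped ENNReal
namespace Monitoring

variable {p : Par} {u : Wt}

/-! ### Concentration of the estimate -/

theorem Ex_add {α : Type} (q : PMF α) (f g : α → ℝ≥0∞) :
    Ex q (fun a => f a + g a) = Ex q f + Ex q g := by
  simp only [Ex, mul_add, ENNReal.tsum_add]

/-- The law of the state of the system after the arrivals in a list. -/
def law (p : Par) (A : List (Fin p.k × Fin p.n)) : PMF (System p.k) :=
  runFrom (PMF.pure (initSystem p.n p.k p.w p.e p.d)) A

theorem codes_lt {n k : ℕ} (A : List (Fin k × Fin n)) : ∀ a ∈ codes A, a.1 < k := by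
  intro a ha
  obtain ⟨b, -, rfl⟩ := List.mem_map.1 ha
  exact b.1.2

theorem codes_snd {n k : ℕ} (A : List (Fin k × Fin n)) :
    (codes A).map Prod.snd = A.map fun a => (a.2 : ℕ) := by simp [codes]

/-- An empty slot has threshold, value and expiry `0` and so counts as hit with weight `χ₁ 0 0`; the
initial potential is `1`. -/
theorem pot_ex (hp : p.Valid) (A : List (Fin p.k × Fin p.n))
    (hu : ∀ Lh ≤ (p.steps sk₀ (codes A)).Lh, u.Good p Lh)
    (hf : ∀ l W T Lh v, fresh p u l W T Lh v ≠ ⊤) (h1 : u.χ₁ 0 0 = 1) (h0 : u.ϰ 0 = 1) :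
    Ex (law p A) (fun S => pot p u [] S.coord.mem) ≤
      ENNReal.ofReal (Real.exp (facSum p u (codes A) sk₀)) := by
  refine (runFrom_ex hp A (skOk_init hp) hu (inv_init hp) fun S' d l _ _ => le_rfl).trans ?_
  have e : pot p u (A.map fun a => (a.2 : ℕ)) (initSystem p.n p.k p.w p.e p.d).coord.mem = 1 := by
    unfold pot slotPot thr val expi
    have z : ∀ a, 5 ≤ a → (initSystem p.n p.k p.w p.e p.d).coord.mem a = 0 := fun a ha =>
      paramMem_zero ha
    rw [z 28 (by norm_num), h0, mul_one]
    refine Finset.prod_eq_one fun s _ => ?_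
    rw [z (4 * s + 65) (by omega), z (4 * s + 66) (by omega), z (4 * s + 67) (by omega), sf_zero, h1]
  rw [e, one_mul]
  exact Qf_init_le hp hf _ (codes_lt A) _

theorem pot_main {r : ℝ} {F : ℕ} {m : Memory} (h9 : m 9 = F) (h28 : m 28 ≤ F) :
    pot p (mainWt p r F) [] m = ENNReal.ofReal (Real.exp (r * (liveSum p m / p.A))) := by
  unfold pot liveSum
  have e : (mainWt p r F).ϰ (m 28) = 1 := if_pos h28
  rw [e, mul_one, Nat.cast_sum, Finset.sum_div, Finset.mul_sum, Real.exp_sum,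
    ENNReal.ofReal_prod_of_nonneg fun _ _ => Real.exp_nonneg _]
  refine Finset.prod_congr rfl fun s _ => ?_
  unfold slotPot mainWt
  rw [h9]
  by_cases h1 : thr m s = 0 <;> by_cases h2 : F < expi m s <;> simp [sf, h1, h2]

/-- A sample was dropped that would still be live at `F`, so all `N` slots were in use then, and
each carries the factor `2`. -/
theorem pot_cnt {F Lh : ℕ} {m : Memory} (h : SlotsOk p Lh m) (h28 : F < m 28) :
    pot p (cntWt p F) [] m = ENNReal.ofReal (Real.exp (p.N * Real.log 2)) := by
  unfold pot
  have e : (cntWt p F).ϰ (m 28) = 1 := rfl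
  rw [e, mul_one, Finset.prod_congr rfl (g := fun _ => 2) fun s hs => ?_]
  · rw [Finset.prod_const, Finset.card_range, mul_comm, Real.exp_mul, Real.exp_log two_pos]
    rw [Real.rpow_natCast, ENNReal.ofReal_pow (by norm_num)]
    simp
  · have hs := Finset.mem_range.1 hs
    have h1 := h.drop s hs
    have h2 := h.pos (by omega) s hs
    unfold slotPot cntWt
    dsimp only
    have h3 : 0 < expi m s ∧ F < expi m s + p.w := ⟨h2, by omega⟩
    rw [if_pos h3]
    simp [sf]

theorem Par.Valid.ell_le (hp : p.Valid) : 2 ^ p.a ≤ 16 * p.lg := by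
  have h1 := hp.lg_pos
  have h2 : 2 ^ (Nat.size p.lg - 1) ≤ p.lg := Nat.lt_size.1 (by
    have := Nat.size_pos.2 (show 0 < p.lg by omega); omega)
  have h3 : Nat.size p.lg = Nat.size p.lg - 1 + 1 := by
    have := Nat.size_pos.2 (show 0 < p.lg by omega); omega
  unfold Par.a
  rw [h3, pow_add, pow_add]
  omega

/-- The exponent in the large deviation bound. -/
theorem exponent_bound (hp : p.Valid) {m x r : ℝ} (hm : 0 < m) (hx : x ≤ 2 * m)
    (hr : r = p.P / (32 * p.e * (2 ^ p.a) ^ 2 * m)) :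
    x * (r / (16 * p.e) + r ^ 2 * (m / p.P * (2 ^ p.a) ^ 2)) - r * (m / (4 * p.e)) ≤ -(2 * p.lg) ∧
      r * (m / p.P * 2 ^ p.a) ≤ 1 ∧ 0 < r := by
  have hP : (0 : ℝ) < p.P := by exact_mod_cast hp.P_pos
  have he : (1 : ℝ) ≤ p.e := by have := hp.e; exact_mod_cast (show 1 ≤ p.e by omega)
  have hl : (9 : ℝ) ≤ p.lg := by exact_mod_cast hp.lg_pos
  have hell : (2 : ℝ) ^ p.a ≤ 16 * p.lg := by exact_mod_cast hp.ell_le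
  have hell1 : (1 : ℝ) ≤ 2 ^ p.a := one_le_pow₀ one_le_two
  have hPd : (p.P : ℝ) = 2 ^ 40 * (p.e * p.e) * (p.lg * p.lg * p.lg * p.lg) := by
    unfold Par.P; push_cast; ring
  have hrp : 0 < r := by rw [hr]; positivity
  refine ⟨?_, ?_, hrp⟩
  · have h1 : x * (r / (16 * p.e) + r ^ 2 * (m / p.P * (2 ^ p.a) ^ 2)) ≤
        2 * m * (r / (16 * p.e) + r ^ 2 * (m / p.P * (2 ^ p.a) ^ 2)) := by gcongr
    -- The bias takes half of the deviation term, and `r` makes the quadratic term half of what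
    -- remains.
    have h2 : 2 * m * (r / (16 * p.e) + r ^ 2 * (m / p.P * (2 ^ p.a) ^ 2)) - r * (m / (4 * p.e)) =
        -(p.P / (512 * p.e ^ 2 * (2 ^ p.a) ^ 2)) := by
      rw [hr]; field_simp; ring
    have h3 : 2 * (p.lg : ℝ) ≤ p.P / (512 * p.e ^ 2 * (2 ^ p.a) ^ 2) := by
      rw [le_div_iff₀ (by positivity)]
      have h4 : ((2 : ℝ) ^ p.a) ^ 2 ≤ (16 * (p.lg : ℝ)) ^ 2 := by gcongr
      calc 2 * (p.lg : ℝ) * (512 * (p.e : ℝ) ^ 2 * ((2 : ℝ) ^ p.a) ^ 2) ≤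
          2 * (p.lg : ℝ) * (512 * (p.e : ℝ) ^ 2 * (16 * (p.lg : ℝ)) ^ 2) := by gcongr
        _ = 2 ^ 18 * ((p.e : ℝ) * p.e) * ((p.lg : ℝ) * p.lg * p.lg * 1) := by ring
        _ ≤ 2 ^ 40 * ((p.e : ℝ) * p.e) * ((p.lg : ℝ) * p.lg * p.lg * p.lg) := by
          gcongr
          · norm_num
          · norm_num
          · linarith
        _ = p.P := hPd.symm
    linarith
  · have : r * (m / p.P * 2 ^ p.a) = 1 / (32 * p.e * 2 ^ p.a) := by rw [hr]; field_simp
    rw [this, div_le_one (by positivity)]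
    nlinarith

/-- With high probability no sample in use was dropped, and the sum of the values is accurate. -/
theorem concentration (hp : p.Valid) (A : List (Fin p.k × Fin p.n)) {t₀ : ℕ} {m : ℕ} (hm : 0 < m)
    (ht₀ : ∀ t ≤ (codes A).length, (p.steps sk₀ (codes A)).Lh <
      (p.steps sk₀ ((codes A).take t)).Lh + p.w + 1 ↔ t₀ ≤ t)
    (h2 : (codes A).length ≤ t₀ + 2 * p.w) (hT : (p.steps sk₀ (codes A)).T ≤ m)
    (hx : (codes A).length - t₀ ≤ 2 * m) :
    (law p A).toOuterMeasure {S | ¬ (S.coord.mem 28 ≤ (p.steps sk₀ (codes A)).Lh ∧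
      |(liveSum p S.coord.mem : ℝ) / p.A - ent (((codes A).map Prod.snd).drop t₀)| ≤
        m / (4 * p.e))} ≤ 3 * ENNReal.ofReal (Real.exp (-(2 * p.lg))) := by
  have hm' : (0 : ℝ) < m := by exact_mod_cast hm
  have hT' : ((p.steps sk₀ (codes A)).T : ℝ) ≤ m := by exact_mod_cast hT
  obtain ⟨r, hr⟩ : ∃ r : ℝ, r = p.P / (32 * p.e * (2 ^ p.a) ^ 2 * m) := ⟨_, rfl⟩
  obtain ⟨b1, b2, b3⟩ := exponent_bound hp hm' (x := ((codes A).length - t₀ : ℕ)) (by exact_mod_cast hx) hr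
  set F := (p.steps sk₀ (codes A)).Lh with hF
  set f := ent (((codes A).map Prod.snd).drop t₀) with hf
  set η : ℝ := m / (4 * p.e) with hη
  have s1 := facSum_main hp (codes_lt A) (r := r) ht₀ h2 hT' (by rwa [abs_of_pos b3])
  have s2 := facSum_main hp (codes_lt A) (r := -r) ht₀ h2 hT' (by rwa [abs_neg, abs_of_pos b3])
  have s3 := facSum_cnt hp (codes_lt A)
  rw [abs_of_pos b3] at s1
  rw [abs_neg, abs_of_pos b3, neg_sq] at s2
  rw [← hF, ← hf] at s1 s2
  rw [← hF] at s3
  have g1 : ∀ r, Ex (law p A) (fun S => pot p (mainWt p r F) [] S.coord.mem) ≤ _ := fun r =>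
    pot_ex hp A (fun Lh h => mainWt_good h) (fresh_main_ne_top hp r F) (by simp [mainWt])
      (by simp [mainWt])
  have g3 := pot_ex hp A (u := cntWt p F) (fun Lh _ => cntWt_good) (fun l W T Lh v => by
    rw [fresh_cnt]; exact ENNReal.ofReal_ne_top) (by simp [cntWt]) rfl
  have comb : ∀ (u : Wt) (c y : ℝ), Ex (law p A) (fun S => pot p u [] S.coord.mem) ≤
      ENNReal.ofReal (Real.exp y) → c + y ≤ -(2 * p.lg) →
      Ex (law p A) (fun S => ENNReal.ofReal (Real.exp c) * pot p u [] S.coord.mem) ≤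
        ENNReal.ofReal (Real.exp (-(2 * p.lg))) := by
    intro u c y h1 h2
    rw [Ex_mul_left]
    refine (mul_le_mul_right h1 _).trans ?_
    rw [← ENNReal.ofReal_mul (Real.exp_nonneg _), ← Real.exp_add]
    exact ENNReal.ofReal_le_ofReal (Real.exp_le_exp.2 h2)
  have k1 := comb _ (-(r * (f + η))) _ (g1 r) (by linarith)
  have k2 := comb _ (r * (f - η)) _ (g1 (-r)) (by linarith)
  -- `N log 2 ≥ 512 P lg` dominates the exponent `24 P lg` of the counting potential.
  have k3 := comb _ (-(p.N * Real.log 2)) _ g3 (by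
    have hl : (9 : ℝ) ≤ p.lg := by exact_mod_cast hp.lg_pos
    have hP : (1 : ℝ) ≤ p.P := by exact_mod_cast hp.P_pos
    have hN : (p.N : ℝ) = 1024 * p.P * p.lg := by unfold Par.N; push_cast; ring
    have hPl : (p.lg : ℝ) ≤ p.P * p.lg := le_mul_of_one_le_left (by linarith) hP
    have h3 : (1024 * p.P * p.lg : ℝ) * (1 / 2) ≤ 1024 * p.P * p.lg * Real.log 2 := by
      have := Real.log_two_gt_d9
      gcongr; linarith
    rw [hN]
    linarith)
  have total := (add_le_add (add_le_add k1 k2) k3)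
  rw [← Ex_add, ← Ex_add] at total
  -- On the bad event one of three test functions is at least `1`: upper deviation, lower deviation,
  -- or a relevant drop.
  refine (measure_le_ex fun S hS hbad => ?_).trans (total.trans_eq (by ring))
  have hI := (runFrom_sure hp A (skOk_init hp) (inv_init hp) S hS).1
  have one : ∀ c y : ℝ, 0 ≤ c + y → (1 : ℝ≥0∞) ≤ ENNReal.ofReal (Real.exp c) * ENNReal.ofReal (Real.exp y) := by
    intro c y h
    rw [← ENNReal.ofReal_mul (Real.exp_nonneg _), ← Real.exp_add]
    exact ENNReal.one_le_ofReal.2 (Real.one_le_exp h)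
  by_cases h28 : S.coord.mem 28 ≤ F
  · have hdev : η < |(liveSum p S.coord.mem : ℝ) / p.A - f| := by
      by_contra h
      exact hbad ⟨h28, not_lt.1 h⟩
    rw [pot_main hI.ci.now h28, pot_main hI.ci.now h28]
    rcases lt_abs.1 hdev with h | h
    · refine (one _ _ ?_).trans (le_self_add.trans le_self_add)
      nlinarith
    · refine (one _ _ ?_).trans (le_add_self.trans le_self_add)
      nlinarith
  · rw [pot_cnt hI.ci.slots (not_le.1 h28)]
    exact (one _ _ (by linarith)).trans le_add_self

end Monitoring
end

/-! ### From the sum of the values to the entropy. -/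

noncomputable section
open scoped ENNReal
namespace Monitoring

variable {p : Par}

/-! ### Entropy -/

theorem sum_count {n : ℕ} (l : List (Fin n)) : ∑ i, (l.count i : ℝ) = l.length := by
  induction l with
  | nil => simp
  | cons v l ih =>
    simp only [List.count_cons, Nat.cast_add, Finset.sum_add_distrib, ih, List.length_cons]
    simp [Nat.cast_ite]

/-- Prepending an item that occurs `r` times raises its `c log c` by `inc r`. -/
theorem ent_eq_sum {n : ℕ} (l : List (Fin n)) :
    ent (l.map (fun a : Fin n => (a : ℕ))) = ∑ i, (l.count i : ℝ) * Real.log (l.count i) := by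
  induction l with
  | nil => simp [ent]
  | cons v l ih =>
    rw [List.map_cons, ent, ih, List.count_map_of_injective l _ Fin.val_injective,
      ← Finset.add_sum_erase _ _ (Finset.mem_univ v),
      ← Finset.add_sum_erase _ (fun i => (((v :: l).count i : ℕ) : ℝ) * _) (Finset.mem_univ v),
      List.count_cons_self, ← add_assoc]
    congr 1
    · unfold inc; push_cast; ring
    · refine Finset.sum_congr rfl fun i hi => ?_
      rw [List.count_cons_of_ne (Finset.ne_of_mem_erase hi).symm]

theorem entropy_eq {n : ℕ} {l : List (Fin n)} (hl : l ≠ []) : entropy l =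
    (Real.log l.length - ent (l.map (fun a : Fin n => (a : ℕ))) / l.length) / Real.log 2 := by
  have hm : (0 : ℝ) < l.length := by exact_mod_cast List.length_pos_iff.2 hl
  rw [ent_eq_sum, Finset.sum_div]
  have e : Real.log l.length = ∑ i, (l.count i : ℝ) / l.length * Real.log l.length := by
    rw [← Finset.sum_mul, ← Finset.sum_div, sum_count, div_self hm.ne', one_mul]
  rw [e, ← Finset.sum_sub_distrib, Finset.sum_div]
  unfold entropy
  refine Finset.sum_congr rfl fun i _ => ?_
  rcases Nat.eq_zero_or_pos (l.count i) with h | h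
  · simp [h]
  · have h' : (0 : ℝ) < l.count i := by exact_mod_cast h
    rw [Real.logb, one_div, inv_div, Real.log_div hm.ne' h'.ne']
    ring

theorem entropy_nonneg {n : ℕ} (l : List (Fin n)) : 0 ≤ entropy l := by
  refine Finset.sum_nonneg fun i _ => mul_nonneg (by positivity) ?_
  rcases Nat.eq_zero_or_pos (l.count i) with h | h
  · simp [h]
  · have h' : (0 : ℝ) < l.count i := by exact_mod_cast h
    have h2 : (l.count i : ℝ) ≤ l.length := by exact_mod_cast List.count_le_length
    refine Real.logb_nonneg one_lt_two ?_
    rw [one_div, inv_div, le_div_iff₀ h']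
    linarith

/-- Each removed entry takes away an `inc` between `0` and `1 + log M`. -/
theorem ent_drop_bounds (l : List ℕ) {M : ℕ} (hM : l.length ≤ M) (j : ℕ) :
    ent (l.drop j) ≤ ent l ∧ ent l ≤ ent (l.drop j) + j * (1 + Real.log M) := by
  induction l generalizing j with
  | nil =>
    have := Real.log_natCast_nonneg M
    simp [ent]; positivity
  | cons v l ih =>
    have hlog := Real.log_natCast_nonneg M
    cases j with
    | zero => simp
    | succ j =>
      obtain ⟨h1, h2⟩ := ih ((Nat.le_succ _).trans hM) j
      obtain ⟨i1, i2⟩ := inc_bounds (l.count v)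
      have h3 : Real.log ((l.count v : ℝ) + 1) ≤ Real.log M := by
        refine Real.log_le_log (by positivity) ?_
        have := List.count_le_length (a := v) (l := l)
        rw [List.length_cons] at hM
        exact_mod_cast (show l.count v + 1 ≤ M by omega)
      simp only [List.drop_succ_cons, ent]
      push_cast
      constructor <;> nlinarith

theorem ent_nonneg (l : List ℕ) : 0 ≤ ent l := by
  have := (ent_drop_bounds l le_rfl l.length).1
  simpa [ent] using this

theorem ent_le (l : List ℕ) {M : ℕ} (hM : l.length ≤ M) : ent l ≤ l.length * (1 + Real.log M) := by
  have := (ent_drop_bounds l hM l.length).2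
  simpa [ent] using this

/-- Two suffixes of about the same length. -/
theorem ent_drop_close (l : List ℕ) {a b M D : ℕ} (ha : l.length ≤ a + M) (hb : l.length ≤ b + M)
    (hab : a ≤ b + D) (hba : b ≤ a + D) :
    |ent (l.drop a) - ent (l.drop b)| ≤ D * (1 + Real.log M) := by
  have hlog := Real.log_natCast_nonneg M
  have main : ∀ a b, l.length ≤ a + M → a ≤ b → b ≤ a + D →
      |ent (l.drop a) - ent (l.drop b)| ≤ D * (1 + Real.log M) := by
    intro a b ha hab hba
    obtain ⟨h1, h2⟩ := ent_drop_bounds (l.drop a) (M := M) (by rw [List.length_drop]; omega) (b - a)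
    rw [List.drop_drop, show a + (b - a) = b by omega] at h1 h2
    rw [abs_of_nonneg (by linarith)]
    have : ((b - a : ℕ) : ℝ) ≤ D := by exact_mod_cast (show b - a ≤ D by omega)
    nlinarith
  rcases le_total a b with h | h
  · exact main a b ha h hba
  · rw [abs_sub_comm]; exact main b a hb h hab

/-! ### Logarithms from lengths -/

/-- The length of `x^E` is `E log₂ x` up to one bit, so division by `E` leaves an error `1/E`. -/
theorem size_pow_bounds {x : ℕ} (hx : 0 < x) (E : ℕ) :
    E * Real.log x ≤ Nat.size (x ^ E) * Real.log 2 ∧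
      Nat.size (x ^ E) * Real.log 2 ≤ E * Real.log x + Real.log 2 := by
  have hpos : 0 < x ^ E := pow_pos hx E
  have h1 : ((x ^ E : ℕ) : ℝ) ≤ 2 ^ Nat.size (x ^ E) := by exact_mod_cast (Nat.lt_size_self _).le
  have hs := Nat.size_pos.2 hpos
  have h2 : 2 ^ (Nat.size (x ^ E) - 1) ≤ x ^ E := Nat.lt_size.1 (by omega)
  have h3 : (2 : ℝ) ^ (Nat.size (x ^ E) - 1) ≤ (x ^ E : ℕ) := by exact_mod_cast h2
  have l1 := Real.log_le_log (by exact_mod_cast hpos) h1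
  have l2 := Real.log_le_log (by positivity) h3
  rw [Real.log_pow] at l1 l2
  rw [Nat.cast_pow, Real.log_pow] at l1 l2
  rw [Nat.cast_sub (by omega)] at l2
  push_cast at l1 l2
  constructor <;> linarith

/-- The approximation of `1 / log 2`. -/
theorem scale_bounds {K E : ℕ} (hK : 0 < K) (hE : 0 < E) :
    |(K : ℝ) * (Nat.size ((K + 1) ^ E) - Nat.size (K ^ E) : ℕ) / E - 1 / Real.log 2| ≤
      2 / K + K / E := by
  have hK' : (0 : ℝ) < K := by exact_mod_cast hK
  have hE' : (0 : ℝ) < E := by exact_mod_cast hE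
  have hL := Real.log_two_gt_d9
  obtain ⟨a1, a2⟩ := size_pow_bounds (Nat.succ_pos K) E
  obtain ⟨b1, b2⟩ := size_pow_bounds hK E
  have hmono : Nat.size (K ^ E) ≤ Nat.size ((K + 1) ^ E) :=
    Nat.size_le_size (Nat.pow_le_pow_left (Nat.le_succ K) E)
  rw [Nat.cast_sub hmono]
  rw [Nat.succ_eq_add_one] at a1 a2
  generalize (Nat.size ((K + 1) ^ E) : ℝ) = x at *
  generalize (Nat.size (K ^ E) : ℝ) = y at *
  push_cast at a1 a2
  have u1 : Real.log ((K : ℝ) + 1) - Real.log K ≤ 1 / K := by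
    rw [← Real.log_div (by positivity) (by positivity)]
    refine (Real.log_le_sub_one_of_pos (by positivity)).trans_eq ?_
    field_simp; ring
  have u2 : 1 / ((K : ℝ) + 1) ≤ Real.log ((K : ℝ) + 1) - Real.log K := by
    rw [← Real.log_div (by positivity) (by positivity)]
    refine le_trans (le_of_eq ?_) (Real.one_sub_inv_le_log_of_pos (by positivity))
    rw [inv_div]; field_simp; ring
  set D := Real.log ((K : ℝ) + 1) - Real.log K with hD
  have v : |(x - y) * Real.log 2 - E * D| ≤ Real.log 2 := by
    rw [abs_le, hD]; constructor <;> linarith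
  -- `K log (1 + 1/K)` is close to `1`; the base-2 version of this is how integers provide `1 / ln
  -- 2`.
  have v2 : |(K : ℝ) * D - 1| ≤ 1 / K := by
    have w1 : (K : ℝ) * D ≤ 1 := by
      calc (K : ℝ) * D ≤ K * (1 / K) := by gcongr
        _ = 1 := by field_simp
    have w2 : 1 - 1 / (K : ℝ) ≤ K * D := by
      calc 1 - 1 / (K : ℝ) ≤ K * (1 / (K + 1)) := by
            rw [mul_one_div, le_div_iff₀ (by positivity), sub_mul, one_div, inv_mul_eq_div]
            have : (1 : ℝ) ≤ (K + 1) / K := by rw [le_div_iff₀ hK']; linarith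
            linarith
        _ ≤ K * D := by gcongr
    rw [abs_le]; constructor <;> linarith
  have e : (K : ℝ) * (x - y) / E - 1 / Real.log 2 =
      (K / E * ((x - y) * Real.log 2 - E * D) + (K * D - 1)) / Real.log 2 := by
    field_simp; ring
  rw [e, abs_div, abs_of_pos (show 0 < Real.log 2 by linarith), div_le_iff₀ (by linarith)]
  refine (abs_add_le _ _).trans ?_
  rw [abs_mul, abs_of_pos (show (0 : ℝ) < K / E by positivity)]
  have z1 : (K : ℝ) / E * |(x - y) * Real.log 2 - E * D| ≤ K / E * Real.log 2 := by gcongr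
  have z2 : 1 / (K : ℝ) ≤ 2 / K * Real.log 2 := by
    rw [div_mul_eq_mul_div]; gcongr; linarith
  linarith

/-! ### Accuracy -/

/-- The value that the coordinator reports. -/
theorem estimate_close (hp : p.Valid) {S : System p.k} (hR : Rep p S.coord.mem) {m : ℕ}
    (hm : min (S.coord.mem 9) p.w = m) (hm0 : 0 < m) {H X : ℝ}
    (hX : X = (liveSum p S.coord.mem : ℝ) / p.A) (hX1 : X ≤ 5 * p.w * m) (hH : 0 ≤ H) :
    |H - S.estimate| ≤ |H - (Real.log m - X / m) / Real.log 2| + 1 / (8 * p.e) := by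
  have hA : (0 : ℝ) < p.A := by exact_mod_cast hp.A_pos
  have hm' : (0 : ℝ) < m := by exact_mod_cast hm0
  have he : (1 : ℝ) ≤ p.e := by have := hp.e; exact_mod_cast (show 1 ≤ p.e by omega)
  have hw : (1 : ℝ) ≤ p.w := by exact_mod_cast hp.w
  have hK0 : 0 < p.K := by have := hp.K_ge.2; omega
  have hKR : (0 : ℝ) < p.K := by exact_mod_cast hK0
  have hL := Real.log_two_gt_d9
  have hE : (p.E : ℝ) = 2 ^ 20 * p.K * p.w * p.e := by unfold Par.E; push_cast; ring
  have hE0 : (0 : ℝ) < p.E := by rw [hE]; positivity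
  have hE1 : 0 < p.E := by exact_mod_cast hE0
  have hX0 : 0 ≤ X := by rw [hX]; positivity
  obtain ⟨hn, hd⟩ := hR
  rw [hm] at hn hd
  set d := p.K * (Nat.size ((p.K + 1) ^ p.E) - Nat.size (p.K ^ p.E)) with hdd
  set Y : ℝ := (d : ℝ) / p.E with hY
  set Z : ℝ := (Nat.size (m ^ p.E) : ℝ) / p.E with hZ
  -- The subtraction in the numerator is truncated at zero, which does no harm because the entropy
  -- is nonnegative.
  have hest : S.estimate = max 0 (Z - Y * (X / m)) := by
    unfold System.estimate
    rw [hn, hd]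
    have e0 : ((p.E * p.A * m : ℕ) : ℝ) = p.E * p.A * m := by push_cast; ring
    have hpos : (0 : ℝ) < (p.E * p.A * m : ℕ) := by rw [e0]; positivity
    have e1 : Z - Y * (X / m) = ((Nat.size (m ^ p.E) * p.A * m : ℕ) - (d * liveSum p S.coord.mem : ℕ) : ℝ)
        / (p.E * p.A * m : ℕ) := by
      rw [hZ, hY, hX, e0]; push_cast; field_simp
    rcases le_total (d * liveSum p S.coord.mem) (Nat.size (m ^ p.E) * p.A * m) with h | h
    · rw [Nat.cast_sub h, ← e1, max_eq_right]
      rw [e1]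
      refine div_nonneg (sub_nonneg.2 ?_) hpos.le
      exact_mod_cast h
    · rw [Nat.sub_eq_zero_of_le h, Nat.cast_zero, zero_div, max_eq_left]
      rw [e1]
      refine div_nonpos_of_nonpos_of_nonneg (sub_nonpos.2 ?_) hpos.le
      exact_mod_cast h
  have h1 : |H - S.estimate| ≤ |H - (Z - Y * (X / m))| := by
    rw [hest]
    have := abs_max_sub_max_le_abs H (Z - Y * (X / m)) 0
    rwa [max_eq_left hH, max_comm] at this
  have hZ' : |Z - Real.log m / Real.log 2| ≤ 1 / p.E := by
    obtain ⟨a1, a2⟩ := size_pow_bounds hm0 p.E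
    have e : Z - Real.log m / Real.log 2 =
        (Nat.size (m ^ p.E) * Real.log 2 - p.E * Real.log m) / (p.E * Real.log 2) := by
      rw [hZ]; field_simp
    rw [e, abs_div, abs_of_nonneg (by linarith : 0 ≤ Nat.size (m ^ p.E) * Real.log 2 - p.E * Real.log m),
      abs_of_pos (mul_pos hE0 (by linarith)), div_le_div_iff₀ (mul_pos hE0 (by linarith)) hE0]
    have : (Nat.size (m ^ p.E) * Real.log 2 - p.E * Real.log m) * p.E ≤ Real.log 2 * p.E := by
      gcongr; linarith
    linarith
  have hY' : |Y - 1 / Real.log 2| ≤ 2 / p.K + p.K / p.E := by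
    have := scale_bounds hK0 hE1
    rw [hY, hdd]
    push_cast at this ⊢
    exact this
  have K1 : (2 : ℝ) ^ 20 * (p.w ^ 2 * p.e) ≤ p.K := by exact_mod_cast hp.K_ge.1
  have hXm : X / m ≤ 5 * p.w := by rw [div_le_iff₀ hm']; exact hX1
  have hXm0 : 0 ≤ X / m := by positivity
  have r1 : 1 / (p.E : ℝ) ≤ 1 / (1024 * p.e) := by
    rw [hE]
    have hK1 : (1 : ℝ) ≤ p.K := by exact_mod_cast hK0
    have : 1 * 1 ≤ (p.K : ℝ) * p.w := by gcongr
    refine one_div_le_one_div_of_le (by positivity) ?_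
    nlinarith
  have r2 : (2 / (p.K : ℝ) + p.K / p.E) * (5 * p.w) ≤ 1 / (1024 * p.e) := by
    have q1 : 2 / (p.K : ℝ) ≤ 2 / (2 ^ 20 * (p.w * p.e)) := by
      refine div_le_div_of_nonneg_left (by norm_num) (by positivity) (le_trans ?_ K1)
      have : (p.w : ℝ) ≤ p.w ^ 2 := by nlinarith
      gcongr
    have q2 : (p.K : ℝ) / p.E = 1 / (2 ^ 20 * (p.w * p.e)) := by rw [hE]; field_simp
    rw [q2]
    calc _ ≤ (2 / (2 ^ 20 * ((p.w : ℝ) * p.e)) + 1 / (2 ^ 20 * (p.w * p.e))) * (5 * p.w) := by gcongr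
      _ = 15 / 2 ^ 20 / p.e := by field_simp; norm_num
      _ ≤ 1 / 1024 / p.e := div_le_div_of_nonneg_right (by norm_num) (by positivity)
      _ = _ := by field_simp
  have h2 : |(Real.log m - X / m) / Real.log 2 - (Z - Y * (X / m))| ≤ 1 / (8 * p.e) := by
    have e : (Real.log m - X / m) / Real.log 2 - (Z - Y * (X / m)) =
        -(Z - Real.log m / Real.log 2) + (Y - 1 / Real.log 2) * (X / m) := by ring
    rw [e]
    refine (abs_add_le _ _).trans ?_
    rw [abs_neg, abs_mul, abs_of_nonneg hXm0]
    have : |Y - 1 / Real.log 2| * (X / m) ≤ (2 / (p.K : ℝ) + p.K / p.E) * (5 * p.w) :=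
      mul_le_mul hY' hXm hXm0 (by positivity)
    have e3 : 1 / (8 * (p.e : ℝ)) = 128 * (1 / (1024 * p.e)) := by field_simp; norm_num
    have : 0 < 1 / (1024 * (p.e : ℝ)) := by positivity
    linarith
  have := abs_sub_le H ((Real.log m - X / m) / Real.log 2) (Z - Y * (X / m))
  linarith

/-- The effect of the errors on the entropy. -/
theorem entropy_error {m m₁ D F F₁ X c e lg : ℝ} (hmR : 0 < m) (m1 : m ≤ m₁) (m2 : m₁ ≤ m + D)
    (hD : 0 ≤ D) (hc : 1 ≤ c) (c3 : c ≤ 2 + lg) (hlg : 9 ≤ lg) (he : 1 ≤ e)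
    (hθ1 : D / m * (64 * e * lg) ≤ 1) (d1 : |F₁ - F| ≤ D * c) (d2 : F₁ ≤ m₁ * c) (d4 : 0 ≤ F₁)
    (hX : |X - F| ≤ m / (4 * e)) :
    |(Real.log m₁ - F₁ / m₁) / Real.log 2 - (Real.log m - X / m) / Real.log 2| ≤ 7 / (8 * e) := by
  have hL := Real.log_two_gt_d9
  have hm₁R : 0 < m₁ := by linarith
  obtain ⟨θ, hθ⟩ : ∃ θ : ℝ, θ = D / m := ⟨_, rfl⟩
  have hθ0 : 0 ≤ θ := by rw [hθ]; positivity
  rw [← hθ] at hθ1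
  have e0 : (Real.log m₁ - F₁ / m₁) / Real.log 2 - (Real.log m - X / m) / Real.log 2 =
      ((Real.log m₁ - Real.log m) + (F₁ / m - F₁ / m₁) + ((F - F₁) / m) + (X - F) / m) /
        Real.log 2 := by ring
  rw [e0, abs_div, abs_of_pos (show 0 < Real.log 2 by linarith)]
  have t1 : |Real.log m₁ - Real.log m| ≤ θ := by
    rw [abs_of_nonneg (sub_nonneg.2 (Real.log_le_log hmR m1)),
      ← Real.log_div hm₁R.ne' hmR.ne']
    refine (Real.log_le_sub_one_of_pos (by positivity)).trans ?_
    rw [hθ, div_sub_one hmR.ne']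
    gcongr; linarith
  have t2 : |F₁ / m - F₁ / m₁| ≤ c * θ := by
    have e1 : F₁ / m - F₁ / m₁ = F₁ / m₁ * ((m₁ - m) / m) := by field_simp
    have h1 : 0 ≤ ((m₁ : ℝ) - m) / m := div_nonneg (by linarith) hmR.le
    rw [e1, abs_of_nonneg (mul_nonneg (by positivity) h1)]
    refine mul_le_mul ?_ ?_ h1 (by linarith)
    · rw [div_le_iff₀ hm₁R]; linarith
    · rw [hθ]; gcongr; linarith
  have t3 : |(F - F₁) / m| ≤ c * θ := by
    rw [abs_div, abs_of_pos hmR, abs_sub_comm, hθ, mul_div_assoc', mul_comm c]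
    gcongr
  have t4 : |(X - F) / m| ≤ 1 / (4 * e) := by
    rw [abs_div, abs_of_pos hmR, div_le_iff₀ hmR]
    refine hX.trans_eq (by ring)
  have t5 : θ + 2 * (c * θ) ≤ 1 / (8 * e) := by
    have h1 : θ + 2 * (c * θ) ≤ θ * (8 * lg) := by
      have : θ * (1 + 2 * c) ≤ θ * (8 * lg) := by gcongr; linarith
      linarith
    refine h1.trans ?_
    rw [le_div_iff₀ (by positivity)]
    calc θ * (8 * lg) * (8 * e) = θ * (64 * e * lg) := by ring
      _ ≤ 1 := hθ1
  have t6 : |(Real.log m₁ - Real.log m) + (F₁ / m - F₁ / m₁) + ((F - F₁) / m) + (X - F) / m| ≤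
      3 / (8 * e) := by
    have a1 := abs_add_le ((Real.log m₁ - Real.log m) + (F₁ / m - F₁ / m₁) + ((F - F₁) / m)) ((X - F) / m)
    have a2 := abs_add_three (Real.log m₁ - Real.log m) (F₁ / m - F₁ / m₁) ((F - F₁) / m)
    have e3 : 3 / (8 * (e : ℝ)) = 1 / (8 * e) + 1 / (4 * e) := by field_simp; norm_num
    linarith
  -- Passing to bits: `log 2 > 3/7`. The last eighth of the error is left for the arithmetic in
  -- `estimate_close`.
  have t7 : 3 / (8 * (e : ℝ)) / Real.log 2 ≤ 7 / (8 * e) := by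
    rw [div_le_iff₀ (by linarith), div_mul_eq_mul_div]
    gcongr
    linarith
  exact (div_le_div_of_nonneg_right t6 (by linarith)).trans t7

/-- If the sum of the values is accurate, then so is the estimate. -/
theorem accurate (hp : p.Valid) {A : List (Fin p.k × Fin p.n)} (hA : A ≠ []) {S : System p.k}
    (hI : Inv p (p.steps sk₀ (codes A)) S) {t₀ m : ℕ}
    (hm : min (p.steps sk₀ (codes A)).Lh p.w = m)
    (ht : t₀ ≤ (codes A).length) (h2 : (codes A).length ≤ t₀ + 2 * p.w)
    (hx : (codes A).length - t₀ ≤ 2 * m)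
    (ha : t₀ ≤ (codes A).length + p.slack (p.steps sk₀ (codes A)).W - p.w)
    (hb : (codes A).length ≤ t₀ + p.w + p.slack (p.steps sk₀ (codes A)).W)
    (hX : |(liveSum p S.coord.mem : ℝ) / p.A - ent (((codes A).map Prod.snd).drop t₀)| ≤
      m / (4 * p.e)) :
    |entropy (window p.w A) - S.estimate| ≤ 1 / p.e := by
  have hs : SkI p (p.steps sk₀ (codes A)) A.length := by
    have := skI_at hp (codes_lt A) le_rfl
    rwa [List.take_length, codes, List.length_map] at this
  have hlen : (codes A).length = A.length := by rw [codes, List.length_map]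
  rw [hlen] at ht h2 hx ha hb
  rw [codes_snd] at hX
  have hA0 := List.length_pos_iff.2 hA
  have hm0 : 0 < m := hm ▸ (hs.length_le hp hA0).2
  obtain ⟨l1, l2⟩ := hs.lag_le hp
  have l3 := hs.slack_le hp
  rw [hm] at l3
  set Δ := p.slack (p.steps sk₀ (codes A)).W with hΔ
  have hw0 := hp.w
  have hB : (window p.w A).length = min A.length p.w := by
    unfold window; rw [List.length_map, List.length_drop]; omega
  have hBne : window p.w A ≠ [] := by
    rw [← List.length_pos_iff, hB]; omega
  have hBm : (window p.w A).map (fun a : Fin p.n => (a : ℕ)) =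
      (A.map fun a => (a.2 : ℕ)).drop (A.length - p.w) := by
    unfold window; rw [List.map_map, List.map_drop]; rfl
  set m₁ := min A.length p.w with hm₁
  have m1 : m ≤ m₁ ∧ m₁ ≤ m + Δ := by omega
  set l := A.map fun a => (a.2 : ℕ) with hl
  have hll : l.length = A.length := by rw [hl, List.length_map]
  obtain ⟨F₁, hF₁⟩ : ∃ F₁, F₁ = ent (l.drop (A.length - p.w)) := ⟨_, rfl⟩
  obtain ⟨F, hF⟩ : ∃ F, F = ent (l.drop t₀) := ⟨_, rfl⟩
  -- The true window and the live segment begin at most `Δ` arrivals apart.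
  have d1 : |F₁ - F| ≤ Δ * (1 + Real.log (2 * p.w : ℕ)) := by
    rw [hF₁, hF]
    exact ent_drop_close l (by omega) (by omega) (by omega) (by omega)
  have d2 : F₁ ≤ m₁ * (1 + Real.log (2 * p.w : ℕ)) := by
    have := ent_le (l.drop (A.length - p.w)) (M := 2 * p.w) (by rw [List.length_drop]; omega)
    rw [List.length_drop, hll, show A.length - (A.length - p.w) = m₁ by omega] at this
    rwa [hF₁]
  have d3 : F ≤ 2 * m * (1 + Real.log (2 * p.w : ℕ)) := by
    have := ent_le (l.drop t₀) (M := 2 * p.w) (by rw [List.length_drop]; omega)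
    rw [List.length_drop, hll, ← hF] at this
    refine this.trans ?_
    have hlog := Real.log_natCast_nonneg (2 * p.w)
    have : ((A.length - t₀ : ℕ) : ℝ) ≤ 2 * m := by exact_mod_cast hx
    gcongr
  have d4 : 0 ≤ F₁ := by rw [hF₁]; exact ent_nonneg _
  obtain ⟨c, hc⟩ : ∃ c : ℝ, c = 1 + Real.log (2 * p.w : ℕ) := ⟨_, rfl⟩
  rw [← hF] at hX
  rw [← hc] at d1 d2 d3
  have hwR : (1 : ℝ) ≤ p.w := by exact_mod_cast hw0
  have hlg : (9 : ℝ) ≤ p.lg := by exact_mod_cast hp.lg_pos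
  have he : (1 : ℝ) ≤ p.e := by have := hp.e; exact_mod_cast (show 1 ≤ p.e by omega)
  have c1 : 1 ≤ c := by rw [hc]; have := Real.log_natCast_nonneg (2 * p.w); linarith
  have c2 : c ≤ 2 * p.w := by
    have := Real.log_le_sub_one_of_pos (show (0 : ℝ) < (2 * p.w : ℕ) by push_cast; linarith)
    push_cast at this
    rw [hc]; push_cast; linarith
  have c3 : c ≤ 2 + p.lg := by
    have h1 := hp.log_w_le
    have h2 := Real.log_two_lt_d9
    rw [hc]; push_cast
    rw [Real.log_mul (by norm_num) (by linarith)]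
    linarith
  have hmR : (0 : ℝ) < m := by exact_mod_cast hm0
  have hmR1 : (1 : ℝ) ≤ m := by exact_mod_cast hm0
  have hP : (0 : ℝ) < p.P := by exact_mod_cast hp.P_pos
  have hΔP : (Δ : ℝ) * p.P ≤ m := by exact_mod_cast l3
  have m₁R : (m : ℝ) ≤ m₁ ∧ (m₁ : ℝ) ≤ m + Δ := by exact_mod_cast m1
  have hθ1 : (Δ : ℝ) / m * (64 * p.e * p.lg) ≤ 1 := by
    have h1 : 64 * (p.e : ℝ) * p.lg ≤ p.P := by
      have hPd : (p.P : ℝ) = 2 ^ 40 * (p.e * p.e) * (p.lg * p.lg * p.lg * p.lg) := by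
        unfold Par.P; push_cast; ring
      rw [hPd]
      calc 64 * (p.e : ℝ) * p.lg = 64 * (p.e * 1) * (1 * 1 * 1 * p.lg) := by ring
        _ ≤ 2 ^ 40 * (p.e * p.e) * (p.lg * p.lg * p.lg * p.lg) := by
          gcongr
          · norm_num
          all_goals linarith
    calc (Δ : ℝ) / m * (64 * p.e * p.lg) ≤ Δ / m * p.P := by gcongr
      _ = Δ * p.P / m := by ring
      _ ≤ 1 := by rw [div_le_one hmR]; exact hΔP
  obtain ⟨X, hXd⟩ : ∃ X : ℝ, X = (liveSum p S.coord.mem : ℝ) / p.A := ⟨_, rfl⟩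
  rw [← hXd] at hX
  have hX' := abs_le.1 hX
  have x1 : X ≤ 5 * p.w * m := by
    have h1 : (m : ℝ) / (4 * p.e) ≤ m := div_le_self hmR.le (by linarith)
    have h2 : 2 * (m : ℝ) * c ≤ 2 * m * (2 * p.w) := by gcongr
    have h3 : (m : ℝ) * 1 ≤ m * p.w := by gcongr
    nlinarith
  have key := estimate_close hp (hI.rep (by omega)) (m := m) (by rw [hI.ci.now]; exact hm) hm0 hXd x1
    (entropy_nonneg (window p.w A))
  refine key.trans ?_
  rw [entropy_eq hBne, hBm, hB, ← hF₁]
  have := entropy_error hmR m₁R.1 m₁R.2 (by positivity) c1 c3 hlg he hθ1 d1 d2 d4 hX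
  have e4 : 1 / (p.e : ℝ) = 7 / (8 * p.e) + 1 / (8 * p.e) := by field_simp; norm_num
  linarith

end Monitoring
end

/-! ### Bounds for bits, space and time. -/

noncomputable section
open scoped ENNReal
namespace Monitoring

variable {p : Par} {fu : List (ℕ × ℕ)}

/-! ### Counting the events of the schedule -/

theorem SkI.T_le (hp : p.Valid) {sk : Sk} {L : ℕ} (h : SkI p sk L) : sk.T ≤ p.w := by
  have := h.len; have := hp.w; omega

theorem changes_pow (sk : Sk) (fu : List (ℕ × ℕ)) : 2 ^ changes p sk fu * sk.T ≤ (p.steps sk fu).T := by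
  induction fu generalizing sk with
  | nil => simp [changes, Par.steps]
  | cons a fu ih =>
    refine le_trans ?_ (ih (p.step sk a.1))
    have h : (p.step sk a.1).T = sk.T ∨ (p.step sk a.1).T = 2 * sk.T := by
      rcases step_cases p sk a.1 with ⟨-, h⟩ | ⟨-, ⟨-, h⟩ | ⟨-, ⟨-, h⟩ | ⟨-, h⟩⟩⟩ <;> rw [h] <;> simp
    rw [changes, pow_add]
    split_ifs with h1
    · rw [h1, pow_zero, one_mul]
    · rw [h.resolve_left h1]
      exact le_of_eq (by ring)

theorem changes_le (hp : p.Valid) {sk : Sk} (h : SkOk p sk) {L : ℕ} (h' : SkI p (p.steps sk fu) L) :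
    changes p sk fu ≤ p.lg := by
  have h1 := changes_pow (p := p) sk fu
  have h2 := Nat.le_mul_of_pos_right (2 ^ changes p sk fu) h.length
  have h3 : p.w < 2 ^ p.lg := (Nat.lt_size_self _).trans_le
    (Nat.pow_le_pow_right (by norm_num) hp.size_le_lg.2.2.1)
  have h4 := h'.T_le hp
  exact (Nat.pow_lt_pow_iff_right (by norm_num : 1 < 2)).1 (by omega) |>.le

/-- A tick advances the clock by at least `W / (4k)`, while `min Lh w < 2T` and `T < 2WP`; so a tick
covers a fraction of order `1 / (kP)` of the window. -/
theorem SkI.unit_bound (hp : p.Valid) {sk : Sk} {L : ℕ} (h : SkI p sk L) :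
    0 < p.unit sk.W ∧ min (sk.Lh + p.unit sk.W) p.w ≤ 17 * (p.k * p.P * p.unit sk.W) := by
  have hk := hp.k
  have hP := hp.P_pos
  have hu : 0 < p.unit sk.W ∧ sk.W ≤ 4 * (p.k * p.unit sk.W) := by
    have h1 := Nat.lt_div_mul_add (a := sk.W) (show 0 < 2 * p.k by omega)
    have h2 : sk.W / (2 * p.k) = p.blk sk.W := rfl
    rw [h2] at h1
    unfold Par.unit
    split_ifs with h0
    · rw [h0] at h1 ⊢; omega
    · have : p.k * 1 ≤ p.k * p.blk sk.W := Nat.mul_le_mul_left _ (by omega)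
      have : p.blk sk.W * (2 * p.k) = 2 * (p.k * p.blk sk.W) := by ring
      rw [add_zero]; omega
  refine ⟨hu.1, ?_⟩
  have h1 := h.len'
  have h2 := h.high
  have h3 : sk.W * p.P ≤ 4 * (p.k * p.unit sk.W) * p.P := Nat.mul_le_mul_right _ hu.2
  have h4 : 4 * (p.k * p.unit sk.W) * p.P = 4 * (p.k * p.P * p.unit sk.W) := by ring
  have h5 : 1 * p.unit sk.W ≤ p.k * p.P * p.unit sk.W := Nat.mul_le_mul_right _ (Nat.mul_pos hk hP)
  rw [mul_assoc] at h2
  omega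

/-- Each tick is charged to the clock values that it passes; by `unit_bound` the weights `1 / min (y
+ 1) w` of these sum to at least `1 / (17 k P)`. -/
theorem ticks_sum (hp : p.Valid) {sk : Sk} {L : ℕ} (h : SkI p sk L) (hi : ∀ a ∈ fu, a.1 < p.k) :
    (ticks p sk fu : ℝ) ≤ 17 * (p.k * p.P) *
      ∑ y ∈ Finset.Ico sk.Lh (p.steps sk fu).Lh, 1 / ((min (y + 1) p.w : ℕ) : ℝ) := by
  induction fu generalizing sk L with
  | nil => simp [ticks, Par.steps]
  | cons a fu ih =>
    have hw := hp.w
    have h' := h.step hp (hi a (by simp))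
    have ih' := ih h' fun b hb => hi b (by simp [hb])
    have e : p.steps sk (a :: fu) = p.steps (p.step sk a.1) fu := rfl
    have m1 := (step_mono (p := p) sk a.1).2.2
    have m2 := (steps_mono (p := p) (p.step sk a.1) fu).2.2
    rw [e, ← Finset.sum_Ico_consecutive _ m1 m2, ticks, mul_add, Nat.cast_add]
    refine add_le_add ?_ ih'
    split_ifs with hE
    swap
    · rw [Nat.cast_zero]; positivity
    have hL : (p.step sk a.1).Lh = sk.Lh + p.unit sk.W := by
      rcases step_cases p sk a.1 with ⟨h0, -⟩ | ⟨-, ⟨-, h⟩ | ⟨-, ⟨-, h⟩ | ⟨-, h⟩⟩⟩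
      · exact absurd hE h0
      all_goals rw [h]
    obtain ⟨u1, u2⟩ := h.unit_bound hp
    rw [hL, Nat.cast_one]
    set U := p.unit sk.W
    have hM : 0 < min (sk.Lh + U) p.w := by omega
    have hMR : (0 : ℝ) < (min (sk.Lh + U) p.w : ℕ) := by exact_mod_cast hM
    calc (1 : ℝ) ≤ 17 * (p.k * p.P) * (U * (1 / (min (sk.Lh + U) p.w : ℕ))) := by
          rw [mul_one_div, mul_div_assoc', le_div_iff₀ hMR, one_mul]
          have : ((min (sk.Lh + U) p.w : ℕ) : ℝ) ≤ (17 * (p.k * p.P * U) : ℕ) := by exact_mod_cast u2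
          refine this.trans_eq ?_
          push_cast; ring
      _ ≤ _ := by
          gcongr
          rw [← nsmul_eq_mul]
          have hc : (Finset.Ico sk.Lh (sk.Lh + U)).card = U := by rw [Nat.card_Ico]; omega
          refine le_trans (le_of_eq (by rw [hc])) (Finset.card_nsmul_le_sum (Finset.Ico sk.Lh (sk.Lh + U))
            _ (1 / ((min (sk.Lh + U) p.w : ℕ) : ℝ)) fun y hy => ?_)
          rw [Finset.mem_Ico] at hy
          refine one_div_le_one_div_of_le ?_ ?_
          · exact_mod_cast (show 0 < min (y + 1) p.w by omega)
          · exact_mod_cast (show min (y + 1) p.w ≤ min (sk.Lh + U) p.w by omega)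

theorem ticks_le (hp : p.Valid) {sk : Sk} {L : ℕ} (h : SkI p sk L) (hi : ∀ a ∈ fu, a.1 < p.k)
    (hL : (p.steps sk fu).Lh ≤ sk.Lh + 2 * p.w) : ticks p sk fu ≤ p.k * p.N := by
  have hw : (0 : ℝ) < p.w := by exact_mod_cast hp.w
  have h1 := ticks_sum hp h hi
  have h2 : ∑ y ∈ Finset.Ico sk.Lh (p.steps sk fu).Lh, 1 / ((min (y + 1) p.w : ℕ) : ℝ) ≤ 3 + p.lg := by
    have s1 : ∀ y ∈ Finset.Ico sk.Lh (p.steps sk fu).Lh, 1 / ((min (y + 1) p.w : ℕ) : ℝ) ≤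
        (if y + 1 ≤ p.w then 1 / ((y : ℝ) + 1) else 0) + 1 / p.w := fun y _ => by
      split_ifs with hy
      · rw [min_eq_left hy]; push_cast
        have : 0 < 1 / (p.w : ℝ) := by positivity
        linarith
      · rw [min_eq_right (by omega), zero_add]
    refine (Finset.sum_le_sum s1).trans ?_
    rw [Finset.sum_add_distrib, Finset.sum_const, nsmul_eq_mul, Nat.card_Ico]
    have s2 : ∑ y ∈ Finset.Ico sk.Lh (p.steps sk fu).Lh,
        (if y + 1 ≤ p.w then 1 / ((y : ℝ) + 1) else 0) ≤ 1 + Real.log p.w := by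
      refine le_trans (Finset.sum_le_sum_of_subset_of_nonneg (fun y hy => ?_) fun y _ _ => ?_)
        (sum_inv_le p.w (p.steps sk fu).Lh)
      · rw [Finset.mem_Ico] at hy; exact Finset.mem_range.2 hy.2
      · split_ifs <;> positivity
    have s3 : (((p.steps sk fu).Lh - sk.Lh : ℕ) : ℝ) * (1 / p.w) ≤ 2 := by
      rw [mul_one_div, div_le_iff₀ hw]
      exact_mod_cast (show (p.steps sk fu).Lh - sk.Lh ≤ 2 * p.w by omega)
    have := hp.log_w_le
    linarith
  have h3 : (9 : ℝ) ≤ p.lg := by exact_mod_cast hp.lg_pos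
  have h4 : (ticks p sk fu : ℝ) ≤ (p.k * p.N : ℕ) := by
    refine h1.trans ?_
    have : (p.N : ℝ) = 2 ^ 10 * p.P * p.lg := by unfold Par.N; push_cast; ring
    rw [Nat.cast_mul, this]
    calc _ ≤ 17 * (p.k * p.P) * (2 * p.lg : ℝ) := by gcongr; linarith
      _ = 34 * (p.k * p.P * p.lg : ℝ) := by ring
      _ ≤ 1024 * (p.k * p.P * p.lg : ℝ) := by gcongr; norm_num
      _ = _ := by ring
  exact_mod_cast h4

/-! ### Resources -/

theorem law_append (p : Par) (A B : List (Fin p.k × Fin p.n)) :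
    law p (A ++ B) = (law p A).bind fun S => runFrom (PMF.pure S) B := by
  unfold law
  rw [runFrom_append, runFrom_bind]

theorem law_sure (hp : p.Valid) (A : List (Fin p.k × Fin p.n)) :
    Sure (law p A) (Inv p (p.steps sk₀ (codes A))) :=
  (runFrom_sure hp A (skOk_init hp) (inv_init hp)).mono fun _ h => h.1

theorem expSum_ge (m : Memory) (R : ℕ) : p.N * R ≤ expSum p m R := by
  unfold expSum
  calc p.N * R = ∑ s ∈ Finset.range p.N, R := by simp
    _ ≤ _ := Finset.sum_le_sum fun s _ => le_max_right _ _

theorem Inv.expSum_le {sk : Sk} {S : System p.k} (h : Inv p sk S) {R : ℕ} (hR : R ≤ sk.Lh) :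
    expSum p S.coord.mem R ≤ p.N * (sk.Lh + p.w + 1) := by
  unfold expSum
  calc _ ≤ ∑ s ∈ Finset.range p.N, (sk.Lh + p.w + 1) := Finset.sum_le_sum fun s hs =>
        max_le (h.ci.slots.expi s (Finset.mem_range.1 hs)) (by omega)
    _ = _ := by simp

theorem skI_codes (hp : p.Valid) (A : List (Fin p.k × Fin p.n)) :
    SkI p (p.steps sk₀ (codes A)) A.length := by
  have := skI_at hp (codes_lt A) le_rfl
  rwa [List.take_length, codes, List.length_map] at this

/-- Over at most `w` arrivals, the bits are paid by the credits at the start, by the broadcasts for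
new samples and resynchronizations, and by the ticks. Each is `O(k N lg)` units. -/
theorem bits_le (hp : p.Valid) (A B : List (Fin p.k × Fin p.n)) (hB : B.length ≤ p.w) :
    Sure (law p (A ++ B)) fun S => (S.bitLog.take B.length).sum ≤ 100 * (p.β * p.k * p.N * p.lg) := by
  rw [law_append]
  refine (law_sure hp A).bind fun S hI => ?_
  have hs := skI_codes hp A
  refine (runFrom_sure hp B hs.ok hI).mono ?_
  rintro S' ⟨hI', d, l, hR⟩
  have hlen : (codes B).length = B.length := by rw [codes, List.length_map]
  have hs' := hs.steps hp (codes_lt B)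
  rw [hR.log, List.take_append_of_le_length (by rw [hR.len, hlen]),
    List.take_of_length_le (by rw [hR.len, hlen])]
  have hLh : (p.steps (p.steps sk₀ (codes A)) (codes B)).Lh ≤ (p.steps sk₀ (codes A)).Lh + 2 * p.w := by
    have h1 := (hs'.lag_le hp).1
    have h2 := (hs.lag_le hp).2
    have h3 := hs.slack_le_w hp
    omega
  -- The clipped expiry sum starts at `N * Lh` or more, ends at `N * (Lh + 3w + 1)` or less, and
  -- gains at least `w + 1` per stored sample.
  have hd : d ≤ 3 * p.N := by
    have h1 := hR.expi _ le_rfl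
    have h2 := expSum_ge (p := p) S.coord.mem (p.steps sk₀ (codes A)).Lh
    have h3 := hI'.expSum_le (steps_mono _ (codes B)).2.2
    have h4 := Nat.mul_le_mul_left p.N (Nat.add_le_add_right hLh (p.w + 1))
    have : (p.w + 1) * d ≤ (p.w + 1) * (3 * p.N) := by nlinarith
    exact Nat.le_of_mul_le_mul_left this (by omega)
  have hc := changes_le hp hs.ok hs'
  have ht := ticks_le hp hs (codes_lt B) hLh
  have hk := p.kk_le hp (p.steps (p.steps sk₀ (codes A)) (codes B)).W
  have hn : netCredit p S.sites ≤ p.k * (2 * p.N) := by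
    unfold netCredit
    calc _ ≤ ∑ j : Fin p.k, 2 * p.N := Finset.sum_le_sum fun j _ => by
          have := credit_le (p := p) (m := (S.sites j).mem)
          have := hp.N_pos
          omega
      _ = _ := by simp
  have hb := hR.bits
  have hlg := hp.lg_pos
  have h1 : 20 * p.β * netCredit p S.sites ≤ 20 * p.β * (p.k * (2 * p.N)) := Nat.mul_le_mul_left _ hn
  have h2 : p.kk (p.steps (p.steps sk₀ (codes A)) (codes B)).W *
      (d + p.N * changes p (p.steps sk₀ (codes A)) (codes B)) ≤ p.k * (3 * p.N + p.N * p.lg) := by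
    gcongr
  have h3 := Nat.mul_le_mul_left (60 * p.β) (Nat.add_le_add h2 ht)
  have h4 : (p.β * p.k * p.N) * (280 + 60 * p.lg) ≤ (p.β * p.k * p.N) * (100 * p.lg) :=
    Nat.mul_le_mul_left _ (by omega)
  have h5 := Nat.zero_le (20 * p.β * netCredit p S'.sites)
  linarith

theorem peak_le (hp : p.Valid) (A : List (Fin p.k × Fin p.n)) :
    Sure (law p A) fun S => ∀ i, (S.sites i).peak ≤ 4 * κ * p.β * p.N := by
  refine (law_sure hp A).mono fun S h i => (h.ci.sites.idle i).res.peak.trans ?_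
  have : 20 ≤ p.N := by
    have h1 := hp.P_pos
    have h2 := hp.lg_pos
    have : 1 * 1 ≤ p.P * p.lg := Nat.mul_le_mul h1 (by omega)
    unfold Par.N
    rw [mul_assoc]; omega
  unfold Par.Y
  calc 2 * κ * p.β * (p.N + 20) ≤ 2 * κ * p.β * (p.N + p.N) := Nat.mul_le_mul_left _ (by omega)
    _ = _ := by ring

/-- Broadcasts reach all `k` sites only once `W ≥ 2k`. Then `2kP ≤ WP ≤ T` is at most `L` and `w`,
so `k N` is `O(lg * L)`, and the cost per arrival does not depend on `k`. -/
theorem work_le (hp : p.Valid) {sk : Sk} {L d : ℕ} (h : SkI p sk L) (hL : 0 < L)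
    (hd : (p.w + 1) * d ≤ p.N * (L + p.w + 1)) :
    p.kk sk.W * (d + p.N * p.lg) ≤ L * (p.N * (2 + p.lg)) := by
  have hlg := hp.lg_pos
  have hP := hp.P_pos
  have hw := hp.w
  by_cases h0 : 0 < sk.W / (2 * p.k)
  · have hW : 2 * p.k ≤ sk.W := (Nat.div_pos_iff.1 h0).2
    have h1 := h.low.resolve_left (by have := hp.k; omega)
    have h2 : 2 * p.k * p.P ≤ sk.W * p.P := Nat.mul_le_mul_right _ hW
    have h3 := (h.length_le hp hL).1
    have h4 := (h.lag_le hp).1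
    have h5 : 2 * p.k * p.P ≤ L ∧ 2 * p.k * p.P ≤ p.w := by omega
    have e : p.kk sk.W = p.k := by unfold Par.kk; rw [if_pos h0]
    rw [e]
    have hN : p.k * p.N = 512 * p.lg * (2 * p.k * p.P) := by unfold Par.N; ring
    have h6 : 1024 * p.lg ≤ p.N := by
      unfold Par.N
      calc 1024 * p.lg = 2 ^ 10 * 1 * p.lg := by ring
        _ ≤ _ := by gcongr; exact hP
    have h7 : p.k * d ≤ L * p.N := by
      refine Nat.le_of_mul_le_mul_left (show (p.w + 1) * (p.k * d) ≤ (p.w + 1) * (L * p.N) from ?_)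
        (Nat.succ_pos _)
      calc (p.w + 1) * (p.k * d) = p.k * ((p.w + 1) * d) := by ring
        _ ≤ p.k * (p.N * (L + p.w + 1)) := Nat.mul_le_mul_left _ hd
        _ = 512 * p.lg * (2 * p.k * p.P * L + 2 * p.k * p.P * (p.w + 1)) := by
            rw [← mul_assoc, hN]; ring
        _ ≤ 512 * p.lg * ((p.w + 1) * L + L * (p.w + 1)) := by
            gcongr
            · omega
            · exact h5.1
        _ = 1024 * p.lg * (L * (p.w + 1)) := by ring
        _ ≤ p.N * (L * (p.w + 1)) := by gcongr
        _ = _ := by ring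
    have h8 : p.k * (p.N * p.lg) ≤ L * (p.N * p.lg) := by
      calc p.k * (p.N * p.lg) = 512 * p.lg * (2 * p.k * p.P) * p.lg := by rw [← hN]; ring
        _ ≤ 1024 * p.lg * L * p.lg := by
            gcongr
            · norm_num
            · exact h5.1
        _ ≤ p.N * L * p.lg := by gcongr
        _ = _ := by ring
    have h9 : 0 ≤ L * p.N := Nat.zero_le _
    calc p.k * (d + p.N * p.lg) = p.k * d + p.k * (p.N * p.lg) := by ring
      _ ≤ L * p.N + L * (p.N * p.lg) := Nat.add_le_add h7 h8
      _ ≤ L * p.N + (L * p.N + L * (p.N * p.lg)) := Nat.le_add_left _ _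
      _ = _ := by ring
  · have e : p.kk sk.W = 1 := by unfold Par.kk; rw [if_neg h0]
    rw [e, one_mul]
    have h1 : d ≤ L * (2 * p.N) := by
      refine Nat.le_of_mul_le_mul_left (show (p.w + 1) * d ≤ (p.w + 1) * (L * (2 * p.N)) from
        hd.trans ?_) (Nat.succ_pos _)
      calc p.N * (L + p.w + 1) ≤ p.N * (2 * (L * (p.w + 1))) := by gcongr; nlinarith
        _ = _ := by ring
    have h2 : 1 * (p.N * p.lg) ≤ L * (p.N * p.lg) := Nat.mul_le_mul_right _ hL
    calc d + p.N * p.lg ≤ L * (2 * p.N) + L * (p.N * p.lg) := by omega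
      _ = _ := by ring

theorem time_le (hp : p.Valid) (A : List (Fin p.k × Fin p.n)) :
    Sure (law p A) fun S => netTime S.sites ≤ 40 * (κ * p.β * p.N * p.lg) * A.length := by
  rcases eq_or_ne A [] with rfl | hA
  · refine sure_pure ?_
    simp [netTime, initSystem, initMachine]
  have hL := List.length_pos_iff.2 hA
  refine (runFrom_sure hp A (skOk_init hp) (inv_init hp)).mono ?_
  rintro S ⟨hI, d, l, hR⟩
  have hs := skI_codes hp A
  have hN := hp.N_pos
  have hlg := hp.lg_pos
  have hd : (p.w + 1) * d ≤ p.N * (A.length + p.w + 1) := by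
    have h1 := hR.expi 0 (Nat.zero_le _)
    have h2 := hI.expSum_le (Nat.zero_le _)
    have h3 : p.N * ((p.steps sk₀ (codes A)).Lh + p.w + 1) ≤ p.N * (A.length + p.w + 1) :=
      Nat.mul_le_mul_left _ (by have := (hs.lag_le hp).1; omega)
    omega
  have hw := work_le hp hs hL hd
  have hc := changes_le hp (skOk_init hp) hs
  have ht := hR.time
  have h0 : netTime (initSystem p.n p.k p.w p.e p.d).sites = 0 := by
    simp [netTime, initSystem, initMachine]
  rw [h0, show (codes A).length = A.length by rw [codes, List.length_map]] at ht
  refine ht.trans ?_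
  have h1 : p.kk (p.steps sk₀ (codes A)).W * (d + p.N * changes p sk₀ (codes A)) ≤
      A.length * (p.N * (2 + p.lg)) := le_trans (by gcongr) hw
  have h2 := Nat.mul_le_mul_left (20 * (κ * p.β)) h1
  have h3 : A.length * (κ * p.β * (7 * p.N + 60 + 20 * (p.N * (2 + p.lg)))) ≤
      A.length * (κ * p.β * (p.N * (40 * p.lg))) := by
    gcongr
    nlinarith
  linarith

end Monitoring
end

/-! ### The theorem. -/

noncomputable section
open scoped ENNReal
namespace Monitoring

variable {p : Par}

/-! ### The theorem -/

theorem accuracy (hp : p.Valid) {A : List (Fin p.k × Fin p.n)} (hA : A ≠ []) :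
    (law p A).toOuterMeasure {S | 1 / (p.e : ℝ) < |entropy (window p.w A) - S.estimate|} ≤
      ENNReal.ofReal (1 / p.d) := by
  obtain ⟨t₀, ht, hlive, ha, hb⟩ := live_start hp (codes_lt A)
  have hs := skI_codes hp A
  have hlen : (codes A).length = A.length := by rw [codes, List.length_map]
  obtain ⟨l1, l2⟩ := hs.length_le hp (List.length_pos_iff.2 hA)
  have l3 := hs.slack_le hp
  have l4 := Nat.le_mul_of_pos_right (p.slack (p.steps sk₀ (codes A)).W) hp.P_pos
  have l5 := (hs.lag_le hp).2
  have h2 : (codes A).length ≤ t₀ + 2 * p.w := by omega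
  have hx : (codes A).length - t₀ ≤ 2 * min (p.steps sk₀ (codes A)).Lh p.w := by omega
  refine ((law p A).toOuterMeasure_mono ?_).trans
    ((concentration hp A l2 hlive h2 l1 hx).trans ?_)
  · rintro S ⟨hS, hsup⟩ h
    exact (accurate hp hA (law_sure hp A S hsup) rfl ht h2 hx ha hb h.2).not_gt hS
  -- `3 e^(-2 lg) ≤ 1/d`, because `3` and `d ≤ 2^lg` are both at most `e^lg`.
  · have h3 : (3 : ℝ≥0∞) = ENNReal.ofReal 3 := by simp
    rw [h3, ← ENNReal.ofReal_mul (by norm_num)]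
    refine ENNReal.ofReal_le_ofReal ?_
    have hd : (0 : ℝ) < p.d := by exact_mod_cast hp.d
    have hlg : (9 : ℝ) ≤ p.lg := by exact_mod_cast hp.lg_pos
    have e1 : (p.d : ℝ) ≤ Real.exp p.lg := by
      have h4 : (p.d : ℝ) ≤ 2 ^ p.lg := by
        exact_mod_cast ((Nat.lt_size_self _).trans_le
          (Nat.pow_le_pow_right (by norm_num) hp.size_le_lg.2.2.2.2)).le
      have h5 : (2 : ℝ) ≤ Real.exp 1 := by have := Real.add_one_le_exp 1; linarith
      calc (p.d : ℝ) ≤ 2 ^ p.lg := h4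
        _ ≤ Real.exp 1 ^ p.lg := by gcongr
        _ = _ := by rw [← Real.exp_nat_mul, mul_one]
    have e2 : 3 ≤ Real.exp p.lg := by have := Real.add_one_le_exp (p.lg : ℝ); linarith
    have e3 : Real.exp (-(2 * p.lg)) * (Real.exp p.lg * Real.exp p.lg) = 1 := by
      rw [← Real.exp_add, ← Real.exp_add, ← Real.exp_zero]; congr 1; ring
    rw [le_div_iff₀ hd]
    calc 3 * Real.exp (-(2 * p.lg)) * p.d ≤ Real.exp p.lg * Real.exp (-(2 * p.lg)) * Real.exp p.lg := by
          gcongr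
      _ = 1 := by rw [← e3]; ring

theorem size_le_logb {x : ℕ} (hx : 0 < x) {Z : ℝ} (hZ : 2 ≤ Z) (h : (x : ℝ) ≤ 2 * Z) :
    (Nat.size x : ℝ) ≤ 3 * Real.logb 2 Z := by
  have hs := Nat.size_pos.2 hx
  have h2 : 2 ^ (Nat.size x - 1) ≤ x := Nat.lt_size.1 (by omega)
  have h3 : (2 : ℝ) ^ (Nat.size x - 1) ≤ 2 * Z := le_trans (by exact_mod_cast h2) h
  have h4 := Real.logb_le_logb_of_le (b := 2) (by norm_num) (by positivity) h3
  rw [Real.logb_pow, Real.logb_mul (by norm_num) (by linarith), Real.logb_self_eq_one (by norm_num),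
    Nat.cast_sub hs, Nat.cast_one] at h4
  have h5 : 1 ≤ Real.logb 2 Z := by
    rw [← Real.logb_self_eq_one (b := 2) (by norm_num)]
    exact Real.logb_le_logb_of_le (by norm_num) (by norm_num) hZ
  linarith

theorem lg_le {n k w : ℕ} {ε δ : ℝ} (hn : 0 < n) (hk : 0 < k) (hw : 0 < w) (hε : 0 < ε) (hε1 : ε ≤ 1)
    (hδ : 0 < δ) (hδ1 : δ ≤ 1) :
    ((Par.mk n k w ⌈1 / ε⌉₊ ⌈1 / δ⌉₊).lg : ℝ) ≤ 15 * Real.logb 2 (2 + n * k * w / (ε * δ)) := by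
  have a1 : (1 : ℝ) ≤ 1 / ε := one_le_one_div hε hε1
  have b1 : (1 : ℝ) ≤ 1 / δ := one_le_one_div hδ hδ1
  have a2 : (⌈1 / ε⌉₊ : ℝ) ≤ 2 * (1 / ε) := by have := (Nat.ceil_lt_add_one (by linarith : 0 ≤ 1 / ε)).le; linarith
  have b2 : (⌈1 / δ⌉₊ : ℝ) ≤ 2 * (1 / δ) := by have := (Nat.ceil_lt_add_one (by linarith : 0 ≤ 1 / δ)).le; linarith
  have hn' : (1 : ℝ) ≤ n := by exact_mod_cast hn
  have hk' : (1 : ℝ) ≤ k := by exact_mod_cast hk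
  have hw' : (1 : ℝ) ≤ w := by exact_mod_cast hw
  obtain ⟨Z, hZ⟩ : ∃ Z : ℝ, Z = 2 + n * k * w / (ε * δ) := ⟨_, rfl⟩
  have e : Z = 2 + n * k * w * (1 / ε) * (1 / δ) := by rw [hZ]; field_simp
  rw [← hZ]
  have ea : 0 < ⌈1 / ε⌉₊ := Nat.ceil_pos.2 (by linarith)
  have eb : 0 < ⌈1 / δ⌉₊ := Nat.ceil_pos.2 (by linarith)
  generalize 1 / ε = a at *
  generalize 1 / δ = b at *
  have z0 : ∀ x y z u v : ℝ, 1 ≤ x → 1 ≤ y → 1 ≤ z → 1 ≤ u → 1 ≤ v → x ≤ x * y * z * u * v := by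
    intro x y z u v hx hy hz hu hv
    calc x = x * 1 * 1 * 1 * 1 := by ring
      _ ≤ x * y * z * u * v := by gcongr
  have i1 := z0 n k w a b hn' hk' hw' a1 b1
  have i2 := z0 k n w a b hk' hn' hw' a1 b1
  have i3 := z0 w n k a b hw' hn' hk' a1 b1
  have i4 := z0 a n k w b a1 hn' hk' hw' b1
  have i5 := z0 b n k w a b1 hn' hk' hw' a1
  have c2 : (k : ℝ) * n * w * a * b = n * k * w * a * b := by ring
  have c3 : (w : ℝ) * n * k * a * b = n * k * w * a * b := by ring
  have c4 : a * n * k * w * b = n * k * w * a * b := by ring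
  have c5 : b * n * k * w * a = n * k * w * a * b := by ring
  have hZ2 : 2 ≤ Z := by linarith
  have s1 := size_le_logb hn hZ2 (by linarith)
  have s2 := size_le_logb hk hZ2 (by linarith)
  have s3 := size_le_logb hw hZ2 (by linarith)
  have s4 := size_le_logb ea hZ2 (by linarith)
  have s5 := size_le_logb eb hZ2 (by linarith)
  unfold Par.lg
  push_cast
  linarith

/-- All resources have the shape `2^85 y e² lg^7`: `N` contributes `e² lg^5`, the length `β` and one
more logarithm the rest. `C` has to exceed `2^87 * 15^7`, and also the exponent `7`. -/
theorem cost_le {e lg C : ℕ} {ε Λ y : ℝ} (hε : 0 < ε) (he : (e : ℝ) ≤ 2 / ε) (hlg : (lg : ℝ) ≤ 15 * Λ)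
    (hΛ : 1 ≤ Λ) (hC : 2 ^ 122 ≤ C) (hy : 0 ≤ y) :
    2 ^ 85 * (y * (e ^ 2 * lg ^ 7)) ≤ C * (y / ε ^ 2) * Λ ^ C := by
  have h7 : 7 ≤ C := le_trans (by norm_num) hC
  have hC' : (2 : ℝ) ^ 122 ≤ C := by exact_mod_cast hC
  have h1 : Λ ^ 7 ≤ Λ ^ C := pow_le_pow_right₀ hΛ h7
  calc 2 ^ 85 * (y * ((e : ℝ) ^ 2 * lg ^ 7)) ≤ 2 ^ 85 * (y * ((2 / ε) ^ 2 * (15 * Λ) ^ 7)) := by gcongr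
    _ = 2 ^ 87 * 15 ^ 7 * (y / ε ^ 2) * Λ ^ 7 := by rw [div_pow, mul_pow]; ring
    _ ≤ 2 ^ 122 * (y / ε ^ 2) * Λ ^ 7 := by gcongr; norm_num
    _ ≤ C * (y / ε ^ 2) * Λ ^ C := by gcongr

theorem Par.β_mul_N (p : Par) (c : ℕ) (h : c ≤ 2 ^ 28) :
    c * (p.β * p.N * p.lg) ≤ 2 ^ 85 * (p.e ^ 2 * p.lg ^ 7) := by
  have : p.β * p.N * p.lg = 2 ^ 57 * (p.e ^ 2 * p.lg ^ 7) := by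
    unfold Par.β Par.N Par.P; ring
  rw [this, ← mul_assoc]
  refine Nat.mul_le_mul_right _ ?_
  calc c * 2 ^ 57 ≤ 2 ^ 28 * 2 ^ 57 := Nat.mul_le_mul_right _ h
    _ = 2 ^ 85 := by norm_num

theorem bitLog_length (hp : p.Valid) (A : List (Fin p.k × Fin p.n)) :
    Sure (law p A) fun S => S.bitLog.length = A.length :=
  (runFrom_sure hp A (skOk_init hp) (inv_init hp)).mono fun S ⟨_, d, l, h⟩ => by
    rw [h.log, List.length_append, h.len, codes, List.length_map]; rfl

theorem resources {C : ℕ} (hC : 2 ^ 122 ≤ C) {ε δ : ℝ} (hp : p.Valid) (hε : 0 < ε)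
    (he : (p.e : ℝ) ≤ 2 / ε) (hlg : (p.lg : ℝ) ≤ 15 * Real.logb 2 (2 + p.n * p.k * p.w / (ε * δ)))
    (hΛ : 1 ≤ Real.logb 2 (2 + p.n * p.k * p.w / (ε * δ))) (A : List (Fin p.k × Fin p.n)) :
    Sure (law p A) fun S =>
      (((S.bitLog.take p.w).sum : ℕ) : ℝ) ≤ softO C p.n p.k p.w ε δ (p.k / ε ^ 2 + √p.k / ε ^ 3) ∧
      (∀ i, ((S.sites i).peak : ℝ) ≤ softO C p.n p.k p.w ε δ (1 / ε ^ 2)) ∧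
      ((∑ i, (S.sites i).time : ℕ) : ℝ) ≤ softO C p.n p.k p.w ε δ (1 / ε ^ 2) * A.length := by
  have hlg9 := hp.lg_pos
  have cost := fun y hy => cost_le (y := y) hε he hlg hΛ hC hy
  have hb : Sure (law p A) fun S => (S.bitLog.take (A.drop (A.length - p.w)).length).sum ≤
      100 * (p.β * p.k * p.N * p.lg) := by
    have := bits_le hp (A.take (A.length - p.w)) (A.drop (A.length - p.w))
      (by rw [List.length_drop]; omega)
    rwa [List.take_append_drop] at this
  refine ((hb.and (bitLog_length hp A)).and ((peak_le hp A).and (time_le hp A))).mono ?_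
  rintro S ⟨⟨h1, h0⟩, h2, h3⟩
  unfold softO
  generalize Real.logb 2 (2 + p.n * p.k * p.w / (ε * δ)) = Λ at *
  have hκ : κ = 2 ^ 22 := rfl
  rw [hκ] at h2 h3
  refine ⟨?_, fun i => ?_, ?_⟩
  -- If there were fewer than `w` arrivals, the log is shorter than `w`, and both sides are the
  -- whole log.
  · have e1 : S.bitLog.take p.w = S.bitLog.take (A.drop (A.length - p.w)).length := by
      rw [List.length_drop, List.take_eq_take_iff, h0]; omega
    rw [e1]
    have h4 := Nat.mul_le_mul_left p.k (p.β_mul_N 100 (by norm_num))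
    have h5 : (S.bitLog.take (A.drop (A.length - p.w)).length).sum ≤
        2 ^ 85 * (p.k * (p.e ^ 2 * p.lg ^ 7)) := by linarith
    calc (((S.bitLog.take (A.drop (A.length - p.w)).length).sum : ℕ) : ℝ)
        ≤ 2 ^ 85 * (p.k * (p.e ^ 2 * p.lg ^ 7)) := by exact_mod_cast h5
      _ ≤ C * (p.k / ε ^ 2) * Λ ^ C := cost _ (by positivity)
      -- The term `k / ε²` alone suffices; `√k / ε³` is slack.
      _ ≤ _ := by
        gcongr
        have : 0 ≤ √(p.k : ℝ) / ε ^ 3 := by positivity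
        linarith
  · have h4 := p.β_mul_N (2 ^ 24) (by norm_num)
    have h5 : p.β * p.N * 1 ≤ p.β * p.N * p.lg := Nat.mul_le_mul_left _ (by omega)
    have h6 : (S.sites i).peak ≤ 2 ^ 85 * (1 * (p.e ^ 2 * p.lg ^ 7)) := by
      have := h2 i
      linarith
    refine le_trans ?_ (cost 1 zero_le_one)
    exact_mod_cast h6
  · have h4 := Nat.mul_le_mul_right A.length (p.β_mul_N (40 * 2 ^ 22) (by norm_num))
    have h6 : ∑ i, (S.sites i).time ≤ 2 ^ 85 * (1 * (p.e ^ 2 * p.lg ^ 7)) * A.length := by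
      refine le_trans h3 (le_trans (le_of_eq ?_) (h4.trans_eq ?_)) <;> ring
    refine le_trans ?_ (mul_le_mul_of_nonneg_right (cost 1 zero_le_one) (Nat.cast_nonneg A.length))
    exact_mod_cast h6

theorem performance {C : ℕ} (hC : 2 ^ 122 ≤ C) {n k w : ℕ} {ε δ : ℝ} (hn : 0 < n) (hk : 0 < k)
    (hw : 0 < w) (hε : 0 < ε) (hε1 : ε ≤ 1 / 20) (hδ : 0 < δ) (hδ1 : δ < 1)
    (A : List (Fin k × Fin n)) :
    (A ≠ [] → (algo.run n k w ε δ A).toOuterMeasure {S | ε < |entropy (window w A) - S.estimate|} ≤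
      ENNReal.ofReal δ) ∧
    ∀ S ∈ (algo.run n k w ε δ A).support,
      (((S.bitLog.take w).sum : ℕ) : ℝ) ≤ softO C n k w ε δ (k / ε ^ 2 + √k / ε ^ 3) ∧
      (∀ i : Fin k, ((S.sites i).peak : ℝ) ≤ softO C n k w ε δ (1 / ε ^ 2)) ∧
      ((∑ i : Fin k, (S.sites i).time : ℕ) : ℝ) ≤ softO C n k w ε δ (1 / ε ^ 2) * A.length := by
  have e1 : (1 : ℝ) ≤ 1 / ε := one_le_one_div hε (by linarith)
  have d1 : (1 : ℝ) ≤ 1 / δ := one_le_one_div hδ hδ1.le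
  have e2 : (20 : ℝ) ≤ 1 / ε := by rw [le_div_iff₀ hε]; linarith
  have e3 := Nat.le_ceil (1 / ε)
  have d3 := Nat.le_ceil (1 / δ)
  have hp : (Par.mk n k w ⌈1 / ε⌉₊ ⌈1 / δ⌉₊).Valid :=
    ⟨hn, hk, hw, by exact_mod_cast e2.trans e3, Nat.ceil_pos.2 (by linarith)⟩
  have inv : ∀ x : ℝ, 0 < x → 0 < 1 / x → 1 / x ≤ ⌈1 / x⌉₊ → 1 / (⌈1 / x⌉₊ : ℝ) ≤ x :=
    fun x hx hx' h => by
      rw [div_le_iff₀ (hx'.trans_le h), mul_comm, ← div_le_iff₀ hx]; exact h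
  refine ⟨fun hA => ?_, ?_⟩
  · refine (PMF.toOuterMeasure_mono _ ?_).trans ((accuracy hp hA).trans
      (ENNReal.ofReal_le_ofReal (inv δ hδ (by linarith) d3)))
    exact fun S hS => (inv ε hε (by linarith) e3).trans_lt hS.1
  · refine resources hC hp hε ?_ (lg_le hn hk hw hε (by linarith) hδ hδ1.le) ?_ A
    · have := (Nat.ceil_lt_add_one (by linarith : 0 ≤ 1 / ε)).le
      have e4 : 2 / ε = 1 / ε + 1 / ε := by ring
      dsimp only; linarith
    · rw [← Real.logb_self_eq_one (b := 2) (by norm_num)]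
      refine Real.logb_le_logb_of_le (by norm_num) (by norm_num) ?_
      have : 0 ≤ (n : ℝ) * k * w / (ε * δ) := by positivity
      dsimp only; linarith

end Monitoring
end

theorem mainTheorem6 :
    ∃ (alg : Monitoring.Algorithm) (C : ℕ),
      ∀ (n k w : ℕ) (ε δ : ℝ), 0 < n → 0 < k → 0 < w → 0 < ε → ε ≤ 1 / 20 → 0 < δ → δ < 1 →
      ∀ A : List (Fin k × Fin n),
        -- accuracy of the current report
        (A ≠ [] →
          (1 < Monitoring.entropy (Monitoring.window w A) →
            (alg.run n k w ε δ A).toOuterMeasure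
              {S | ε * Monitoring.entropy (Monitoring.window w A) <
                |Monitoring.entropy (Monitoring.window w A) - S.estimate|} ≤ ENNReal.ofReal δ) ∧
          (Monitoring.entropy (Monitoring.window w A) ≤ 1 →
            (alg.run n k w ε δ A).toOuterMeasure
              {S | ε < |Monitoring.entropy (Monitoring.window w A) - S.estimate|} ≤
                ENNReal.ofReal δ)) ∧
        ∀ S ∈ (alg.run n k w ε δ A).support,
          -- bits exchanged during the last `w` arrivals
          (((S.bitLog.take w).sum : ℕ) : ℝ) ≤
            Monitoring.softO C n k w ε δ (k / ε ^ 2 + √k / ε ^ 3) ∧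
          -- bits of space at each site
          (∀ i : Fin k, ((S.sites i).peak : ℝ) ≤ Monitoring.softO C n k w ε δ (1 / ε ^ 2)) ∧
          -- total time at the sites, amortized over the items
          ((∑ i : Fin k, (S.sites i).time : ℕ) : ℝ) ≤
            Monitoring.softO C n k w ε δ (1 / ε ^ 2) * A.length := by
  refine ⟨Monitoring.algo, 2 ^ 122, fun n k w ε δ hn hk hw hε hε1 hδ hδ1 A => ?_⟩
  obtain ⟨h1, h2⟩ := Monitoring.performance le_rfl hn hk hw hε hε1 hδ hδ1 A
  refine ⟨fun hA => ⟨fun hH => ?_, fun _ => h1 hA⟩, h2⟩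
  -- For `H > 1` the relative error `ε H` allows more than the additive error `ε`.
  refine le_trans (PMF.toOuterMeasure_mono _ ?_) (h1 hA)
  intro S hS
  exact (le_mul_of_one_le_right hε.le hH.le).trans_lt hS.1
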